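/- Let $\mathbb T^2=\mathbb R^2/\mathbb Z^2$ carry its standard orientation. An MS-foliation on $\mathbb T^2$ is a one-dimensional foliation (leaves need not be coherently orientable) such that: (1) it has only finitely many compact leaves; (2) every half leaf of a non-compact leaf is asymptotic to a compact leaf; (3) every compact leaf can be oriented so that its holonomy is a (topological) contraction. The orientation in (3) is called the contracting orientation; compact leaves are always given this orientation. A geometrical enumeration of the compact leaves of an MS-foliation with $n$ compact leaves is an enumeration $\gamma_0,\dots,\gamma_{n-1}$ of them such that, for every $i$ (indices mod $n$), $\gamma_i$ and $\gamma_{i+1}$ bound a connected component $A_i$ of $\mathbb T^2\setminus\bigcup_k\gamma_k$, and such that $A_0$ lies (locally) on the right-hand side of $\gamma_0$ (if $n=1$, $A_0$ lies on both sides of $\gamma_0$). The associated combinatorial type is the map $\sigma:\{0,\dots,n-1\}\to\{+,-\}$ with $\sigma(i)=+$ if and only if $\gamma_i$ and $\gamma_0$, as oriented closed curves, are freely homotopic. Two foliations $\mathcal F,\mathcal G$ of $\mathbb T^2$ are topologically equivalent if there is an orientation-preserving homeomorphism of $\mathbb T^2$ that maps the leaves of $\mathcal F$ onto the leaves of $\mathcal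 G$. **Proposition 5.1.** An MS-foliation on $\mathbb T^2$ is characterized up to topological equivalence by any of its combinatorial types: if $\mathcal F$ and $\mathcal G$ are MS-foliations on $\mathbb T^2$ and $\sigma$ is a combinatorial type of $\mathcal F$, then $\sigma$ is a combinatorial type of $\mathcal G$ if and only if $\mathcal F$ and $\mathcal G$ are topologically equivalent. -/

import Mathlib

open Set Filter Topology

/-- A (topological) one-dimensional foliation of a surface `S`, given by a foliated atlas.  Every
chart identifies its domain with `ℝ × ℝ`; its plaques are the preimages of the horizontal lines
`ℝ × {y}`.  The transition maps locally have the form `(x, y) ↦ (f (x, y), g y)`. -/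
structure OneFoliation (S : Type*) [TopologicalSpace S] where
  atlas : Set (OpenPartialHomeomorph S (ℝ × ℝ))
  target_eq : ∀ φ ∈ atlas, φ.target = univ
  cover : ∀ p : S, ∃ φ ∈ atlas, p ∈ φ.source
  compatible : ∀ φ ∈ atlas, ∀ ψ ∈ atlas, ∀ p ∈ φ.source ∩ ψ.source,
    ∃ W ∈ 𝓝 p, W ⊆ φ.source ∩ ψ.source ∧
      ∀ q ∈ W, ∀ r ∈ W, (φ q).2 = (φ r).2 → (ψ q).2 = (ψ r).2

namespace OneFoliation

variable {S : Type*} [TopologicalSpace S]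

/-- `p` and `q` lie in a common plaque. -/
def SamePlaque (F : OneFoliation S) (p q : S) : Prop :=
  ∃ φ ∈ F.atlas, p ∈ φ.source ∧ q ∈ φ.source ∧ (φ p).2 = (φ q).2

/-- The leaf through `p`: all the points that are joined to `p` by a finite chain of plaques. -/
def leaf (F : OneFoliation S) (p : S) : Set S :=
  {q | Relation.EqvGen F.SamePlaque p q}

def IsLeaf (F : OneFoliation S) (L : Set S) : Prop :=
  ∃ p, L = F.leaf p

def IsCompactLeaf (F : OneFoliation S) (L : Set S) : Prop :=
  F.IsLeaf L ∧ IsCompact L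

/-- `τ` restricted to `(-ε, ε)` is an arc transverse to the foliation, inside one foliated chart:
it meets every plaque of that chart at most once. -/
def IsTransverseArc (F : OneFoliation S) (ε : ℝ) (τ : ℝ → S) : Prop :=
  ContinuousOn τ (Ioo (-ε) ε) ∧
    ∃ φ ∈ F.atlas, MapsTo τ (Ioo (-ε) ε) φ.source ∧
      InjOn (fun s => (φ (τ s)).2) (Ioo (-ε) ε)

/-- `h` is the holonomy of the foliation along the closed curve `γ` (contained in a leaf), read on
the transverse arc `τ`: the curve `γ` extends to a continuous family `s ↦ K (·, s)` of
paths in leaves, starting at `τ s` and ending at `τ (h s)`. -/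
def IsHolonomy (F : OneFoliation S) (γ : C(UnitAddCircle, S)) (ε : ℝ) (τ : ℝ → S) (h : ℝ → ℝ) :
    Prop :=
  ∃ K : ℝ × ℝ → S, ContinuousOn K (Icc 0 1 ×ˢ Ioo (-ε) ε) ∧
    (∀ t ∈ Icc (0 : ℝ) 1, K (t, 0) = γ (t : UnitAddCircle)) ∧
    ∀ s ∈ Ioo (-ε) ε,
      (∀ t ∈ Icc (0 : ℝ) 1, K (t, s) ∈ F.leaf (τ s)) ∧
      K (0, s) = τ s ∧ h s ∈ Ioo (-ε) ε ∧ K (1, s) = τ (h s)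

/-- The holonomy of the foliation along `γ` is a contraction (in the topological sense: in a suitable
parameter of a transverse arc, every point other than the one on `γ` is moved closer to it). -/
def HolonomyContracts (F : OneFoliation S) (γ : C(UnitAddCircle, S)) : Prop :=
  ∃ ε > 0, ∃ τ : ℝ → S, ∃ h : ℝ → ℝ,
    F.IsTransverseArc ε τ ∧ τ 0 = γ 0 ∧ F.IsHolonomy γ ε τ h ∧
      ∀ s ∈ Ioo (-ε) ε, s ≠ 0 → |h s| < |s|

/-- `γ` is a simple closed parametrization of the compact leaf `L` for its contracting
orientation. -/
def IsContractingParam (F : OneFoliation S) (L : Set S) (γ : C(UnitAddCircle, S)) : Prop :=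
  Function.Injective γ ∧ range γ = L ∧ F.HolonomyContracts γ

/-- MS-foliations (Morse-Smale foliations).  A non-compact leaf is an injectively immersed line;
its half leaves are the two ends of an injective parametrization by `ℝ`, and a half
leaf is asymptotic to a compact leaf `K` if it eventually enters every neighbourhood of `K`. -/
structure IsMS (F : OneFoliation S) : Prop where
  finite_compact : {L | F.IsCompactLeaf L}.Finite
  asymptotic : ∀ L, F.IsLeaf L → ¬ IsCompact L →
    ∃ c : ℝ → S, Continuous c ∧ Function.Injective c ∧ range c = L ∧
      (∃ K, F.IsCompactLeaf K ∧ Tendsto c atTop (𝓝ˢ K)) ∧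
      (∃ K, F.IsCompactLeaf K ∧ Tendsto c atBot (𝓝ˢ K))
  contracting : ∀ L, F.IsCompactLeaf L → ∃ γ, F.IsContractingParam L γ

end OneFoliation

/-- The torus `ℝ² / ℤ²`, with the orientation induced by the standard orientation of `ℝ²`. -/
abbrev Torus : Type := UnitAddCircle × UnitAddCircle

namespace Torus

/-- The universal covering map `ℝ² → ℝ² / ℤ²`. -/
def proj (p : ℝ × ℝ) : Torus := ((p.1 : UnitAddCircle), (p.2 : UnitAddCircle))

/-- The determinant of two vectors of the plane. -/
def cross (v w : ℝ × ℝ) : ℝ := v.1 * w.2 - v.2 * w.1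

/-- `f` preserves the orientation: its action on `H₁(ℝ² / ℤ²) = ℤ²` has determinant `1` (equivalently,
it fixes the fundamental class in `H₂ = Λ² H₁`).  If `H` is a lift of `f` to `ℝ²`, the images of the
two standard generators are `H (1, 0) - H (0, 0)` and `H (0, 1) - H (0, 0)`. -/
def OrientationPreserving (f : Torus ≃ₜ Torus) : Prop :=
  ∃ H : ℝ × ℝ → ℝ × ℝ, Continuous H ∧ (∀ p, proj (H p) = f (proj p)) ∧
    cross (H (1, 0) - H (0, 0)) (H (0, 1) - H (0, 0)) = 1

/-- `g` is a lift to `ℝ²` of the closed curve `γ`. -/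
def IsLift (γ : C(UnitAddCircle, Torus)) (g : ℝ → ℝ × ℝ) : Prop :=
  Continuous g ∧ ∀ t : ℝ, proj (g t) = γ (t : UnitAddCircle)

/-- The region of the plane on the right of the lift `g` of a closed curve that is not
null-homotopic.  Such a `g` is a curve invariant under the translation by `v = g 1 - g 0 ≠ 0`, which
remains in a strip parallel to `v`.  A point is on the right of `g` if it can be joined, without
crossing `g`, to a point of the half-plane on the right of that strip. -/
def rightOf (g : ℝ → ℝ × ℝ) : Set (ℝ × ℝ) :=
  {p | ∃ q, JoinedIn (range g)ᶜ p q ∧ ∀ t, cross (g 1 - g 0) (q - g t) < 0}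

/-- `A` lies locally on the right-hand side of the oriented closed curve `γ`: it accumulates on `γ`
from the right.  (`A` may at the same time lie on the left-hand side.) -/
def OnRightSide (A : Set Torus) (γ : C(UnitAddCircle, Torus)) : Prop :=
  ∃ g, IsLift γ g ∧ range g ⊆ closure (proj ⁻¹' A ∩ rightOf g)

end Torus

namespace OneFoliation

/-- `γ 0, …, γ (n - 1)` are the compact leaves of the foliation, each one exactly once and
parametrized for its contracting orientation, such that `γ i` and `γ (i + 1)` (indices modulo `n`)
bound a connected component `A i` of the complement of the compact leaves, and `A 0` is on the
right-hand side of `γ 0`. -/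
structure IsGeometricalEnumeration (F : OneFoliation Torus) {n : ℕ} [NeZero n]
    (γ : Fin n → C(UnitAddCircle, Torus)) : Prop where
  isCompactLeaf : ∀ i, F.IsCompactLeaf (range (γ i))
  contracting : ∀ i, F.IsContractingParam (range (γ i)) (γ i)
  distinct : Function.Injective fun i => range (γ i)
  exhaustive : ∀ L, F.IsCompactLeaf L → ∃ i, range (γ i) = L
  bounds : ∀ i, ∃ A : Set Torus,
    (∃ x ∈ (⋃ k, range (γ k))ᶜ, A = connectedComponentIn (⋃ k, range (γ k))ᶜ x) ∧
    frontier A = range (γ i) ∪ range (γ (i + 1)) ∧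
    (i = 0 → Torus.OnRightSide A (γ 0))

/-- `σ` is the combinatorial type associated with some geometrical enumeration: `σ i = 1` if and
only if the contracting orientations of `γ i` and `γ 0` are coherent, i.e. `γ i` and `γ 0` are freely
homotopic as oriented closed curves. -/
def IsCombinatorialType (F : OneFoliation Torus) {n : ℕ} [NeZero n] (σ : Fin n → ℤˣ) : Prop :=
  ∃ γ : Fin n → C(UnitAddCircle, Torus), F.IsGeometricalEnumeration γ ∧
    ∀ i, σ i = 1 ↔ (γ i).Homotopic (γ 0)

/-- Topological equivalence: an orientation-preserving homeomorphism maps the leaves of `F` onto the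
leaves of `G`. -/
def TopologicallyEquivalent (F G : OneFoliation Torus) : Prop :=
  ∃ f : Torus ≃ₜ Torus, Torus.OrientationPreserving f ∧ ∀ p, f '' F.leaf p = G.leaf (f p)

end OneFoliation

/-! Cut the torus along the compact leaves. The foliation between two consecutive cuts has no
moduli. Each non-compact leaf spirals out of one side of a compact leaf and into another side. A
topological contraction of a half line is conjugate to a translation, so all spirals look alike near
their ends. The leaves leaving a given side form a circle, and following them to their other ends
gives a map of circles of degree `ε = 1` or `ε = -1`. Hence the closure of each component of the
complement is the image of a standard foliated annulus `P i`, a circle times `[-π/2, π/2]`, whose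
only invariant is the sign `ε i`. This is the structure `Strips`.

The annulus `P i` is itself a free homotopy from `γ i` to `γ (i + 1)`, the latter traversed with the
sign `ε i`. The class of `γ 0` is nonzero, since otherwise nothing could lie on its right. Therefore
`γ k` is homotopic to `γ 0` exactly when `ε 0 ⋯ ε (k - 1) = 1`, and a combinatorial type carries the
same information as the signs (`Strips.sign_eq`). Two foliations with equal signs are the same
annuli glued by the same rule, which gives a homeomorphism matching the leaves
(`Strips.topologicallyEquivalent`). It preserves orientation because in both foliations the annulus
`P 0` starts on the right of `γ 0`, and the lift of a closed curve separates its right from its left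
(`IsLift.disjoint_sideOf`). Conversely an equivalence carries geometrical enumerations to
geometrical enumerations (`IsCombinatorialType.map`).

Everything is only continuous. A leaf meets a chart in countably many plaques, so a connected piece
of a leaf inside a chart stays in one plaque (`chart_snd_eq_of_isPreconnected`); this gives flow
boxes along arcs of leaves (`exists_transport`). Flow boxes and the linearized return map give
spiralling collars of the compact leaves (`exists_collar`). Collars turn each non-compact leaf into
a `NormalForm`, and the normal forms fit into continuous periodic families (`exists_pairing`) and
then annuli (`exists_annulus`). Orientability of the torus enters through a local degree `Ori`,
defined by winding numbers: it shows that return maps are increasing and that no side is paired with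
itself. -/

/-- Local-to-global induction along a compact interval. -/
theorem Icc_local_induction {P : ℝ → Prop} {a b : ℝ} (hab : a ≤ b) (h0 : P a)
    (h : ∀ t ∈ Icc a b, ∃ ε > 0, ∀ x ∈ Icc a b, ∀ y ∈ Icc a b,
      |x - t| < ε → |y - t| < ε → x ≤ y → P x → P y) : P b := by
  choose! ε hε hP using h
  obtain ⟨t, ht0, htm, ⟨m, hm⟩, hsub⟩ := exists_monotone_Icc_subset_open_cover_Icc hab
    (c := fun i : Icc a b => {x : Icc a b | |(x : ℝ) - i| < ε i})
    (fun i => isOpen_lt (by fun_prop) (by fun_prop))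
    (fun x _ => mem_iUnion.2 ⟨x, by simpa using hε x x.2⟩)
  have key : ∀ n, P (t n) := by
    intro n
    induction n with
    | zero => rw [ht0]; exact h0
    | succ n ih =>
      obtain ⟨i, hi⟩ := hsub n
      have h1 : t n ≤ t (n + 1) := htm (Nat.le_succ n)
      exact hP i i.2 _ (t n).2 _ (t (n + 1)).2 (hi ⟨le_rfl, h1⟩) (hi ⟨h1, le_rfl⟩) h1 ih
  rw [← hm m le_rfl]
  exact key m

/-! ### Leaves, plaques and countability. -/

namespace OneFoliation

variable {S : Type*} [TopologicalSpace S] (F : OneFoliation S)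

theorem mem_leaf_self (p : S) : p ∈ F.leaf p := Relation.EqvGen.refl p

variable {F}

theorem mem_leaf_symm {p q : S} (h : q ∈ F.leaf p) : p ∈ F.leaf q := Relation.EqvGen.symm _ _ h

theorem mem_leaf_trans {p q r : S} (h : q ∈ F.leaf p) (h' : r ∈ F.leaf q) : r ∈ F.leaf p :=
  Relation.EqvGen.trans _ _ _ h h'

theorem leaf_eq_of_mem {p q : S} (h : q ∈ F.leaf p) : F.leaf q = F.leaf p :=
  Set.ext fun _ => ⟨mem_leaf_trans h, mem_leaf_trans (mem_leaf_symm h)⟩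

theorem SamePlaque.mem_leaf {p q : S} (h : F.SamePlaque p q) : q ∈ F.leaf p :=
  Relation.EqvGen.rel _ _ h

theorem compatible_iff {φ ψ : OpenPartialHomeomorph S (ℝ × ℝ)} (hφ : φ ∈ F.atlas)
    (hψ : ψ ∈ F.atlas) {p : S} (hp : p ∈ φ.source) (hp' : p ∈ ψ.source) :
    ∃ W ∈ 𝓝 p, W ⊆ φ.source ∩ ψ.source ∧
      ∀ q ∈ W, ∀ r ∈ W, ((φ q).2 = (φ r).2 ↔ (ψ q).2 = (ψ r).2) := by
  obtain ⟨W, hW, hs, h⟩ := F.compatible φ hφ ψ hψ p ⟨hp, hp'⟩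
  obtain ⟨W', hW', hs', h'⟩ := F.compatible ψ hψ φ hφ p ⟨hp', hp⟩
  exact ⟨W ∩ W', inter_mem hW hW', fun x hx => hs hx.1,
    fun q hq r hr => ⟨h q hq.1 r hr.1, h' q hq.2 r hr.2⟩⟩

section plaque

variable {φ : OpenPartialHomeomorph S (ℝ × ℝ)} (hφ : φ ∈ F.atlas)
include hφ

theorem mem_target (z : ℝ × ℝ) : z ∈ φ.target := by rw [F.target_eq φ hφ]; trivial

theorem chart_symm_mem (z : ℝ × ℝ) : φ.symm z ∈ φ.source := φ.map_target (mem_target hφ z)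

theorem chart_right_inv (z : ℝ × ℝ) : φ (φ.symm z) = z := φ.right_inv (mem_target hφ z)

theorem continuous_chart_symm : Continuous φ.symm := by
  rw [← continuousOn_univ, ← F.target_eq φ hφ]
  exact φ.continuousOn_symm

theorem chart_samePlaque {p q : S} (hp : p ∈ φ.source) (hq : q ∈ φ.source)
    (h : (φ p).2 = (φ q).2) : F.SamePlaque p q := ⟨φ, hφ, hp, hq, h⟩

theorem chart_symm_mem_leaf (x x' y : ℝ) : φ.symm (x', y) ∈ F.leaf (φ.symm (x, y)) :=
  (chart_samePlaque hφ (chart_symm_mem hφ _) (chart_symm_mem hφ _)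
    (by simp [chart_right_inv hφ])).mem_leaf

end plaque

/-- A set is thin if it meets only countably many plaques of each chart. -/
def Thin (F : OneFoliation S) (B : Set S) : Prop :=
  ∀ φ ∈ F.atlas, ((fun p => (φ p).2) '' (B ∩ φ.source)).Countable

theorem Thin.mono {B C : Set S} (h : F.Thin C) (hB : B ⊆ C) : F.Thin B := fun φ hφ =>
  (h φ hφ).mono (image_mono (inter_subset_inter_left _ hB))

theorem thin_iUnion {ι : Type*} [Countable ι] {B : ι → Set S} (h : ∀ i, F.Thin (B i)) :
    F.Thin (⋃ i, B i) := fun φ hφ => by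
  rw [iUnion_inter, image_iUnion]
  exact countable_iUnion fun i => h i φ hφ

theorem thin_biUnion {ι : Type*} {s : Set ι} (hs : s.Countable) {B : ι → Set S}
    (h : ∀ i ∈ s, F.Thin (B i)) : F.Thin (⋃ i ∈ s, B i) := fun φ hφ => by
  simp only [iUnion_inter, image_iUnion]
  exact hs.biUnion fun i hi => h i hi φ hφ

/-- Compatibility makes the `ψ`-height locally constant along a plaque of `φ`, and a subset of the
line is Lindelöf, so only countably many heights occur. -/
theorem thin_plaque {φ : OpenPartialHomeomorph S (ℝ × ℝ)} (hφ : φ ∈ F.atlas) (y : ℝ) :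
    F.Thin (range fun x : ℝ => φ.symm (x, y)) := by
  intro ψ hψ
  set P : ℝ → S := fun x => φ.symm (x, y) with hP
  have hPc : Continuous P := (continuous_chart_symm hφ).comp (by fun_prop)
  have hloc : ∀ x : ℝ, ∃ V ∈ 𝓝 x, P x ∈ ψ.source →
      ∀ x' ∈ V, (ψ (P x')).2 = (ψ (P x)).2 := by
    intro x
    by_cases hx : P x ∈ ψ.source
    · obtain ⟨W, hW, -, h⟩ := F.compatible φ hφ ψ hψ (P x) ⟨chart_symm_mem hφ _, hx⟩
      refine ⟨P ⁻¹' W, hPc.continuousAt hW, fun _ x' hx' => h _ hx' _ (mem_of_mem_nhds hW) ?_⟩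
      simp [hP, chart_right_inv hφ]
    · exact ⟨univ, univ_mem, fun h => absurd h hx⟩
  choose V hV hVP using hloc
  obtain ⟨T, hTs, hTc, hT⟩ := TopologicalSpace.countable_cover_nhdsWithin
    (f := V) (s := {x | P x ∈ ψ.source}) (fun x _ => mem_nhdsWithin_of_mem_nhds (hV x))
  refine (hTc.image fun x => (ψ (P x)).2).mono ?_
  rintro _ ⟨_, ⟨⟨x, rfl⟩, hx⟩, rfl⟩
  obtain ⟨t, ht, hxt⟩ := mem_iUnion₂.1 (hT hx)
  exact ⟨t, ht, (hVP t (hTs ht) x hxt).symm⟩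

/-- Countably many charts cover the surface, and chains of plaques of these charts alone already
generate the leaves. The points reached by a chain of given length then lie on countably many
plaques, by induction on the length. -/
theorem thin_leaf [SecondCountableTopology S] (p : S) : F.Thin (F.leaf p) := by
  choose φ hφ hpφ using F.cover
  obtain ⟨s, hsc, hs⟩ := TopologicalSpace.countable_cover_nhds
    (f := fun x => (φ x).source) (fun x => (φ x).open_source.mem_nhds (hpφ x))
  set R : S → S → Prop := fun p q => ∃ x ∈ s, p ∈ (φ x).source ∧ q ∈ (φ x).source ∧
    (φ x p).2 = (φ x q).2 with hR
  -- A plaque of an arbitrary chart is connected, and nearby points of it share a plaque of one of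
  -- the countably many charts.
  have hRs : ∀ p q, F.SamePlaque p q → Relation.EqvGen R p q := by
    rintro p q ⟨ψ, hψ, hp, hq, hy⟩
    set P : ℝ → S := fun x => ψ.symm (x, (ψ p).2) with hP
    have hPc : Continuous P := (continuous_chart_symm hψ).comp (by fun_prop)
    have hpP : p = P (ψ p).1 := by simp [hP, ψ.left_inv hp]
    have hqP : q = P (ψ q).1 := by rw [hP]; simp only [hy]; simp [ψ.left_inv hq]
    have key : ∀ x x', Relation.EqvGen R (P x) (P x') := by
      intro x x'
      refine isPreconnected_univ.induction₂ (fun x x' => Relation.EqvGen R (P x) (P x')) ?_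
        (fun a b c _ _ _ => Relation.EqvGen.trans _ _ _) (fun a b _ _ => Relation.EqvGen.symm _ _)
        (mem_univ x) (mem_univ x')
      intro t _
      obtain ⟨x, hx, htx⟩ := mem_iUnion₂.1 (hs.ge (mem_univ (P t)))
      obtain ⟨W, hW, hWs, h⟩ := F.compatible ψ hψ (φ x) (hφ x) (P t) ⟨chart_symm_mem hψ _, htx⟩
      rw [nhdsWithin_univ]
      filter_upwards [hPc.continuousAt hW] with t' ht'
      refine Relation.EqvGen.rel _ _ ⟨x, hx, htx, (hWs ht').2, h _ (mem_of_mem_nhds hW) _ ht' ?_⟩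
      simp [hP, chart_right_inv hψ]
    rw [hpP, hqP]
    exact key _ _
  have hRs' : ∀ a b, Relation.EqvGen F.SamePlaque a b → Relation.EqvGen R a b := by
    intro a b h
    induction h with
    | rel a b h => exact hRs a b h
    | refl a => exact Relation.EqvGen.refl a
    | symm a b _ ih => exact Relation.EqvGen.symm _ _ ih
    | trans a b c _ _ ih ih' => exact Relation.EqvGen.trans _ _ _ ih ih'
  have hsymm : Std.Symm R := ⟨fun a b ⟨x, hx, ha, hb, h⟩ => ⟨x, hx, hb, ha, h.symm⟩⟩
  -- `N k` is the set of points reached from `p` by a chain of `k` plaques of the countable family.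
  let N : ℕ → Set S := fun k => Nat.rec {p} (fun _ B => {q | ∃ r ∈ B, R r q}) k
  have hN : ∀ k, F.Thin (N k) := by
    intro k
    induction k with
    | zero => intro ψ _; exact ((countable_singleton p).mono inter_subset_left).image _
    | succ k ih =>
      have : N (k + 1) ⊆ ⋃ x ∈ s, ⋃ y ∈ (fun p => (φ x p).2) '' (N k ∩ (φ x).source),
          range fun t : ℝ => (φ x).symm (t, y) := by
        rintro q ⟨r, hr, x, hx, hrx, hqx, hy⟩
        refine mem_iUnion₂.2 ⟨x, hx, mem_iUnion₂.2 ⟨(φ x r).2, ⟨r, ⟨hr, hrx⟩, rfl⟩, (φ x q).1, ?_⟩⟩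
        simp only [hy]
        simp [(φ x).left_inv hqx]
      exact (thin_biUnion hsc fun x hx => thin_biUnion (ih _ (hφ x)) fun y _ =>
        thin_plaque (hφ x) y).mono this
  refine (thin_iUnion hN).mono fun q hq => ?_
  have h3 : Relation.ReflTransGen R p q := by
    have := hRs' p q hq
    rwa [Relation.EqvGen.eqvGen_eq_reflTransGen] at this
  clear hq
  induction h3 with
  | refl => exact mem_iUnion.2 ⟨0, rfl⟩
  | tail _ hbc ih =>
    obtain ⟨k, hk⟩ := mem_iUnion.1 ih
    exact mem_iUnion.2 ⟨k + 1, _, hk, hbc⟩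

/-- A connected piece of a leaf inside a chart lies in one plaque. -/
theorem chart_snd_eq_of_isPreconnected [SecondCountableTopology S]
    {φ : OpenPartialHomeomorph S (ℝ × ℝ)} (hφ : φ ∈ F.atlas) {X : Type*} [TopologicalSpace X]
    {A : Set X} (hA : IsPreconnected A) {c : X → S} (hc : ContinuousOn c A) {p : S}
    (hleaf : ∀ x ∈ A, c x ∈ F.leaf p) (hs : ∀ x ∈ A, c x ∈ φ.source) {x y : X}
    (hx : x ∈ A) (hy : y ∈ A) : (φ (c x)).2 = (φ (c y)).2 := by
  have hcount := thin_leaf (F := F) p φ hφ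
  have hcont : ContinuousOn (fun x => (φ (c x)).2) A :=
    (continuous_snd.comp_continuousOn φ.continuousOn).comp hc hs
  have himg : ((fun x => (φ (c x)).2) '' A).Countable := hcount.mono (by
    rintro _ ⟨x, hx, rfl⟩; exact ⟨c x, ⟨hleaf x hx, hs x hx⟩, rfl⟩)
  exact himg.isTotallyDisconnected _ subset_rfl (hA.image _ hcont) ⟨x, hx, rfl⟩ ⟨y, hy, rfl⟩

end OneFoliation

/-! ### Openness and injectivity of triangular maps of the plane. -/

theorem ContinuousOn.injOn_image_Icc_mem_nhds {f : ℝ → ℝ} {a b s : ℝ} (hs : s ∈ Ioo a b)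
    (hc : ContinuousOn f (Icc a b)) (hi : InjOn f (Icc a b)) : f '' Icc a b ∈ 𝓝 (f s) := by
  have hab : a ≤ b := (hs.1.trans hs.2).le
  have ha : a ∈ Icc a b := ⟨le_rfl, hab⟩
  have hb : b ∈ Icc a b := ⟨hab, le_rfl⟩
  have hs' : s ∈ Icc a b := ⟨hs.1.le, hs.2.le⟩
  rcases hc.strictMonoOn_of_injOn_Icc' hab hi with h | h
  · exact mem_of_superset (Icc_mem_nhds (h ha hs' hs.1) (h hs' hb hs.2))
      (intermediate_value_Icc hab hc)
  · exact mem_of_superset (Icc_mem_nhds (h hs' hb hs.2) (h ha hs' hs.1))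
      (intermediate_value_Icc' hab hc)

/-- A map `(t, s) ↦ (x (t, s), y s)` that is injective on a rectangle is open at its interior
points. -/
theorem triangular_image_mem_nhds {G : ℝ × ℝ → ℝ × ℝ} {B : Set (ℝ × ℝ)} {t s : ℝ}
    (hB : B ∈ 𝓝 (t, s)) (hc : ContinuousOn G B) (hinj : InjOn G B)
    (hy : ∀ z ∈ B, ∀ w ∈ B, (G z).2 = (G w).2 ↔ z.2 = w.2) : G '' B ∈ 𝓝 (G (t, s)) := by
  obtain ⟨η, hη, hsub⟩ := Metric.nhds_basis_closedBall.mem_iff.1 hB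
  rw [← closedBall_prod_same, Real.closedBall_eq_Icc, Real.closedBall_eq_Icc] at hsub
  have ht : t ∈ Ioo (t - η) (t + η) := ⟨by linarith, by linarith⟩
  have hrow : ∀ s' ∈ Icc (s - η) (s + η),
      ContinuousOn (fun t' => (G (t', s')).1) (Icc (t - η) (t + η)) := fun s' hs' =>
    continuous_fst.comp_continuousOn (hc.comp (by fun_prop) fun t' ht' => hsub ⟨ht', hs'⟩)
  have hcol : ∀ t' ∈ Icc (t - η) (t + η),
      ContinuousOn (fun s' => G (t', s')) (Icc (s - η) (s + η)) := fun t' ht' =>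
    hc.comp (by fun_prop) fun s' hs' => hsub ⟨ht', hs'⟩
  have hs0 : s ∈ Icc (s - η) (s + η) := ⟨by linarith, by linarith⟩
  have ht0 : t ∈ Icc (t - η) (t + η) := ⟨by linarith, by linarith⟩
  have hl : t - η ∈ Icc (t - η) (t + η) := ⟨by linarith, by linarith⟩
  have hr : t + η ∈ Icc (t - η) (t + η) := ⟨by linarith, by linarith⟩
  have hxinj : InjOn (fun t' => (G (t', s)).1) (Icc (t - η) (t + η)) := fun a ha b hb hab => by
    have := hinj (hsub ⟨ha, hs0⟩) (hsub ⟨hb, hs0⟩)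
      (Prod.ext hab ((hy _ (hsub ⟨ha, hs0⟩) _ (hsub ⟨hb, hs0⟩)).2 rfl))
    exact congrArg Prod.fst this
  have hcolAt : ∀ t' ∈ Icc (t - η) (t + η), ContinuousAt (fun s' => G (t', s')) s := fun t' ht' =>
    (hcol t' ht').continuousAt (Icc_mem_nhds (by linarith) (by linarith))
  -- The row at height `s` is strictly monotone, so its end values lie strictly on either side of
  -- `(G (t, s)).1`. This persists for nearby rows and nearby values, and the intermediate value
  -- theorem solves for the first coordinate on each such row.
  have hev : ∀ᶠ q : ℝ × ℝ in 𝓝 ((G (t, s)).1, s),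
      ∃ t' ∈ Icc (t - η) (t + η), q.2 ∈ Icc (s - η) (s + η) ∧ (G (t', q.2)).1 = q.1 := by
    have hq2 : ∀ᶠ q : ℝ × ℝ in 𝓝 ((G (t, s)).1, s), q.2 ∈ Icc (s - η) (s + η) :=
      continuousAt_snd.eventually_mem (Icc_mem_nhds (by simp; linarith) (by simp; linarith))
    have hL : Tendsto (fun q : ℝ × ℝ => (G (t - η, q.2)).1) (𝓝 ((G (t, s)).1, s))
        (𝓝 (G (t - η, s)).1) :=
      (continuous_fst.tendsto _).comp ((hcolAt _ hl).tendsto.comp continuousAt_snd.tendsto)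
    have hR : Tendsto (fun q : ℝ × ℝ => (G (t + η, q.2)).1) (𝓝 ((G (t, s)).1, s))
        (𝓝 (G (t + η, s)).1) :=
      (continuous_fst.tendsto _).comp ((hcolAt _ hr).tendsto.comp continuousAt_snd.tendsto)
    have h1 : Tendsto (fun q : ℝ × ℝ => q.1) (𝓝 ((G (t, s)).1, s)) (𝓝 (G (t, s)).1) :=
      continuousAt_fst
    rcases (hrow s hs0).strictMonoOn_of_injOn_Icc' (by linarith) hxinj with h | h
    · filter_upwards [hq2, hL.eventually_lt h1 (h hl ht0 ht.1), h1.eventually_lt hR (h ht0 hr ht.2)]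
        with q hq hq1 hq3
      obtain ⟨t', ht', h'⟩ := intermediate_value_Icc (by linarith) (hrow q.2 hq) ⟨hq1.le, hq3.le⟩
      exact ⟨t', ht', hq, h'⟩
    · filter_upwards [hq2, h1.eventually_lt hL (h hl ht0 ht.1), hR.eventually_lt h1 (h ht0 hr ht.2)]
        with q hq hq1 hq3
      obtain ⟨t', ht', h'⟩ := intermediate_value_Icc' (by linarith) (hrow q.2 hq) ⟨hq3.le, hq1.le⟩
      exact ⟨t', ht', hq, h'⟩
  obtain ⟨U, hU, V, hV, hUV⟩ := mem_nhds_prod_iff.1 hev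
  obtain ⟨δ, hδ, hδV⟩ := Metric.nhds_basis_closedBall.mem_iff.1
    (inter_mem hV (Icc_mem_nhds (by linarith : s - η < s) (by linarith : s < s + η)))
  rw [Real.closedBall_eq_Icc] at hδV
  -- The second coordinate of `G` depends on the row only, and injectively, so it covers a
  -- neighbourhood of its value.
  have hY := ContinuousOn.injOn_image_Icc_mem_nhds (s := s) (a := s - δ) (b := s + δ)
    (f := fun s' => (G (t, s')).2) ⟨by linarith, by linarith⟩
    (continuous_snd.comp_continuousOn ((hcol t ht0).mono fun x hx => (hδV hx).2))
    (fun a ha b hb hab => (hy _ (hsub ⟨ht0, (hδV ha).2⟩) _ (hsub ⟨ht0, (hδV hb).2⟩)).1 hab)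
  refine mem_of_superset (prod_mem_nhds hU hY) ?_
  rintro ⟨X, Y⟩ ⟨hX, s', hs', rfl⟩
  obtain ⟨t', ht', hs'', h⟩ := hUV (show (X, s') ∈ U ×ˢ V from ⟨hX, (hδV hs').1⟩)
  exact ⟨(t', s'), hsub ⟨ht', hs''⟩, Prod.ext h
    ((hy (t', s') (hsub ⟨ht', hs''⟩) (t, s') (hsub ⟨ht0, hs''⟩)).2 rfl)⟩

/-- Each nearby row is monotone on both halves; it could only fold at `b`. Comparing the values at
`b - η`, `b`, `b + η`, whose order is inherited from the row `s`, shows that both halves increase.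
-/
theorem eventually_injOn_of_halves_of_strictMonoOn {g : ℝ × ℝ → ℝ} {b η s : ℝ} {J : Set ℝ} (hη : 0 < η)
    (hJ : J ∈ 𝓝 s) (hc : ContinuousOn g (Icc (b - η) (b + η) ×ˢ J))
    (h1 : ∀ s' ∈ J, InjOn (fun t => g (t, s')) (Icc (b - η) b))
    (h2 : ∀ s' ∈ J, InjOn (fun t => g (t, s')) (Icc b (b + η)))
    (h0 : StrictMonoOn (fun t => g (t, s)) (Icc (b - η) (b + η))) :
    ∀ᶠ s' in 𝓝 s, InjOn (fun t => g (t, s')) (Icc (b - η) (b + η)) := by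
  have hl : b - η ∈ Icc (b - η) (b + η) := ⟨by linarith, by linarith⟩
  have hm : b ∈ Icc (b - η) (b + η) := ⟨by linarith, by linarith⟩
  have hr : b + η ∈ Icc (b - η) (b + η) := ⟨by linarith, by linarith⟩
  have hcol : ∀ t ∈ Icc (b - η) (b + η), ContinuousAt (fun s' => g (t, s')) s := fun t ht =>
    (hc.comp (f := fun s' => (t, s')) (s := J) (by fun_prop) fun s' hs' => ⟨ht, hs'⟩).continuousAt hJ
  filter_upwards [hJ, (hcol _ hl).eventually_lt (hcol _ hm) (h0 hl hm (by linarith)),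
    (hcol _ hm).eventually_lt (hcol _ hr) (h0 hm hr (by linarith))] with s' hs' hlt hlt'
  have hrow : ContinuousOn (fun t => g (t, s')) (Icc (b - η) (b + η)) :=
    hc.comp (by fun_prop) fun t ht => ⟨ht, hs'⟩
  have m1 : StrictMonoOn (fun t => g (t, s')) (Icc (b - η) b) :=
    ContinuousOn.strictMonoOn_of_injOn_Icc (by linarith) hlt.le
      (hrow.mono (Icc_subset_Icc_right (by linarith))) (h1 s' hs')
  have m2 : StrictMonoOn (fun t => g (t, s')) (Icc b (b + η)) :=
    ContinuousOn.strictMonoOn_of_injOn_Icc (by linarith) hlt'.le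
      (hrow.mono (Icc_subset_Icc_left (by linarith))) (h2 s' hs')
  have := m1.union m2 (c := b) (isGreatest_Icc (by linarith)) (isLeast_Icc (by linarith))
  rw [Icc_union_Icc_eq_Icc (by linarith) (by linarith)] at this
  exact this.injOn

theorem eventually_injOn_of_halves {g : ℝ × ℝ → ℝ} {b η s : ℝ} {J : Set ℝ} (hη : 0 < η)
    (hJ : J ∈ 𝓝 s) (hc : ContinuousOn g (Icc (b - η) (b + η) ×ˢ J))
    (h1 : ∀ s' ∈ J, InjOn (fun t => g (t, s')) (Icc (b - η) b))
    (h2 : ∀ s' ∈ J, InjOn (fun t => g (t, s')) (Icc b (b + η)))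
    (h0 : InjOn (fun t => g (t, s)) (Icc (b - η) (b + η))) :
    ∀ᶠ s' in 𝓝 s, InjOn (fun t => g (t, s')) (Icc (b - η) (b + η)) := by
  have hrow : ContinuousOn (fun t => g (t, s)) (Icc (b - η) (b + η)) :=
    hc.comp (by fun_prop) fun t ht => ⟨ht, mem_of_mem_nhds hJ⟩
  rcases hrow.strictMonoOn_of_injOn_Icc' (by linarith) h0 with h | h
  · exact eventually_injOn_of_halves_of_strictMonoOn hη hJ hc h1 h2 h
  · have := eventually_injOn_of_halves_of_strictMonoOn (g := fun z => - g z) hη hJ hc.neg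
      (fun s' hs' => neg_injective.comp_injOn (h1 s' hs'))
      (fun s' hs' => neg_injective.comp_injOn (h2 s' hs')) h.neg
    filter_upwards [this] with s' hs' a ha b hb hab
    exact hs' ha hb (by simpa using hab)

/-! ### Locally foliated maps from the plane to the surface. -/

namespace OneFoliation

variable {S : Type*} [TopologicalSpace S] {F : OneFoliation S}

/-- `Ψ` is injective near `z` and maps the horizontal segments, and no other pairs of points, into
common plaques. -/
def LocFol (F : OneFoliation S) (Ψ : ℝ × ℝ → S) (A : Set (ℝ × ℝ)) (z : ℝ × ℝ) : Prop :=
  ∃ φ ∈ F.atlas, ∃ O ∈ 𝓝[A] z, ∀ z₁ ∈ O, Ψ z₁ ∈ φ.source ∧ ∀ z₂ ∈ O,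
    ((φ (Ψ z₁)).2 = (φ (Ψ z₂)).2 ↔ z₁.2 = z₂.2) ∧ (Ψ z₁ = Ψ z₂ → z₁ = z₂)

theorem LocFol.mono {Ψ : ℝ × ℝ → S} {A B : Set (ℝ × ℝ)} {z : ℝ × ℝ} (h : F.LocFol Ψ A z)
    (hB : B ⊆ A) : F.LocFol Ψ B z := by
  obtain ⟨φ, hφ, O, hO, h⟩ := h
  exact ⟨φ, hφ, O, nhdsWithin_mono _ hB hO, h⟩

theorem LocFol.of_mem_nhds {Ψ : ℝ × ℝ → S} {A B : Set (ℝ × ℝ)} {z : ℝ × ℝ} (h : F.LocFol Ψ A z)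
    (hA : A ∈ 𝓝 z) : F.LocFol Ψ B z := by
  obtain ⟨φ, hφ, O, hO, h⟩ := h
  rw [nhdsWithin_eq_nhds.2 hA] at hO
  exact ⟨φ, hφ, O, mem_nhdsWithin_of_mem_nhds hO, h⟩

theorem LocFol.congr {Ψ Ψ' : ℝ × ℝ → S} {A : Set (ℝ × ℝ)} {z : ℝ × ℝ} (h : F.LocFol Ψ A z)
    (he : Ψ' =ᶠ[𝓝[A] z] Ψ) : F.LocFol Ψ' A z := by
  obtain ⟨φ, hφ, O, hO, h⟩ := h
  refine ⟨φ, hφ, O ∩ {x | Ψ' x = Ψ x}, inter_mem hO he, fun z₁ h₁ => ?_⟩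
  rw [show Ψ' z₁ = Ψ z₁ from h₁.2]
  refine ⟨(h z₁ h₁.1).1, fun z₂ h₂ => ?_⟩
  rw [show Ψ' z₂ = Ψ z₂ from h₂.2]
  exact (h z₁ h₁.1).2 z₂ h₂.1

theorem LocFol.eventually {Ψ : ℝ × ℝ → S} {A : Set (ℝ × ℝ)} {z : ℝ × ℝ} (h : F.LocFol Ψ A z) :
    ∀ᶠ w in 𝓝[A] z, F.LocFol Ψ A w := by
  obtain ⟨φ, hφ, O, hO, h⟩ := h
  filter_upwards [eventually_eventually_nhdsWithin.2 hO] with w hw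
  exact ⟨φ, hφ, O, hw, h⟩

/-- The chart in `LocFol` is existential; compatibility in both directions lets any chart around `Ψ
z` take its place, after shrinking. -/
theorem LocFol.exists_chart {Ψ : ℝ × ℝ → S} {A : Set (ℝ × ℝ)} {z : ℝ × ℝ} (h : F.LocFol Ψ A z)
    (hz : z ∈ A) (hc : ContinuousWithinAt Ψ A z) {ψ : OpenPartialHomeomorph S (ℝ × ℝ)}
    (hψ : ψ ∈ F.atlas) (hs : Ψ z ∈ ψ.source) :
    ∃ O ∈ 𝓝[A] z, ∀ z₁ ∈ O, Ψ z₁ ∈ ψ.source ∧ ∀ z₂ ∈ O,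
      ((ψ (Ψ z₁)).2 = (ψ (Ψ z₂)).2 ↔ z₁.2 = z₂.2) ∧ (Ψ z₁ = Ψ z₂ → z₁ = z₂) := by
  obtain ⟨φ, hφ, O, hO, h⟩ := h
  obtain ⟨W, hW, hWs, hWc⟩ := compatible_iff hφ hψ (h z (mem_of_mem_nhdsWithin hz hO)).1 hs
  refine ⟨O ∩ Ψ ⁻¹' W, inter_mem hO (hc hW), fun z₁ h₁ => ⟨(hWs h₁.2).2, fun z₂ h₂ => ?_⟩⟩
  rw [← hWc _ h₁.2 _ h₂.2]
  exact (h z₁ h₁.1).2 z₂ h₂.1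

theorem LocFol.comp {Ψ : ℝ × ℝ → S} {A B : Set (ℝ × ℝ)} {z : ℝ × ℝ} {χ : ℝ × ℝ → ℝ × ℝ}
    (h : F.LocFol Ψ A (χ z)) (hχ : ContinuousWithinAt χ B z) (hm : ∀ᶠ w in 𝓝[B] z, χ w ∈ A)
    {N : Set (ℝ × ℝ)} (hN : N ∈ 𝓝[B] z) (ht : ∀ z₁ ∈ N, ∀ z₂ ∈ N,
      ((χ z₁).2 = (χ z₂).2 ↔ z₁.2 = z₂.2) ∧ (χ z₁ = χ z₂ → z₁ = z₂)) :
    F.LocFol (Ψ ∘ χ) B z := by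
  obtain ⟨φ, hφ, O, hO, h⟩ := h
  have h1 : χ ⁻¹' O ∈ 𝓝[B] z := (tendsto_nhdsWithin_iff.2 ⟨hχ, hm⟩) hO
  refine ⟨φ, hφ, χ ⁻¹' O ∩ N, inter_mem h1 hN, fun z₁ h₁ => ⟨(h _ h₁.1).1, fun z₂ h₂ => ?_⟩⟩
  exact ⟨((h _ h₁.1).2 _ h₂.1).1.trans (ht _ h₁.2 _ h₂.2).1,
    fun e => (ht _ h₁.2 _ h₂.2).2 (((h _ h₁.1).2 _ h₂.1).2 e)⟩

theorem LocFol.exists_injOn {Ψ : ℝ × ℝ → S} {z : ℝ × ℝ} (h : F.LocFol Ψ univ z) :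
    ∃ O ∈ 𝓝 z, InjOn Ψ O := by
  obtain ⟨φ, hφ, O, hO, h⟩ := h
  exact ⟨O, by simpa using hO, fun a ha b hb e => ((h a ha).2 b hb).2 e⟩

/-- Read in a chart, `Ψ` is an injective triangular map, so `triangular_image_mem_nhds` plays the
part of invariance of domain. -/
theorem LocFol.image_mem_nhds {Ψ : ℝ × ℝ → S} {z : ℝ × ℝ} (h : F.LocFol Ψ univ z)
    (hc : ∀ᶠ w in 𝓝 z, ContinuousAt Ψ w) {B : Set (ℝ × ℝ)} (hB : B ∈ 𝓝 z) : Ψ '' B ∈ 𝓝 (Ψ z) := by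
  obtain ⟨φ, hφ, O, hO, h⟩ := h
  rw [nhdsWithin_univ] at hO
  set B' := B ∩ O ∩ {w | ContinuousAt Ψ w}
  have hB' : B' ∈ 𝓝 z := inter_mem (inter_mem hB hO) hc
  have hz := mem_of_mem_nhds hB'
  have key := triangular_image_mem_nhds (G := fun w => φ (Ψ w)) (t := z.1) (s := z.2) hB'
    (fun w hw => ((φ.continuousAt (h w hw.1.2).1).comp hw.2).continuousWithinAt)
    (fun a ha b hb e => ((h a ha.1.2).2 b hb.1.2).2
      (φ.injOn (h a ha.1.2).1 (h b hb.1.2).1 e))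
    (fun a ha b hb => ((h a ha.1.2).2 b hb.1.2).1)
  have h2 := (φ.continuousAt (h z hz.1.2).1) key
  filter_upwards [h2, φ.open_source.mem_nhds (h z hz.1.2).1] with p ⟨w, hw, hwp⟩ hps
  exact ⟨w, hw.1.1, φ.injOn (h w hw.1.2).1 hps hwp⟩

/-- The local inverse of a locally foliated map. -/
theorem LocFol.exists_openPartialHomeomorph {Ψ : ℝ × ℝ → S} {z : ℝ × ℝ} (h : F.LocFol Ψ univ z)
    (hc : ∀ᶠ w in 𝓝 z, ContinuousAt Ψ w) {B : Set (ℝ × ℝ)} (hB : B ∈ 𝓝 z) :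
    ∃ e : OpenPartialHomeomorph (ℝ × ℝ) S, z ∈ e.source ∧ e.source ⊆ B ∧ ⇑e = Ψ := by
  obtain ⟨O, hO, hinj⟩ := h.exists_injOn
  have hev : ∀ᶠ w in 𝓝 z, F.LocFol Ψ univ w := by simpa using h.eventually
  obtain ⟨V, hV, hVo, hzV⟩ := mem_nhds_iff.1 (inter_mem (inter_mem hB hO)
    (inter_mem hev hc.eventually_nhds))
  have hVi : InjOn Ψ V := hinj.mono fun x hx => (hV hx).1.2
  let e : PartialEquiv (ℝ × ℝ) S := hVi.bijOn_image.toPartialEquiv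
  have he : ⇑e = Ψ := rfl
  refine ⟨OpenPartialHomeomorph.ofContinuousOpenRestrict e
    (fun w hw => ((hV hw).2.2.self_of_nhds).continuousWithinAt) ?_ hVo, hzV,
    fun w hw => (hV hw).1.1, rfl⟩
  refine isOpenMap_iff_nhds_le.2 fun w => ?_
  rw [nhds_subtype_eq_comap]
  intro B hB
  rw [mem_map, mem_comap] at hB
  obtain ⟨C, hC, hCB⟩ := hB
  have := (hV w.2).2.1.image_mem_nhds (hV w.2).2.2 (inter_mem hC (hVo.mem_nhds w.2))
  refine mem_of_superset this ?_
  rintro _ ⟨x, ⟨hxC, hxV⟩, rfl⟩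
  exact hCB (show (⟨x, hxV⟩ : e.source) ∈ Subtype.val ⁻¹' C from hxC)

/-- Along the common edge the two halves have the same heights, so rows go to plaques and distinct
rows to distinct plaques. Only a fold of a row at `b` could spoil injectivity. The row `s` does not
fold by `hinj`, and then neither do nearby rows. -/
theorem LocFol.glue {Ψ : ℝ × ℝ → S} {a b c s : ℝ} {J : Set ℝ} (hab : a < b) (hbc : b < c)
    (hJ : J ∈ 𝓝 s) (hc : ContinuousOn Ψ (Icc a c ×ˢ J)) (h1 : F.LocFol Ψ (Icc a b ×ˢ J) (b, s))
    (h2 : F.LocFol Ψ (Icc b c ×ˢ J) (b, s))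
    (hinj : ∃ N ∈ 𝓝 b, InjOn (fun t => Ψ (t, s)) (N ∩ Icc a c)) :
    F.LocFol Ψ (Icc a c ×ˢ J) (b, s) := by
  have hsJ := mem_of_mem_nhds hJ
  have hA1 : Icc a b ×ˢ J ⊆ Icc a c ×ˢ J := prod_mono (Icc_subset_Icc_right hbc.le) subset_rfl
  have hA2 : Icc b c ×ˢ J ⊆ Icc a c ×ˢ J := prod_mono (Icc_subset_Icc_left hab.le) subset_rfl
  have hb1 : (b, s) ∈ Icc a b ×ˢ J := ⟨⟨hab.le, le_rfl⟩, hsJ⟩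
  have hb2 : (b, s) ∈ Icc b c ×ˢ J := ⟨⟨le_rfl, hbc.le⟩, hsJ⟩
  obtain ⟨φ, hφ, O₁, hO₁, h1⟩ := h1
  have hsrc := (h1 _ (mem_of_mem_nhdsWithin hb1 hO₁)).1
  obtain ⟨O₂, hO₂, h2⟩ := h2.exists_chart hb2 ((hc.mono hA2) _ hb2) hφ hsrc
  obtain ⟨N, hN, hNi⟩ := hinj
  obtain ⟨U₁, hU₁, hU₁O⟩ := mem_nhdsWithin_iff_exists_mem_nhds_inter.1 hO₁
  obtain ⟨U₂, hU₂, hU₂O⟩ := mem_nhdsWithin_iff_exists_mem_nhds_inter.1 hO₂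
  have hbox : (U₁ ∩ U₂) ∩ ((N ∩ Icc a c) ×ˢ J) ∈ 𝓝 (b, s) :=
    inter_mem (inter_mem hU₁ hU₂) (prod_mem_nhds (inter_mem hN (Icc_mem_nhds hab hbc)) hJ)
  obtain ⟨η, hη, hsub⟩ := Metric.nhds_basis_closedBall.mem_iff.1 hbox
  rw [← closedBall_prod_same, Real.closedBall_eq_Icc, Real.closedBall_eq_Icc] at hsub
  set K := Icc (s - η) (s + η)
  have hK : K ∈ 𝓝 s := Icc_mem_nhds (by linarith) (by linarith)
  have hsK : s ∈ K := mem_of_mem_nhds hK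
  have hL : ∀ t ∈ Icc (b - η) b, ∀ s' ∈ K, (t, s') ∈ O₁ := fun t ht s' hs' => by
    have := hsub (show (t, s') ∈ Icc (b - η) (b + η) ×ˢ K from ⟨⟨ht.1, by linarith [ht.2]⟩, hs'⟩)
    exact hU₁O ⟨this.1.1, ⟨this.2.1.2.1, ht.2⟩, this.2.2⟩
  have hR : ∀ t ∈ Icc b (b + η), ∀ s' ∈ K, (t, s') ∈ O₂ := fun t ht s' hs' => by
    have := hsub (show (t, s') ∈ Icc (b - η) (b + η) ×ˢ K from ⟨⟨by linarith [ht.1], ht.2⟩, hs'⟩)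
    exact hU₂O ⟨this.1.2, ⟨ht.1, this.2.1.2.2⟩, this.2.2⟩
  have hLR : ∀ t ∈ Icc (b - η) (b + η), ∀ s' ∈ K, Ψ (t, s') ∈ φ.source ∧
      (φ (Ψ (t, s'))).2 = (φ (Ψ (b, s'))).2 := fun t ht s' hs' => by
    rcases le_total t b with h | h
    · have := h1 _ (hL t ⟨ht.1, h⟩ s' hs')
      exact ⟨this.1, (this.2 _ (hL b ⟨by linarith, le_rfl⟩ s' hs')).1.2 rfl⟩
    · have := h2 _ (hR t ⟨h, ht.2⟩ s' hs')
      exact ⟨this.1, (this.2 _ (hR b ⟨le_rfl, by linarith⟩ s' hs')).1.2 rfl⟩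
  have hcont : ContinuousOn (fun z => φ (Ψ z)) (Icc (b - η) (b + η) ×ˢ K) :=
    φ.continuousOn.comp (hc.mono fun z hz => ⟨(hsub hz).2.1.2, (hsub hz).2.2⟩)
      fun z hz => (hLR z.1 hz.1 z.2 hz.2).1
  have hxi : ∀ t ∈ Icc (b - η) (b + η), ∀ t' ∈ Icc (b - η) (b + η), ∀ s' ∈ K,
      (φ (Ψ (t, s'))).1 = (φ (Ψ (t', s'))).1 → Ψ (t, s') = Ψ (t', s') := fun t ht t' ht' s' hs' h =>
    φ.injOn (hLR t ht s' hs').1 (hLR t' ht' s' hs').1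
      (Prod.ext h ((hLR t ht s' hs').2.trans (hLR t' ht' s' hs').2.symm))
  have sub1 : Icc (b - η) b ⊆ Icc (b - η) (b + η) := Icc_subset_Icc_right (by linarith)
  have sub2 : Icc b (b + η) ⊆ Icc (b - η) (b + η) := Icc_subset_Icc_left (by linarith)
  have key := eventually_injOn_of_halves (g := fun z => (φ (Ψ z)).1) hη hK
    (continuous_fst.comp_continuousOn hcont)
    (fun s' hs' t ht t' ht' e => congrArg Prod.fst
      (((h1 _ (hL t ht s' hs')).2 _ (hL t' ht' s' hs')).2
        (hxi t (sub1 ht) t' (sub1 ht') s' hs' e)))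
    (fun s' hs' t ht t' ht' e => congrArg Prod.fst
      (((h2 _ (hR t ht s' hs')).2 _ (hR t' ht' s' hs')).2
        (hxi t (sub2 ht) t' (sub2 ht') s' hs' e)))
    (fun t ht t' ht' e => hNi (hsub (show (t, s) ∈ _ from ⟨ht, hsK⟩)).2.1
      (hsub (show (t', s) ∈ _ from ⟨ht', hsK⟩)).2.1 (hxi t ht t' ht' s hsK e))
  refine ⟨φ, hφ, Icc (b - η) (b + η) ×ˢ (K ∩ {s' | InjOn (fun t => (φ (Ψ (t, s'))).1)
    (Icc (b - η) (b + η))}), mem_nhdsWithin_of_mem_nhds (prod_mem_nhds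
      (Icc_mem_nhds (by linarith) (by linarith)) (inter_mem hK key)), ?_⟩
  rintro ⟨t, s₁⟩ ⟨ht, hs₁, hi₁⟩
  refine ⟨(hLR t ht s₁ hs₁).1, ?_⟩
  rintro ⟨t', s₂⟩ ⟨ht', hs₂, hi₂⟩
  have hbb : b ∈ Icc b (b + η) := ⟨le_rfl, by linarith⟩
  have hiff : (φ (Ψ (t, s₁))).2 = (φ (Ψ (t', s₂))).2 ↔ s₁ = s₂ := by
    rw [(hLR t ht s₁ hs₁).2, (hLR t' ht' s₂ hs₂).2]
    exact ((h2 _ (hR b hbb s₁ hs₁)).2 _ (hR b hbb s₂ hs₂)).1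
  refine ⟨hiff, fun e => ?_⟩
  have e2 : s₁ = s₂ := hiff.1 (by rw [e])
  subst e2
  exact Prod.ext (hi₁ ht ht' (by simp only [e])) rfl

end OneFoliation

/-! ### Transport along leaves. -/

/-- `J` need not be closed, so the two strips need not be closed sets; it suffices that each is
closed relative to the points with second coordinate in `J`. -/
theorem continuousOn_Icc_prod_glue {X : Type*} [TopologicalSpace X] {f : ℝ × ℝ → X} {a b c : ℝ}
    {J : Set ℝ} (hab : a ≤ b) (hbc : b ≤ c) (h1 : ContinuousOn f (Icc a b ×ˢ J))
    (h2 : ContinuousOn f (Icc b c ×ˢ J)) : ContinuousOn f (Icc a c ×ˢ J) := by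
  rw [← Icc_union_Icc_eq_Icc hab hbc, union_prod]
  intro z hz
  have hzJ : z.2 ∈ J := hz.elim (fun h => h.2) fun h => h.2
  have c1 : ContinuousWithinAt f (Icc a b ×ˢ J) z := by
    by_cases h : z ∈ Icc a b ×ˢ J
    · exact h1 z h
    by_cases h' : z ∈ closure (Icc a b ×ˢ J)
    · have : z ∈ Icc a b ×ˢ closure J := by rwa [closure_prod_eq, isClosed_Icc.closure_eq] at h'
      exact absurd ⟨this.1, hzJ⟩ h
    · exact continuousWithinAt_of_notMem_closure h'
  have c2 : ContinuousWithinAt f (Icc b c ×ˢ J) z := by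
    by_cases h : z ∈ Icc b c ×ˢ J
    · exact h2 z h
    by_cases h' : z ∈ closure (Icc b c ×ˢ J)
    · have : z ∈ Icc b c ×ˢ closure J := by rwa [closure_prod_eq, isClosed_Icc.closure_eq] at h'
      exact absurd ⟨this.1, hzJ⟩ h
    · exact continuousWithinAt_of_notMem_closure h'
  exact c1.union c2

theorem nhdsWithin_Icc_prod_le_of_lt {a b c : ℝ} {J : Set ℝ} {z : ℝ × ℝ} (h : z.1 < b) :
    𝓝[Icc a c ×ˢ J] z ≤ 𝓝[Icc a b ×ˢ J] z := by
  refine le_inf nhdsWithin_le_nhds (le_principal_iff.2 ?_)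
  filter_upwards [self_mem_nhdsWithin,
    mem_nhdsWithin_of_mem_nhds (continuousAt_fst.eventually_lt_const h)] with w hw hw'
  exact ⟨⟨hw.1.1, le_of_lt hw'⟩, hw.2⟩

theorem nhdsWithin_Icc_prod_le_of_gt {a b c : ℝ} {J : Set ℝ} {z : ℝ × ℝ} (h : b < z.1) :
    𝓝[Icc a c ×ˢ J] z ≤ 𝓝[Icc b c ×ˢ J] z := by
  refine le_inf nhdsWithin_le_nhds (le_principal_iff.2 ?_)
  filter_upwards [self_mem_nhdsWithin,
    mem_nhdsWithin_of_mem_nhds (continuousAt_fst.eventually_const_lt h)] with w hw hw'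
  exact ⟨⟨le_of_lt hw', hw.1.2⟩, hw.2⟩

theorem exists_Ioo_subset_of_mem_nhds {s : ℝ} {N : Set ℝ} (hN : N ∈ 𝓝 s) :
    ∃ δ > 0, Ioo (s - δ) (s + δ) ⊆ N := by
  obtain ⟨δ, hδ, h⟩ := Metric.mem_nhds_iff.1 hN
  exact ⟨δ, hδ, by rwa [Real.ball_eq_Ioo] at h⟩

theorem Ioo_symm_mem_nhds {s δ : ℝ} (hδ : 0 < δ) : Ioo (s - δ) (s + δ) ∈ 𝓝 s :=
  Ioo_mem_nhds (by linarith) (by linarith)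

namespace OneFoliation

variable {S : Type*} [TopologicalSpace S] {F : OneFoliation S}

theorem LocFol.of_nhdsWithin_le {Ψ : ℝ × ℝ → S} {A B : Set (ℝ × ℝ)} {z : ℝ × ℝ}
    (h : F.LocFol Ψ A z) (hB : 𝓝[B] z ≤ 𝓝[A] z) : F.LocFol Ψ B z := by
  obtain ⟨φ, hφ, O, hO, h⟩ := h
  exact ⟨φ, hφ, O, hB hO, h⟩

/-- Being locally foliated is an open condition, and the core arc is compact: a condition along the
core spreads to a thin strip. -/
theorem LocFol.exists_uniform {Ψ : ℝ × ℝ → S} {a b s : ℝ} {J : Set ℝ} (hJ : J ∈ 𝓝 s)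
    (h : ∀ t ∈ Icc a b, F.LocFol Ψ (Icc a b ×ˢ J) (t, s)) :
    ∃ δ > 0, Ioo (s - δ) (s + δ) ⊆ J ∧
      ∀ z ∈ Icc a b ×ˢ Ioo (s - δ) (s + δ), F.LocFol Ψ (Icc a b ×ˢ J) z := by
  have := isCompact_Icc.eventually_forall_of_forall_eventually (x₀ := s) (K := Icc a b)
    (P := fun s' t => (t, s') ∈ Icc a b ×ˢ J → F.LocFol Ψ (Icc a b ×ˢ J) (t, s')) (by
      intro t ht
      have h1 := (h t ht).eventually
      rw [eventually_nhdsWithin_iff] at h1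
      exact (continuous_swap.tendsto (s, t)).eventually h1)
  obtain ⟨δ, hδ, hsub⟩ := exists_Ioo_subset_of_mem_nhds (inter_mem this hJ)
  refine ⟨δ, hδ, fun s' hs' => (hsub hs').2, fun z hz => ?_⟩
  exact (hsub hz.2).1 z.1 hz.1 ⟨hz.1, (hsub hz.2).2⟩

/-- Existence of a flow box along a locally injective arc in a leaf, starting at a given
transversal. -/
theorem exists_transport [SecondCountableTopology S] {c : ℝ → S} {a b s₀ : ℝ} (hab : a ≤ b)
    (hc : Continuous c) (hloc : ∀ t ∈ Icc a b, ∃ N ∈ 𝓝 t, InjOn c N)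
    (hleaf : ∀ t ∈ Icc a b, c t ∈ F.leaf (c a)) {v : ℝ → S} {J₀ : Set ℝ} (hJ₀ : J₀ ∈ 𝓝 s₀)
    (hv : ContinuousOn v J₀) (hv0 : v s₀ = c a) {φ₀ : OpenPartialHomeomorph S (ℝ × ℝ)}
    (hφ₀ : φ₀ ∈ F.atlas) (hvs : ∀ s ∈ J₀, v s ∈ φ₀.source)
    (hvy : InjOn (fun s => (φ₀ (v s)).2) J₀) :
    ∃ Ψ : ℝ × ℝ → S, ∃ δ > 0, Ioo (s₀ - δ) (s₀ + δ) ⊆ J₀ ∧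
      ContinuousOn Ψ (Icc a b ×ˢ Ioo (s₀ - δ) (s₀ + δ)) ∧
      (∀ s ∈ Ioo (s₀ - δ) (s₀ + δ), Ψ (a, s) = v s) ∧ (∀ t ∈ Icc a b, Ψ (t, s₀) = c t) ∧
      (∀ z ∈ Icc a b ×ˢ Ioo (s₀ - δ) (s₀ + δ), Ψ z ∈ F.leaf (v z.2)) ∧
      ∀ z ∈ Icc a b ×ˢ Ioo (s₀ - δ) (s₀ + δ),
        F.LocFol Ψ (Icc a b ×ˢ Ioo (s₀ - δ) (s₀ + δ)) z := by
  -- It is enough to be locally foliated along the core `s = s₀`; `LocFol.exists_uniform` then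
  -- shrinks the strip. The weaker form is the one that survives gluing.
  suffices H : ∃ Ψ : ℝ × ℝ → S, ∃ δ > 0, Ioo (s₀ - δ) (s₀ + δ) ⊆ J₀ ∧
      ContinuousOn Ψ (Icc a b ×ˢ Ioo (s₀ - δ) (s₀ + δ)) ∧
      (∀ s ∈ Ioo (s₀ - δ) (s₀ + δ), Ψ (a, s) = v s) ∧ (∀ t ∈ Icc a b, Ψ (t, s₀) = c t) ∧
      (∀ z ∈ Icc a b ×ˢ Ioo (s₀ - δ) (s₀ + δ), Ψ z ∈ F.leaf (v z.2)) ∧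
      ∀ t ∈ Icc a b, F.LocFol Ψ (Icc a b ×ˢ Ioo (s₀ - δ) (s₀ + δ)) (t, s₀) by
    obtain ⟨Ψ, δ, hδ, h1, h2, h3, h4, h5, h6⟩ := H
    obtain ⟨δ', hδ', hsub, h7⟩ := LocFol.exists_uniform (Ioo_symm_mem_nhds hδ) h6
    have hp : Icc a b ×ˢ Ioo (s₀ - δ') (s₀ + δ') ⊆ Icc a b ×ˢ Ioo (s₀ - δ) (s₀ + δ) :=
      prod_mono subset_rfl hsub
    exact ⟨Ψ, δ', hδ', hsub.trans h1, h2.mono hp, fun s hs => h3 s (hsub hs), h4,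
      fun z hz => h5 z (hp hz), fun z hz => (h7 z hz).mono hp⟩
  refine Icc_local_induction (P := fun b => ∃ Ψ : ℝ × ℝ → S, ∃ δ > 0, Ioo (s₀ - δ) (s₀ + δ) ⊆ J₀ ∧
      ContinuousOn Ψ (Icc a b ×ˢ Ioo (s₀ - δ) (s₀ + δ)) ∧
      (∀ s ∈ Ioo (s₀ - δ) (s₀ + δ), Ψ (a, s) = v s) ∧ (∀ t ∈ Icc a b, Ψ (t, s₀) = c t) ∧
      (∀ z ∈ Icc a b ×ˢ Ioo (s₀ - δ) (s₀ + δ), Ψ z ∈ F.leaf (v z.2)) ∧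
      ∀ t ∈ Icc a b, F.LocFol Ψ (Icc a b ×ˢ Ioo (s₀ - δ) (s₀ + δ)) (t, s₀)) hab ?_ ?_
  · obtain ⟨δ, hδ, hsub⟩ := exists_Ioo_subset_of_mem_nhds hJ₀
    have haa : ∀ t ∈ Icc a a, t = a := fun t ht => le_antisymm ht.2 ht.1
    refine ⟨fun z => v z.2, δ, hδ, hsub, hv.comp (by fun_prop) fun z hz => hsub hz.2,
      fun _ _ => rfl, fun t ht => by rw [haa t ht, ← hv0], fun z _ => F.mem_leaf_self _,
      fun t ht => ⟨φ₀, hφ₀, _, self_mem_nhdsWithin, fun z hz => ⟨hvs _ (hsub hz.2),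
        fun w hw => ?_⟩⟩⟩
    have hiff : (φ₀ (v z.2)).2 = (φ₀ (v w.2)).2 ↔ z.2 = w.2 :=
      ⟨fun e => hvy (hsub hz.2) (hsub hw.2) e, fun e => by rw [e]⟩
    exact ⟨hiff, fun e => Prod.ext ((haa _ hz.1).trans (haa _ hw.1).symm)
      (hiff.1 (by rw [show v z.2 = v w.2 from e]))⟩
  · intro t₁ ht₁
    obtain ⟨φ, hφ, hφt⟩ := F.cover (c t₁)
    obtain ⟨N, hN, hNi⟩ := hloc t₁ ht₁
    obtain ⟨ε, hε, hεs⟩ := Metric.mem_nhds_iff.1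
      (inter_mem hN (hc.continuousAt (φ.open_source.mem_nhds hφt)))
    refine ⟨ε, hε, fun x hx y hy hxt hyt hxy => ?_⟩
    rintro ⟨Ψ, δ, hδ, h1, h2, h3, h4, h5, h6⟩
    rcases hxy.eq_or_lt with rfl | hxy
    · exact ⟨Ψ, δ, hδ, h1, h2, h3, h4, h5, h6⟩
    have hsub : ∀ t ∈ Icc x y, t ∈ N ∧ c t ∈ φ.source := fun t ht => by
      refine hεs ?_
      rw [Metric.mem_ball, Real.dist_eq]
      rw [abs_lt] at hxt hyt ⊢
      exact ⟨by linarith [ht.1], by linarith [ht.2]⟩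
    have hxI : x ∈ Icc x y := ⟨le_rfl, hxy.le⟩
    have hxa : x ∈ Icc a x := ⟨hx.1, le_rfl⟩
    have hcy : ∀ t ∈ Icc x y, (φ (c t)).2 = (φ (c x)).2 := fun t ht =>
      chart_snd_eq_of_isPreconnected hφ isPreconnected_Icc hc.continuousOn
        (fun t ht => hleaf t ⟨hx.1.trans ht.1, ht.2.trans hy.2⟩) (fun t ht => (hsub t ht).2) ht hxI
    have hsJ : s₀ ∈ Ioo (s₀ - δ) (s₀ + δ) := mem_of_mem_nhds (Ioo_symm_mem_nhds hδ)
    have hΨx : Ψ (x, s₀) = c x := h4 x hxa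
    obtain ⟨O, hO, hOφ⟩ := (h6 x hxa).exists_chart (z := (x, s₀)) ⟨hxa, hsJ⟩ (h2 _ ⟨hxa, hsJ⟩) hφ
      (by rw [hΨx]; exact (hsub x hxI).2)
    obtain ⟨U, hU, hUO⟩ := mem_nhdsWithin_iff_exists_mem_nhds_inter.1 hO
    obtain ⟨δ', hδ', hδ's⟩ := exists_Ioo_subset_of_mem_nhds (inter_mem (Ioo_symm_mem_nhds hδ)
      ((show ContinuousAt (fun s => (x, s)) s₀ by fun_prop) hU))
    set J := Ioo (s₀ - δ') (s₀ + δ') with hJdef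
    have hJ : J ∈ 𝓝 s₀ := Ioo_symm_mem_nhds hδ'
    have hsJ' : s₀ ∈ J := mem_of_mem_nhds hJ
    have hJδ : J ⊆ Ioo (s₀ - δ) (s₀ + δ) := fun s hs => (hδ's hs).1
    have hpO : ∀ s ∈ J, (x, s) ∈ O := fun s hs => hUO ⟨(hδ's hs).2, hxa, hJδ hs⟩
    have hps : ∀ s ∈ J, Ψ (x, s) ∈ φ.source := fun s hs => (hOφ _ (hpO s hs)).1
    have hpc : ContinuousOn (fun z : ℝ × ℝ => φ (Ψ (x, z.2))) (Icc x y ×ˢ J) :=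
      φ.continuousOn.comp (h2.comp (by fun_prop) fun z hz => ⟨hxa, hJδ hz.2⟩)
        fun z hz => hps z.2 hz.2
    have hcc : ContinuousOn (fun z : ℝ × ℝ => φ (c z.1)) (Icc x y ×ˢ J) :=
      φ.continuousOn.comp (by fun_prop) fun z hz => (hsub z.1 hz.1).2
    -- Inside one chart, every nearby plaque is followed by copying the displacement of `c` since
    -- time `x`. This displacement is horizontal by `hcy`, and the sum is a legitimate point because
    -- the chart is onto `ℝ × ℝ`.
    let Ψ₂ : ℝ × ℝ → S := fun z => φ.symm (φ (c z.1) - φ (c x) + φ (Ψ (x, z.2)))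
    have hΨ₂c : ContinuousOn Ψ₂ (Icc x y ×ˢ J) :=
      (continuous_chart_symm hφ).comp_continuousOn ((hcc.sub continuousOn_const).add hpc)
    have hΨ₂φ : ∀ z, φ (Ψ₂ z) = φ (c z.1) - φ (c x) + φ (Ψ (x, z.2)) := fun z =>
      chart_right_inv hφ _
    have hΨ₂x : ∀ s ∈ J, Ψ₂ (x, s) = Ψ (x, s) := fun s hs => by
      simp only [Ψ₂, sub_self, zero_add]
      exact φ.left_inv (hps s hs)
    have hΨ₂y : ∀ z ∈ Icc x y ×ˢ J, (φ (Ψ₂ z)).2 = (φ (Ψ (x, z.2))).2 := fun z hz => by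
      rw [hΨ₂φ]; simp [hcy z.1 hz.1]
    have hΨ₂L : ∀ t ∈ Icc x y, F.LocFol Ψ₂ (Icc x y ×ˢ J) (t, s₀) := fun t ht => by
      refine ⟨φ, hφ, _, self_mem_nhdsWithin, fun z hz => ⟨chart_symm_mem hφ _, fun w hw => ?_⟩⟩
      have hiff : (φ (Ψ₂ z)).2 = (φ (Ψ₂ w)).2 ↔ z.2 = w.2 := by
        rw [hΨ₂y z hz, hΨ₂y w hw]
        exact ((hOφ _ (hpO _ hz.2)).2 _ (hpO _ hw.2)).1.trans (by simp)
      refine ⟨hiff, fun e => ?_⟩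
      have e2 : z.2 = w.2 := hiff.1 (by rw [e])
      have e1 : φ (Ψ₂ z) = φ (Ψ₂ w) := by rw [e]
      rw [hΨ₂φ, hΨ₂φ, e2] at e1
      have e3 : φ (c z.1) = φ (c w.1) := by simpa using e1
      exact Prod.ext (hNi (hsub _ hz.1).1 (hsub _ hw.1).1
        (φ.injOn (hsub _ hz.1).2 (hsub _ hw.1).2 e3)) e2
    let Ψ' : ℝ × ℝ → S := fun z => if z.1 ≤ x then Ψ z else Ψ₂ z
    have e1 : EqOn Ψ' Ψ (Icc a x ×ˢ J) := fun z hz => if_pos hz.1.2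
    have e2 : EqOn Ψ' Ψ₂ (Icc x y ×ˢ J) := fun z hz => by
      rcases hz.1.1.eq_or_lt with h | h
      · have hz1 : z = (x, z.2) := Prod.ext h.symm rfl
        rw [hz1, hΨ₂x _ hz.2]
        exact if_pos le_rfl
      · exact if_neg h.not_ge
    have hc1 : ContinuousOn Ψ' (Icc a x ×ˢ J) :=
      (h2.mono (prod_mono subset_rfl hJδ)).congr e1
    have hc2 : ContinuousOn Ψ' (Icc x y ×ˢ J) := hΨ₂c.congr e2
    have hc' := continuousOn_Icc_prod_glue hx.1 hxy.le hc1 hc2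
    have hL1 : ∀ t ∈ Icc a x, F.LocFol Ψ' (Icc a x ×ˢ J) (t, s₀) := fun t ht =>
      ((h6 t ht).mono (prod_mono subset_rfl hJδ)).congr (eventuallyEq_nhdsWithin_of_eqOn e1)
    have hL2 : ∀ t ∈ Icc x y, F.LocFol Ψ' (Icc x y ×ˢ J) (t, s₀) := fun t ht =>
      (hΨ₂L t ht).congr (eventuallyEq_nhdsWithin_of_eqOn e2)
    have h4' : ∀ t ∈ Icc a y, Ψ' (t, s₀) = c t := fun t ht => by
      rcases le_total t x with h | h
      · rw [e1 ⟨⟨ht.1, h⟩, hsJ'⟩]; exact h4 t ⟨ht.1, h⟩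
      · rw [e2 ⟨⟨h, ht.2⟩, hsJ'⟩]
        simp only [Ψ₂, hΨx, sub_add_cancel]
        exact φ.left_inv (hsub t ⟨h, ht.2⟩).2
    refine ⟨Ψ', δ', hδ', hJδ.trans h1, hc', ?_, h4', ?_, ?_⟩
    · intro s hs
      rw [e1 ⟨⟨le_rfl, hx.1⟩, hs⟩]
      exact h3 s (hJδ hs)
    · intro z hz
      rcases le_total z.1 x with h | h
      · rw [e1 ⟨⟨hz.1.1, h⟩, hz.2⟩]
        exact h5 z ⟨⟨hz.1.1, h⟩, hJδ hz.2⟩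
      · have hz2 : z ∈ Icc x y ×ˢ J := ⟨⟨h, hz.1.2⟩, hz.2⟩
        rw [e2 hz2]
        exact mem_leaf_trans (h5 (x, z.2) ⟨hxa, hJδ hz.2⟩) (chart_samePlaque hφ (hps _ hz.2)
          (chart_symm_mem hφ _) (hΨ₂y z hz2).symm).mem_leaf
    · intro t ht
      rcases lt_trichotomy t x with h | h | h
      · exact (hL1 t ⟨ht.1, h.le⟩).of_nhdsWithin_le (nhdsWithin_Icc_prod_le_of_lt h)
      · subst h
        rcases hx.1.eq_or_lt with h' | h'
        · rw [h']; exact hL2 t hxI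
        -- At the seam the core row does not fold because it is the locally injective arc `c`.
        · refine LocFol.glue h' hxy hJ hc' (hL1 t hxa) (hL2 t hxI) ?_
          obtain ⟨N', hN', hN'i⟩ := hloc t hx
          exact ⟨N', hN', fun p hp q hq e => hN'i hp.1 hq.1
            ((h4' p hp.2).symm.trans (e.trans (h4' q hq.2)))⟩
      · exact (hL2 t ⟨h.le, ht.2⟩).of_nhdsWithin_le (nhdsWithin_Icc_prod_le_of_gt h)

/-- Two families of paths in leaves that start at the same points and have one path in common
run through the same plaques. -/
theorem eventually_chart_snd_eq [SecondCountableTopology S] {K Ψ : ℝ × ℝ → S} {a b s₀ : ℝ}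
    (hab : a ≤ b) {J : Set ℝ} (hJ : J ∈ 𝓝 s₀) (hK : ContinuousOn K (Icc a b ×ˢ J))
    (hΨ : ContinuousOn Ψ (Icc a b ×ˢ J)) (h0 : ∀ t ∈ Icc a b, K (t, s₀) = Ψ (t, s₀))
    (ha : ∀ s ∈ J, K (a, s) = Ψ (a, s)) (hKl : ∀ z ∈ Icc a b ×ˢ J, K z ∈ F.leaf (K (a, z.2)))
    (hΨl : ∀ z ∈ Icc a b ×ˢ J, Ψ z ∈ F.leaf (Ψ (a, z.2)))
    {φ : OpenPartialHomeomorph S (ℝ × ℝ)} (hφ : φ ∈ F.atlas) (hφs : Ψ (b, s₀) ∈ φ.source) :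
    ∀ᶠ s in 𝓝 s₀, K (b, s) ∈ φ.source ∧ Ψ (b, s) ∈ φ.source ∧
      (φ (K (b, s))).2 = (φ (Ψ (b, s))).2 := by
  have hs₀ := mem_of_mem_nhds hJ
  have hcol : ∀ {f : ℝ × ℝ → S}, ContinuousOn f (Icc a b ×ˢ J) → ∀ t ∈ Icc a b,
      ContinuousAt (fun s => f (t, s)) s₀ := fun hf t ht =>
    (hf.comp (f := fun s => (t, s)) (s := J) (by fun_prop) fun s hs => ⟨ht, hs⟩).continuousAt hJ
  -- The claim is made for all charts around the current point, so that the induction may change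
  -- charts at every step.
  refine Icc_local_induction (P := fun b => ∀ φ ∈ F.atlas, Ψ (b, s₀) ∈ φ.source →
    ∀ᶠ s in 𝓝 s₀, K (b, s) ∈ φ.source ∧ Ψ (b, s) ∈ φ.source ∧
      (φ (K (b, s))).2 = (φ (Ψ (b, s))).2) hab ?_ ?_ φ hφ hφs
  · intro φ hφ hs
    filter_upwards [hJ, (hcol hΨ a ⟨le_rfl, hab⟩) (φ.open_source.mem_nhds hs)] with s hs hs'
    rw [ha s hs]
    exact ⟨hs', hs', rfl⟩
  · intro t₁ ht₁
    obtain ⟨φ₁, hφ₁, hφ₁t⟩ := F.cover (Ψ (t₁, s₀))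
    have hz : (t₁, s₀) ∈ Icc a b ×ˢ J := ⟨ht₁, hs₀⟩
    have n1 := hΨ _ hz (φ₁.open_source.mem_nhds hφ₁t)
    have n2 := hK _ hz (φ₁.open_source.mem_nhds ((h0 t₁ ht₁).symm ▸ hφ₁t))
    obtain ⟨U, hU, hUs⟩ := mem_nhdsWithin_iff_exists_mem_nhds_inter.1 (inter_mem n1 n2)
    obtain ⟨V, hV, V', hV', hVV⟩ := mem_nhds_prod_iff.1 hU
    obtain ⟨ε, hε, hεs⟩ := Metric.mem_nhds_iff.1 hV
    refine ⟨ε, hε, fun x hx y hy hxt hyt hxy hP φ hφ hφs => ?_⟩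
    have hmem : ∀ t ∈ Icc x y, ∀ s ∈ V' ∩ J, Ψ (t, s) ∈ φ₁.source ∧ K (t, s) ∈ φ₁.source := by
      intro t ht s hs
      refine hUs ⟨hVV ⟨hεs ?_, hs.1⟩, ⟨hx.1.trans ht.1, ht.2.trans hy.2⟩, hs.2⟩
      rw [Metric.mem_ball, Real.dist_eq]
      rw [abs_lt] at hxt hyt ⊢
      exact ⟨by linarith [ht.1], by linarith [ht.2]⟩
    have hxI : x ∈ Icc x y := ⟨le_rfl, hxy⟩
    have hyI : y ∈ Icc x y := ⟨hxy, le_rfl⟩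
    have hcst : ∀ {f : ℝ × ℝ → S}, ContinuousOn f (Icc a b ×ˢ J) →
        (∀ z ∈ Icc a b ×ˢ J, f z ∈ F.leaf (f (a, z.2))) → ∀ s ∈ V' ∩ J,
        (∀ t ∈ Icc x y, f (t, s) ∈ φ₁.source) → (φ₁ (f (x, s))).2 = (φ₁ (f (y, s))).2 := by
      intro f hf hfl s hs hfs
      have hI : ∀ t ∈ Icc x y, (t, s) ∈ Icc a b ×ˢ J := fun t ht =>
        ⟨⟨hx.1.trans ht.1, ht.2.trans hy.2⟩, hs.2⟩
      exact chart_snd_eq_of_isPreconnected hφ₁ (c := fun t => f (t, s)) isPreconnected_Icc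
        (hf.comp (by fun_prop) hI) (p := f (a, s)) (fun t ht => hfl _ (hI t ht)) hfs hxI hyI
    obtain ⟨W, hW, hWs, hWc⟩ := compatible_iff hφ₁ hφ (hmem y hyI s₀ ⟨mem_of_mem_nhds hV', hs₀⟩).1
      hφs
    filter_upwards [hP φ₁ hφ₁ (hmem x hxI s₀ ⟨mem_of_mem_nhds hV', hs₀⟩).1, inter_mem hV' hJ,
      (hcol hΨ y hy) hW, (hcol hK y hy) (show W ∈ 𝓝 (K (y, s₀)) by rw [h0 y hy]; exact hW)] with s h1 h2 h3 h4
    refine ⟨(hWs h4).2, (hWs h3).2, (hWc _ h4 _ h3).1 ?_⟩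
    rw [← hcst hK hKl s h2 fun t ht => (hmem t ht s h2).2, h1.2.2]
    exact hcst hΨ hΨl s h2 fun t ht => (hmem t ht s h2).1

/-- A path in a leaf is continuous for the leaf topology, given by an injective parametrization. -/
theorem continuousOn_leaf_param [SecondCountableTopology S] {c : ℝ → S} (hc : Continuous c)
    (hinj : Function.Injective c) {p : S} (hr : range c = F.leaf p) {j : ℝ → S} {m : ℝ → ℝ}
    {I : Set ℝ} (hI : I.OrdConnected) (hj : ContinuousOn j I) (hm : ∀ d ∈ I, c (m d) = j d) :
    ContinuousOn m I := by
  intro d₀ hd₀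
  have hcl : ∀ t, c t ∈ F.leaf p := fun t => hr ▸ mem_range_self t
  obtain ⟨φ, hφ, hφs⟩ := F.cover (c (m d₀))
  rw [ContinuousWithinAt, Metric.nhds_basis_closedBall.tendsto_right_iff]
  intro η hη
  obtain ⟨η', hη', hη's⟩ := Metric.nhds_basis_closedBall.mem_iff.1
    (hc.continuousAt (φ.open_source.mem_nhds hφs))
  set r := min η η'
  have hr0 : 0 < r := lt_min hη hη'
  set T := Icc (m d₀ - r) (m d₀ + r)
  have ht₀ : m d₀ ∈ T := ⟨by linarith, by linarith⟩
  have hTs : ∀ t ∈ T, c t ∈ φ.source := fun t ht => hη's (by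
    rw [Real.closedBall_eq_Icc]
    exact ⟨by linarith [ht.1, min_le_right η η'], by linarith [ht.2, min_le_right η η']⟩)
  have hTy : ∀ t ∈ T, (φ (c t)).2 = (φ (c (m d₀))).2 := fun t ht =>
    chart_snd_eq_of_isPreconnected hφ isPreconnected_Icc hc.continuousOn
      (fun t _ => hcl t) hTs ht ht₀
  -- The short arc of `c` on `T` fills a neighbourhood of its centre within its plaque. The path `j`
  -- remains in that plaque for `d` near `d₀`, hence on this arc, and injectivity of `c` forces `m
  -- d` into `T`.
  have hN := ContinuousOn.injOn_image_Icc_mem_nhds (s := m d₀) (a := m d₀ - r) (b := m d₀ + r)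
    (f := fun t => (φ (c t)).1) ⟨by linarith, by linarith⟩
    (continuous_fst.comp_continuousOn (φ.continuousOn.comp hc.continuousOn hTs))
    (fun t ht t' ht' e => hinj (φ.injOn (hTs t ht) (hTs t' ht')
      (Prod.ext e ((hTy t ht).trans (hTy t' ht').symm))))
  have hjs : j ⁻¹' φ.source ∈ 𝓝[I] d₀ := hj d₀ hd₀ (φ.open_source.mem_nhds (hm d₀ hd₀ ▸ hφs))
  obtain ⟨ε, hε, hεs⟩ := Metric.mem_nhdsWithin_iff.1 hjs
  have hA : IsPreconnected (Metric.ball d₀ ε ∩ I) := by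
    rw [Real.ball_eq_Ioo]
    exact (ordConnected_Ioo.inter hI).isPreconnected
  have hd₀A : d₀ ∈ Metric.ball d₀ ε ∩ I := ⟨Metric.mem_ball_self hε, hd₀⟩
  have hjx : ContinuousWithinAt (fun d => (φ (j d)).1) I d₀ :=
    continuous_fst.continuousAt.comp_continuousWithinAt
      ((φ.continuousAt (hm d₀ hd₀ ▸ hφs)).comp_continuousWithinAt (hj d₀ hd₀))
  have hN' := hjx (show _ ∈ 𝓝 (φ (j d₀)).1 by rw [← hm d₀ hd₀]; exact hN)
  filter_upwards [hN', mem_nhdsWithin_of_mem_nhds (Metric.ball_mem_nhds d₀ hε),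
    self_mem_nhdsWithin] with d ⟨t, ht, htx⟩ hd hdI
  have hdA : d ∈ Metric.ball d₀ ε ∩ I := ⟨hd, hdI⟩
  have hy : (φ (j d)).2 = (φ (j d₀)).2 :=
    chart_snd_eq_of_isPreconnected hφ hA (hj.mono inter_subset_right)
      (fun d hd => hm d hd.2 ▸ hcl _) (fun d hd => hεs hd) hdA hd₀A
  have : c t = c (m d) := by
    rw [hm d hdI]
    refine φ.injOn (hTs t ht) (hεs hdA) (Prod.ext htx ?_)
    rw [hTy t ht, hy, hm d₀ hd₀]
  rw [← hinj this, Real.closedBall_eq_Icc]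
  exact ⟨by linarith [ht.1, min_le_left η η'], by linarith [ht.2, min_le_left η η']⟩

end OneFoliation

/-! ### Winding numbers and the local degree. -/

theorem eq_of_continuous_of_int {X : Type*} [TopologicalSpace X] [PreconnectedSpace X] {g : X → ℝ}
    (hg : Continuous g) (h : ∀ x, ∃ n : ℤ, g x = n) (x y : X) : g x = g y := by
  have hc : (range g).Countable := (countable_range ((↑) : ℤ → ℝ)).mono (by
    rintro _ ⟨x, rfl⟩; obtain ⟨n, hn⟩ := h x; exact ⟨n, hn.symm⟩)
  exact hc.isTotallyDisconnected _ subset_rfl (isPreconnected_range hg) ⟨x, rfl⟩ ⟨y, rfl⟩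

theorem exists_continuous_log {D : ℝ × ℝ → ℂ} (hD : Continuous D) (h0 : ∀ z, D z ≠ 0) :
    ∃ L : ℝ × ℝ → ℂ, Continuous L ∧ ∀ z, Complex.exp (L z) = D z := by
  let f : C(ℝ × ℝ, {z : ℂ // z ≠ 0}) := ⟨fun z => ⟨D z, h0 z⟩, by fun_prop⟩
  obtain ⟨L, ⟨-, hL⟩, -⟩ := Complex.isCoveringMap_exp.existsUnique_continuousMap_lifts f (0, 0)
    (Complex.log (D (0, 0))) (Subtype.ext (Complex.exp_log (h0 _)))
  exact ⟨L, L.continuous, fun z => congrArg Subtype.val (congrFun hL z)⟩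

/-- The argument of `D` changes by `k * π` along each half-turn. -/
def HasWind (D : ℝ → ℂ) (k : ℤ) : Prop :=
  ∃ L : ℝ → ℂ, Continuous L ∧ (∀ θ, Complex.exp (L θ) = D θ) ∧
    ∀ θ, L (θ + Real.pi) = L θ + k * (Real.pi * Complex.I)

theorem pi_I_ne_zero : (Real.pi : ℂ) * Complex.I ≠ 0 :=
  mul_ne_zero (Complex.ofReal_ne_zero.2 Real.pi_ne_zero) Complex.I_ne_zero

/-- A half-turn negates `D`, so the logarithm changes by an odd multiple of `π * I`. That multiple
is continuous in all parameters and discrete, hence constant; being odd, it is nonzero. -/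
theorem exists_odd_hasWind {D : ℝ × ℝ → ℂ} (hD : Continuous D) (h0 : ∀ z, D z ≠ 0)
    (hanti : ∀ l θ, D (l, θ + Real.pi) = - D (l, θ)) :
    ∃ k : ℤ, Odd k ∧ ∀ l, HasWind (fun θ => D (l, θ)) k := by
  obtain ⟨L, hL, hexp⟩ := exists_continuous_log hD h0
  have hn : ∀ z : ℝ × ℝ, ∃ n : ℤ,
      L (z.1, z.2 + Real.pi) - L z = ((2 * n + 1 : ℤ) : ℂ) * (Real.pi * Complex.I) := by
    intro z
    have : Complex.exp (L (z.1, z.2 + Real.pi)) = Complex.exp (L z + Real.pi * Complex.I) := by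
      rw [Complex.exp_add, Complex.exp_pi_mul_I, hexp, hexp, hanti]; ring
    obtain ⟨n, hn⟩ := Complex.exp_eq_exp_iff_exists_int.1 this
    exact ⟨n, by rw [hn]; push_cast; ring⟩
  set g : ℝ × ℝ → ℂ := fun z => (L (z.1, z.2 + Real.pi) - L z) / (Real.pi * Complex.I) with hg
  have hgn : ∀ z, ∃ n : ℤ, g z = ((2 * n + 1 : ℤ) : ℂ) := fun z => by
    obtain ⟨n, hn⟩ := hn z
    exact ⟨n, by rw [hg]; simp only [hn]; exact mul_div_cancel_right₀ _ pi_I_ne_zero⟩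
  have hgc : Continuous fun z => (g z).re := by
    refine Complex.continuous_re.comp (Continuous.div_const ?_ _)
    exact (hL.comp (by fun_prop)).sub hL
  have hconst := eq_of_continuous_of_int hgc fun z => by
    obtain ⟨n, hn⟩ := hgn z
    exact ⟨2 * n + 1, by rw [hn]; exact Complex.intCast_re _⟩
  obtain ⟨n, hn0⟩ := hgn (0, 0)
  refine ⟨2 * n + 1, ⟨n, rfl⟩, fun l => ⟨fun θ => L (l, θ), by fun_prop, fun θ => hexp _,
    fun θ => ?_⟩⟩
  obtain ⟨m, hm⟩ := hgn (l, θ)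
  have h1 := hconst (l, θ) (0, 0)
  rw [hm, hn0, Complex.intCast_re, Complex.intCast_re] at h1
  have h2 : g (l, θ) = ((2 * n + 1 : ℤ) : ℂ) := by rw [hm]; exact_mod_cast h1
  rw [hg, div_eq_iff pi_I_ne_zero] at h2
  exact sub_eq_iff_eq_add'.1 h2

theorem HasWind.unique {D : ℝ → ℂ} {k k' : ℤ} (h : HasWind D k) (h' : HasWind D k') : k = k' := by
  obtain ⟨L, hL, hexp, hk⟩ := h
  obtain ⟨L', hL', hexp', hk'⟩ := h'
  have hn : ∀ θ, ∃ n : ℤ, L θ = L' θ + n * (2 * Real.pi * Complex.I) := fun θ =>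
    Complex.exp_eq_exp_iff_exists_int.1 ((hexp θ).trans (hexp' θ).symm)
  have h2 : (2 * Real.pi * Complex.I : ℂ) ≠ 0 := by
    rw [mul_assoc]; exact mul_ne_zero two_ne_zero pi_I_ne_zero
  have hconst := eq_of_continuous_of_int
    (g := fun θ => ((L θ - L' θ) / (2 * Real.pi * Complex.I)).re)
    (Complex.continuous_re.comp ((hL.sub hL').div_const _)) fun θ => by
      obtain ⟨n, hn⟩ := hn θ
      refine ⟨n, ?_⟩
      rw [hn, add_sub_cancel_left, mul_div_cancel_right₀ _ h2, Complex.intCast_re]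
  obtain ⟨n, hn0⟩ := hn 0
  obtain ⟨m, hm⟩ := hn (0 + Real.pi)
  have h1 := hconst 0 (0 + Real.pi)
  rw [hn0, hm, add_sub_cancel_left, add_sub_cancel_left, mul_div_cancel_right₀ _ h2,
    mul_div_cancel_right₀ _ h2, Complex.intCast_re, Complex.intCast_re] at h1
  have h3 : n = m := by exact_mod_cast h1
  rw [hk, hk', hn0, h3] at hm
  have h4 : (k : ℂ) * (Real.pi * Complex.I) = k' * (Real.pi * Complex.I) := by linear_combination hm
  exact_mod_cast mul_right_cancel₀ pi_I_ne_zero h4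

theorem HasWind.comp_neg {D : ℝ → ℂ} {k : ℤ} (h : HasWind D k) : HasWind (fun θ => D (-θ)) (-k) := by
  obtain ⟨L, hL, hexp, hk⟩ := h
  refine ⟨fun θ => L (-θ), by fun_prop, fun θ => hexp _, fun θ => ?_⟩
  have := hk (-θ - Real.pi)
  rw [sub_add_cancel] at this
  show L (-(θ + Real.pi)) = L (-θ) + _
  rw [this, neg_add']
  push_cast; ring

theorem HasWind.comp_add {D : ℝ → ℂ} {k : ℤ} (h : HasWind D k) (a : ℝ) :
    HasWind (fun θ => D (θ + a)) k := by
  obtain ⟨L, hL, hexp, hk⟩ := h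
  refine ⟨fun θ => L (θ + a), by fun_prop, fun θ => hexp _, fun θ => ?_⟩
  show L (θ + Real.pi + a) = L (θ + a) + _
  rw [← hk (θ + a)]
  ring_nf

namespace Torus

/-- An odd function on the torus, with values in the plane, vanishing only at the points of order
two. -/
noncomputable def oddMap (p : Torus) : ℂ :=
  ⟨(AddCircle.toCircle p.1 : ℂ).im, (AddCircle.toCircle p.2 : ℂ).im⟩

theorem continuous_oddMap : Continuous oddMap := by
  have : oddMap = fun p : Torus => (((AddCircle.toCircle p.1 : ℂ).im : ℝ) : ℂ) +
      (((AddCircle.toCircle p.2 : ℂ).im : ℝ) : ℂ) * Complex.I := by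
    funext p; exact Complex.ext (by simp [oddMap]) (by simp [oddMap])
  rw [this]
  have h1 : Continuous fun p : Torus => ((AddCircle.toCircle p.1 : ℂ).im : ℝ) :=
    Complex.continuous_im.comp (continuous_subtype_val.comp
      (AddCircle.continuous_toCircle.comp continuous_fst))
  have h2 : Continuous fun p : Torus => ((AddCircle.toCircle p.2 : ℂ).im : ℝ) :=
    Complex.continuous_im.comp (continuous_subtype_val.comp
      (AddCircle.continuous_toCircle.comp continuous_snd))
  exact (Complex.continuous_ofReal.comp h1).add
    ((Complex.continuous_ofReal.comp h2).mul continuous_const)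

theorem oddMap_neg (p : Torus) : oddMap (-p) = - oddMap p := by
  apply Complex.ext <;> simp [oddMap, AddCircle.toCircle_neg]

theorem eventually_oddMap : ∀ᶠ p : Torus in 𝓝 0, oddMap p = 0 → p = 0 := by
  have hc : ∀ x : UnitAddCircle, 0 < (AddCircle.toCircle x : ℂ).re →
      (AddCircle.toCircle x : ℂ).im = 0 → x = 0 := by
    intro x hre him
    have h1 : Complex.normSq (AddCircle.toCircle x : ℂ) = 1 := Circle.normSq_coe _
    rw [Complex.normSq_apply, him] at h1
    have h2 : (AddCircle.toCircle x : ℂ).re = 1 := by nlinarith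
    apply AddCircle.injective_toCircle one_ne_zero
    rw [AddCircle.toCircle_zero]
    exact Circle.ext (Complex.ext (by simpa using h2) (by simpa using him))
  have hpos : ∀ᶠ x : UnitAddCircle in 𝓝 0, 0 < (AddCircle.toCircle x : ℂ).re := by
    have : Continuous fun x : UnitAddCircle => (AddCircle.toCircle x : ℂ).re :=
      Complex.continuous_re.comp (continuous_subtype_val.comp AddCircle.continuous_toCircle)
    exact this.continuousAt.eventually_const_lt (by simp)
  have := hpos.prod_nhds hpos
  filter_upwards [this] with p hp h
  exact Prod.ext (hc p.1 hp.1 (congrArg Complex.re h)) (hc p.2 hp.2 (congrArg Complex.im h))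

/-- A continuous injective map of small oscillation on a convex open set. -/
def Good (Ψ : ℝ × ℝ → Torus) (O : Set (ℝ × ℝ)) : Prop :=
  ContinuousOn Ψ O ∧ ∀ p ∈ O, ∀ q ∈ O, oddMap (Ψ p - Ψ q) = 0 → p = q

theorem exists_good {Ψ : ℝ × ℝ → Torus} {z : ℝ × ℝ} (hc : ∀ᶠ w in 𝓝 z, ContinuousAt Ψ w)
    (hi : ∃ O ∈ 𝓝 z, InjOn Ψ O) : ∃ r > 0, Good Ψ (Metric.ball z r) := by
  obtain ⟨O, hO, hi⟩ := hi
  have h1 : Tendsto (fun w : (ℝ × ℝ) × (ℝ × ℝ) => Ψ w.1 - Ψ w.2) (𝓝 (z, z)) (𝓝 0) := by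
    have := (hc.self_of_nhds.comp (f := Prod.fst) (x := (z, z)) continuousAt_fst).sub
      (hc.self_of_nhds.comp (f := Prod.snd) (x := (z, z)) continuousAt_snd)
    rw [ContinuousAt] at this
    simp only [Pi.sub_apply, Function.comp_apply, sub_self] at this
    exact this
  obtain ⟨U, hU, V, hV, hUV⟩ := mem_nhds_prod_iff.1 (h1.eventually eventually_oddMap)
  obtain ⟨r, hr, hrs⟩ := Metric.mem_nhds_iff.1 (inter_mem (inter_mem hU hV) (inter_mem hO hc))
  refine ⟨r, hr, fun w hw => (hrs hw).2.2.continuousWithinAt, fun p hp q hq h => ?_⟩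
  exact hi (hrs hp).2.1 (hrs hq).2.1 (sub_eq_zero.1
    (hUV (show (p, q) ∈ U ×ˢ V from ⟨(hrs hp).1.1, (hrs hq).1.2⟩) h))

/-- The torus is a group, so a pair of nearby image points has a difference, which `oddMap` turns
into a plane vector without any lifting. A half-turn exchanges `P` and `Q`, and oddness of `oddMap`
turns this exchange into a sign. -/
theorem Good.exists_hasWind {Ψ : ℝ × ℝ → Torus} {O : Set (ℝ × ℝ)} (h : Good Ψ O)
    {P Q : ℝ × ℝ → ℝ × ℝ} (hP : Continuous P) (hQ : Continuous Q) (hPO : ∀ z, P z ∈ O)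
    (hQO : ∀ z, Q z ∈ O) (hne : ∀ z, P z ≠ Q z)
    (hPQ : ∀ l θ, P (l, θ + Real.pi) = Q (l, θ)) (hQP : ∀ l θ, Q (l, θ + Real.pi) = P (l, θ)) :
    ∃ k : ℤ, Odd k ∧ ∀ l, HasWind (fun θ => oddMap (Ψ (P (l, θ)) - Ψ (Q (l, θ)))) k := by
  refine exists_odd_hasWind (D := fun z => oddMap (Ψ (P z) - Ψ (Q z)))
    (continuous_oddMap.comp ((h.1.comp_continuous hP hPO).sub (h.1.comp_continuous hQ hQO)))
    (fun z hz => hne z (h.2 _ (hPO z) _ (hQO z) hz)) fun l θ => ?_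
  simp only [hPQ, hQP]
  rw [← oddMap_neg, neg_sub]

/-- The point at angle `θ` of the ellipse with centre `z` and semi-axes `a` and `b`. -/
noncomputable def ell (z : ℝ × ℝ) (a b θ : ℝ) : ℝ × ℝ :=
  (z.1 + a * Real.cos θ, z.2 + b * Real.sin θ)

theorem ell_add_pi (z : ℝ × ℝ) (a b θ : ℝ) : ell z a b (θ + Real.pi) = ell z (-a) (-b) θ := by
  simp [ell, Real.cos_add_pi, Real.sin_add_pi]

theorem ell_mem_ball {z w : ℝ × ℝ} {a b r δ θ : ℝ} (ha : |a| < δ) (hb : |b| < δ)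
    (hz : w ∈ Metric.ball z (r - δ)) : ell w a b θ ∈ Metric.ball z r := by
  have hzz := Metric.mem_ball.1 hz
  have h : dist (ell w a b θ) w < δ := by
    rw [Prod.dist_eq, max_lt_iff, Real.dist_eq, Real.dist_eq]
    simp only [ell, add_sub_cancel_left, abs_mul]
    exact ⟨(mul_le_of_le_one_right (abs_nonneg _) (Real.abs_cos_le_one θ)).trans_lt ha,
      (mul_le_of_le_one_right (abs_nonneg _) (Real.abs_sin_le_one θ)).trans_lt hb⟩
  rw [Metric.mem_ball]
  linarith [dist_triangle (ell w a b θ) w z]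

theorem cos_ne_zero_of_sin {θ : ℝ} (h : Real.sin θ = 0) : Real.cos θ ≠ 0 := fun h' => by
  have := Real.sin_sq_add_cos_sq θ
  rw [h, h'] at this; norm_num at this

/-- The local degree (or an odd multiple of it) of a locally injective map at a point. -/
def Ori (Ψ : ℝ × ℝ → Torus) (z : ℝ × ℝ) (k : ℤ) : Prop :=
  ∀ᶠ ρ in 𝓝[>] (0 : ℝ), HasWind (fun θ => oddMap (Ψ (ell z ρ ρ θ) - Ψ (ell z (-ρ) (-ρ) θ))) k

theorem Ori.unique {Ψ : ℝ × ℝ → Torus} {z : ℝ × ℝ} {k k' : ℤ} (h : Ori Ψ z k) (h' : Ori Ψ z k') :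
    k = k' := by
  obtain ⟨ρ, h1, h2⟩ := (h.and h').exists
  exact h1.unique h2

/-- Any two small circles are joined by moving centre and radius linearly. Antipodal points stay
distinct on the way, so the winding does not change. Allowing the centre to vary gives local
constancy of the degree. -/
theorem Good.exists_ori {Ψ : ℝ × ℝ → Torus} {z : ℝ × ℝ} {r : ℝ} (hr : 0 < r)
    (h : Good Ψ (Metric.ball z r)) :
    ∃ k : ℤ, Odd k ∧ ∀ w ∈ Metric.ball z (r / 2), ∀ ρ ∈ Ioo 0 (r / 2),
      HasWind (fun θ => oddMap (Ψ (ell w ρ ρ θ) - Ψ (ell w (-ρ) (-ρ) θ))) k := by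
  have key : ∀ w ∈ Metric.ball z (r / 2), ∀ ρ ∈ Ioo 0 (r / 2), ∃ k : ℤ, Odd k ∧
      HasWind (fun θ => oddMap (Ψ (ell w ρ ρ θ) - Ψ (ell w (-ρ) (-ρ) θ))) k ∧
      HasWind (fun θ => oddMap (Ψ (ell z (r / 4) (r / 4) θ) - Ψ (ell z (-(r / 4)) (-(r / 4)) θ)))
        k := by
    intro w hw ρ hρ
    -- The deformation is indexed by all of `ℝ`; clamping the parameter to `[0, 1]` keeps it inside
    -- the ball.
    let T : ℝ → ℝ := fun l => max 0 (min 1 l)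
    have hT : Continuous T := by fun_prop
    have hT0 : ∀ l, 0 ≤ T l := fun l => le_max_left _ _
    have hT1 : ∀ l, T l ≤ 1 := fun l => max_le zero_le_one (min_le_left _ _)
    let C : ℝ → ℝ × ℝ := fun l => (1 - T l) • w + T l • z
    let R : ℝ → ℝ := fun l => (1 - T l) * ρ + T l * (r / 4)
    have hRc : Continuous R := by fun_prop
    have hC1 : Continuous fun l => (C l).1 := by fun_prop
    have hC2 : Continuous fun l => (C l).2 := by fun_prop
    have hR : ∀ l, 0 < R l ∧ R l < r / 2 := fun l => by
      have h0 := hT0 l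
      have h1 := hT1 l
      have a1 : 0 ≤ (1 - T l) * ρ := mul_nonneg (by linarith) hρ.1.le
      have a2 : 0 ≤ T l * (r / 4) := mul_nonneg h0 (by linarith)
      have a3 : 0 ≤ (1 - T l) * (r / 2 - ρ) := mul_nonneg (by linarith) (by linarith [hρ.2])
      simp only [R]
      rcases h0.eq_or_lt with h | h
      · rw [← h]; constructor <;> linarith [hρ.1, hρ.2]
      · have a4 : 0 < T l * (r / 4) := mul_pos h (by linarith)
        constructor
        · linarith
        · nlinarith
    have hCb : ∀ l, C l ∈ Metric.ball z (r - r / 2) := fun l => by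
      rw [show r - r / 2 = r / 2 by ring]
      exact (convex_ball z (r / 2)) hw (Metric.mem_ball_self (by linarith))
        (by linarith [hT1 l]) (hT0 l) (by ring)
    obtain ⟨k, hk, hkw⟩ := h.exists_hasWind
      (P := fun q => ell (C q.1) (R q.1) (R q.1) q.2)
      (Q := fun q => ell (C q.1) (-R q.1) (-R q.1) q.2)
      (by unfold ell; fun_prop) (by unfold ell; fun_prop)
      (fun q => ell_mem_ball (by rw [abs_of_pos (hR _).1]; exact (hR _).2)
        (by rw [abs_of_pos (hR _).1]; exact (hR _).2) (hCb _))
      (fun q => ell_mem_ball (by rw [abs_neg, abs_of_pos (hR _).1]; exact (hR _).2)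
        (by rw [abs_neg, abs_of_pos (hR _).1]; exact (hR _).2) (hCb _))
      (fun q e => by
        have e1 := congrArg Prod.fst e
        have e2 := congrArg Prod.snd e
        simp only [ell] at e1 e2
        have hRq := (hR q.1).1
        have h1 : R q.1 * Real.cos q.2 = 0 := by linarith
        have h2 : R q.1 * Real.sin q.2 = 0 := by linarith
        exact cos_ne_zero_of_sin ((mul_eq_zero.1 h2).resolve_left hRq.ne')
          ((mul_eq_zero.1 h1).resolve_left hRq.ne'))
      (fun l θ => ell_add_pi _ _ _ _) (fun l θ => by simp only [ell_add_pi, neg_neg])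
    refine ⟨k, hk, ?_, ?_⟩
    · have := hkw 0
      simpa [C, R, T] using this
    · have := hkw 1
      simpa [C, R, T] using this
  have hz : z ∈ Metric.ball z (r / 2) := Metric.mem_ball_self (by linarith)
  obtain ⟨k, hk, -, hk0⟩ := key z hz (r / 4) ⟨by linarith, by linarith⟩
  refine ⟨k, hk, fun w hw ρ hρ => ?_⟩
  obtain ⟨k', -, h1, h2⟩ := key w hw ρ hρ
  rwa [h2.unique hk0] at h1

theorem eventually_ori {Ψ : ℝ × ℝ → Torus} {z : ℝ × ℝ} (hc : ∀ᶠ w in 𝓝 z, ContinuousAt Ψ w)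
    (hi : ∃ O ∈ 𝓝 z, InjOn Ψ O) : ∃ k : ℤ, Odd k ∧ ∀ᶠ w in 𝓝 z, Ori Ψ w k := by
  obtain ⟨r, hr, hg⟩ := exists_good hc hi
  obtain ⟨k, hk, h⟩ := hg.exists_ori hr
  refine ⟨k, hk, ?_⟩
  filter_upwards [Metric.ball_mem_nhds z (half_pos hr)] with w hw
  filter_upwards [Ioo_mem_nhdsGT (half_pos hr)] with ρ hρ
  exact h w hw ρ hρ

/-- The local degree is constant on connected sets. -/
theorem ori_of_isPreconnected {Ψ : ℝ × ℝ → Torus} {A : Set (ℝ × ℝ)} (hA : IsPreconnected A)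
    (hc : ∀ z ∈ A, ∀ᶠ w in 𝓝 z, ContinuousAt Ψ w) (hi : ∀ z ∈ A, ∃ O ∈ 𝓝 z, InjOn Ψ O)
    {z w : ℝ × ℝ} (hz : z ∈ A) (hw : w ∈ A) {k : ℤ} (h : Ori Ψ z k) : Ori Ψ w k := by
  refine (hA.induction₂ (fun z w => ∀ k, Ori Ψ z k ↔ Ori Ψ w k) (fun z hz => ?_)
    (fun a b c _ _ _ h1 h2 k => (h1 k).trans (h2 k)) (fun a b _ _ h k => (h k).symm)
    hz hw k).1 h
  obtain ⟨k, -, h⟩ := eventually_ori (hc z hz) (hi z hz)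
  filter_upwards [mem_nhdsWithin_of_mem_nhds h] with w hw k'
  have hz' := h.self_of_nhds
  exact ⟨fun h1 => by rwa [h1.unique hz'], fun h1 => by rwa [h1.unique hw]⟩

theorem exists_ori {Ψ : ℝ × ℝ → Torus} {z : ℝ × ℝ} (hc : ∀ᶠ w in 𝓝 z, ContinuousAt Ψ w)
    (hi : ∃ O ∈ 𝓝 z, InjOn Ψ O) : ∃ k : ℤ, k ≠ 0 ∧ Ori Ψ z k := by
  obtain ⟨k, hk, h⟩ := eventually_ori hc hi
  exact ⟨k, fun h0 => by simp [h0] at hk, h.self_of_nhds⟩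

theorem convex_comb_ne_zero {u v c T : ℝ} (hu : 0 < c * u) (hv : 0 < c * v) (h0 : 0 ≤ T)
    (h1 : T ≤ 1) : (1 - T) * u + T * v ≠ 0 := fun h => by
  have : (1 - T) * (c * u) + T * (c * v) = 0 := by linear_combination c * h
  rcases h0.eq_or_lt with rfl | h0
  · simp only [sub_zero, one_mul, zero_mul, add_zero] at this; linarith
  · have := mul_pos h0 hv
    have := mul_nonneg (sub_nonneg.2 h1) hu.le
    linarith

/-- Behaviour of the local degree under a change of parameters that respects the horizontal lines. -/
theorem Ori.comp {Ψ Ψ' : ℝ × ℝ → Torus} {χ : ℝ × ℝ → ℝ × ℝ} {z : ℝ × ℝ} {k a b : ℤ}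
    (h : Ori Ψ (χ z) k) (hc : ∀ᶠ w in 𝓝 (χ z), ContinuousAt Ψ w)
    (hi : ∃ O ∈ 𝓝 (χ z), InjOn Ψ O) (he : Ψ' =ᶠ[𝓝 z] Ψ ∘ χ)
    (hχ : ∀ᶠ w in 𝓝 z, ContinuousAt χ w) (ha : a = 1 ∨ a = -1) (hb : b = 1 ∨ b = -1)
    {N : Set (ℝ × ℝ)} (hN : N ∈ 𝓝 z)
    (hs : ∀ p ∈ N, ∀ q ∈ N, (p.2 < q.2 → 0 < (b : ℝ) * ((χ q).2 - (χ p).2)) ∧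
      (p.2 = q.2 → p.1 < q.1 → 0 < (a : ℝ) * ((χ q).1 - (χ p).1))) :
    Ori Ψ' z (k * (a * b)) := by
  obtain ⟨r, hr, hg⟩ := exists_good hc hi
  obtain ⟨r', hr', hrs⟩ := Metric.mem_nhds_iff.1 (inter_mem (inter_mem hχ
    (hχ.self_of_nhds (Metric.ball_mem_nhds _ hr))) (inter_mem hN he))
  obtain ⟨ρ', hw, hρ'⟩ := (Filter.Eventually.and h (Ioo_mem_nhdsGT hr)).exists
  have ha2 : (a : ℝ) * a = 1 := by rcases ha with rfl | rfl <;> norm_num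
  have hb2 : (b : ℝ) * b = 1 := by rcases hb with rfl | rfl <;> norm_num
  have habs : |(a : ℝ) * ρ'| < r := by
    rw [abs_mul, abs_of_pos hρ'.1, show |(a : ℝ)| = 1 by rcases ha with rfl | rfl <;> simp, one_mul]
    exact hρ'.2
  have hbbs : |(b : ℝ) * ρ'| < r := by
    rw [abs_mul, abs_of_pos hρ'.1, show |(b : ℝ)| = 1 by rcases hb with rfl | rfl <;> simp, one_mul]
    exact hρ'.2
  filter_upwards [Ioo_mem_nhdsGT hr'] with ρ hρ
  let T : ℝ → ℝ := fun l => max 0 (min 1 l)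
  have hT : Continuous T := by fun_prop
  have hT0 : ∀ l, 0 ≤ T l := fun l => le_max_left _ _
  have hT1 : ∀ l, T l ≤ 1 := fun l => max_le zero_le_one (min_le_left _ _)
  have hzs : ∀ {w : ℝ × ℝ} {r : ℝ}, 0 < r → w ∈ Metric.ball w (r - r + r) := fun {w r} h => by
    rw [sub_self, zero_add]; exact Metric.mem_ball_self h
  have hbp : ∀ θ, ell z ρ ρ θ ∈ Metric.ball z r' := fun θ => by
    refine ell_mem_ball (w := z) (δ := (ρ + r') / 2) ?_ ?_ (Metric.mem_ball_self ?_)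
    · rw [abs_of_pos hρ.1]; linarith [hρ.2]
    · rw [abs_of_pos hρ.1]; linarith [hρ.2]
    · linarith [hρ.2]
  have hbm : ∀ θ, ell z (-ρ) (-ρ) θ ∈ Metric.ball z r' := fun θ => by
    rw [← ell_add_pi]; exact hbp _
  have hep : ∀ θ, ell (χ z) (a * ρ') (b * ρ') θ ∈ Metric.ball (χ z) r := fun θ => by
    have hm := max_lt habs hbbs
    refine ell_mem_ball (w := χ z) (δ := (max |(a : ℝ) * ρ'| |(b : ℝ) * ρ'| + r) / 2) ?_ ?_
      (Metric.mem_ball_self ?_)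
    · linarith [le_max_left |(a : ℝ) * ρ'| |(b : ℝ) * ρ'|]
    · linarith [le_max_right |(a : ℝ) * ρ'| |(b : ℝ) * ρ'|]
    · linarith
  have hem : ∀ θ, ell (χ z) (-(a * ρ')) (-(b * ρ')) θ ∈ Metric.ball (χ z) r := fun θ => by
    rw [← ell_add_pi]; exact hep _
  have hχc : ContinuousOn χ (Metric.ball z r') := fun w hw => (hrs hw).1.1.continuousWithinAt
  have hc1 : Continuous fun q : ℝ × ℝ => χ (ell z ρ ρ q.2) :=
    hχc.comp_continuous (by unfold ell; fun_prop) fun q => hbp _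
  have hc2 : Continuous fun q : ℝ × ℝ => χ (ell z (-ρ) (-ρ) q.2) :=
    hχc.comp_continuous (by unfold ell; fun_prop) fun q => hbm _
  have hc3 : Continuous fun q : ℝ × ℝ => ell (χ z) (a * ρ') (b * ρ') q.2 := by
    unfold ell; fun_prop
  have hc4 : Continuous fun q : ℝ × ℝ => ell (χ z) (-(a * ρ')) (-(b * ρ')) q.2 := by
    unfold ell; fun_prop
  -- The image under `χ` of a small circle is deformed linearly to the model ellipse with signed
  -- semi-axes `a * ρ'` and `b * ρ'`. Antipodal points never meet: when `sin θ ≠ 0` their second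
  -- coordinates are ordered alike at both ends of the deformation, and otherwise their first
  -- coordinates are.
  obtain ⟨k', -, hk'⟩ := hg.exists_hasWind
    (P := fun q => (1 - T q.1) • χ (ell z ρ ρ q.2) + T q.1 • ell (χ z) (a * ρ') (b * ρ') q.2)
    (Q := fun q => (1 - T q.1) • χ (ell z (-ρ) (-ρ) q.2) +
      T q.1 • ell (χ z) (-(a * ρ')) (-(b * ρ')) q.2)
    (((continuous_const.sub (hT.comp continuous_fst)).smul hc1).add
      ((hT.comp continuous_fst).smul hc3))
    (((continuous_const.sub (hT.comp continuous_fst)).smul hc2).add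
      ((hT.comp continuous_fst).smul hc4))
    (fun q => (convex_ball _ _) (hrs (hbp _)).1.2 (hep _) (by linarith [hT1 q.1]) (hT0 _) (by ring))
    (fun q => (convex_ball _ _) (hrs (hbm _)).1.2 (hem _) (by linarith [hT1 q.1]) (hT0 _) (by ring))
    (fun q e => by
      have e1 := congrArg Prod.fst e
      have e2 := congrArg Prod.snd e
      simp only [Prod.fst_add, Prod.snd_add, Prod.smul_fst, Prod.smul_snd, smul_eq_mul] at e1 e2
      have hpN := (hrs (hbp q.2)).2.1
      have hmN := (hrs (hbm q.2)).2.1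
      have hsm := hs _ hmN _ hpN
      have hsp := hs _ hpN _ hmN
      set X := χ (ell z ρ ρ q.2)
      set Y := χ (ell z (-ρ) (-ρ) q.2)
      simp only [ell] at hsm hsp e1 e2
      have hρ0 := hρ.1
      have hρ'0 := hρ'.1
      have E2 : (1 - T q.1) * (X.2 - Y.2) + T q.1 * (2 * b * ρ' * Real.sin q.2) = 0 := by
        linear_combination e2
      have E1 : (1 - T q.1) * (X.1 - Y.1) + T q.1 * (2 * a * ρ' * Real.cos q.2) = 0 := by
        linear_combination e1
      rcases lt_trichotomy (Real.sin q.2) 0 with hsin | hsin | hsin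
      · have h1 := hsp.1 (by nlinarith)
        refine convex_comb_ne_zero (c := -b) (by linarith) ?_ (hT0 _) (hT1 _) E2
        have : 0 < 2 * ρ' * (-Real.sin q.2) := by nlinarith
        calc (0 : ℝ) < 2 * ρ' * (-Real.sin q.2) := this
          _ = _ := by linear_combination (2 * ρ' * (-Real.sin q.2)) * (-hb2)
      · have hcos := cos_ne_zero_of_sin hsin
        rcases lt_or_gt_of_ne hcos with hcos | hcos
        · have h1 := hsp.2 (by rw [hsin]; ring) (by nlinarith)
          refine convex_comb_ne_zero (c := -a) (by linarith) ?_ (hT0 _) (hT1 _) E1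
          have : 0 < 2 * ρ' * (-Real.cos q.2) := by nlinarith
          calc (0 : ℝ) < 2 * ρ' * (-Real.cos q.2) := this
            _ = _ := by linear_combination (2 * ρ' * (-Real.cos q.2)) * (-ha2)
        · have h1 := hsm.2 (by rw [hsin]; ring) (by nlinarith)
          refine convex_comb_ne_zero (c := a) (by linarith) ?_ (hT0 _) (hT1 _) E1
          have : 0 < 2 * ρ' * Real.cos q.2 := by positivity
          calc (0 : ℝ) < 2 * ρ' * Real.cos q.2 := this
            _ = _ := by linear_combination (2 * ρ' * Real.cos q.2) * (-ha2)
      · have h1 := hsm.1 (by nlinarith)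
        refine convex_comb_ne_zero (c := b) (by linarith) ?_ (hT0 _) (hT1 _) E2
        have : 0 < 2 * ρ' * Real.sin q.2 := by positivity
        calc (0 : ℝ) < 2 * ρ' * Real.sin q.2 := this
          _ = _ := by linear_combination (2 * ρ' * Real.sin q.2) * (-hb2))
    (fun l θ => by simp only [ell_add_pi]) (fun l θ => by simp only [ell_add_pi, neg_neg])
  have hk0 := hk' 0
  have hk1 := hk' 1
  -- On the model, a single reflection reverses `θ` (up to a half-turn) and changes the sign of the
  -- winding, while two reflections make a half-turn and leave it alone.
  have hkk : k' = k * (a * b) := by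
    have e1 : HasWind (fun θ => oddMap (Ψ (ell (χ z) (a * ρ') (b * ρ') θ) -
        Ψ (ell (χ z) (-(a * ρ')) (-(b * ρ')) θ))) k' := by simpa [T] using hk1
    rcases ha with rfl | rfl <;> rcases hb with rfl | rfl
    · simpa using (e1.unique (by simpa using hw))
    · have := hw.comp_neg
      simp only [ell, Real.cos_neg, Real.sin_neg] at this
      refine (e1.unique ?_).trans (by ring : -k = _)
      simpa [ell] using this
    · have := (hw.comp_add Real.pi).comp_neg
      simp only [ell, Real.cos_add_pi, Real.sin_add_pi, Real.cos_neg, Real.sin_neg] at this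
      refine (e1.unique ?_).trans (by ring : -k = _)
      simpa [ell] using this
    · have := hw.comp_add Real.pi
      simp only [ell, Real.cos_add_pi, Real.sin_add_pi] at this
      refine (e1.unique ?_).trans (by ring : k = _)
      simpa [ell] using this
  rw [← hkk]
  have e3 : (fun θ => oddMap (Ψ' (ell z ρ ρ θ) - Ψ' (ell z (-ρ) (-ρ) θ))) =
      fun θ => oddMap (Ψ (χ (ell z ρ ρ θ)) - Ψ (χ (ell z (-ρ) (-ρ) θ))) := by
    funext θ
    rw [show Ψ' (ell z ρ ρ θ) = _ from (hrs (hbp θ)).2.2,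
      show Ψ' (ell z (-ρ) (-ρ) θ) = _ from (hrs (hbm θ)).2.2]
    rfl
  rw [e3]
  simpa [T] using hk0

end Torus

/-! ### One-dimensional dynamics: contractions are translations. -/

/-- The interval `[h s₁, s₁]` is a fundamental domain of the contraction. An affine parameter on it,
extended by iterating `h`, conjugates `h` to the translation `x ↦ x - 1`. This removes the holonomy
as an invariant. -/
theorem exists_linearization {h : ℝ → ℝ} {δ s₁ : ℝ} (hc : ContinuousOn h (Ioo 0 δ))
    (hm : StrictMonoOn h (Ioo 0 δ)) (hlt : ∀ s ∈ Ioo 0 δ, 0 < h s ∧ h s < s) (hs₁ : s₁ ∈ Ioo 0 δ) :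
    ∃ Λ : ℝ → ℝ, (∀ x ≤ 1, Λ x ∈ Ioc 0 s₁) ∧ StrictMonoOn Λ (Iic 1) ∧ ContinuousOn Λ (Iic 1) ∧
      (∀ x ≤ 1, Λ (x - 1) = h (Λ x)) ∧ Tendsto Λ atBot (𝓝 0) ∧ ∀ s ∈ Ioc 0 s₁, ∃ x ≤ 1, Λ x = s := by
  have hsub : Ioc 0 s₁ ⊆ Ioo 0 δ := fun s hs => ⟨hs.1, hs.2.trans_lt hs₁.2⟩
  have hs₁' : s₁ ∈ Ioc 0 s₁ := ⟨hs₁.1, le_rfl⟩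
  obtain ⟨h1, h2⟩ := hlt s₁ hs₁
  let aff : ℝ → ℝ := fun y => h s₁ + y * (s₁ - h s₁)
  -- `⌊1 - x⌋₊` counts the unit steps that bring `x` up into `(0, 1]`, where `aff` is used.
  let Λ : ℝ → ℝ := fun x => h^[⌊1 - x⌋₊] (aff (x + ⌊1 - x⌋₊))
  have hΛ1 : Λ 1 = s₁ := by simp [Λ, aff]
  have hrec : ∀ x ≤ 1, Λ (x - 1) = h (Λ x) := fun x hx => by
    have : ⌊1 - (x - 1)⌋₊ = ⌊1 - x⌋₊ + 1 := by
      rw [show 1 - (x - 1) = 1 - x + 1 by ring, Nat.floor_add_one (by linarith)]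
    simp only [Λ]
    rw [this, Function.iterate_succ_apply']
    congr 3
    push_cast; ring
  have hbase : EqOn Λ aff (Icc 0 1) := fun x hx => by
    rcases hx.1.eq_or_lt with rfl | h0
    · rw [show (0 : ℝ) = 1 - 1 by ring, hrec 1 le_rfl, hΛ1]; simp [aff]
    · have : ⌊1 - x⌋₊ = 0 := Nat.floor_eq_zero.2 (by linarith)
      simp [Λ, this]
  have key : ∀ N : ℕ, (∀ x ∈ Icc (-N : ℝ) 1, Λ x ∈ Ioc 0 s₁) ∧ StrictMonoOn Λ (Icc (-N : ℝ) 1) ∧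
      ContinuousOn Λ (Icc (-N : ℝ) 1) := by
    intro N
    induction N with
    | zero =>
      simp only [Nat.cast_zero, neg_zero]
      refine ⟨fun x hx => ?_, fun x hx y hy hxy => ?_, ?_⟩
      · rw [hbase hx]
        exact ⟨by have := mul_nonneg hx.1 (sub_nonneg.2 h2.le); simp only [aff]; linarith,
          by have := mul_le_mul_of_nonneg_right hx.2 (sub_nonneg.2 h2.le); simp only [aff]; linarith⟩
      · rw [hbase hx, hbase hy]
        have := mul_lt_mul_of_pos_right hxy (sub_pos.2 h2)
        simp only [aff]; linarith
      · exact ContinuousOn.congr (by fun_prop) hbase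
    | succ N ih =>
      obtain ⟨i1, i2, i3⟩ := ih
      have hN : (0 : ℝ) ≤ N := N.cast_nonneg
      have hsh : ∀ x ∈ Icc (-(N + 1 : ℕ) : ℝ) (-N), x + 1 ∈ Icc (-N : ℝ) 1 := fun x hx => by
        have := hx.1; push_cast at this
        exact ⟨by linarith, by linarith [hx.2]⟩
      have hr : ∀ x ∈ Icc (-(N + 1 : ℕ) : ℝ) (-N), Λ x = h (Λ (x + 1)) := fun x hx => by
        rw [← hrec _ (hsh x hx).2]; ring_nf
      have hle : (-(N + 1 : ℕ) : ℝ) ≤ -N := by push_cast; linarith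
      have hU : Icc (-(N + 1 : ℕ) : ℝ) 1 = Icc (-(N + 1 : ℕ) : ℝ) (-N) ∪ Icc (-N : ℝ) 1 :=
        (Icc_union_Icc_eq_Icc hle (by linarith)).symm
      refine ⟨fun x hx => ?_, ?_, ?_⟩
      · rw [hU] at hx
        rcases hx with hx | hx
        · rw [hr x hx]
          have := i1 _ (hsh x hx)
          exact ⟨(hlt _ (hsub this)).1, (hlt _ (hsub this)).2.le.trans this.2⟩
        · exact i1 x hx
      · rw [hU]
        refine StrictMonoOn.union ?_ i2 (isGreatest_Icc hle) (isLeast_Icc (by linarith))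
        intro x hx y hy hxy
        rw [hr x hx, hr y hy]
        exact hm (hsub (i1 _ (hsh x hx))) (hsub (i1 _ (hsh y hy)))
          (i2 (hsh x hx) (hsh y hy) (by linarith))
      · rw [hU]
        refine ContinuousOn.union_of_isClosed ?_ i3 isClosed_Icc isClosed_Icc
        refine ContinuousOn.congr (hc.comp (i3.comp (by fun_prop) hsh)
          fun x hx => hsub (i1 _ (hsh x hx))) hr
  have hmem : ∀ x ≤ 1, ∃ N : ℕ, x ∈ Ioc (-N : ℝ) 1 := fun x hx => by
    obtain ⟨N, hN⟩ := exists_nat_gt (-x)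
    exact ⟨N, by linarith, hx⟩
  have p1 : ∀ x ≤ 1, Λ x ∈ Ioc 0 s₁ := fun x hx => by
    obtain ⟨N, hN⟩ := hmem x hx
    exact (key N).1 x (Ioc_subset_Icc_self hN)
  have p2 : StrictMonoOn Λ (Iic 1) := fun x hx y hy hxy => by
    obtain ⟨N, hN⟩ := hmem x hx
    exact (key N).2.1 (Ioc_subset_Icc_self hN) ⟨hN.1.le.trans hxy.le, hy⟩ hxy
  have p3 : ContinuousOn Λ (Iic 1) := fun x hx => by
    obtain ⟨N, hN⟩ := hmem x hx
    refine ((key N).2.2 x (Ioc_subset_Icc_self hN)).mono_of_mem_nhdsWithin ?_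
    filter_upwards [self_mem_nhdsWithin, mem_nhdsWithin_of_mem_nhds (Ioi_mem_nhds hN.1)]
      with y hy hy'
    exact ⟨le_of_lt hy', hy⟩
  -- If the values stayed above some `ε`, their infimum `L` would satisfy `h L < L`. By continuity
  -- `h` would send values near `L` below `L`, yet these are again values of `Λ`.
  have p5 : ∀ ε > 0, ∃ x₀ ≤ 1, Λ x₀ < ε := by
    by_contra! hcon
    obtain ⟨ε, hε, hcon⟩ := hcon
    set L := sInf (Λ '' Iic 1)
    have hne : (Λ '' Iic 1).Nonempty := ⟨_, 1, (mem_Iic.2 le_rfl), rfl⟩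
    have hbd : BddBelow (Λ '' Iic 1) := ⟨ε, by rintro _ ⟨x, hx, rfl⟩; exact hcon x hx⟩
    have hLε : ε ≤ L := le_csInf hne (by rintro _ ⟨x, hx, rfl⟩; exact hcon x hx)
    have hL1 : L ≤ s₁ := hΛ1 ▸ csInf_le hbd ⟨1, (mem_Iic.2 le_rfl), rfl⟩
    have hLI : L ∈ Ioo 0 δ := ⟨by linarith, hL1.trans_lt hs₁.2⟩
    have hca : ContinuousAt h L := (hc L hLI).continuousAt (Ioo_mem_nhds hLI.1 hLI.2)
    obtain ⟨η, hη, hηs⟩ := Metric.mem_nhds_iff.1 (hca.eventually_lt_const (hlt L hLI).2)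
    obtain ⟨_, ⟨x, hx, rfl⟩, hx'⟩ := exists_lt_of_csInf_lt hne (lt_add_of_pos_right L hη)
    have hLx : L ≤ Λ x := csInf_le hbd ⟨x, hx, rfl⟩
    have h3 : h (Λ x) < L := hηs (by rw [Real.ball_eq_Ioo]; exact ⟨by linarith, hx'⟩)
    have h4 : L ≤ Λ (x - 1) := csInf_le hbd ⟨x - 1, by have := mem_Iic.1 hx; exact mem_Iic.2 (by linarith), rfl⟩
    rw [hrec x hx] at h4
    linarith
  refine ⟨Λ, p1, p2, p3, hrec, ?_, fun s hs => ?_⟩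
  · rw [Metric.tendsto_nhds]
    intro ε hε
    obtain ⟨x₀, hx₀, hlt'⟩ := p5 ε hε
    filter_upwards [eventually_le_atBot x₀] with x hx
    have := p1 x (hx.trans hx₀)
    rw [Real.dist_eq, sub_zero, abs_of_pos this.1]
    exact (p2.monotoneOn (mem_Iic.2 (hx.trans hx₀)) (mem_Iic.2 hx₀) hx).trans_lt hlt'
  · obtain ⟨x₀, hx₀, hlt'⟩ := p5 s hs.1
    obtain ⟨x, hx, hxs⟩ := intermediate_value_Icc hx₀ (p3.mono fun x hx => hx.2)
      (show s ∈ Icc (Λ x₀) (Λ 1) from ⟨hlt'.le, hΛ1 ▸ hs.2⟩)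
    exact ⟨x, hx.2, hxs⟩

/-- An increasing homeomorphism from the line onto `(D, ∞)` that is the identity far away. -/
noncomputable def pushUp (D x : ℝ) : ℝ := D + Real.exp (min (x - D) 1 - 1) + max (x - D - 1) 0

theorem continuous_pushUp (D : ℝ) : Continuous (pushUp D) := by unfold pushUp; fun_prop

theorem lt_pushUp (D x : ℝ) : D < pushUp D x := by
  have := Real.exp_pos (min (x - D) 1 - 1)
  have := le_max_right (x - D - 1) 0
  unfold pushUp; linarith

theorem pushUp_of_le {D x : ℝ} (h : D + 1 ≤ x) : pushUp D x = x := by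
  rw [pushUp, min_eq_right (by linarith), max_eq_left (by linarith), sub_self, Real.exp_zero]; ring

theorem strictMono_pushUp (D : ℝ) : StrictMono (pushUp D) := fun x y h => by
  unfold pushUp
  have h1 : max (x - D - 1) 0 ≤ max (y - D - 1) 0 := max_le_max (by linarith) le_rfl
  rcases le_or_gt 1 (x - D) with hx | hx
  · rw [min_eq_right hx, min_eq_right (by linarith), max_eq_left (by linarith),
      max_eq_left (by linarith)]
    linarith
  · have : Real.exp (min (x - D) 1 - 1) < Real.exp (min (y - D) 1 - 1) := by
      rw [Real.exp_lt_exp, min_eq_left hx.le]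
      have := lt_min (show x - D < y - D by linarith) hx
      linarith
    linarith

/-- An injective continuous map on a compact set is an embedding, so continuity can be tested after
`b`. This recovers continuity of a holonomy map from that of its lifted paths. -/
theorem continuousOn_of_comp_injOn {X : Type*} [TopologicalSpace X] {b : ℝ → ℝ} {C : Set ℝ}
    (hC : IsCompact C) (hb : ContinuousOn b C) (hi : InjOn b C) {h : X → ℝ} {A : Set X}
    (hm : MapsTo h A C) (hbh : ContinuousOn (b ∘ h) A) : ContinuousOn h A := by
  have := isCompact_iff_compactSpace.1 hC
  have he : IsClosedEmbedding (fun x : C => b x) :=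
    Continuous.isClosedEmbedding (hb.comp_continuous continuous_subtype_val fun x => x.2)
      fun x y hxy => Subtype.ext (hi x.2 y.2 hxy)
  have h1 : Continuous (fun x : A => (⟨h x, hm x.2⟩ : C)) :=
    he.isInducing.continuous_iff.2 (hbh.comp_continuous continuous_subtype_val fun x => x.2)
  rw [continuousOn_iff_continuous_domRestrict]
  exact continuous_subtype_val.comp h1

theorem ContinuousOn.eventually_continuousAt {X Y : Type*} [TopologicalSpace X] [TopologicalSpace Y]
    {f : X → Y} {A : Set X} {z : X} (hf : ContinuousOn f A) (hA : A ∈ 𝓝 z) :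
    ∀ᶠ w in 𝓝 z, ContinuousAt f w :=
  (eventually_mem_nhds_iff.2 hA).mono fun _ hw => hf.continuousAt hw

theorem strip_mem_nhds {δ t s a b : ℝ} (ht : t ∈ Ioo a b) (hs : s ∈ Ioo (-δ) δ) :
    Icc a b ×ˢ Ioo (-δ) δ ∈ 𝓝 (t, s) :=
  prod_mem_nhds (Icc_mem_nhds ht.1 ht.2) (Ioo_mem_nhds hs.1 hs.2)

/-! ### Foliated neighbourhoods of a closed leaf. -/

namespace OneFoliation

/-- A foliated neighbourhood of a closed leaf `γ`, cut open and prolonged to two turns; `h` is its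
return map. -/
structure FlowCollar (F : OneFoliation Torus) (γ : C(UnitAddCircle, Torus)) (Ψ : ℝ × ℝ → Torus)
    (δ : ℝ) (h : ℝ → ℝ) : Prop where
  pos : 0 < δ
  cont : ContinuousOn Ψ (Icc 0 2 ×ˢ Ioo (-δ) δ)
  loc : ∀ z ∈ Icc 0 2 ×ˢ Ioo (-δ) δ, F.LocFol Ψ (Icc 0 2 ×ˢ Ioo (-δ) δ) z
  core : ∀ t ∈ Icc (0 : ℝ) 2, Ψ (t, 0) = γ (t : UnitAddCircle)
  shift : ∀ t ∈ Icc (0 : ℝ) 1, ∀ s ∈ Ioo (-δ) δ, Ψ (t + 1, s) = Ψ (t, h s)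
  leaf : ∀ z ∈ Icc 0 2 ×ˢ Ioo (-δ) δ, Ψ z ∈ F.leaf (Ψ (0, z.2))
  h_cont : ContinuousOn h (Ioo (-δ) δ)
  h_mono : StrictMonoOn h (Ioo (-δ) δ)
  h_zero : h 0 = 0
  h_lt : ∀ s ∈ Ioo (-δ) δ, s ≠ 0 → |h s| < |s|

variable {F : OneFoliation Torus} {γ : C(UnitAddCircle, Torus)} {Ψ : ℝ × ℝ → Torus} {δ : ℝ}
  {h : ℝ → ℝ}

theorem FlowCollar.mono (H : FlowCollar F γ Ψ δ h) {δ' : ℝ} (h0 : 0 < δ') (hδ : δ' ≤ δ) :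
    FlowCollar F γ Ψ δ' h := by
  have hJ : Ioo (-δ') δ' ⊆ Ioo (-δ) δ := Ioo_subset_Ioo (neg_le_neg hδ) hδ
  have hp : Icc (0 : ℝ) 2 ×ˢ Ioo (-δ') δ' ⊆ Icc 0 2 ×ˢ Ioo (-δ) δ := prod_mono subset_rfl hJ
  exact ⟨h0, H.cont.mono hp, fun z hz => (H.loc z (hp hz)).mono hp, H.core,
    fun t ht s hs => H.shift t ht s (hJ hs), fun z hz => H.leaf z (hp hz), H.h_cont.mono hJ,
    H.h_mono.mono hJ, H.h_zero, fun s hs => H.h_lt s (hJ hs)⟩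

theorem coe_injOn_Ico (t : ℝ) : InjOn (fun x : ℝ => (x : UnitAddCircle)) (Ico t (t + 1)) :=
  fun _ hx _ hy hxy => (AddCircle.coe_eq_coe_iff_of_mem_Ico hx hy).1 hxy

/-- Orientability of the torus. The local degree is constant on the connected two-turn strip, and
the second turn is the first composed with `(t, s) ↦ (t - 1, h s)`. A decreasing `h` would negate
the degree, which is nonzero. -/
theorem strictMonoOn_of_shift {J : Set ℝ} (hJo : IsOpen J) (hJc : OrdConnected J) (h0 : (0 : ℝ) ∈ J)
    (hc : ContinuousOn Ψ (Icc 0 2 ×ˢ J)) (hl : ∀ z ∈ Icc 0 2 ×ˢ J, F.LocFol Ψ (Icc 0 2 ×ˢ J) z)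
    (hs : ∀ t ∈ Icc (0 : ℝ) 1, ∀ s ∈ J, Ψ (t + 1, s) = Ψ (t, h s))
    (hh : ContinuousOn h J) (hz : h 0 = 0) (hor : StrictMonoOn h J ∨ StrictAntiOn h J) :
    StrictMonoOn h J := by
  refine hor.resolve_right fun hanti => ?_
  have hn : ∀ z ∈ Ioo (0 : ℝ) 2 ×ˢ J, Icc 0 2 ×ˢ J ∈ 𝓝 z := fun z hz =>
    prod_mem_nhds (Icc_mem_nhds hz.1.1 hz.1.2) (hJo.mem_nhds hz.2)
  have hcev : ∀ z ∈ Ioo (0 : ℝ) 2 ×ˢ J, ∀ᶠ w in 𝓝 z, ContinuousAt Ψ w := fun z hz =>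
    hc.eventually_continuousAt (hn z hz)
  have hinj : ∀ z ∈ Ioo (0 : ℝ) 2 ×ˢ J, ∃ O ∈ 𝓝 z, InjOn Ψ O := fun z hz =>
    ((hl z (mem_of_mem_nhds (hn z hz))).of_mem_nhds (B := univ) (hn z hz)).exists_injOn
  have m1 : ((1 / 2, 0) : ℝ × ℝ) ∈ Ioo (0 : ℝ) 2 ×ˢ J := ⟨by norm_num, h0⟩
  have m2 : ((3 / 2, 0) : ℝ × ℝ) ∈ Ioo (0 : ℝ) 2 ×ˢ J := ⟨by norm_num, h0⟩
  obtain ⟨k, hk0, hk⟩ := Torus.exists_ori (hcev _ m1) (hinj _ m1)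
  have hk2 : Torus.Ori Ψ (3 / 2, 0) k := Torus.ori_of_isPreconnected
    (isPreconnected_Ioo.prod hJc.isPreconnected) hcev hinj m1 m2 hk
  let χ : ℝ × ℝ → ℝ × ℝ := fun z => (z.1 - 1, h z.2)
  have hχ0 : χ (3 / 2, 0) = (1 / 2, 0) := by simp only [χ, hz]; norm_num
  have hN : Ioo (1 : ℝ) 2 ×ˢ J ∈ 𝓝 ((3 / 2, 0) : ℝ × ℝ) :=
    prod_mem_nhds (Ioo_mem_nhds (by norm_num) (by norm_num)) (hJo.mem_nhds h0)
  have hχc : ContinuousOn χ (Ioo (1 : ℝ) 2 ×ˢ J) :=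
    ContinuousOn.prodMk (by fun_prop) (hh.comp continuousOn_snd fun z hz => hz.2)
  have := Torus.Ori.comp (Ψ := Ψ) (Ψ' := Ψ) (χ := χ) (z := (3 / 2, 0)) (k := k) (a := 1) (b := -1)
    (by rwa [hχ0]) (by rw [hχ0]; exact hcev _ m1) (by rw [hχ0]; exact hinj _ m1)
    (by
      filter_upwards [hN] with z hz
      have := hs (z.1 - 1) ⟨by linarith [hz.1.1], by linarith [hz.1.2]⟩ z.2 hz.2
      rwa [sub_add_cancel] at this)
    (hχc.eventually_continuousAt hN) (Or.inl rfl) (Or.inr rfl) hN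
    (fun p hp q hq => ⟨fun hpq => by
      have := hanti hp.2 hq.2 hpq
      simp only [χ]; push_cast; linarith, fun _ hpq => by simp only [χ]; push_cast; linarith⟩)
  have := hk2.unique this
  omega

/-- Transport from the transversal `τ` gives a strip that returns near `τ` after one turn without
ending on it exactly. Comparison with the holonomy paths `K` shows that the row `s` hits `τ (h s)`
at a time `ω s` near `1`. Rescaling each row by `ω` makes the first turn end on `τ`, and the second
turn is defined as the first precomposed with the return map. -/
theorem exists_flowCollar_of_leaf_eq (hγ : Function.Injective γ) {p : Torus} (hr : range γ = F.leaf p)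
    (hc : F.HolonomyContracts γ) : ∃ Ψ δ h, FlowCollar F γ Ψ δ h := by
  obtain ⟨ε, hε, τ, h, ⟨hτc, φ₀, hφ₀, hτs, hτi⟩, hτ0, ⟨K, hKc, hK0, hK⟩, hlt⟩ := hc
  have h0ε : (0 : ℝ) ∈ Ioo (-ε) ε := ⟨by linarith, hε⟩
  have hτinj : InjOn τ (Ioo (-ε) ε) := fun x hx y hy hxy => hτi hx hy (by simp only [hxy])
  have hone : ((1 : ℝ) : UnitAddCircle) = 0 := AddCircle.coe_period 1
  have hh0 : h 0 = 0 := by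
    obtain ⟨-, -, h1, h2⟩ := hK 0 h0ε
    refine hτinj h1 h0ε ?_
    rw [← h2, hK0 1 ⟨zero_le_one, le_rfl⟩, hτ0, hone]
  have hmem : ∀ x y, γ x ∈ F.leaf (γ y) := fun x y => by
    have h1 : γ x ∈ F.leaf p := hr ▸ mem_range_self x
    have h2 : γ y ∈ F.leaf p := hr ▸ mem_range_self y
    exact mem_leaf_trans (mem_leaf_symm h2) h1
  have hJ₀ : Ioo (-ε) ε ∈ 𝓝 (0 : ℝ) := Ioo_mem_nhds h0ε.1 h0ε.2
  have hcc : Continuous fun t : ℝ => γ (t : UnitAddCircle) :=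
    γ.continuous.comp (AddCircle.continuous_mk' 1)
  have hcinj : ∀ t : ℝ, ∃ N ∈ 𝓝 t, InjOn (fun t : ℝ => γ (t : UnitAddCircle)) N := fun t =>
    ⟨Ico (t - 1 / 2) (t - 1 / 2 + 1), Ico_mem_nhds (by linarith) (by linarith),
      fun x hx y hy hxy => coe_injOn_Ico _ hx hy (hγ hxy)⟩
  -- Only one turn is kept in the end, but the flow box covers two because `ω s` may exceed `1`.
  obtain ⟨Ψ₀, δ₀, hδ₀, hsub, P1, P2, P3, P4, P5⟩ := exists_transport (F := F) (a := 0) (b := 2)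
    zero_le_two hcc (fun t _ => hcinj t) (fun t _ => hmem _ _) hJ₀ hτc (by simpa using hτ0) hφ₀ hτs hτi
  rw [zero_sub, zero_add] at hsub P1 P2 P4 P5
  have h0δ₀ : (0 : ℝ) ∈ Ioo (-δ₀) δ₀ := ⟨by linarith, hδ₀⟩
  have hn1 : Icc (0 : ℝ) 2 ×ˢ Ioo (-δ₀) δ₀ ∈ 𝓝 ((1, 0) : ℝ × ℝ) :=
    strip_mem_nhds (by norm_num) h0δ₀
  have hloc1 : F.LocFol Ψ₀ univ (1, 0) := (P5 _ (mem_of_mem_nhds hn1)).of_mem_nhds hn1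
  have hcev := P1.eventually_continuousAt hn1
  obtain ⟨ψ, hψ, hψs⟩ := F.cover (Ψ₀ (1, 0))
  have hsub01 : Icc (0 : ℝ) 1 ×ˢ Ioo (-δ₀) δ₀ ⊆ Icc 0 2 ×ˢ Ioo (-δ₀) δ₀ :=
    prod_mono (Icc_subset_Icc_right one_le_two) subset_rfl
  have hcmp := eventually_chart_snd_eq (F := F) (K := K) (Ψ := Ψ₀) (a := 0) (b := 1) (s₀ := 0)
    zero_le_one (Ioo_mem_nhds h0δ₀.1 h0δ₀.2) (hKc.mono (prod_mono subset_rfl hsub)) (P1.mono hsub01)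
    (fun t ht => by rw [hK0 t ht, P3 t ⟨ht.1, ht.2.trans one_le_two⟩])
    (fun s hs => by rw [(hK s (hsub hs)).2.1, P2 s hs])
    (fun z hz => by rw [(hK z.2 (hsub hz.2)).2.1]; exact (hK z.2 (hsub hz.2)).1 z.1 hz.1)
    (fun z hz => by rw [P2 z.2 hz.2]; exact P4 z (hsub01 hz)) hψ hψs
  obtain ⟨O, hO, hO'⟩ := hloc1.exists_chart (mem_univ _)
    hcev.self_of_nhds.continuousWithinAt hψ hψs
  rw [nhdsWithin_univ] at hO
  obtain ⟨e, he1, hesub, heΨ⟩ := hloc1.exists_openPartialHomeomorph hcev hO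
  have hK1c : ContinuousOn (fun s => K (1, s)) (Ioo (-ε) ε) :=
    hKc.comp (by fun_prop) fun s hs => ⟨⟨zero_le_one, le_rfl⟩, hs⟩
  have hK10 : K (1, 0) = Ψ₀ (1, 0) := by
    rw [hK0 1 ⟨zero_le_one, le_rfl⟩, P3 1 ⟨zero_le_one, one_le_two⟩]
  have hKt : K (1, 0) ∈ e.target := by rw [hK10, ← heΨ]; exact e.map_source he1
  have hK1a : ContinuousAt (fun s => K (1, s)) 0 := hK1c.continuousAt hJ₀
  have hζ0 : e.symm (K (1, 0)) = (1, 0) := by rw [hK10, ← heΨ]; exact e.left_inv he1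
  have hζc : ContinuousAt (fun s => e.symm (K (1, s))) 0 :=
    ContinuousAt.comp (f := fun s => K (1, s)) (e.continuousAt_symm hKt) hK1a
  have hev : ∀ᶠ s in 𝓝 (0 : ℝ), (K (1, s) ∈ e.target ∧ (1, s) ∈ O ∧
      (e.symm (K (1, s))).1 ∈ Ioo (0 : ℝ) 2) ∧ s ∈ Ioo (-δ₀) δ₀ ∧
      (ψ (K (1, s))).2 = (ψ (Ψ₀ (1, s))).2 := by
    refine Filter.Eventually.and (Filter.Eventually.and ?_ (Filter.Eventually.and ?_ ?_))
      (Filter.Eventually.and ?_ ?_)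
    · exact hK1a (e.open_target.mem_nhds hKt)
    · exact (Continuous.prodMk_right (1 : ℝ)).tendsto 0 hO
    · refine (continuous_fst.continuousAt.comp hζc) (Ioo_mem_nhds ?_ ?_) <;>
        simp [hζ0]
    · exact Ioo_mem_nhds h0δ₀.1 h0δ₀.2
    · exact hcmp.mono fun s hs => hs.2.2
  obtain ⟨δ₁, hδ₁, hδ₁s⟩ := exists_Ioo_subset_of_mem_nhds hev
  rw [zero_sub, zero_add] at hδ₁s
  have h0δ₁ : (0 : ℝ) ∈ Ioo (-δ₁) δ₁ := ⟨by linarith, hδ₁⟩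
  have hJ1 : Ioo (-δ₁) δ₁ ⊆ Ioo (-δ₀) δ₀ := fun s hs => (hδ₁s hs).2.1
  set J := Ioo (-δ₁) δ₁ with hJdef
  have hJε : J ⊆ Ioo (-ε) ε := hJ1.trans hsub
  -- `K (1, s)` lies in the same plaque as `Ψ₀ (1, s)`, so its preimage under the local inverse `e`
  -- of `Ψ₀` has second coordinate `s`; the first coordinate is the hitting time.
  set ω : ℝ → ℝ := fun s => (e.symm (K (1, s))).1 with hω
  have hωm : ∀ s ∈ J, ω s ∈ Ioo (0 : ℝ) 2 := fun s hs => (hδ₁s hs).1.2.2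
  have hωc : ContinuousOn ω J := continuous_fst.comp_continuousOn
    (e.continuousOn_symm.comp (hK1c.mono hJε) fun s hs => (hδ₁s hs).1.1)
  have hh : ∀ s ∈ J, h s ∈ J := fun s hs => by
    rcases eq_or_ne s 0 with rfl | h0
    · rwa [hh0]
    · have := (hlt s (hJε hs) h0).trans (abs_lt.2 hs)
      exact abs_lt.1 this
  have hΨω : ∀ s ∈ J, Ψ₀ (ω s, s) = τ (h s) := fun s hs => by
    have ht := (hδ₁s hs).1.1
    have h1 : Ψ₀ (e.symm (K (1, s))) = K (1, s) := by rw [← heΨ]; exact e.right_inv ht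
    have h2 := (((hO' _ (hesub (e.map_target ht))).2 _ (hδ₁s hs).1.2.1).1).1
      (by rw [h1]; exact (hδ₁s hs).2.2)
    rw [← (hK s (hJε hs)).2.2.2, ← h1]
    congr 1
    exact Prod.ext rfl h2.symm
  have hhi : InjOn h J := fun s hs s' hs' hss => by
    have h1 : K (1, s) = K (1, s') := by
      rw [(hK s (hJε hs)).2.2.2, (hK s' (hJε hs')).2.2.2, hss]
    exact (((hO' _ (hδ₁s hs).1.2.1).2 _ (hδ₁s hs').1.2.1).1).1
      (by rw [← (hδ₁s hs).2.2, ← (hδ₁s hs').2.2, h1])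
  -- The chart height of `τ (h s)` is that of `K (1, s)`, which is continuous, and the height is
  -- injective along `τ`. The contraction keeps `h` in the compact interval where
  -- `continuousOn_of_comp_injOn` applies.
  have hhc : ContinuousOn h J := fun s hs => by
    obtain ⟨r, hr1, hr2⟩ := exists_between (abs_lt.2 hs)
    have hCJ : Icc (-r) r ⊆ J := fun x hx => ⟨by linarith [hx.1], by linarith [hx.2]⟩
    have hbc : ContinuousOn (fun s => (φ₀ (τ s)).2) (Ioo (-ε) ε) :=
      continuous_snd.comp_continuousOn (φ₀.continuousOn.comp hτc hτs)
    have := continuousOn_of_comp_injOn (h := h) (A := Ioo (-r) r) isCompact_Icc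
      (hbc.mono (hCJ.trans hJε)) (hτi.mono (hCJ.trans hJε)) (fun x hx => by
        rcases eq_or_ne x 0 with rfl | h0
        · rw [hh0]; exact Ioo_subset_Icc_self hx
        · have := (hlt x (hJε (hCJ (Ioo_subset_Icc_self hx))) h0).trans (abs_lt.2 hx)
          exact abs_le.1 this.le) (by
        have hrJ : Ioo (-r) r ⊆ Ioo (-ε) ε := (Ioo_subset_Icc_self.trans hCJ).trans hJε
        refine ContinuousOn.congr (f := fun s => (φ₀ (K (1, s))).2)
          (continuous_snd.comp_continuousOn (φ₀.continuousOn.comp (hK1c.mono hrJ) fun x hx => ?_))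
          fun x hx => ?_
        · rw [(hK x (hrJ hx)).2.2.2]; exact hτs (hK x (hrJ hx)).2.2.1
        · simp only [Function.comp]; rw [(hK x (hrJ hx)).2.2.2])
    exact ((this.continuousAt (Ioo_mem_nhds (abs_lt.1 hr1).1 (abs_lt.1 hr1).2))).continuousWithinAt
  let χ₁ : ℝ × ℝ → ℝ × ℝ := fun z => (ω z.2 * z.1, z.2)
  let χ₂ : ℝ × ℝ → ℝ × ℝ := fun z => (z.1 - 1, h z.2)
  have hχ₁c : ContinuousOn χ₁ (Icc 0 1 ×ˢ J) := ((hωc.comp continuousOn_snd fun z hz => hz.2).mul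
    continuousOn_fst).prodMk continuousOn_snd
  have hχ₁m : MapsTo χ₁ (Icc 0 1 ×ˢ J) (Icc 0 2 ×ˢ Ioo (-δ₀) δ₀) := fun z hz => by
    have := hωm _ hz.2
    exact ⟨⟨mul_nonneg this.1.le hz.1.1, (mul_le_of_le_one_right this.1.le hz.1.2).trans this.2.le⟩,
      hJ1 hz.2⟩
  have hχ₂c : ContinuousOn χ₂ (Icc 1 2 ×ˢ J) :=
    ContinuousOn.prodMk (by fun_prop) (hhc.comp continuousOn_snd fun z hz => hz.2)
  have hχ₂m : MapsTo χ₂ (Icc 1 2 ×ˢ J) (Icc 0 1 ×ˢ J) := fun z hz =>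
    ⟨⟨by linarith [hz.1.1], by linarith [hz.1.2]⟩, hh _ hz.2⟩
  have hL1 : ∀ z ∈ Icc (0 : ℝ) 1 ×ˢ J, F.LocFol (Ψ₀ ∘ χ₁) (Icc 0 1 ×ˢ J) z := fun z hz => by
    refine (P5 _ (hχ₁m hz)).comp (hχ₁c z hz) (eventually_mem_nhdsWithin.mono fun w hw => hχ₁m hw)
      self_mem_nhdsWithin fun z₁ h₁ z₂ h₂ => ⟨Iff.rfl, fun h12 => ?_⟩
    obtain ⟨e1, e2⟩ := Prod.ext_iff.1 h12
    simp only [χ₁] at e1 e2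
    rw [e2] at e1
    exact Prod.ext (mul_left_cancel₀ (hωm _ h₂.2).1.ne' e1) e2
  have hL2 : ∀ z ∈ Icc (1 : ℝ) 2 ×ˢ J, F.LocFol ((Ψ₀ ∘ χ₁) ∘ χ₂) (Icc 1 2 ×ˢ J) z := fun z hz => by
    refine (hL1 _ (hχ₂m hz)).comp (hχ₂c z hz) (eventually_mem_nhdsWithin.mono fun w hw => hχ₂m hw)
      self_mem_nhdsWithin fun z₁ h₁ z₂ h₂ => ⟨hhi.eq_iff h₁.2 h₂.2, fun h12 => ?_⟩
    obtain ⟨e1, e2⟩ := Prod.ext_iff.1 h12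
    simp only [χ₂] at e1 e2
    exact Prod.ext (by linarith) (hhi h₁.2 h₂.2 e2)
  let Ψ : ℝ × ℝ → Torus := fun z => if z.1 ≤ 1 then (Ψ₀ ∘ χ₁) z else ((Ψ₀ ∘ χ₁) ∘ χ₂) z
  have hjoin : ∀ s ∈ J, (Ψ₀ ∘ χ₁) (1, s) = (Ψ₀ ∘ χ₁) (0, h s) := fun s hs => by
    simp only [χ₁, Function.comp, mul_one, mul_zero]
    rw [hΨω s hs, P2 _ (hJ1 (hh s hs))]
  have hE1 : EqOn Ψ (Ψ₀ ∘ χ₁) (Icc 0 1 ×ˢ J) := fun z hz => if_pos hz.1.2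
  have hE2 : EqOn Ψ ((Ψ₀ ∘ χ₁) ∘ χ₂) (Icc 1 2 ×ˢ J) := fun z hz => by
    rcases hz.1.1.eq_or_lt with h1 | h1
    · have hz1 : z = (1, z.2) := Prod.ext h1.symm rfl
      simp only [Ψ]
      rw [if_pos h1.symm.le, hz1, hjoin _ hz.2]
      simp only [Function.comp, χ₂, sub_self]
    · exact if_neg (not_le.2 h1)
  have hΨc : ContinuousOn Ψ (Icc 0 2 ×ˢ J) := continuousOn_Icc_prod_glue zero_le_one one_le_two
    ((P1.comp hχ₁c hχ₁m).congr hE1) (((P1.comp hχ₁c hχ₁m).comp hχ₂c hχ₂m).congr hE2)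
  have hcore : ∀ t ∈ Icc (0 : ℝ) 2, Ψ (t, 0) = γ (t : UnitAddCircle) := by
    have hω0 : ω 0 = 1 := by simp only [hω, hζ0]
    have h1 : ∀ t ∈ Icc (0 : ℝ) 1, (Ψ₀ ∘ χ₁) (t, 0) = γ (t : UnitAddCircle) := fun t ht => by
      simp only [Function.comp, χ₁, hω0, one_mul]
      exact P3 t ⟨ht.1, ht.2.trans one_le_two⟩
    intro t ht
    rcases le_total t 1 with hle | hle
    · rw [hE1 ⟨⟨ht.1, hle⟩, h0δ₁⟩, h1 t ⟨ht.1, hle⟩]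
    · rw [hE2 ⟨⟨hle, ht.2⟩, h0δ₁⟩]
      show (Ψ₀ ∘ χ₁) (t - 1, h 0) = _
      rw [hh0, h1 _ ⟨by linarith, by linarith [ht.2]⟩, AddCircle.coe_sub, hone, sub_zero]
  have hΨL1 : ∀ s ∈ J, ∀ t ∈ Icc (0 : ℝ) 1, F.LocFol Ψ (Icc 0 1 ×ˢ J) (t, s) := fun s hs t ht =>
    (hL1 (t, s) ⟨ht, hs⟩).congr (eventually_mem_nhdsWithin.mono fun w hw => hE1 hw)
  have hΨL2 : ∀ s ∈ J, ∀ t ∈ Icc (1 : ℝ) 2, F.LocFol Ψ (Icc 1 2 ×ˢ J) (t, s) := fun s hs t ht =>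
    (hL2 (t, s) ⟨ht, hs⟩).congr (eventually_mem_nhdsWithin.mono fun w hw => hE2 hw)
  have hJn : J ∈ 𝓝 (0 : ℝ) := Ioo_mem_nhds h0δ₁.1 h0δ₁.2
  -- The seam at `t = 1` needs checking on the core only, where the row is the locally injective
  -- curve `γ`.
  obtain ⟨δ₂, hδ₂, hδ₂s, hΨL⟩ := LocFol.exists_uniform (F := F) (Ψ := Ψ) (a := 0) (b := 2) hJn
    (fun t ht => by
      rcases lt_trichotomy t 1 with h1 | rfl | h1
      · exact (hΨL1 0 h0δ₁ t ⟨ht.1, h1.le⟩).of_nhdsWithin_le (nhdsWithin_Icc_prod_le_of_lt h1)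
      · refine LocFol.glue zero_lt_one one_lt_two hJn hΨc (hΨL1 0 h0δ₁ 1 (by norm_num))
          (hΨL2 0 h0δ₁ 1 (by norm_num)) ?_
        obtain ⟨N, hN, hNi⟩ := hcinj 1
        refine ⟨N, hN, fun x hx y hy hxy => hNi hx.1 hy.1 ?_⟩
        simpa only [hcore x hx.2, hcore y hy.2] using hxy
      · exact (hΨL2 0 h0δ₁ t ⟨h1.le, ht.2⟩).of_nhdsWithin_le (nhdsWithin_Icc_prod_le_of_gt h1))
  rw [zero_sub, zero_add] at hδ₂s hΨL
  have hp : Icc (0 : ℝ) 2 ×ˢ Ioo (-δ₂) δ₂ ⊆ Icc 0 2 ×ˢ J := prod_mono subset_rfl hδ₂s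
  have hshift : ∀ t ∈ Icc (0 : ℝ) 1, ∀ s ∈ J, Ψ (t + 1, s) = Ψ (t, h s) := fun t ht s hs => by
    rw [hE1 (show (t, h s) ∈ _ from ⟨ht, hh s hs⟩),
      hE2 (show (t + 1, s) ∈ _ from ⟨⟨by linarith [ht.1], by linarith [ht.2]⟩, hs⟩)]
    simp only [Function.comp, χ₂, add_sub_cancel_right]
  have hleaf1 : ∀ z ∈ Icc (0 : ℝ) 1 ×ˢ J, (Ψ₀ ∘ χ₁) z ∈ F.leaf (τ z.2) := fun z hz =>
    P4 _ (hχ₁m hz)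
  have hΨ0 : ∀ s ∈ J, Ψ (0, s) = τ s := fun s hs => by
    rw [hE1 ⟨⟨le_rfl, zero_le_one⟩, hs⟩]
    simp only [Function.comp, χ₁, mul_zero]
    exact P2 s (hJ1 hs)
  refine ⟨Ψ, δ₂, h, hδ₂, hΨc.mono hp, fun z hz => (hΨL z hz).mono hp, hcore,
    fun t ht s hs => hshift t ht s (hδ₂s hs), fun z hz => ?_, hhc.mono hδ₂s, ?_, hh0,
    fun s hs => hlt s (hJε (hδ₂s hs))⟩
  · have hz2 := hδ₂s hz.2
    rw [hΨ0 _ hz2]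
    rcases le_total z.1 1 with h1 | h1
    · rw [hE1 ⟨⟨hz.1.1, h1⟩, hz2⟩]; exact hleaf1 _ ⟨⟨hz.1.1, h1⟩, hz2⟩
    · rw [hE2 ⟨⟨h1, hz.1.2⟩, hz2⟩]
      refine mem_leaf_trans ?_ (hleaf1 _ (hχ₂m (x := z) ⟨⟨h1, hz.1.2⟩, hz2⟩))
      show τ (h z.2) ∈ F.leaf (τ z.2)
      rw [← hΨω _ hz2]
      exact P4 (ω z.2, z.2) ⟨Ioo_subset_Icc_self (hωm _ hz2), hJ1 hz2⟩
  · exact strictMonoOn_of_shift isOpen_Ioo ordConnected_Ioo ⟨by linarith, hδ₂⟩ (hΨc.mono hp)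
      (fun z hz => (hΨL z hz).mono hp) (fun t ht s hs => hshift t ht s (hδ₂s hs)) (hhc.mono hδ₂s) hh0
      ((hhc.mono hδ₂s).strictMonoOn_of_injOn_Ioo (by linarith) (hhi.mono hδ₂s))

/-- The flow collar can be taken injective up to its return map, and inside a given neighbourhood of
the leaf. -/
theorem exists_flowCollar (hγ : Function.Injective γ) {p : Torus} (hr : range γ = F.leaf p)
    (hc : F.HolonomyContracts γ) {U : Set Torus} (hU : U ∈ 𝓝ˢ (range γ)) :
    ∃ Ψ δ h, FlowCollar F γ Ψ δ h ∧ (∀ z ∈ Icc 0 2 ×ˢ Ioo (-δ) δ, Ψ z ∈ U) ∧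
      ∀ a ∈ ({1 / 4, 1 / 2, 3 / 4} : Set ℝ), InjOn Ψ (Icc a (a + 3 / 4) ×ˢ Ioo (-δ) δ) := by
  obtain ⟨Ψ, δ, h, H⟩ := exists_flowCollar_of_leaf_eq hγ hr hc
  have h0 : (0 : ℝ) ∈ Ioo (-δ) δ := ⟨by linarith [H.pos], H.pos⟩
  have hev : ∀ᶠ s in 𝓝 (0 : ℝ), ∀ t ∈ Icc (0 : ℝ) 2, (t, s) ∈ Icc (0 : ℝ) 2 ×ˢ Ioo (-δ) δ →
      Ψ (t, s) ∈ U := by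
    refine isCompact_Icc.eventually_forall_of_forall_eventually (x₀ := (0 : ℝ)) (K := Icc (0 : ℝ) 2)
      (P := fun s t => (t, s) ∈ Icc (0 : ℝ) 2 ×ˢ Ioo (-δ) δ → Ψ (t, s) ∈ U) fun t ht => ?_
    have h1 : ∀ᶠ w in 𝓝[Icc 0 2 ×ˢ Ioo (-δ) δ] (t, 0), Ψ w ∈ U :=
      H.cont (t, 0) ⟨ht, h0⟩ (by
        rw [H.core t ht]; exact nhds_le_nhdsSet (mem_range_self _) hU)
    rw [eventually_nhdsWithin_iff] at h1
    exact (continuous_swap.tendsto ((0 : ℝ), t)).eventually h1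
  -- A window of length `3/4`, shorter than one turn, meets the core injectively; local injectivity
  -- and compactness extend this to a thin strip. The windows `[1/4, 1]`, `[1/2, 5/4]`, `[3/4, 3/2]`
  -- are the ones needed to compare two times in `[1/2, 3/2)`.
  have hin : ∀ a ∈ ({1 / 4, 1 / 2, 3 / 4} : Set ℝ), ∀ᶠ η in 𝓝[>] (0 : ℝ),
      InjOn Ψ (Icc a (a + 3 / 4) ×ˢ Ioo (-η) η) := fun a ha => by
    have ha' : 0 < a ∧ a + 3 / 4 < 2 := by
      rcases ha with rfl | rfl | rfl <;> norm_num
    have hk : ∀ z ∈ Icc a (a + 3 / 4) ×ˢ {(0 : ℝ)}, Icc 0 2 ×ˢ Ioo (-δ) δ ∈ 𝓝 z := by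
      rintro ⟨t, s⟩ ⟨ht, rfl⟩
      exact strip_mem_nhds ⟨by linarith [ht.1], by linarith [ht.2]⟩ h0
    obtain ⟨V, hV, hVi⟩ := Set.InjOn.exists_mem_nhdsSet (f := Ψ) (s := Icc a (a + 3 / 4) ×ˢ {(0 : ℝ)})
      (by
        rintro ⟨t, s⟩ ⟨ht, rfl⟩ ⟨t', s'⟩ ⟨ht', rfl⟩ htt
        rw [H.core t ⟨by linarith [ht.1], by linarith [ht.2]⟩,
          H.core t' ⟨by linarith [ht'.1], by linarith [ht'.2]⟩] at htt
        exact Prod.ext (coe_injOn_Ico a ⟨ht.1, by linarith [ht.2]⟩ ⟨ht'.1, by linarith [ht'.2]⟩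
          (hγ htt)) rfl)
      (isCompact_Icc.prod isCompact_singleton) (fun z hz => H.cont.continuousAt (hk z hz))
      (fun z hz => ((H.loc z (mem_of_mem_nhds (hk z hz))).of_mem_nhds (B := univ)
        (hk z hz)).exists_injOn)
    obtain ⟨A, B, hAo, hBo, hA, hB, hAB⟩ := generalized_tube_lemma (isCompact_Icc)
      (isCompact_singleton) isOpen_interior (subset_interior_iff_mem_nhdsSet.2 hV)
    obtain ⟨η, hη, hηB⟩ := exists_Ioo_subset_of_mem_nhds (hBo.mem_nhds (hB rfl))
    rw [zero_sub, zero_add] at hηB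
    filter_upwards [Ioo_mem_nhdsGT hη] with η' hη'
    exact hVi.mono fun z hz => interior_subset (hAB ⟨hA hz.1, hηB
      ⟨by linarith [hz.2.1, hη'.2], by linarith [hz.2.2, hη'.2]⟩⟩)
  obtain ⟨η, hη, hηs⟩ := exists_Ioo_subset_of_mem_nhds hev
  rw [zero_sub, zero_add] at hηs
  obtain ⟨δ', ⟨h1, h2, h3⟩, h4, h5⟩ := ((((hin (1 / 4) (by simp)).and ((hin (1 / 2) (by simp)).and
    (hin (3 / 4) (by simp))))).and (Ioo_mem_nhdsGT (lt_min hη H.pos))).exists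
  have hle := lt_min_iff.1 h5
  refine ⟨Ψ, δ', h, H.mono h4 hle.2.le, fun z hz => ?_, ?_⟩
  · exact hηs ⟨by linarith [hz.2.1], by linarith [hz.2.2]⟩ z.1 hz.1
      ⟨hz.1, by linarith [hz.2.1], by linarith [hz.2.2]⟩
  · rintro a (rfl | rfl | rfl) <;> assumption

end OneFoliation

theorem isOpenQuotientMap_coe_prod :
    IsOpenQuotientMap (fun z : ℝ × ℝ => ((z.1 : UnitAddCircle), z.2)) :=
  (QuotientAddGroup.isOpenQuotientMap_mk).prodMap IsOpenQuotientMap.id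

namespace OneFoliation

/-- `S b`, for the two values of `b`, parametrizes the two sides of the closed leaf `γ` by half open
cylinders; the lines `{u} × ℝ` go to leaves that spiral towards `γ`. -/
structure IsCollar (F : OneFoliation Torus) (γ : C(UnitAddCircle, Torus))
    (S : Bool → UnitAddCircle × ℝ → Torus) : Prop where
  openEmb : ∀ b, IsOpenEmbedding (S b)
  disj : ∀ p q, S true p ≠ S false q
  disj_core : ∀ b p, S b p ∉ range γ
  leaf : ∀ b u d d', S b (u, d') ∈ F.leaf (S b (u, d))
  nhds : ∀ (D : ℝ) (θ : UnitAddCircle), ∀ᶠ y in 𝓝 (γ θ), y ∈ range γ ∨ ∃ b u d, D < d ∧ S b (u, d) = y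
  lim : ∀ b (θ : UnitAddCircle), Tendsto (fun q : UnitAddCircle × ℝ => S b (q.1 - (q.2 : UnitAddCircle), q.2))
    (𝓝 θ ×ˢ atTop) (𝓝 (γ θ))
  locFol : ∀ b z, F.LocFol (fun z : ℝ × ℝ => S b ((z.2 : UnitAddCircle), z.1)) univ z

variable {F : OneFoliation Torus} {γ : C(UnitAddCircle, Torus)} {Ψ : ℝ × ℝ → Torus} {δ : ℝ}
  {h : ℝ → ℝ}

/-- A parameter of a half transversal that linearizes the return map. -/
structure LinParam (h : ℝ → ℝ) (δ : ℝ) (l : ℝ → ℝ) : Prop where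
  mem : ∀ x ≤ 1, l x ∈ Ioo (-δ) δ
  inj : InjOn l (Iic 1)
  cont : ContinuousOn l (Iic 1)
  step : ∀ x ≤ 1, l (x - 1) = h (l x)
  lim : Tendsto l atBot (𝓝 0)

/-- `u` labels the leaf and `d` is the distance travelled along it, so `u + d` is the running time.
Subtracting the floor removes whole turns from the time, keeping it in `[1/2, 3/2)`, and applies the
return map to the transverse parameter once per turn, since `l (x - 1) = h (l x)`. -/
noncomputable def spiral (Ψ : ℝ × ℝ → Torus) (l : ℝ → ℝ) (u d : ℝ) : Torus :=
  Ψ (u + d - ⌊u + d - 1 / 2⌋, l (u - ⌊u + d - 1 / 2⌋))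

theorem coe_intCast (k : ℤ) : (((k : ℝ)) : UnitAddCircle) = 0 :=
  (AddCircle.coe_eq_zero_iff 1).2 ⟨k, by simp⟩

theorem floor_half (a : ℝ) : a - ⌊a - 1 / 2⌋ ∈ Ico (1 / 2 : ℝ) (3 / 2) :=
  ⟨by linarith [Int.floor_le (a - 1 / 2)], by linarith [Int.lt_floor_add_one (a - 1 / 2)]⟩

/-- Neighbouring turn counts give the same point by `shift`. Any count placing the time in `[1/4,
7/4]` may be used, so the jumps of the floor do no harm to continuity. -/
theorem FlowCollar.spiral_eq (H : FlowCollar F γ Ψ δ h) {l : ℝ → ℝ} (hl : LinParam h δ l) {u d : ℝ}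
    (hd : 1 < d) {k : ℤ} (hk : u + d - k ∈ Icc (1 / 4 : ℝ) (7 / 4)) :
    spiral Ψ l u d = Ψ (u + d - k, l (u - k)) := by
  unfold spiral
  set k₀ := ⌊u + d - 1 / 2⌋
  have h0 : u + d - k₀ ∈ Ico (1 / 2 : ℝ) (3 / 2) := floor_half _
  have h1 : (k₀ : ℝ) < k + 2 := by linarith [h0.1, hk.2]
  have h2 : (k : ℝ) < k₀ + 2 := by linarith [h0.2, hk.1]
  have h1' : k₀ < k + 2 := by exact_mod_cast h1
  have h2' : k < k₀ + 2 := by exact_mod_cast h2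
  obtain rfl | rfl | rfl : k = k₀ ∨ k = k₀ + 1 ∨ k = k₀ - 1 := by omega
  · rfl
  · have hu : u - k₀ ≤ 1 := by linarith [h0.2]
    push_cast at hk ⊢
    rw [show u - (k₀ + 1 : ℝ) = u - k₀ - 1 by ring, hl.step _ hu,
      ← H.shift _ ⟨by linarith [hk.1], by linarith [h0.2]⟩ _ (hl.mem _ hu)]
    congr 2; ring
  · push_cast at hk ⊢
    have hu : u - (k₀ - 1 : ℝ) ≤ 1 := by linarith [hk.2]
    rw [show u - (k₀ : ℝ) = u - (k₀ - 1) - 1 by ring, hl.step _ hu,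
      ← H.shift _ ⟨by linarith [h0.1], by linarith [hk.2]⟩ _ (hl.mem _ hu)]
    congr 2; ring

theorem spiral_periodic (Ψ : ℝ × ℝ → Torus) (l : ℝ → ℝ) (d : ℝ) :
    Function.Periodic (fun u => spiral Ψ l u d) 1 := fun u => by
  simp only [spiral]
  rw [show u + 1 + d - 1 / 2 = u + d - 1 / 2 + 1 by ring, Int.floor_add_one]
  push_cast
  congr 2 <;> ring_nf

/-- The half collar on the side of a closed leaf on which the parameter `l` runs. -/
noncomputable def halfCollar (Ψ : ℝ × ℝ → Torus) (l : ℝ → ℝ) (p : UnitAddCircle × ℝ) : Torus :=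
  (spiral_periodic Ψ l (pushUp 1 p.2)).lift p.1

theorem halfCollar_coe (Ψ : ℝ × ℝ → Torus) (l : ℝ → ℝ) (u d : ℝ) :
    halfCollar Ψ l ((u : UnitAddCircle), d) = spiral Ψ l u (pushUp 1 d) := rfl

theorem exists_spiral (l : ℝ → ℝ) (hl : LinParam h δ l) (u : ℝ) {d : ℝ}
    (hd : 1 < d) : ∃ (k : ℤ), u + d - k ∈ Ico (1 / 2 : ℝ) (3 / 2) ∧ u - k ≤ 1 ∧
      l (u - k) ∈ Ioo (-δ) δ ∧ spiral Ψ l u d = Ψ (u + d - k, l (u - k)) := by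
  have h0 := floor_half (u + d)
  have h1 : u - ⌊u + d - 1 / 2⌋ ≤ 1 := by linarith [h0.2]
  exact ⟨_, h0, h1, hl.mem _ h1, rfl⟩

/-- Two times in `[1/2, 3/2)` either share one of the three windows or lie below `3/4` and above
`5/4`. In the latter case, moving the larger one back a turn puts both in `[1/4, 1]`; injectivity
there would make them differ by exactly one turn, which is too much. -/
theorem FlowCollar.eq_of_eq (H : FlowCollar F γ Ψ δ h)
    (hi : ∀ a ∈ ({1 / 4, 1 / 2, 3 / 4} : Set ℝ), InjOn Ψ (Icc a (a + 3 / 4) ×ˢ Ioo (-δ) δ))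
    {t t' s s' : ℝ} (ht : t ∈ Ico (1 / 2 : ℝ) (3 / 2)) (ht' : t' ∈ Ico (1 / 2 : ℝ) (3 / 2))
    (hs : s ∈ Ioo (-δ) δ) (hs' : s' ∈ Ioo (-δ) δ) (he : Ψ (t, s) = Ψ (t', s')) : t = t' ∧ s = s' := by
  have hh : ∀ s ∈ Ioo (-δ) δ, h s ∈ Ioo (-δ) δ := fun s hs => by
    rcases eq_or_ne s 0 with rfl | h0
    · rwa [H.h_zero]
    · exact abs_lt.1 ((H.h_lt s hs h0).trans (abs_lt.2 hs))
  have key : ∀ {t t' s s' : ℝ}, t ∈ Ico (1 / 2 : ℝ) (3 / 2) → t' ∈ Ico (1 / 2 : ℝ) (3 / 2) →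
      s ∈ Ioo (-δ) δ → s' ∈ Ioo (-δ) δ → Ψ (t, s) = Ψ (t', s') → t ≤ t' → t = t' ∧ s = s' := by
    intro t t' s s' ht ht' hs hs' he hle
    rcases le_total t' (5 / 4) with h1 | h1
    · exact Prod.ext_iff.1 (hi (1 / 2) (by simp) (x₁ := (t, s)) (x₂ := (t', s'))
        ⟨⟨ht.1, by linarith⟩, hs⟩ ⟨⟨ht'.1, by linarith⟩, hs'⟩ he)
    rcases le_total (3 / 4) t with h2 | h2
    · exact Prod.ext_iff.1 (hi (3 / 4) (by simp) (x₁ := (t, s)) (x₂ := (t', s'))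
        ⟨⟨h2, by linarith [ht.2]⟩, hs⟩ ⟨⟨by linarith, by linarith [ht'.2]⟩, hs'⟩ he)
    · have h3 := H.shift (t' - 1) ⟨by linarith, by linarith [ht'.2]⟩ s' hs'
      rw [sub_add_cancel, ← he] at h3
      have := (Prod.ext_iff.1 (hi (1 / 4) (by simp) (x₁ := (t, s)) (x₂ := (t' - 1, h s'))
        ⟨⟨by linarith [ht.1], by linarith⟩, hs⟩ ⟨⟨by linarith, by linarith [ht'.2]⟩, hh _ hs'⟩ h3)).1
      simp only at this
      linarith [ht.1, ht'.2]
  rcases le_total t t' with hle | hle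
  · exact key ht ht' hs hs' he hle
  · have := key ht' ht hs' hs he.symm hle
    exact ⟨this.1.symm, this.2.symm⟩

theorem FlowCollar.spiral_leaf (H : FlowCollar F γ Ψ δ h) {l : ℝ → ℝ} (hl : LinParam h δ l) {u : ℝ}
    {d d' : ℝ} (hd : 1 < d) (hd' : 1 < d') : spiral Ψ l u d' ∈ F.leaf (spiral Ψ l u d) := by
  have step : ∀ (n : ℕ) (x : ℝ), x ≤ 1 → Ψ (0, l (x - n)) ∈ F.leaf (Ψ (0, l x)) := by
    intro n x hx
    induction n with
    | zero => simpa using mem_leaf_self F _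
    | succ n ih =>
      have hx' : x - n ≤ 1 := by linarith [(Nat.cast_nonneg n : (0 : ℝ) ≤ n)]
      refine mem_leaf_trans ih ?_
      rw [show x - ((n + 1 : ℕ) : ℝ) = x - n - 1 by push_cast; ring, hl.step _ hx',
        ← H.shift 0 (by norm_num) _ (hl.mem _ hx')]
      exact H.leaf (0 + 1, l (x - n)) ⟨by norm_num, hl.mem _ hx'⟩
  have step2 : ∀ {k k' : ℤ}, u - k ≤ 1 → u - k' ≤ 1 → k ≤ k' →
      Ψ (0, l (u - k')) ∈ F.leaf (Ψ (0, l (u - k))) := by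
    intro k k' hk hk' hkk
    obtain ⟨n, rfl⟩ := Int.le.dest hkk
    have := step n _ hk
    push_cast
    rwa [show u - ((k : ℝ) + n) = u - k - n by ring]
  obtain ⟨k, hk, hu, hm, e⟩ := exists_spiral (Ψ := Ψ) l hl u hd
  obtain ⟨k', hk', hu', hm', e'⟩ := exists_spiral (Ψ := Ψ) l hl u hd'
  rw [e, e']
  have h1 := H.leaf (u + d - k, l (u - k)) ⟨⟨by linarith [hk.1], by linarith [hk.2]⟩, hm⟩
  have h2 := H.leaf (u + d' - k', l (u - k')) ⟨⟨by linarith [hk'.1], by linarith [hk'.2]⟩, hm'⟩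
  refine mem_leaf_trans (mem_leaf_symm h1) (mem_leaf_trans ?_ h2)
  rcases le_total k k' with hkk | hkk
  · exact step2 hu hu' hkk
  · exact mem_leaf_symm (step2 hu' hu hkk)

theorem FlowCollar.continuousAt (H : FlowCollar F γ Ψ δ h) {z : ℝ × ℝ} (h1 : z.1 ∈ Ioo (0 : ℝ) 2)
    (h2 : z.2 ∈ Ioo (-δ) δ) : ContinuousAt Ψ z :=
  H.cont.continuousAt (strip_mem_nhds h1 h2)

theorem FlowCollar.locFol_univ (H : FlowCollar F γ Ψ δ h) {z : ℝ × ℝ} (h1 : z.1 ∈ Ioo (0 : ℝ) 2)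
    (h2 : z.2 ∈ Ioo (-δ) δ) : F.LocFol Ψ univ z :=
  (H.loc z ⟨Ioo_subset_Icc_self h1, h2⟩).of_mem_nhds (strip_mem_nhds h1 h2)

section half

variable {l : ℝ → ℝ}

/-- Near a given point, the half collar is a triangular reparametrization of the flow collar. -/
theorem FlowCollar.halfCollar_chart (H : FlowCollar F γ Ψ δ h) (hl : LinParam h δ l) (z : ℝ × ℝ) :
    ∃ k : ℤ, ∃ N ∈ 𝓝 z, ∀ w ∈ N, w.2 + pushUp 1 w.1 - k ∈ Ioo (0 : ℝ) 2 ∧ w.2 - k < 1 ∧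
      halfCollar Ψ l ((w.2 : UnitAddCircle), w.1) = Ψ (w.2 + pushUp 1 w.1 - k, l (w.2 - k)) := by
  obtain ⟨k, hk, -⟩ := exists_spiral (Ψ := Ψ) l hl z.2 (lt_pushUp 1 z.1)
  have hc : Continuous fun w : ℝ × ℝ => w.2 + pushUp 1 w.1 - k := by
    have := (continuous_pushUp 1).comp continuous_fst (Y := ℝ) (X := ℝ × ℝ)
    exact (continuous_snd.add this).sub continuous_const
  refine ⟨k, _, hc.continuousAt (Ioo_mem_nhds (a := 1 / 4) (b := 7 / 4) (by linarith [hk.1])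
    (by linarith [hk.2])), fun w hw => ?_⟩
  have hw' : w.2 + pushUp 1 w.1 - k ∈ Ioo (1 / 4 : ℝ) (7 / 4) := hw
  refine ⟨⟨by linarith [hw'.1], by linarith [hw'.2]⟩, by linarith [hw'.2, lt_pushUp 1 w.1], ?_⟩
  rw [halfCollar_coe, H.spiral_eq hl (lt_pushUp 1 _) (Ioo_subset_Icc_self hw')]

/-- The coordinates are swapped because in `LocFol` the second coordinate is the transverse one,
here the leaf label `u`, while the depth `d` runs along the leaf. -/
theorem FlowCollar.halfCollar_locFol (H : FlowCollar F γ Ψ δ h) (hl : LinParam h δ l) (z : ℝ × ℝ) :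
    ContinuousAt (fun z : ℝ × ℝ => halfCollar Ψ l ((z.2 : UnitAddCircle), z.1)) z ∧
      F.LocFol (fun z : ℝ × ℝ => halfCollar Ψ l ((z.2 : UnitAddCircle), z.1)) univ z := by
  obtain ⟨k, N, hN, hk⟩ := H.halfCollar_chart hl z
  let χ : ℝ × ℝ → ℝ × ℝ := fun w => (w.2 + pushUp 1 w.1 - k, l (w.2 - k))
  obtain ⟨z1, z2, -⟩ := hk z (mem_of_mem_nhds hN)
  have he : (fun z : ℝ × ℝ => halfCollar Ψ l ((z.2 : UnitAddCircle), z.1)) =ᶠ[𝓝 z] Ψ ∘ χ :=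
    eventually_of_mem hN fun w hw => (hk w hw).2.2
  have hlc : ContinuousAt (fun w : ℝ × ℝ => l (w.2 - k)) z :=
    ContinuousAt.comp (f := fun w : ℝ × ℝ => w.2 - k) (hl.cont.continuousAt (Iic_mem_nhds z2))
      (by fun_prop)
  have hχc : ContinuousAt χ z := by
    have := (continuous_pushUp 1).comp continuous_fst (Y := ℝ) (X := ℝ × ℝ)
    exact ((continuous_snd.add this).sub continuous_const).continuousAt.prodMk hlc
  have hm2 : l (z.2 - k) ∈ Ioo (-δ) δ := hl.mem _ z2.le
  refine ⟨((H.continuousAt (z := χ z) z1 hm2).comp hχc).congr he.symm, ?_⟩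
  refine LocFol.congr (LocFol.comp (A := univ) (H.locFol_univ (z := χ z) z1 hm2)
    hχc.continuousWithinAt (by simp) (N := N) (by rwa [nhdsWithin_univ]) fun z₁ h₁ z₂ h₂ => ?_)
    (by rwa [nhdsWithin_univ])
  have hs : l (z₁.2 - k) = l (z₂.2 - k) ↔ z₁.2 = z₂.2 :=
    (hl.inj.eq_iff (mem_Iic.2 (hk z₁ h₁).2.1.le) (mem_Iic.2 (hk z₂ h₂).2.1.le)).trans sub_left_inj
  refine ⟨hs, fun h12 => ?_⟩
  obtain ⟨e1, e2⟩ := Prod.ext_iff.1 h12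
  have e2' := hs.1 e2
  simp only [χ] at e1
  exact Prod.ext ((strictMono_pushUp 1).injective (by linarith)) e2'

theorem FlowCollar.continuous_halfCollar (H : FlowCollar F γ Ψ δ h) (hl : LinParam h δ l) :
    Continuous (halfCollar Ψ l) := by
  rw [isOpenQuotientMap_coe_prod.isQuotientMap.continuous_iff, continuous_iff_continuousAt]
  exact fun z => ContinuousAt.comp (f := Prod.swap) (H.halfCollar_locFol hl z.swap).1
    continuous_swap.continuousAt

theorem FlowCollar.isOpenEmbedding_halfCollar (H : FlowCollar F γ Ψ δ h) (hl : LinParam h δ l)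
    (hi : ∀ a ∈ ({1 / 4, 1 / 2, 3 / 4} : Set ℝ), InjOn Ψ (Icc a (a + 3 / 4) ×ˢ Ioo (-δ) δ)) :
    IsOpenEmbedding (halfCollar Ψ l) := by
  refine IsOpenEmbedding.of_continuous_injective_isOpenMap (H.continuous_halfCollar hl) ?_ ?_
  · intro p q hpq
    obtain ⟨⟨u, d⟩, rfl⟩ := isOpenQuotientMap_coe_prod.surjective p
    obtain ⟨⟨u', d'⟩, rfl⟩ := isOpenQuotientMap_coe_prod.surjective q
    simp only [halfCollar_coe] at hpq
    obtain ⟨k, hk, hu, hm, e⟩ := exists_spiral (Ψ := Ψ) l hl u (lt_pushUp 1 d)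
    obtain ⟨k', hk', hu', hm', e'⟩ := exists_spiral (Ψ := Ψ) l hl u' (lt_pushUp 1 d')
    rw [e, e'] at hpq
    obtain ⟨e1, e2⟩ := H.eq_of_eq hi hk hk' hm hm' hpq
    have e3 := hl.inj hu hu' e2
    have e4 : d = d' := (strictMono_pushUp 1).injective (by linarith)
    refine Prod.ext ?_ e4
    simp only
    rw [show u = u' + ((k - k' : ℤ) : ℝ) by push_cast; linarith, AddCircle.coe_add, coe_intCast,
      add_zero]
  · rw [isOpenMap_iff_nhds_le]
    intro p
    obtain ⟨⟨u, d⟩, rfl⟩ := isOpenQuotientMap_coe_prod.surjective p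
    intro V hV
    have h1 := isOpenQuotientMap_coe_prod.continuous.continuousAt (x := (u, d)) hV
    have h2 : (fun z : ℝ × ℝ => halfCollar Ψ l ((z.2 : UnitAddCircle), z.1)) ''
        (Prod.swap ⁻¹' ((fun z : ℝ × ℝ => ((z.1 : UnitAddCircle), z.2)) ⁻¹' (halfCollar Ψ l ⁻¹' V)))
        ∈ 𝓝 _ := (H.halfCollar_locFol hl (d, u)).2.image_mem_nhds
      (Eventually.of_forall fun w => (H.halfCollar_locFol hl w).1)
      (continuous_swap.continuousAt (x := (d, u)) h1)
    refine mem_of_superset h2 ?_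
    rintro _ ⟨w, hw, rfl⟩
    exact hw

/-- With leaf label `θ - d` at depth `d` the running time is the constant `θ`, while the transverse
parameter is `l (θ - d - k)` and tends to `0`. Thus the spiral is unwound and the limit on the core
is `γ θ`. -/
theorem FlowCollar.halfCollar_lim (H : FlowCollar F γ Ψ δ h) (hl : LinParam h δ l)
    (θ : UnitAddCircle) :
    Tendsto (fun q : UnitAddCircle × ℝ => halfCollar Ψ l (q.1 - (q.2 : UnitAddCircle), q.2))
      (𝓝 θ ×ˢ atTop) (𝓝 (γ θ)) := by
  obtain ⟨x, rfl⟩ := QuotientAddGroup.mk_surjective θ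
  have hmap : 𝓝 (x : UnitAddCircle) ×ˢ (atTop : Filter ℝ) =
      map (fun z : ℝ × ℝ => ((z.1 : UnitAddCircle), z.2)) (𝓝 x ×ˢ atTop) := by
    rw [← (QuotientAddGroup.isOpenQuotientMap_mk (G := ℝ)).map_nhds_eq x]
    exact (prod_map_left _ _ _).trans rfl
  show Tendsto _ (𝓝 (x : UnitAddCircle) ×ˢ atTop) (𝓝 (γ (x : UnitAddCircle)))
  rw [hmap, tendsto_map'_iff]
  set k := ⌊x - 1 / 2⌋ with hk
  have hx := floor_half x
  rw [← hk] at hx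
  have hγ : γ (x : UnitAddCircle) = Ψ (x - k, 0) := by
    rw [H.core _ ⟨by linarith [hx.1], by linarith [hx.2]⟩]
    rw [AddCircle.coe_sub, coe_intCast, sub_zero]
  have h0 : (0 : ℝ) ∈ Ioo (-δ) δ := ⟨by linarith [H.pos], H.pos⟩
  have hlim : Tendsto (fun z : ℝ × ℝ => Ψ (z.1 - k, l (z.1 - z.2 - k))) (𝓝 x ×ˢ atTop)
      (𝓝 (Ψ (x - k, 0))) := by
    refine (H.continuousAt (z := (x - k, 0)) ⟨by linarith [hx.1], by linarith [hx.2]⟩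
      h0).tendsto.comp ?_
    rw [nhds_prod_eq]
    refine Tendsto.prodMk (tendsto_fst.sub_const _) (hl.lim.comp ?_)
    have h1 : Tendsto (fun z : ℝ × ℝ => z.1 - k) (𝓝 x ×ˢ atTop) (𝓝 (x - k)) :=
      tendsto_fst.sub_const _
    have h2 : Tendsto (fun z : ℝ × ℝ => - z.2) (𝓝 x ×ˢ atTop) atBot :=
      tendsto_neg_atTop_atBot.comp tendsto_snd
    refine (h1.add_atBot h2).congr fun z => by ring
  rw [hγ]
  refine hlim.congr' ?_
  have e1 : ∀ᶠ z : ℝ × ℝ in 𝓝 x ×ˢ atTop, z.1 ∈ Ioo (x - 1 / 4) (x + 1 / 4) :=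
    tendsto_fst.eventually (Ioo_mem_nhds (by linarith) (by linarith))
  have e2 : ∀ᶠ z : ℝ × ℝ in 𝓝 x ×ˢ atTop, 2 ≤ z.2 := tendsto_snd.eventually (eventually_ge_atTop 2)
  filter_upwards [e1, e2] with z h1 h2
  show _ = halfCollar Ψ l ((z.1 : UnitAddCircle) - (z.2 : UnitAddCircle), z.2)
  rw [← AddCircle.coe_sub, halfCollar_coe, pushUp_of_le (by linarith),
    H.spiral_eq hl (k := k) (by linarith) ⟨by linarith [h1.1, hx.1], by linarith [h1.2, hx.2]⟩,
    sub_add_cancel]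

theorem halfCollar_mem (hl : LinParam h δ l) {U : Set Torus}
    (hU : ∀ z ∈ Icc 0 2 ×ˢ Ioo (-δ) δ, Ψ z ∈ U) (p : UnitAddCircle × ℝ) : halfCollar Ψ l p ∈ U := by
  obtain ⟨⟨u, d⟩, rfl⟩ := isOpenQuotientMap_coe_prod.surjective p
  obtain ⟨k, hk, hu, hm, e⟩ := exists_spiral (Ψ := Ψ) l hl u (lt_pushUp 1 d)
  simp only [halfCollar_coe, e]
  exact hU _ ⟨⟨by linarith [hk.1], by linarith [hk.2]⟩, hm⟩

/-- The part of a half collar beyond a given depth covers a half neighbourhood of the leaf. -/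
theorem FlowCollar.halfCollar_eq (H : FlowCollar F γ Ψ δ h) (hl : LinParam h δ l) {D x t : ℝ}
    (hD : 2 ≤ D) (hx : x < -D) (ht : t ∈ Ioo (1 / 4 : ℝ) (7 / 4)) :
    ∃ u d, D < d ∧ halfCollar Ψ l (u, d) = Ψ (t, l x) := by
  refine ⟨(x : UnitAddCircle), t - x, by linarith [ht.1], ?_⟩
  rw [halfCollar_coe, pushUp_of_le (by linarith [ht.1]),
    H.spiral_eq hl (k := 0) (by linarith [ht.1]) (by simpa using Ioo_subset_Icc_self ht)]
  simp

end half

/-- The return map is linearized separately on the two half transversals, which gives one half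
collar on each side. They are disjoint from each other and from the core because the transverse
parameters have different signs. -/
theorem exists_collar (hγ : Function.Injective γ) {p : Torus} (hr : range γ = F.leaf p)
    (hc : F.HolonomyContracts γ) {U : Set Torus} (hU : U ∈ 𝓝ˢ (range γ)) :
    ∃ S, IsCollar F γ S ∧ ∀ b p, S b p ∈ U := by
  obtain ⟨Ψ, δ, h, H, hΨU, hi⟩ := exists_flowCollar hγ hr hc hU
  have hδ := H.pos
  have h0 : (0 : ℝ) ∈ Ioo (-δ) δ := ⟨by linarith, hδ⟩
  have hpos : ∀ s ∈ Ioo 0 δ, 0 < h s ∧ h s < s := fun s hs => by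
    have hs' : s ∈ Ioo (-δ) δ := ⟨by linarith [hs.1], hs.2⟩
    have h1 := H.h_mono h0 hs' hs.1
    rw [H.h_zero] at h1
    have h2 := H.h_lt s hs' hs.1.ne'
    rw [abs_of_pos h1, abs_of_pos hs.1] at h2
    exact ⟨h1, h2⟩
  have hneg : ∀ s ∈ Ioo 0 δ, 0 < - h (-s) ∧ - h (-s) < s := fun s hs => by
    have hs' : -s ∈ Ioo (-δ) δ := ⟨by linarith [hs.2], by linarith [hs.1]⟩
    have h1 := H.h_mono hs' h0 (by linarith [hs.1])
    rw [H.h_zero] at h1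
    have h2 := H.h_lt _ hs' (by linarith [hs.1])
    rw [abs_of_neg h1, abs_neg, abs_of_pos hs.1] at h2
    exact ⟨by linarith, h2⟩
  have hd2 : δ / 2 ∈ Ioo 0 δ := ⟨by linarith, by linarith⟩
  have hsubp : Ioo 0 δ ⊆ Ioo (-δ) δ := Ioo_subset_Ioo_left (by linarith)
  have hmapn : ∀ s ∈ Ioo 0 δ, -s ∈ Ioo (-δ) δ := fun s hs => ⟨by linarith [hs.2], by linarith [hs.1]⟩
  obtain ⟨L, L1, L2, L3, L4, L5, L6⟩ := exists_linearization (H.h_cont.mono hsubp)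
    (H.h_mono.mono hsubp) hpos hd2
  -- The negative half transversal is turned into a positive one by `s ↦ -s`.
  obtain ⟨M, M1, M2, M3, M4, M5, M6⟩ := exists_linearization (h := fun s => - h (-s)) (δ := δ)
    (H.h_cont.comp continuousOn_neg hmapn).neg
    (fun x hx y hy hxy => neg_lt_neg (H.h_mono (hmapn y hy) (hmapn x hx) (neg_lt_neg hxy))) hneg hd2
  have hL : LinParam h δ L := ⟨fun x hx => ⟨by linarith [(L1 x hx).1], by linarith [(L1 x hx).2]⟩,
    L2.injOn, L3, L4, L5⟩
  have hM : LinParam h δ (fun x => - M x) :=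
    ⟨fun x hx => ⟨by linarith [(M1 x hx).2], by linarith [(M1 x hx).1]⟩,
      fun x hx y hy hxy => M2.injOn hx hy (neg_inj.1 hxy), M3.neg, fun x hx => by simp [M4 x hx],
      by simpa using M5.neg⟩
  have key : ∀ {l l' : ℝ → ℝ}, LinParam h δ l → LinParam h δ l' → (∀ x ≤ 1, ∀ y ≤ 1, l x ≠ l' y) →
      ∀ p q, halfCollar Ψ l p ≠ halfCollar Ψ l' q := by
    intro l l' hl hl' hne p q hpq
    obtain ⟨⟨u, d⟩, rfl⟩ := isOpenQuotientMap_coe_prod.surjective p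
    obtain ⟨⟨u', d'⟩, rfl⟩ := isOpenQuotientMap_coe_prod.surjective q
    simp only [halfCollar_coe] at hpq
    obtain ⟨k, hk, hu, hm, e⟩ := exists_spiral (Ψ := Ψ) l hl u (lt_pushUp 1 d)
    obtain ⟨k', hk', hu', hm', e'⟩ := exists_spiral (Ψ := Ψ) l' hl' u' (lt_pushUp 1 d')
    rw [e, e'] at hpq
    exact hne _ hu _ hu' (H.eq_of_eq hi hk hk' hm hm' hpq).2
  have keyγ : ∀ {l : ℝ → ℝ}, LinParam h δ l → (∀ x ≤ 1, l x ≠ 0) →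
      ∀ p, halfCollar Ψ l p ∉ range γ := by
    rintro l hl hne p ⟨θ, hθ⟩
    obtain ⟨⟨u, d⟩, rfl⟩ := isOpenQuotientMap_coe_prod.surjective p
    obtain ⟨x, rfl⟩ := QuotientAddGroup.mk_surjective θ
    simp only [halfCollar_coe] at hθ
    obtain ⟨k, hk, hu, hm, e⟩ := exists_spiral (Ψ := Ψ) l hl u (lt_pushUp 1 d)
    have hx := floor_half x
    have hγ : γ (x : UnitAddCircle) = Ψ (x - ⌊x - 1 / 2⌋, 0) := by
      rw [H.core _ ⟨by linarith [hx.1], by linarith [hx.2]⟩, AddCircle.coe_sub, coe_intCast,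
        sub_zero]
    rw [e] at hθ
    exact hne _ hu (H.eq_of_eq hi hk hx hm h0 ((hθ.symm).trans hγ)).2
  let l : Bool → ℝ → ℝ := fun b => if b then L else fun x => - M x
  have hl : ∀ b, LinParam h δ (l b) := by rintro (_ | _); exacts [hM, hL]
  have hl0 : ∀ b, ∀ x ≤ 1, l b x ≠ 0 := by
    rintro (_ | _) x hx
    · have : - M x ≠ 0 := by linarith [(M1 x hx).1] |> fun h : M x > 0 => neg_ne_zero.2 h.ne'
      exact this
    · exact (L1 x hx).1.ne'
  refine ⟨fun b => halfCollar Ψ (l b), ⟨fun b => H.isOpenEmbedding_halfCollar (hl b) hi,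
    key (hl true) (hl false) fun x hx y hy hxy => ?_, fun b => keyγ (hl b) (hl0 b), ?_, ?_,
    fun b => H.halfCollar_lim (hl b), fun b z => (H.halfCollar_locFol (hl b) z).2⟩,
    fun b => halfCollar_mem (hl b) hΨU⟩
  · have h1 : L x = - M y := hxy
    linarith [(L1 x hx).1, (M1 y hy).1]
  · intro b u d d'
    obtain ⟨x, rfl⟩ := QuotientAddGroup.mk_surjective u
    exact H.spiral_leaf (hl b) (lt_pushUp 1 _) (lt_pushUp 1 _)
  · intro D θ
    obtain ⟨x, rfl⟩ := QuotientAddGroup.mk_surjective θ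
    have hx := floor_half x
    set t := x - ⌊x - 1 / 2⌋
    have hγt : γ (x : UnitAddCircle) = Ψ (t, 0) := by
      rw [H.core _ ⟨by linarith [hx.1], by linarith [hx.2]⟩, AddCircle.coe_sub, coe_intCast,
        sub_zero]
    show ∀ᶠ y in 𝓝 (γ (x : UnitAddCircle)), _
    rw [hγt]
    -- Transverse parameters between those of `-E - 1` on the two sides correspond to linear
    -- parameters below `-E`, hence to depths beyond `D`; the bound `2` puts them where `pushUp 1`
    -- is the identity.
    set E := max D 2
    have hE1 : -E - 1 ≤ 1 := by linarith [le_max_right D 2]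
    have hLE := L1 _ hE1
    have hME := M1 _ hE1
    have hB : Ioo (1 / 4 : ℝ) (7 / 4) ×ˢ Ioo (-M (-E - 1)) (L (-E - 1)) ∈ 𝓝 ((t, 0) : ℝ × ℝ) :=
      prod_mem_nhds (Ioo_mem_nhds (by linarith [hx.1]) (by linarith [hx.2]))
        (Ioo_mem_nhds (by linarith [hME.1]) hLE.1)
    have ht2 : t ∈ Ioo (0 : ℝ) 2 := ⟨by linarith [hx.1], by linarith [hx.2]⟩
    refine mem_of_superset ((H.locFol_univ (z := (t, 0)) ht2 h0).image_mem_nhds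
      (H.cont.eventually_continuousAt (strip_mem_nhds ht2 h0)) hB) ?_
    rintro _ ⟨⟨t', s⟩, ⟨ht', hs⟩, rfl⟩
    have fin : ∀ b, ∀ y < -E, l b y = s → Ψ (t', s) ∈ range γ ∨ ∃ b u d, D < d ∧
        halfCollar Ψ (l b) (u, d) = Ψ (t', s) := fun b y hy he => by
      obtain ⟨u, d, hd, hud⟩ := H.halfCollar_eq (hl b) (le_max_right D 2) hy ht'
      exact Or.inr ⟨b, u, d, (le_max_left D 2).trans_lt hd, by rw [hud, he]⟩
    rcases lt_trichotomy s 0 with h1 | h1 | h1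
    · obtain ⟨y, hy, hys⟩ := M6 (-s) ⟨by linarith, by linarith [hME.2, hs.1]⟩
      have := (M2.lt_iff_lt (mem_Iic.2 hy) (mem_Iic.2 hE1)).1 (by linarith [hs.1])
      exact fin false y (by linarith) (by show - M y = s; linarith)
    · refine Or.inl ⟨(t' : UnitAddCircle), ?_⟩
      rw [h1, H.core _ ⟨by linarith [ht'.1], by linarith [ht'.2]⟩]
    · obtain ⟨y, hy, hys⟩ := L6 s ⟨h1, by linarith [hLE.2, hs.2]⟩
      have := (L2.lt_iff_lt (mem_Iic.2 hy) (mem_Iic.2 hE1)).1 (by linarith [hs.2])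
      exact fin true y (by linarith) hys

end OneFoliation

/-! ### Collars of all compact leaves, and the ends of non-compact leaves. -/

namespace OneFoliation

variable {F : OneFoliation Torus} {n : ℕ} {γ : Fin n → C(UnitAddCircle, Torus)}
  {S : Fin n × Bool → UnitAddCircle × ℝ → Torus}

/-- Pairwise disjoint collars of all the compact leaves; the sides of the compact leaves are indexed
by `Fin n × Bool`. -/
structure CollarSystem (F : OneFoliation Torus) {n : ℕ} (γ : Fin n → C(UnitAddCircle, Torus))
    (S : Fin n × Bool → UnitAddCircle × ℝ → Torus) : Prop where
  collar : ∀ i, IsCollar F (γ i) fun b => S (i, b)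
  eq_of_eq : ∀ {e e' p q}, S e p = S e' q → e = e' ∧ p = q
  notMem : ∀ e p i, S e p ∉ range (γ i)
  compactLeaf : ∀ L, F.IsCompactLeaf L ↔ ∃ i, range (γ i) = L

theorem exists_disjoint_nhdsSet {ι X : Type*} [Finite ι] [TopologicalSpace X] [T2Space X]
    {K : ι → Set X} (hK : ∀ i, IsCompact (K i)) (hd : Pairwise fun i j => Disjoint (K i) (K j)) :
    ∃ U : ι → Set X, (∀ i, U i ∈ 𝓝ˢ (K i)) ∧ Pairwise fun i j => Disjoint (U i) (U j) := by
  have : ∀ i j, ∃ U V : Set X, U ∈ 𝓝ˢ (K i) ∧ V ∈ 𝓝ˢ (K j) ∧ (i ≠ j → Disjoint U V) := by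
    intro i j
    by_cases h : i = j
    · exact ⟨univ, univ, univ_mem, univ_mem, fun h' => absurd h h'⟩
    · obtain ⟨U, V, hU, hV, hKU, hKV, hUV⟩ := SeparatedNhds.of_isCompact_isCompact (hK i) (hK j) (hd h)
      exact ⟨U, V, hU.mem_nhdsSet.2 hKU, hV.mem_nhdsSet.2 hKV, fun _ => hUV⟩
  choose U V hU hV hUV using this
  refine ⟨fun i => ⋂ j, (U i j ∩ V j i), fun i => iInter_mem.2 fun j => inter_mem (hU i j) (hV j i),
    fun i j hij => (hUV i j hij).mono (fun x hx => (mem_iInter.1 hx j).1)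
      (fun x hx => (mem_iInter.1 hx i).2)⟩

theorem leaf_disjoint_of_ne {p q : Torus} (h : F.leaf p ≠ F.leaf q) :
    Disjoint (F.leaf p) (F.leaf q) :=
  disjoint_left.2 fun _ h1 h2 => h ((leaf_eq_of_mem h1).symm.trans (leaf_eq_of_mem h2))

theorem IsGeometricalEnumeration.exists_collarSystem [NeZero n]
    (h : F.IsGeometricalEnumeration γ) : ∃ S, CollarSystem F γ S := by
  have hleaf : ∀ i, ∃ p, range (γ i) = F.leaf p := fun i => (h.isCompactLeaf i).1
  choose p hp using hleaf
  have hd : Pairwise fun i j => Disjoint (range (γ i)) (range (γ j)) := fun i j hij => by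
    show Disjoint (range (γ i)) (range (γ j))
    rw [hp i, hp j]
    refine leaf_disjoint_of_ne fun h' => hij (h.distinct ?_)
    simp only [hp, h']
  obtain ⟨U, hU, hUd⟩ := exists_disjoint_nhdsSet (fun i => (h.isCompactLeaf i).2) hd
  choose S hS hSU using fun i => exists_collar (h.contracting i).1 (hp i) (h.contracting i).2.2 (hU i)
  refine ⟨fun e => S e.1 e.2, hS, ?_, ?_, fun L => ⟨h.exhaustive L, ?_⟩⟩
  · rintro ⟨i, b⟩ ⟨j, b'⟩ x y hxy
    have hij : i = j := by
      by_contra hij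
      exact disjoint_left.1 (hUd hij) (hSU i b x) (by simp only at hxy; rw [hxy]; exact hSU j b' y)
    subst hij
    have hb : b = b' := by
      cases b <;> cases b'
      · rfl
      · exact absurd hxy.symm ((hS i).disj _ _)
      · exact absurd hxy ((hS i).disj _ _)
      · rfl
    subst hb
    exact ⟨rfl, ((hS i).openEmb b).injective hxy⟩
  · intro e x i hx
    by_cases hi : e.1 = i
    · subst hi; exact (hS _).disj_core _ _ hx
    · exact disjoint_left.1 (hUd hi) (hSU _ _ x) (subset_of_mem_nhdsSet (hU i) hx)
  · rintro ⟨i, rfl⟩; exact h.isCompactLeaf i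

namespace CollarSystem

variable (H : CollarSystem F γ S)
include H

theorem range_eq_leaf (i : Fin n) (θ : UnitAddCircle) : range (γ i) = F.leaf (γ i θ) := by
  obtain ⟨p, hp⟩ := ((H.compactLeaf _).2 ⟨i, rfl⟩).1
  have : γ i θ ∈ F.leaf p := hp ▸ mem_range_self θ
  rw [hp, leaf_eq_of_mem this]

theorem not_isCompact_leaf (e : Fin n × Bool) (x : UnitAddCircle × ℝ) :
    ¬ IsCompact (F.leaf (S e x)) := fun hc => by
  obtain ⟨i, hi⟩ := (H.compactLeaf _).1 ⟨⟨_, rfl⟩, hc⟩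
  exact H.notMem e x i (hi ▸ mem_leaf_self F _)

theorem line_mem_leaf (e : Fin n × Bool) (u : UnitAddCircle) (d d' : ℝ) :
    S e (u, d') ∈ F.leaf (S e (u, d)) := (H.collar e.1).leaf e.2 u d d'

theorem continuous (e : Fin n × Bool) : Continuous (S e) :=
  ((H.collar e.1).openEmb e.2).continuous

/-- In the parameter of its leaf a collar line is a continuous injective function `m`, hence
monotone. It cannot converge: the line accumulates on a compact leaf, and a finite limit would put a
point of that compact leaf on the non-compact one. -/
theorem line_param {c : ℝ → Torus} (hc : Continuous c) (hinj : Function.Injective c) {p : Torus}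
    (hr : range c = F.leaf p) {e : Fin n × Bool} {u : UnitAddCircle} (hm : S e (u, 0) ∈ F.leaf p) :
    ∃ m : ℝ → ℝ, (∀ d, c (m d) = S e (u, d)) ∧ Continuous m ∧
      ((StrictMono m ∧ Tendsto m atTop atTop) ∨ (StrictAnti m ∧ Tendsto m atTop atBot)) := by
  have hmem : ∀ d, ∃ t, c t = S e (u, d) := fun d => by
    have : S e (u, d) ∈ range c := hr ▸ mem_leaf_trans hm (H.line_mem_leaf e u 0 d)
    exact this
  choose m hm' using hmem
  have hmc : Continuous m := continuousOn_univ.1 (continuousOn_leaf_param hc hinj hr ordConnected_univ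
    (j := fun d => S e (u, d)) ((H.continuous e).comp (by fun_prop)).continuousOn fun d _ => hm' d)
  have hmi : Function.Injective m := fun d d' hd => by
    have : S e (u, d) = S e (u, d') := by rw [← hm', ← hm', hd]
    exact (Prod.ext_iff.1 (H.eq_of_eq this).2).2
  have hno : ∀ l, ¬ Tendsto m atTop (𝓝 l) := fun l hl => by
    have h1 : Tendsto (fun k : ℕ => S e (u, (k : ℝ))) atTop (𝓝 (c l)) := by
      simp only [← hm']
      exact (hc.tendsto l).comp (hl.comp tendsto_natCast_atTop_atTop)
    -- At integer depths the unwinding term vanishes in the circle, so the limit property of the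
    -- collar applies with fixed label `u`.
    have h2 : Tendsto (fun k : ℕ => S e (u, (k : ℝ))) atTop (𝓝 (γ e.1 u)) := by
      have := ((H.collar e.1).lim e.2 u).comp
        (tendsto_const_nhds.prodMk (tendsto_natCast_atTop_atTop (R := ℝ)) : Tendsto
          (fun k : ℕ => (u, (k : ℝ))) atTop (𝓝 u ×ˢ atTop))
      refine this.congr fun k => ?_
      have h0 : ((k : ℝ) : UnitAddCircle) = 0 := by simpa using coe_intCast (k : ℤ)
      simp only [Function.comp, h0, sub_zero]
    have h3 := tendsto_nhds_unique h1 h2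
    have h4 : γ e.1 u ∈ F.leaf p := h3 ▸ hr ▸ mem_range_self l
    have h5 : S e (u, 0) ∈ range (γ e.1) := by
      rw [H.range_eq_leaf e.1 u, leaf_eq_of_mem h4]; exact hm
    exact H.notMem _ _ _ h5
  refine ⟨m, hm', hmc, ?_⟩
  rcases hmc.strictMono_of_inj hmi with h | h
  · exact Or.inl ⟨h, (tendsto_atTop_of_monotone h.monotone).resolve_right fun ⟨l, hl⟩ => hno l hl⟩
  · exact Or.inr ⟨h, (tendsto_atTop_of_antitone h.antitone).resolve_right fun ⟨l, hl⟩ => hno l hl⟩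

/-- A path in a leaf that stays in a half collar stays on one line of it. -/
theorem line_const {e : Fin n × Bool} {A : Set ℝ} (hA : A.OrdConnected)
    {g : ℝ → UnitAddCircle × ℝ} (hg : ContinuousOn g A) {p : Torus}
    (hl : ∀ t ∈ A, S e (g t) ∈ F.leaf p) {t t' : ℝ} (ht : t ∈ A) (ht' : t' ∈ A) :
    (g t).1 = (g t').1 := by
  refine hA.isPreconnected.induction₂ (fun t t' => (g t).1 = (g t').1) (fun t₀ ht₀ => ?_)
    (fun a b c _ _ _ h1 h2 => h1.trans h2) (fun a b _ _ h => h.symm) ht ht'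
  obtain ⟨⟨x, d⟩, hxd⟩ := isOpenQuotientMap_coe_prod.surjective (g t₀)
  obtain ⟨φ, hφ, O, hO, hO'⟩ := (H.collar e.1).locFol e.2 (d, x)
  rw [nhdsWithin_univ] at hO
  have hW : (fun z : ℝ × ℝ => ((z.1 : UnitAddCircle), z.2)) '' (Prod.swap ⁻¹' O) ∈ 𝓝 (g t₀) := by
    rw [← hxd]
    exact isOpenQuotientMap_coe_prod.isOpenMap.image_mem_nhds
      (continuous_swap.continuousAt (x := (x, d)) hO)
  obtain ⟨r, hr, hrs⟩ := Metric.mem_nhdsWithin_iff.1 (hg t₀ ht₀ hW)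
  have hlift : ∀ t ∈ Metric.ball t₀ r ∩ A, ∃ z ∈ O, ((z.2 : UnitAddCircle), z.1) = g t := fun t ht => by
    obtain ⟨z, hz, hzt⟩ := hrs ht
    exact ⟨z.swap, hz, hzt⟩
  have hpc : IsPreconnected (Metric.ball t₀ r ∩ A) := by
    rw [Real.ball_eq_Ioo]
    exact (ordConnected_Ioo.inter hA).isPreconnected
  have hcst : ∀ t ∈ Metric.ball t₀ r ∩ A, ∀ t' ∈ Metric.ball t₀ r ∩ A,
      (φ (S e (g t))).2 = (φ (S e (g t'))).2 := fun t ht t' ht' =>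
    chart_snd_eq_of_isPreconnected hφ hpc (c := fun t => S e (g t))
      ((H.continuous e).comp_continuousOn (hg.mono inter_subset_right)) (fun t ht => hl t ht.2)
      (fun t ht => by
        obtain ⟨z, hz, hzt⟩ := hlift t ht
        rw [← hzt]; exact (hO' z hz).1) ht ht'
  filter_upwards [self_mem_nhdsWithin, mem_nhdsWithin_of_mem_nhds (Metric.ball_mem_nhds t₀ hr)]
    with t ht htb
  obtain ⟨z, hz, hzt⟩ := hlift t ⟨htb, ht⟩
  obtain ⟨z₀, hz₀, hz₀t⟩ := hlift t₀ ⟨Metric.mem_ball_self hr, ht₀⟩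
  have := hcst t₀ ⟨Metric.mem_ball_self hr, ht₀⟩ t ⟨htb, ht⟩
  rw [← hzt, ← hz₀t] at this ⊢
  show (z₀.2 : UnitAddCircle) = z.2
  rw [(((hO' z₀ hz₀).2 z hz).1).1 this]

/-- A half leaf asymptotic to a compact leaf is eventually a line of a half collar. -/
theorem exists_line {c : ℝ → Torus} (hc : Continuous c) (hinj : Function.Injective c) {p : Torus}
    (hr : range c = F.leaf p) (hp : ¬ IsCompact (F.leaf p)) {K : Set Torus}
    (hK : F.IsCompactLeaf K) (hlim : Tendsto c atTop (𝓝ˢ K)) :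
    ∃ e u, S e (u, 0) ∈ F.leaf p ∧ ∃ m : ℝ → ℝ, (∀ d, c (m d) = S e (u, d)) ∧ Continuous m ∧
      StrictMono m ∧ Tendsto m atTop atTop := by
  obtain ⟨i, rfl⟩ := (H.compactLeaf K).1 hK
  have hnc : ∀ t, c t ∉ range (γ i) := by
    rintro t ⟨θ, hθ⟩
    have h1 : γ i θ ∈ F.leaf p := hθ ▸ hr ▸ mem_range_self t
    exact hp (by rw [← leaf_eq_of_mem h1, ← H.range_eq_leaf]; exact hK.2)
  have hev : ∀ D, ∀ᶠ t in atTop, ∃ b u d, D < d ∧ S (i, b) (u, d) = c t := fun D => by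
    have : {y | y ∈ range (γ i) ∨ ∃ b u d, D < d ∧ S (i, b) (u, d) = y} ∈ 𝓝ˢ (range (γ i)) := by
      rw [mem_nhdsSet_iff_forall]
      rintro _ ⟨θ, rfl⟩
      exact (H.collar i).nhds D θ
    filter_upwards [hlim this] with t ht
    exact ht.resolve_left (hnc t)
  obtain ⟨T, hT⟩ := eventually_atTop.1 (hev 0)
  have hcov : c '' Ici T ⊆ range (S (i, true)) ∪ range (S (i, false)) := by
    rintro _ ⟨t, ht, rfl⟩
    obtain ⟨b, u, d, -, h⟩ := hT t ht
    cases b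
    · exact Or.inr ⟨_, h⟩
    · exact Or.inl ⟨_, h⟩
  have hpre : IsPreconnected (c '' Ici T) := isPreconnected_Ici.image _ hc.continuousOn
  have hdis : Disjoint (range (S (i, true))) (range (S (i, false))) := by
    rw [disjoint_left]
    rintro _ ⟨x, rfl⟩ ⟨y, hy⟩
    exact (H.collar i).disj _ _ hy.symm
  -- The tail of the half leaf is connected and the two half collars are disjoint and open, so it
  -- stays on one side.
  have hone : ∃ b, c '' Ici T ⊆ range (S (i, b)) := by
    rcases isPreconnected_iff_subset_of_disjoint.1 hpre _ _
      ((H.collar i).openEmb true).isOpen_range ((H.collar i).openEmb false).isOpen_range hcov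
      (by rw [hdis.inter_eq, inter_empty]) with h | h
    · exact ⟨_, h⟩
    · exact ⟨_, h⟩
  obtain ⟨b, hb⟩ := hone
  have hlift : ∀ t, ∃ x, t ∈ Ici T → S (i, b) x = c t := fun t => by
    by_cases ht : t ∈ Ici T
    · obtain ⟨x, hx⟩ := hb ⟨t, ht, rfl⟩
      exact ⟨x, fun _ => hx⟩
    · exact ⟨default, fun h => absurd h ht⟩
  choose g hg using hlift
  have hgc : ContinuousOn g (Ici T) :=
    ((H.collar i).openEmb b).isInducing.continuousOn_iff.2 (hc.continuousOn.congr hg)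
  have hgl : ∀ t ∈ Ici T, S (i, b) (g t) ∈ F.leaf p := fun t ht => by
    rw [hg t ht, ← hr]; exact mem_range_self t
  have hg1 : ∀ t ∈ Ici T, g t = ((g T).1, (g t).2) := fun t ht =>
    Prod.ext (H.line_const ordConnected_Ici hgc hgl ht self_mem_Ici) rfl
  have hu : S (i, b) ((g T).1, 0) ∈ F.leaf p :=
    mem_leaf_trans (hgl T self_mem_Ici) (H.line_mem_leaf (i, b) _ (g T).2 0)
  obtain ⟨m, hm, hmc, hor⟩ := H.line_param hc hinj hr hu
  refine ⟨(i, b), (g T).1, hu, m, hm, hmc, hor.resolve_right fun ⟨hanti, _⟩ => ?_⟩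
  -- If `m` decreased, positive depths would occur only at times before `m 0`; but at arbitrarily
  -- late times the half leaf has positive depth.
  obtain ⟨t, ⟨b', u', d', hd', h'⟩, ht⟩ :=
    ((hev 0).and (eventually_ge_atTop (max T (m 0)))).exists
  have htT : t ∈ Ici T := (le_max_left _ _).trans ht
  have h1 : S (i, b) ((g T).1, (g t).2) = c t := by rw [← hg1 t htT, hg t htT]
  have h2 := H.eq_of_eq (h'.trans h1.symm)
  have h3 : d' = (g t).2 := (Prod.ext_iff.1 h2.2).2
  have h4 : m (g t).2 = t := hinj (by rw [hm, h1])
  have := hanti (h3 ▸ hd')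
  linarith [le_max_right T (m 0)]

end CollarSystem

/-! ### Normal forms of non-compact leaves. -/

/-- A parametrization of a non-compact leaf that is, near its ends, given by lines of half
collars. -/
structure NormalForm (F : OneFoliation Torus) {n : ℕ} (S : Fin n × Bool → UnitAddCircle × ℝ → Torus)
    (e e' : Fin n × Bool) (u w : UnitAddCircle) (N : ℝ) (c : ℝ → Torus) : Prop where
  cont : Continuous c
  inj : Function.Injective c
  range_eq : range c = F.leaf (S e (u, 0))
  neg : ∀ t ≤ -N, c t = S e (u, -t)
  pos : ∀ t ≥ N, c t = S e' (w, t)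

/-- A leaf has only two ends. Any collar line in it runs out to one of them, where it meets the
collar line already known to be there, and collars are injective. -/
theorem NormalForm.line_eq {e e' e'' : Fin n × Bool} {u w x : UnitAddCircle} {N : ℝ} {c : ℝ → Torus}
    (h : NormalForm F S e e' u w N c) (H : CollarSystem F γ S)
    (hx : S e'' (x, 0) ∈ F.leaf (S e (u, 0))) :
    e'' = e ∧ x = u ∨ e'' = e' ∧ x = w := by
  obtain ⟨m, hm, -, ⟨-, hm1⟩ | ⟨-, hm1⟩⟩ := H.line_param h.cont h.inj h.range_eq hx
  · obtain ⟨d, hd⟩ := (hm1.eventually_ge_atTop N).exists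
    have := hm d
    rw [h.pos _ hd] at this
    obtain ⟨h1, h2⟩ := H.eq_of_eq this.symm
    exact Or.inr ⟨h1, (Prod.ext_iff.1 h2).1⟩
  · obtain ⟨d, hd⟩ := (hm1.eventually_le_atBot (-N)).exists
    have := hm d
    rw [h.neg _ hd] at this
    obtain ⟨h1, h2⟩ := H.eq_of_eq this.symm
    exact Or.inl ⟨h1, (Prod.ext_iff.1 h2).1⟩

theorem NormalForm.ne {e e' : Fin n × Bool} {u w : UnitAddCircle} {N : ℝ} {c : ℝ → Torus}
    (h : NormalForm F S e e' u w N c) : ¬ (e' = e ∧ w = u) := by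
  rintro ⟨rfl, rfl⟩
  have h1 : c (-max N 1) = c (max N 1) := by
    rw [h.neg _ (neg_le_neg (le_max_left _ _)), h.pos _ (le_max_left _ _), neg_neg]
  linarith [h.inj h1, le_max_right N 1]

theorem exists_eq_of_tendsto_atTop {m : ℝ → ℝ} (hm : Continuous m) (ht : Tendsto m atTop atTop)
    {a y : ℝ} (h : m a ≤ y) : ∃ d, m d = y := by
  obtain ⟨b, hb, hab⟩ := ((ht.eventually_ge_atTop y).and (eventually_ge_atTop a)).exists
  obtain ⟨d, -, hd⟩ := intermediate_value_Icc hab hm.continuousOn ⟨h, hb⟩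
  exact ⟨d, hd⟩

/-- Clamping makes each of the three summands constant outside its own range: `m₂` on the left, an
affine bridge on `[-1, 1]`, and `m₁` on the right. -/
theorem exists_interpolation {m₁ m₂ : ℝ → ℝ} (c1 : Continuous m₁) (c2 : Continuous m₂)
    (s1 : StrictMono m₁) (s2 : StrictAnti m₂) (t1 : Tendsto m₁ atTop atTop)
    (t2 : Tendsto m₂ atTop atBot) (hlt : m₂ 1 < m₁ 1) :
    ∃ r : ℝ → ℝ, Continuous r ∧ StrictMono r ∧ Function.Surjective r ∧ (∀ t ≤ -1, r t = m₂ (-t)) ∧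
      ∀ t ≥ 1, r t = m₁ t := by
  let r : ℝ → ℝ := fun t => m₂ (max (-t) 1) + (m₁ (max t 1) - m₁ 1) +
    (m₁ 1 - m₂ 1) * ((max (-1) (min 1 t) + 1) / 2)
  have hneg : ∀ t ≤ -1, r t = m₂ (-t) := fun t ht => by
    simp only [r]
    rw [max_eq_left (show 1 ≤ -t by linarith), max_eq_right (show t ≤ 1 by linarith),
      min_eq_right (show t ≤ 1 by linarith), max_eq_left ht]
    ring
  have hpos : ∀ t ≥ 1, r t = m₁ t := fun t ht => by
    simp only [r]
    rw [max_eq_right (show -t ≤ 1 by linarith), max_eq_left (show 1 ≤ t from ht),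
      min_eq_left (show 1 ≤ t from ht), max_eq_right (show (-1 : ℝ) ≤ 1 by norm_num)]
    ring
  have hc : Continuous r := by fun_prop
  refine ⟨r, hc, fun x y hxy => ?_, hc.surjective ?_ ?_, hneg, hpos⟩
  · have a1 : m₂ (max (-x) 1) ≤ m₂ (max (-y) 1) :=
      s2.antitone (max_le_max (by linarith) le_rfl)
    have a2 : m₁ (max x 1) ≤ m₁ (max y 1) := s1.monotone (max_le_max hxy.le le_rfl)
    have a3 : (m₁ 1 - m₂ 1) * ((max (-1) (min 1 x) + 1) / 2) ≤
        (m₁ 1 - m₂ 1) * ((max (-1) (min 1 y) + 1) / 2) :=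
      mul_le_mul_of_nonneg_left (by
        have : max (-1) (min 1 x) ≤ max (-1) (min 1 y) :=
          max_le_max le_rfl (min_le_min le_rfl hxy.le)
        linarith) (by linarith)
    simp only [r]
    rcases lt_or_ge x (-1) with h1 | h1
    · have : m₂ (max (-x) 1) < m₂ (max (-y) 1) := s2 (by
        rw [max_eq_left (show 1 ≤ -x by linarith)]
        exact max_lt (by linarith) (by linarith))
      linarith
    rcases lt_or_ge 1 y with h2 | h2
    · have : m₁ (max x 1) < m₁ (max y 1) := s1 (by
        rw [max_eq_left h2.le]
        exact max_lt hxy h2)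
      linarith
    · have : (m₁ 1 - m₂ 1) * ((max (-1) (min 1 x) + 1) / 2) <
        (m₁ 1 - m₂ 1) * ((max (-1) (min 1 y) + 1) / 2) := by
        refine mul_lt_mul_of_pos_left ?_ (by linarith)
        rw [min_eq_right (by linarith), min_eq_right h2, max_eq_right h1,
          max_eq_right (by linarith)]
        linarith
      linarith
  · exact t1.congr' ((eventually_ge_atTop 1).mono fun t ht => (hpos t ht).symm)
  · exact (t2.comp tendsto_neg_atBot_atTop).congr'
      ((eventually_le_atBot (-1)).mono fun t ht => (hneg t ht).symm)

/-- Both half leaves end as collar lines, and the given line `(e, u)` runs out to one of the two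
ends. After reversing the leaf if necessary this is the end at `-∞`; the line at the other end
supplies `(e', w)`. -/
theorem CollarSystem.exists_normalForm (H : CollarSystem F γ S) (hF : F.IsMS) (e : Fin n × Bool)
    (u : UnitAddCircle) : ∃ e' w c, NormalForm F S e e' u w 1 c := by
  have key : ∀ {c : ℝ → Torus} {e' : Fin n × Bool} {w : UnitAddCircle} {m₁ m₂ : ℝ → ℝ},
      Continuous c → Function.Injective c → range c = F.leaf (S e (u, 0)) →
      (∀ d, c (m₁ d) = S e' (w, d)) → Continuous m₁ → StrictMono m₁ → Tendsto m₁ atTop atTop →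
      (∀ d, c (m₂ d) = S e (u, d)) → Continuous m₂ → StrictAnti m₂ → Tendsto m₂ atTop atBot →
      ∃ c', NormalForm F S e e' u w 1 c' := by
    intro c e' w m₁ m₂ hc hi hr h1 c1 s1 t1 h2 c2 s2 t2
    -- Otherwise the two lines overlap and so coincide as collar lines, but one parameter increases
    -- along the leaf and the other decreases.
    have hlt : m₂ 1 < m₁ 1 := by
      by_contra! hcon
      obtain ⟨d, hd⟩ := exists_eq_of_tendsto_atTop c1 t1 hcon
      have h3 : S e' (w, d) = S e (u, 1) := by rw [← h1, ← h2, hd]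
      obtain ⟨rfl, h4⟩ := H.eq_of_eq h3
      have hw : w = u := (Prod.ext_iff.1 h4).1
      have heq : ∀ d, m₁ d = m₂ d := fun d => hi (by rw [h1, h2, hw])
      have a := s1 (zero_lt_one (α := ℝ))
      have b := s2 (zero_lt_one (α := ℝ))
      rw [heq, heq] at a
      linarith
    obtain ⟨r, rc, rs, rsur, rn, rp⟩ := exists_interpolation c1 c2 s1 s2 t1 t2 hlt
    exact ⟨c ∘ r, hc.comp rc, hi.comp rs.injective, by rw [rsur.range_comp, hr],
      fun t ht => by rw [Function.comp, rn t ht, h2], fun t ht => by rw [Function.comp, rp t ht, h1]⟩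
  have same : ∀ {c : ℝ → Torus} {e₁ e₂ : Fin n × Bool} {u₁ u₂ : UnitAddCircle} {m₁ m₂ : ℝ → ℝ},
      (∀ d, c (m₁ d) = S e₁ (u₁, d)) → Continuous m₁ → Tendsto m₁ atTop atTop →
      (∀ d, c (m₂ d) = S e₂ (u₂, d)) → Tendsto m₂ atTop atTop → e₁ = e₂ ∧ u₁ = u₂ := by
    intro c e₁ e₂ u₁ u₂ m₁ m₂ h1 c1 t1 h2 t2
    obtain ⟨d, hd⟩ := (t2.eventually_ge_atTop (m₁ 0)).exists
    obtain ⟨d', hd'⟩ := exists_eq_of_tendsto_atTop c1 t1 hd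
    have h3 : S e₁ (u₁, d') = S e₂ (u₂, d) := by rw [← h1, ← h2, hd']
    obtain ⟨h4, h5⟩ := H.eq_of_eq h3
    exact ⟨h4, (Prod.ext_iff.1 h5).1⟩
  have hnc := H.not_isCompact_leaf e (u, 0)
  obtain ⟨c, hc, hi, hr, ⟨K, hK, hlim⟩, ⟨K', hK', hlim'⟩⟩ := hF.asymptotic _ ⟨_, rfl⟩ hnc
  have hc' : Continuous (fun t => c (-t)) := hc.comp continuous_neg
  have hi' : Function.Injective (fun t => c (-t)) := hi.comp neg_injective
  have hr' : range (fun t => c (-t)) = F.leaf (S e (u, 0)) := by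
    rw [← hr]; exact neg_surjective.range_comp c
  obtain ⟨e₁, u₁, -, m₁, h1, c1, s1, t1⟩ := H.exists_line hc hi hr hnc hK hlim
  obtain ⟨e₂, u₂, -, m₂, h2, c2, s2, t2⟩ := H.exists_line hc' hi' hr' hnc hK'
    (hlim'.comp tendsto_neg_atTop_atBot)
  obtain ⟨m, hm, mc, ⟨ms, mt⟩ | ⟨ms, mt⟩⟩ := H.line_param hc hi hr (mem_leaf_self F (S e (u, 0)))
  · obtain ⟨c', hcn⟩ := key hc' hi' hr' h2 c2 s2 t2 (m₂ := fun d => - m d) (fun d => by simp [hm])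
      mc.neg (fun x y hxy => neg_lt_neg (ms hxy)) (tendsto_neg_atTop_atBot.comp mt)
    exact ⟨_, _, _, hcn⟩
  · obtain ⟨c', hcn⟩ := key hc hi hr h1 c1 s1 t1 hm mc ms mt
    exact ⟨_, _, _, hcn⟩

-- Continuous dependence of the normal form on the leaf.

end OneFoliation

theorem continuousOn_of_closed_cover {X Y : Type*} [TopologicalSpace X] [TopologicalSpace Y]
    {f : X → Y} {A B C : Set X} (hB : IsClosed B) (hC : IsClosed C) (hA : ∀ x ∈ A, x ∈ B ∨ x ∈ C)
    (h1 : ContinuousOn f (A ∩ B)) (h2 : ContinuousOn f (A ∩ C)) : ContinuousOn f A := by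
  have key : ∀ D : Set X, IsClosed D → ContinuousOn f (A ∩ D) → ∀ z,
      z ∈ A → ContinuousWithinAt f (A ∩ D) z := fun D hD hc z hz => by
    by_cases h : z ∈ D
    · exact hc z ⟨hz, h⟩
    · have : 𝓝[A ∩ D] z = ⊥ := notMem_closure_iff_nhdsWithin_eq_bot.1
        fun h' => h (hD.closure_subset (closure_mono inter_subset_right h'))
      rw [ContinuousWithinAt, this]; exact tendsto_bot
  intro z hz
  refine ((key B hB h1 z hz).union (key C hC h2 z hz)).mono fun x hx => ?_
  exact (hA x hx).imp (fun h => ⟨hx, h⟩) fun h => ⟨hx, h⟩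

/-- Two equal values would produce an interior local extremum, near which no continuous function is
injective. -/
theorem ContinuousOn.injOn_Icc_of_locally {f : ℝ → ℝ} {a b : ℝ} (hc : ContinuousOn f (Icc a b))
    (h : ∀ t ∈ Ioo a b, ∃ N ∈ 𝓝 t, InjOn f N) : InjOn f (Icc a b) := by
  have key : ∀ x ∈ Icc a b, ∀ y ∈ Icc a b, x < y → f x ≠ f y := by
    intro x hx y hy hxy he
    have hsub : Icc x y ⊆ Icc a b := Icc_subset_Icc hx.1 hy.2
    obtain ⟨c, hcm, hex⟩ := exists_isLocalExtr_Ioo hxy (hc.mono hsub) he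
    obtain ⟨N, hN, hNi⟩ := h c ⟨hx.1.trans_lt hcm.1, hcm.2.trans_le hy.2⟩
    have hco : ∀ r, Icc (c - r) (c + r) ⊆ Icc x y → ContinuousOn f (Icc (c - r) (c + r)) :=
      fun r hr => hc.mono (hr.trans hsub)
    obtain ⟨N', hN', hex'⟩ : ∃ N' ∈ 𝓝 c, (∀ z ∈ N', f c ≤ f z) ∨ (∀ z ∈ N', f z ≤ f c) := by
      rcases hex with h | h
      · exact ⟨_, h, Or.inl fun z hz => hz⟩
      · exact ⟨_, h, Or.inr fun z hz => hz⟩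
    obtain ⟨r, hr, hrs⟩ := Metric.nhds_basis_closedBall.mem_iff.1
      (inter_mem (inter_mem hN hN') (Icc_mem_nhds hcm.1 hcm.2))
    rw [Real.closedBall_eq_Icc] at hrs
    have m1 : c - r ∈ Icc (c - r) (c + r) := ⟨le_rfl, by linarith⟩
    have m2 : c ∈ Icc (c - r) (c + r) := ⟨by linarith, by linarith⟩
    have m3 : c + r ∈ Icc (c - r) (c + r) := ⟨by linarith, le_rfl⟩
    have hor := (hco r fun z hz => (hrs hz).2).strictMonoOn_of_injOn_Icc' (by linarith)
      (hNi.mono fun z hz => (hrs hz).1.1)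
    rcases hor with hm | hm
    · have a1 := hm m1 m2 (by linarith)
      have a2 := hm m2 m3 (by linarith)
      rcases hex' with h | h
      · linarith [h _ (hrs m1).1.2]
      · linarith [h _ (hrs m3).1.2]
    · have a1 := hm m1 m2 (by linarith)
      have a2 := hm m2 m3 (by linarith)
      rcases hex' with h | h
      · linarith [h _ (hrs m3).1.2]
      · linarith [h _ (hrs m1).1.2]
  intro x hx y hy hxy
  rcases lt_trichotomy x y with h | h | h
  · exact absurd hxy (key x hx y hy h)
  · exact h
  · exact absurd hxy.symm (key y hy x hx h)

/-- An increasing bijection of `[3, ∞)` onto `[d, ∞)` (for `2 < d < 4`), the identity beyond `4`. -/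
noncomputable def stretch (d t : ℝ) : ℝ := t + (d - 3) * max (4 - t) 0

theorem stretch_three (d : ℝ) : stretch d 3 = d := by
  rw [stretch, max_eq_left (by norm_num)]; ring

theorem stretch_of_le {d t : ℝ} (h : 4 ≤ t) : stretch d t = t := by
  rw [stretch, max_eq_right (by linarith)]; ring

theorem stretch_strictMono {d : ℝ} (hd : d < 4) : StrictMono (stretch d) := fun x y h => by
  unfold stretch
  rcases le_total 4 x with hx | hx
  · rw [max_eq_right (by linarith), max_eq_right (by linarith)]; linarith
  rcases le_total 4 y with hy | hy
  · rw [max_eq_left (by linarith), max_eq_right (by linarith)]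
    rcases eq_or_lt_of_le hx with rfl | hx
    · linarith
    · nlinarith
  · rw [max_eq_left (by linarith), max_eq_left (by linarith)]; nlinarith

/-- Three increasing pieces. -/
theorem exists_strictMono_pieces {m : ℝ → ℝ} {d : ℝ} (hd : d ∈ Ioo (2 : ℝ) 4)
    (hm : ContinuousOn m (Icc (-3) 3)) (hs : StrictMonoOn m (Icc (-3) 3)) (h1 : m (-3) = -3)
    (h2 : m 3 = d) : ∃ M : ℝ → ℝ, StrictMono M ∧ Function.Surjective M ∧
      (∀ t ≤ -3, M t = t) ∧ (∀ t ∈ Icc (-3) 3, M t = m t) ∧ ∀ t ≥ 3, M t = stretch d t := by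
  let M : ℝ → ℝ := fun t => if t ≤ -3 then t else if t ≤ 3 then m t else stretch d t
  have e1 : ∀ t ≤ -3, M t = t := fun t ht => if_pos ht
  have e2 : ∀ t ∈ Icc (-3 : ℝ) 3, M t = m t := fun t ht => by
    rcases ht.1.eq_or_lt with rfl | h
    · rw [e1 _ le_rfl, h1]
    · simp only [M]; rw [if_neg (not_le.2 h), if_pos ht.2]
  have e3 : ∀ t ≥ 3, M t = stretch d t := fun t ht => by
    rcases eq_or_lt_of_le ht with rfl | h
    · rw [e2 _ ⟨by norm_num, le_rfl⟩, h2, stretch_three]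
    · simp only [M]; rw [if_neg (by linarith), if_neg (not_le.2 h)]
  have s1 : StrictMonoOn M (Iic (-3)) := fun x hx y hy h => by rwa [e1 x hx, e1 y hy]
  have s2 : StrictMonoOn M (Icc (-3) 3) := fun x hx y hy h => by
    rw [e2 x hx, e2 y hy]; exact hs hx hy h
  have s3 : StrictMonoOn M (Ici 3) := fun x hx y hy h => by
    rw [e3 x hx, e3 y hy]; exact stretch_strictMono hd.2 h
  have s12 : StrictMonoOn M (Iic 3) := by
    have := s1.union s2 isGreatest_Iic (isLeast_Icc (by norm_num))
    rwa [Iic_union_Icc_eq_Iic (by norm_num)] at this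
  have s : StrictMono M := by
    have := s12.union s3 isGreatest_Iic isLeast_Ici
    rwa [Iic_union_Ici, strictMonoOn_univ] at this
  refine ⟨M, s, fun y => ?_, e1, e2, e3⟩
  rcases le_total y (-3) with h | h
  · exact ⟨y, e1 y h⟩
  rcases le_total y d with h' | h'
  · obtain ⟨t, ht, hty⟩ := intermediate_value_Icc (by norm_num) hm
      (show y ∈ Icc (m (-3)) (m 3) from ⟨by rwa [h1], by rwa [h2]⟩)
    exact ⟨t, by rw [e2 t ht, hty]⟩
  rcases le_total 4 y with h4 | h4
  · exact ⟨y, by rw [e3 y (by linarith), stretch_of_le h4]⟩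
  · have hc : Continuous (stretch d) := by unfold stretch; fun_prop
    obtain ⟨t, ht, hty⟩ := intermediate_value_Icc (show (3 : ℝ) ≤ 4 by norm_num) hc.continuousOn
      (show y ∈ Icc (stretch d 3) (stretch d 4) from
        ⟨by rwa [stretch_three], by rwa [stretch_of_le le_rfl]⟩)
    exact ⟨t, by rw [e3 t ht.1, hty]⟩

namespace OneFoliation

variable {F : OneFoliation Torus} {n : ℕ} {γ : Fin n → C(UnitAddCircle, Torus)}
  {S : Fin n × Bool → UnitAddCircle × ℝ → Torus}

/-- Transport carries the compact middle `[-3, 3]` of one leaf to its neighbours, starting at depth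
`3` in the collar of `e`. The transported arcs end inside the open collar of `e'`, so the
neighbouring leaves leave through the same side `e'`, along labels `κ s` that vary continuously. -/
theorem CollarSystem.exists_local_family (H : CollarSystem F γ S) (hF : F.IsMS) (e : Fin n × Bool)
    (u₀ : ℝ) : ∃ e' δ, 0 < δ ∧ ∃ (κ : ℝ → ℝ) (Θ : ℝ × ℝ → Torus) (N : ℝ),
      ContinuousOn κ (Ioo (u₀ - δ) (u₀ + δ)) ∧ ContinuousOn Θ (Ioo (u₀ - δ) (u₀ + δ) ×ˢ univ) ∧
      ∀ s ∈ Ioo (u₀ - δ) (u₀ + δ),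
        NormalForm F S e e' (s : UnitAddCircle) (κ s : UnitAddCircle) N (fun t => Θ (s, t)) := by
  obtain ⟨e', w, c, hc⟩ := H.exists_normalForm hF e (u₀ : UnitAddCircle)
  obtain ⟨w₀, rfl⟩ := QuotientAddGroup.mk_surjective w
  change NormalForm F S e e' (u₀ : UnitAddCircle) (w₀ : UnitAddCircle) 1 c at hc
  obtain ⟨φ₀, hφ₀, O, hO, hO'⟩ := (H.collar e.1).locFol e.2 (3, u₀)
  rw [nhdsWithin_univ] at hO
  have hSc := H.continuous e
  have hSc' := H.continuous e'
  have hcoe : Continuous (fun s : ℝ => (s : UnitAddCircle)) := AddCircle.continuous_mk' 1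
  have hJ₀ : {s : ℝ | ((3, s) : ℝ × ℝ) ∈ O} ∈ 𝓝 u₀ :=
    (Continuous.prodMk_right (3 : ℝ)).continuousAt (x := u₀) hO
  obtain ⟨Ψ, δ₁, hδ₁, hsub, P1, P2, P3, P4, P5⟩ := exists_transport (F := F) (c := c) (a := -3)
    (b := 3) (s₀ := u₀) (by norm_num) hc.cont (fun t _ => ⟨univ, univ_mem, hc.inj.injOn⟩)
    (fun t _ => by
      have h1 : ∀ t, c t ∈ F.leaf (S e (u₀, 0)) := fun t => hc.range_eq ▸ mem_range_self t
      exact mem_leaf_trans (mem_leaf_symm (h1 _)) (h1 _))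
    (v := fun s => S e ((s : UnitAddCircle), 3)) hJ₀
    (hSc.comp (hcoe.prodMk continuous_const)).continuousOn
    (by rw [hc.neg _ (by norm_num)]; norm_num) hφ₀ (fun s hs => (hO' _ hs).1)
    (fun s hs s' hs' h => (((hO' _ hs).2 _ hs').1).1 h)
  have hΨ3 : ContinuousOn (fun s => Ψ (3, s)) (Ioo (u₀ - δ₁) (u₀ + δ₁)) :=
    P1.comp (by fun_prop) fun s hs => ⟨⟨by norm_num, le_rfl⟩, hs⟩
  have h3 : Ψ (3, u₀) = S e' ((w₀ : UnitAddCircle), 3) := by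
    rw [P3 3 (by norm_num), hc.pos _ (by norm_num)]
  have hemb := (H.collar e'.1).openEmb e'.2
  change IsOpenEmbedding (S e') at hemb
  let E := hemb.toOpenPartialHomeomorph
  have hE : ⇑E = S e' := rfl
  have hEt : E.target = range (S e') := hemb.toOpenPartialHomeomorph_target
  have hEs : ∀ x, E.symm (S e' x) = x := fun x => E.left_inv (by simp [E])
  -- A local inverse of the covering of the circle by the line gives the label `κ` as a real number.
  obtain ⟨q, hq₀, hq⟩ := (AddCircle.isCoveringMap_coe (1 : ℝ)).isLocalHomeomorph w₀
  have hu₀ : u₀ ∈ Ioo (u₀ - δ₁) (u₀ + δ₁) := ⟨by linarith, by linarith⟩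
  have hJ1 : Ioo (u₀ - δ₁) (u₀ + δ₁) ∈ 𝓝 u₀ := Ioo_symm_mem_nhds hδ₁
  set g : ℝ → UnitAddCircle × ℝ := fun s => E.symm (Ψ (3, s)) with hg
  have hg₀ : g u₀ = ((w₀ : UnitAddCircle), 3) := by simp only [hg]; rw [h3, hEs]
  have hgc : ContinuousAt g u₀ := ContinuousAt.comp (f := fun s => Ψ (3, s))
    (E.continuousAt_symm (by rw [h3, hEt]; exact mem_range_self _)) (hΨ3.continuousAt hJ1)
  have hqw : q w₀ = (w₀ : UnitAddCircle) := by rw [← hq]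
  -- The last condition keeps the final line distinct from the initial one, so that
  -- `NormalForm.line_eq` recognizes it as the other end. The depth stays in `(2, 4)` so that
  -- `stretch` applies.
  have hev : ∀ᶠ s in 𝓝 u₀, s ∈ Ioo (u₀ - δ₁) (u₀ + δ₁) ∧ Ψ (3, s) ∈ range (S e') ∧
      (g s).1 ∈ q.target ∧ (g s).2 ∈ Ioo (2 : ℝ) 4 ∧ ¬ (e' = e ∧ (g s).1 = (s : UnitAddCircle)) := by
    refine Filter.Eventually.and hJ1 (Filter.Eventually.and ?_ (Filter.Eventually.and ?_
      (Filter.Eventually.and ?_ ?_)))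
    · exact (hΨ3.continuousAt hJ1) (hemb.isOpen_range.mem_nhds (by show Ψ (3, u₀) ∈ _; rw [h3]; exact mem_range_self _))
    · refine (continuous_fst.continuousAt.comp hgc) (q.open_target.mem_nhds ?_)
      simp only [Function.comp, hg₀]
      rw [← hqw]; exact q.map_source hq₀
    · exact (continuous_snd.continuousAt.comp hgc) (Ioo_mem_nhds (by simp only [Function.comp, hg₀]; norm_num)
        (by simp only [Function.comp, hg₀]; norm_num))
    · by_cases hee : e' = e
      · have hne : (g u₀).1 ≠ (u₀ : UnitAddCircle) := fun h => hc.ne ⟨hee, by rw [hg₀] at h; exact h⟩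
        have hne' := (ContinuousAt.ne_iff_eventually_ne (continuous_fst.continuousAt.comp hgc)
          (hcoe.continuousAt (x := u₀))).1 hne
        exact hne'.mono fun s hs h => hs h.2
      · exact Eventually.of_forall fun s h => hee h.1
  obtain ⟨δ, hδ, hδs⟩ := exists_Ioo_subset_of_mem_nhds hev
  set J := Ioo (u₀ - δ) (u₀ + δ) with hJ
  have hJs : J ⊆ Ioo (u₀ - δ₁) (u₀ + δ₁) := fun s hs => (hδs hs).1
  have hgJ : ContinuousOn g J := E.continuousOn_symm.comp (hΨ3.mono hJs) fun s hs => by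
    rw [hEt]; exact (hδs hs).2.1
  let κ : ℝ → ℝ := fun s => q.symm (g s).1
  have hκc : ContinuousOn κ J := q.continuousOn_symm.comp (continuous_fst.comp_continuousOn hgJ)
    fun s hs => (hδs hs).2.2.1
  have hκ : ∀ s ∈ J, (κ s : UnitAddCircle) = (g s).1 := fun s hs => by
    have := q.right_inv (hδs hs).2.2.1
    rw [← hq] at this
    exact this
  have hSg : ∀ s ∈ J, S e' ((κ s : UnitAddCircle), (g s).2) = Ψ (3, s) := fun s hs => by
    rw [hκ s hs, ← hE]
    exact E.right_inv (by rw [hEt]; exact (hδs hs).2.1)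
  -- The pieces are the collar line of `e`, the transported arc, and the collar line of `e'`. The
  -- last is entered at depth `(g z.1).2` instead of `3`, and `stretch` corrects this before depth
  -- `4`.
  let Θ : ℝ × ℝ → Torus := fun z => if z.2 ≤ -3 then S e ((z.1 : UnitAddCircle), -z.2) else
    if z.2 ≤ 3 then Ψ (z.2, z.1) else S e' ((κ z.1 : UnitAddCircle), stretch (g z.1).2 z.2)
  have T1 : ∀ s ∈ J, ∀ t ≤ -3, Θ (s, t) = S e ((s : UnitAddCircle), -t) := fun s _ t ht => if_pos ht
  have T2 : ∀ s ∈ J, ∀ t ∈ Icc (-3 : ℝ) 3, Θ (s, t) = Ψ (t, s) := fun s hs t ht => by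
    rcases ht.1.eq_or_lt with rfl | h
    · rw [T1 s hs _ le_rfl, P2 s (hJs hs), neg_neg]
    · simp only [Θ]; rw [if_neg (not_le.2 h), if_pos ht.2]
  have T3 : ∀ s ∈ J, ∀ t ≥ 3, Θ (s, t) = S e' ((κ s : UnitAddCircle), stretch (g s).2 t) :=
    fun s hs t ht => by
      rcases eq_or_lt_of_le ht with rfl | h
      · rw [T2 s hs _ ⟨by norm_num, le_rfl⟩, stretch_three, hSg s hs]
      · simp only [Θ]; rw [if_neg (by linarith), if_neg (not_le.2 h)]
  refine ⟨e', δ, hδ, κ, Θ, 4, hκc, ?_, fun s hs => ?_⟩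
  · refine continuousOn_of_closed_cover (B := {z | z.2 ≤ -3}) (C := {z | -3 ≤ z.2})
      (isClosed_le continuous_snd continuous_const) (isClosed_le continuous_const continuous_snd)
      (fun z _ => le_total z.2 _) ?_ ?_
    · refine ContinuousOn.congr (f := fun z : ℝ × ℝ => S e ((z.1 : UnitAddCircle), -z.2))
        (hSc.comp ((hcoe.comp continuous_fst).prodMk continuous_snd.neg)).continuousOn
        fun z hz => T1 z.1 hz.1.1 z.2 hz.2
    refine continuousOn_of_closed_cover (B := {z | z.2 ≤ 3}) (C := {z | 3 ≤ z.2})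
      (isClosed_le continuous_snd continuous_const) (isClosed_le continuous_const continuous_snd)
      (fun z _ => le_total z.2 _) ?_ ?_
    · refine ContinuousOn.congr (f := fun z : ℝ × ℝ => Ψ (z.2, z.1)) (P1.comp (by fun_prop)
        fun z hz => ⟨⟨hz.1.2, hz.2⟩, hJs hz.1.1.1⟩) fun z hz => T2 z.1 hz.1.1.1 z.2 ⟨hz.1.2, hz.2⟩
    · have hm : MapsTo Prod.fst (((J ×ˢ univ) ∩ {z : ℝ × ℝ | -3 ≤ z.2}) ∩ {z | 3 ≤ z.2}) J :=
        fun z hz => hz.1.1.1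
      refine ContinuousOn.congr (f := fun z : ℝ × ℝ => S e' ((κ z.1 : UnitAddCircle),
        stretch (g z.1).2 z.2)) (hSc'.comp_continuousOn (ContinuousOn.prodMk
          (hcoe.comp_continuousOn (hκc.comp continuousOn_fst hm)) ?_))
        fun z hz => T3 z.1 hz.1.1.1 z.2 hz.2
      have hg2 : ContinuousOn (fun z : ℝ × ℝ => (g z.1).2) (((J ×ˢ univ) ∩ {z : ℝ × ℝ | -3 ≤ z.2}) ∩
        {z | 3 ≤ z.2}) := continuous_snd.comp_continuousOn (hgJ.comp continuousOn_fst hm)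
      unfold stretch
      exact continuousOn_snd.add ((hg2.sub continuousOn_const).mul (by fun_prop))
  -- Injectivity and surjectivity onto the leaf come from comparison with a normal form `cs` of the
  -- same leaf: `Θ (s, ·)` is `cs` after an increasing bijection `M`.
  · obtain ⟨e₁, w₁, cs, hcs⟩ := H.exists_normalForm hF e (s : UnitAddCircle)
    have hmemΨ : ∀ t ∈ Icc (-3 : ℝ) 3, Ψ (t, s) ∈ F.leaf (S e ((s : UnitAddCircle), 0)) :=
      fun t ht => mem_leaf_trans (H.line_mem_leaf e _ 0 3) (P4 (t, s) ⟨ht, hJs hs⟩)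
    have hline : S e' ((κ s : UnitAddCircle), 0) ∈ F.leaf (S e ((s : UnitAddCircle), 0)) := by
      refine mem_leaf_trans ?_ (H.line_mem_leaf e' _ (g s).2 0)
      rw [hSg s hs]; exact hmemΨ 3 (by norm_num)
    obtain ⟨rfl, hw₁⟩ := (hcs.line_eq H hline).resolve_left
      fun h => (hδs hs).2.2.2.2 ⟨h.1, by rw [← hκ s hs]; exact h.2⟩
    subst hw₁
    have hex : ∀ t, ∃ r, t ∈ Icc (-3 : ℝ) 3 → cs r = Ψ (t, s) := fun t => by
      by_cases ht : t ∈ Icc (-3 : ℝ) 3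
      · have : Ψ (t, s) ∈ range cs := hcs.range_eq ▸ hmemΨ t ht
        obtain ⟨r, hr⟩ := this
        exact ⟨r, fun _ => hr⟩
      · exact ⟨0, fun h => absurd h ht⟩
    choose m hm using hex
    have hΨs : ContinuousOn (fun t => Ψ (t, s)) (Icc (-3) 3) :=
      P1.comp (by fun_prop) fun t ht => ⟨ht, hJs hs⟩
    have hmc : ContinuousOn m (Icc (-3) 3) :=
      continuousOn_leaf_param hcs.cont hcs.inj hcs.range_eq ordConnected_Icc hΨs hm
    have hmi : InjOn m (Icc (-3) 3) := hmc.injOn_Icc_of_locally fun t ht => by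
      obtain ⟨φ, hφ, V, hV, hV'⟩ := P5 (t, s) ⟨Ioo_subset_Icc_self ht, hJs hs⟩
      have hn : Icc (-3 : ℝ) 3 ×ˢ Ioo (u₀ - δ₁) (u₀ + δ₁) ∈ 𝓝 (t, s) :=
        prod_mem_nhds (Icc_mem_nhds ht.1 ht.2) (Ioo_mem_nhds (hJs hs).1 (hJs hs).2)
      rw [nhdsWithin_eq_nhds.2 hn] at hV
      refine ⟨_, inter_mem ((Continuous.prodMk_left s).continuousAt (x := t) hV)
        (Icc_mem_nhds ht.1 ht.2), fun x hx y hy hxy => ?_⟩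
      have : Ψ (x, s) = Ψ (y, s) := by rw [← hm x hx.2, ← hm y hy.2, hxy]
      exact congrArg Prod.fst (((hV' _ hx.1).2 _ hy.1).2 this)
    have m3 : m (-3) = -3 := hcs.inj (by
      rw [hm _ (by norm_num), P2 s (hJs hs), hcs.neg _ (by norm_num), neg_neg])
    have hd := (hδs hs).2.2.2.1
    have m3' : m 3 = (g s).2 := hcs.inj (by
      rw [hm _ (by norm_num), hcs.pos _ (by linarith [hd.1]), hSg s hs])
    have hms : StrictMonoOn m (Icc (-3) 3) :=
      (hmc.strictMonoOn_of_injOn_Icc' (by norm_num) hmi).resolve_right fun h => by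
        have := h (show (-3 : ℝ) ∈ Icc (-3 : ℝ) 3 by norm_num) (show (3 : ℝ) ∈ Icc (-3 : ℝ) 3 by norm_num)
          (by norm_num)
        linarith [hd.1]
    obtain ⟨M, M1, M2, M3, M4, M5⟩ := exists_strictMono_pieces hd hmc hms m3 m3'
    have hΘM : ∀ t, Θ (s, t) = cs (M t) := fun t => by
      rcases le_total t (-3) with h | h
      · rw [T1 s hs t h, M3 t h, hcs.neg t (by linarith)]
      rcases le_total t 3 with h' | h'
      · rw [T2 s hs t ⟨h, h'⟩, M4 t ⟨h, h'⟩, hm t ⟨h, h'⟩]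
      · have := (stretch_strictMono hd.2).monotone h'
        rw [stretch_three] at this
        rw [T3 s hs t h', M5 t h', hcs.pos _ (by linarith [hd.1])]
    have hMc : Continuous M := M1.monotone.continuous_of_surjective M2
    have hΘe : (fun t => Θ (s, t)) = cs ∘ M := funext hΘM
    refine ⟨hΘe ▸ hcs.cont.comp hMc, hΘe ▸ hcs.inj.comp M1.injective, ?_,
      fun t ht => T1 s hs t (by linarith), fun t ht => ?_⟩
    · rw [hΘe, M2.range_comp, hcs.range_eq]
    · rw [T3 s hs t (by linarith), stretch_of_le ht]

end OneFoliation

/-! ### The family of all leaves through one side. -/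

theorem exists_int_of_coe_eq {a b : ℝ} (h : (a : UnitAddCircle) = b) : ∃ k : ℤ, a = b + k := by
  have : ((a - b : ℝ) : UnitAddCircle) = 0 := by rw [AddCircle.coe_sub, h, sub_self]
  obtain ⟨k, hk⟩ := (AddCircle.coe_eq_zero_iff 1).1 this
  exact ⟨k, by simp at hk; linarith⟩

theorem coe_add_int (a : ℝ) (k : ℤ) : ((a + k : ℝ) : UnitAddCircle) = a := by
  rw [AddCircle.coe_add, OneFoliation.coe_intCast, add_zero]

/-- An increasing homeomorphism of the line that is the identity outside `[-M, M]`. -/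
structure TailId (g : ℝ → ℝ) (M : ℝ) : Prop where
  cont : Continuous g
  mono : StrictMono g
  neg : ∀ t ≤ -M, g t = t
  pos : ∀ t ≥ M, g t = t

theorem TailId.surjective {g : ℝ → ℝ} {M : ℝ} (h : TailId g M) : Function.Surjective g :=
  h.cont.surjective
    (tendsto_id.congr' ((eventually_ge_atTop M).mono fun t ht => (h.pos t ht).symm))
    (tendsto_id.congr' ((eventually_le_atBot (-M)).mono fun t ht => (h.neg t ht).symm))

theorem TailId.convexComb {g : ℝ → ℝ} {M : ℝ} (hg : TailId g M) {s : ℝ} (hs : s ∈ Icc (0 : ℝ) 1) :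
    TailId (fun t => (1 - s) * t + s * g t) M where
  cont := by have := hg.cont; fun_prop
  mono x y h := by
    have := hg.mono h
    rcases hs.2.eq_or_lt with rfl | h1
    · simpa using this
    · have a := mul_lt_mul_of_pos_left h (sub_pos.2 h1)
      have b := mul_le_mul_of_nonneg_left this.le hs.1
      simp only; linarith
  neg t ht := by rw [hg.neg t ht]; ring
  pos t ht := by rw [hg.pos t ht]; ring

namespace OneFoliation

variable {F : OneFoliation Torus} {n : ℕ} {γ : Fin n → C(UnitAddCircle, Torus)}
  {S : Fin n × Bool → UnitAddCircle × ℝ → Torus} {e e' e₁ e₂ : Fin n × Bool}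
  {u w w₁ w₂ : UnitAddCircle} {N N' : ℝ} {c c' : ℝ → Torus}

theorem NormalForm.line_mem (h : NormalForm F S e e' u w N c) (H : CollarSystem F γ S) :
    S e' (w, 0) ∈ F.leaf (S e (u, 0)) := by
  refine mem_leaf_trans ?_ (H.line_mem_leaf e' w N 0)
  rw [← h.pos N le_rfl, ← h.range_eq]
  exact mem_range_self N

theorem NormalForm.unique (H : CollarSystem F γ S) (h : NormalForm F S e e₁ u w₁ N c)
    (h' : NormalForm F S e e₂ u w₂ N' c') : e₁ = e₂ ∧ w₁ = w₂ :=
  (h'.line_eq H (h.line_mem H)).resolve_left h.ne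

theorem NormalForm.comp (h : NormalForm F S e e' u w N c) {g : ℝ → ℝ} {M : ℝ} (hg : TailId g M)
    (hM : N ≤ M) : NormalForm F S e e' u w M (fun t => c (g t)) where
  cont := h.cont.comp hg.cont
  inj := h.inj.comp hg.mono.injective
  range_eq := by rw [← h.range_eq]; exact hg.surjective.range_comp c
  neg t ht := by rw [hg.neg t ht, h.neg t (by linarith)]
  pos t ht := by rw [hg.pos t ht, h.pos t (hM.trans ht)]

theorem NormalForm.mono (h : NormalForm F S e e' u w N c) (hM : N ≤ N') :
    NormalForm F S e e' u w N' c :=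
  ⟨h.cont, h.inj, h.range_eq, fun t ht => h.neg t (by linarith), fun t ht => h.pos t (hM.trans ht)⟩

/-- Injective parametrizations of one leaf differ by a homeomorphism of the line. Near both ends the
two agree with the same collar lines, so this homeomorphism is the identity there, and is therefore
increasing. -/
theorem NormalForm.exists_reparam (h : NormalForm F S e e' u w N c)
    (h' : NormalForm F S e e' u w N' c') :
    ∃ g M, TailId g M ∧ N ≤ M ∧ N' ≤ M ∧ ∀ t, c t = c' (g t) := by
  have hex : ∀ t, ∃ r, c' r = c t := fun t => by
    have : c t ∈ range c' := by rw [h'.range_eq, ← h.range_eq]; exact mem_range_self t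
    exact this
  choose g hg using hex
  have hgc : Continuous g := continuousOn_univ.1 (continuousOn_leaf_param h'.cont h'.inj h'.range_eq
    ordConnected_univ h.cont.continuousOn fun t _ => hg t)
  have hgi : Function.Injective g := fun x y hxy => h.inj (by rw [← hg, ← hg, hxy])
  set M := max (max N N') 1
  have hN : N ≤ M := (le_max_left _ _).trans (le_max_left _ _)
  have hN' : N' ≤ M := (le_max_right _ _).trans (le_max_left _ _)
  have hM : 1 ≤ M := le_max_right _ _
  have hneg : ∀ t ≤ -M, g t = t := fun t ht => h'.inj (by
    rw [hg, h.neg t (by linarith), h'.neg t (by linarith)])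
  have hpos : ∀ t ≥ M, g t = t := fun t ht => h'.inj (by
    rw [hg, h.pos t (by linarith), h'.pos t (by linarith)])
  refine ⟨g, M, ⟨hgc, (hgc.strictMono_of_inj hgi).resolve_right fun ha => ?_, hneg, hpos⟩, hN, hN',
    fun t => (hg t).symm⟩
  have := ha (show -M < M by linarith)
  rw [hneg _ le_rfl, hpos _ le_rfl] at this
  linarith

/-- The leaves through the side `e`, parametrized all together. -/
structure Pairing (F : OneFoliation Torus) {n : ℕ} (S : Fin n × Bool → UnitAddCircle × ℝ → Torus)
    (e e' : Fin n × Bool) (ε : ℤ) (κ : ℝ → ℝ) (Θ : ℝ × ℝ → Torus) (N : ℝ) : Prop where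
  κ_cont : Continuous κ
  Θ_cont : Continuous Θ
  κ_add : ∀ u, κ (u + 1) = κ u + ε
  Θ_add : ∀ u t, Θ (u + 1, t) = Θ (u, t)
  nf : ∀ u : ℝ, NormalForm F S e e' (u : UnitAddCircle) (κ u : UnitAddCircle) N fun t => Θ (u, t)

/-- Local families are attached one after another along `[0, 1]`. The end of a leaf is determined by
its beginning, so at the seam two families differ only by a reparametrization `g` and an integer
shift of `κ`; applying both to the whole new piece makes it fit. -/
theorem CollarSystem.exists_family (H : CollarSystem F γ S) (hF : F.IsMS) (e : Fin n × Bool) :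
    ∃ (e' : Fin n × Bool) (κ : ℝ → ℝ) (Θ : ℝ × ℝ → Torus) (N : ℝ), ContinuousOn κ (Icc 0 1) ∧ ContinuousOn Θ (Icc (0 : ℝ) 1 ×ˢ univ) ∧
      ∀ s ∈ Icc (0 : ℝ) 1,
        NormalForm F S e e' (s : UnitAddCircle) (κ s : UnitAddCircle) N (fun t => Θ (s, t)) := by
  obtain ⟨e', w, c, hc⟩ := H.exists_normalForm hF e ((0 : ℝ) : UnitAddCircle)
  obtain ⟨w₀, rfl⟩ := QuotientAddGroup.mk_surjective w
  refine ⟨e', Icc_local_induction (a := 0) (b := 1)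
    (P := fun x => ∃ (κ : ℝ → ℝ) (Θ : ℝ × ℝ → Torus) (N : ℝ), ContinuousOn κ (Icc 0 x) ∧
      ContinuousOn Θ (Icc (0 : ℝ) x ×ˢ univ) ∧ ∀ s ∈ Icc (0 : ℝ) x,
        NormalForm F S e e' (s : UnitAddCircle) (κ s : UnitAddCircle) N (fun t => Θ (s, t)))
    zero_le_one ?_ ?_⟩
  · refine ⟨fun _ => w₀, fun z => c z.2, 1, continuousOn_const,
      (hc.cont.comp continuous_snd).continuousOn, fun s hs => ?_⟩
    obtain rfl : s = 0 := le_antisymm hs.2 hs.1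
    exact hc
  · intro t ht
    obtain ⟨e'', δ, hδ, κ', Θ', N', k1, k2, k3⟩ := H.exists_local_family hF e t
    refine ⟨δ, hδ, fun x hx y hy hxt hyt hxy => ?_⟩
    rintro ⟨κ, Θ, N, h1, h2, h3⟩
    have hB : ∀ s ∈ Icc x y, s ∈ Ioo (t - δ) (t + δ) := fun s hs => by
      rw [abs_lt] at hxt hyt
      exact ⟨by linarith [hs.1], by linarith [hs.2]⟩
    have hxx : x ∈ Icc 0 x := ⟨hx.1, le_rfl⟩
    have hx' := hB x ⟨le_rfl, hxy⟩
    obtain ⟨rfl, hw⟩ := (h3 x hxx).unique H (k3 x hx')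
    obtain ⟨k, hk⟩ := exists_int_of_coe_eq hw
    have hnx := k3 x hx'
    rw [← hw] at hnx
    obtain ⟨g, M, hg, hM, hM', hgt⟩ := (h3 x hxx).exists_reparam hnx
    let κn : ℝ → ℝ := fun s => if s ≤ x then κ s else κ' s + k
    let Θn : ℝ × ℝ → Torus := fun z => if z.1 ≤ x then Θ z else Θ' (z.1, g z.2)
    have a1 : ∀ s ≤ x, κn s = κ s := fun s hs => if_pos hs
    have a2 : ∀ s ≥ x, κn s = κ' s + k := fun s hs => by
      rcases eq_or_lt_of_le hs with rfl | h
      · rw [a1 _ le_rfl, hk]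
      · exact if_neg (not_le.2 h)
    have b1 : ∀ z : ℝ × ℝ, z.1 ≤ x → Θn z = Θ z := fun s hs => if_pos hs
    have b2 : ∀ z : ℝ × ℝ, z.1 ≥ x → Θn z = Θ' (z.1, g z.2) := fun z hs => by
      rcases eq_or_lt_of_le hs with h | h
      · rw [b1 z h.symm.le, ← h, ← hgt, h]
      · exact if_neg (not_le.2 h)
    refine ⟨κn, Θn, M, ?_, ?_, fun s hs => ?_⟩
    · refine continuousOn_of_closed_cover isClosed_Iic (isClosed_Ici (a := x)) (fun s _ => le_total s x) ?_ ?_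
      · exact (h1.mono fun s hs => ⟨hs.1.1, hs.2⟩).congr fun s hs => a1 s hs.2
      · exact ((k1.mono fun s hs => hB s ⟨hs.2, hs.1.2⟩).add continuousOn_const).congr
          fun s hs => a2 s hs.2
    · refine continuousOn_of_closed_cover (isClosed_le continuous_fst continuous_const)
        (isClosed_le (continuous_const (y := x)) continuous_fst) (fun z _ => le_total z.1 x) ?_ ?_
      · exact (h2.mono fun z hz => ⟨⟨hz.1.1.1, hz.2⟩, trivial⟩).congr fun z hz => b1 z hz.2
      · refine ContinuousOn.congr (f := fun z : ℝ × ℝ => Θ' (z.1, g z.2)) (k2.comp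
          (continuous_fst.prodMk (hg.cont.comp continuous_snd)).continuousOn
          fun z hz => ⟨hB z.1 ⟨hz.2, hz.1.1.2⟩, trivial⟩) fun z hz => b2 z hz.2
    · rcases le_total s x with h | h
      · have := (h3 s ⟨hs.1, h⟩).mono hM
        rw [← a1 s h] at this
        refine cast (congrArg _ (funext fun t => ?_)) this
        exact (b1 (s, t) h).symm
      · have := (k3 s (hB s ⟨h, hs.2⟩)).comp hg hM'
        rw [← coe_add_int (κ' s) k, ← a2 s h] at this
        refine cast (congrArg _ (funext fun t => ?_)) this
        exact (b2 (s, t) h).symm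

/-- The labels `0` and `1` denote the same leaf, but its two parametrizations may differ by a
homeomorphism `g`. The linear isotopy from the identity to `g`, spread over `[0, 1]`, makes the
family periodic; the integer by which `κ` increases is `ε`. -/
theorem CollarSystem.exists_pairing (H : CollarSystem F γ S) (hF : F.IsMS) (e : Fin n × Bool) :
    ∃ e' ε κ Θ N, Pairing F S e e' ε κ Θ N := by
  obtain ⟨e', κ, Θ, N, h1, h2, h3⟩ := H.exists_family hF e
  have n0 := h3 0 (by norm_num)
  have n1 := h3 1 (by norm_num)
  have h10 : ((1 : ℝ) : UnitAddCircle) = ((0 : ℝ) : UnitAddCircle) := by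
    have := coe_intCast 1
    simp
  rw [h10] at n1
  obtain ⟨-, hw⟩ := n1.unique H n0
  obtain ⟨ε, hε⟩ := exists_int_of_coe_eq hw
  rw [hw] at n1
  obtain ⟨g, M, hg, hM, -, hgt⟩ := n0.exists_reparam n1
  have hgc := hg.cont
  -- Convex combinations of the identity and `g` are again increasing and fix the tails, so normal
  -- forms are preserved, and the values at `s = 0` and `s = 1` agree by `hgt`.
  let Θ₁ : ℝ → ℝ → Torus := fun t s => Θ (s, (1 - s) * t + s * g t)
  have hfr : ∀ u : ℝ, Int.fract u ∈ Icc (0 : ℝ) 1 := fun u =>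
    ⟨Int.fract_nonneg u, (Int.fract_lt_one u).le⟩
  have hκ : Continuous ((fun s => κ s - ε * s) ∘ Int.fract) :=
    ContinuousOn.comp_fract'' (h1.sub (by fun_prop)) (by rw [hε]; ring)
  have hΘ : Continuous fun z : ℝ × ℝ => Θ₁ z.1 (Int.fract z.2) := by
    refine ContinuousOn.comp_fract' (h2.comp (Continuous.continuousOn ?_)
      fun z hz => ⟨hz.2, trivial⟩) fun t => ?_
    · fun_prop
    · simp only [Θ₁]
      rw [show (1 - 0 : ℝ) * t + 0 * g t = t by ring, hgt t,
        show (1 - 1 : ℝ) * t + 1 * g t = g t by ring]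
  have hfrc : ∀ u : ℝ, ((Int.fract u : ℝ) : UnitAddCircle) = (u : UnitAddCircle) := fun u => by
    rw [← coe_add_int (Int.fract u) ⌊u⌋, Int.fract_add_floor]
  refine ⟨e', ε, fun u => (κ (Int.fract u) - ε * Int.fract u) + ε * u,
    fun z => Θ₁ z.2 (Int.fract z.1), M, hκ.add (by fun_prop), hΘ.comp continuous_swap, fun u => ?_,
    fun u t => ?_, fun u => ?_⟩
  · simp only [Int.fract_add_one]; ring
  · simp only [Int.fract_add_one]
  · have := (h3 _ (hfr u)).comp (hg.convexComb (hfr u)) hM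
    rw [hfrc] at this
    have hcoe : ((κ (Int.fract u) - ε * Int.fract u + ε * u : ℝ) : UnitAddCircle) =
        (κ (Int.fract u) : UnitAddCircle) := by
      rw [← coe_add_int (κ (Int.fract u)) (ε * ⌊u⌋)]
      congr 1
      push_cast
      rw [← Int.self_sub_floor u]; ring
    rw [hcoe]
    exact this

end OneFoliation

/-! ### The pairing of sides has degree one up to sign and no fixed side. -/

namespace OneFoliation

variable {F : OneFoliation Torus} {n : ℕ} {γ : Fin n → C(UnitAddCircle, Torus)}
  {S : Fin n × Bool → UnitAddCircle × ℝ → Torus} {e e' : Fin n × Bool} {ε : ℤ} {κ : ℝ → ℝ}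
  {Θ : ℝ × ℝ → Torus} {N : ℝ}

theorem periodic_add_int {X : Type*} {f : ℝ → X} (h : ∀ u, f (u + 1) = f u) (u : ℝ) (k : ℤ) :
    f (u + k) = f u := by
  have := (show Function.Periodic f 1 from h).int_mul k u
  simpa using this

namespace Pairing

variable (Q : Pairing F S e e' ε κ Θ N)
include Q

theorem κ_add_int (u : ℝ) (k : ℤ) : κ (u + k) = κ u + ε * k := by
  have := periodic_add_int (f := fun u => κ u - ε * u) (fun u => by rw [Q.κ_add]; ring) u k
  linarith

theorem Θ_add_int (u t : ℝ) (k : ℤ) : Θ (u + k, t) = Θ (u, t) :=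
  periodic_add_int (f := fun u => Θ (u, t)) (fun u => Q.Θ_add u t) u k

theorem mem_leaf (s t : ℝ) : Θ (s, t) ∈ F.leaf (S e ((s : UnitAddCircle), 0)) := by
  rw [← (Q.nf s).range_eq]; exact mem_range_self t

theorem eq_of_coe_eq {s s' t t' : ℝ} (h : Θ (s, t) = Θ (s', t'))
    (hs : (s : UnitAddCircle) = (s' : UnitAddCircle)) : t = t' := by
  obtain ⟨k, rfl⟩ := exists_int_of_coe_eq hs
  rw [Q.Θ_add_int] at h
  exact (Q.nf s').inj h

variable (H : CollarSystem F γ S)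
include H

theorem coe_eq_or {s s' t t' : ℝ} (h : Θ (s, t) = Θ (s', t')) :
    (s' : UnitAddCircle) = s ∨ e = e' ∧ (s' : UnitAddCircle) = κ s := by
  refine ((Q.nf s).line_eq H ?_).imp (fun h => h.2) id
  exact mem_leaf_trans (Q.mem_leaf s t) (h ▸ mem_leaf_symm (Q.mem_leaf s' t'))

/-- Leaves with the same final line coincide, and a leaf determines its two end lines; the exchange
of the two ends is ruled out by `NormalForm.ne`. -/
theorem κ_inj_mod {s s' : ℝ} (h : (κ s : UnitAddCircle) = κ s') :
    (s' : UnitAddCircle) = s := by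
  have h1 := (Q.nf s).line_mem H
  have h2 := mem_leaf_symm ((Q.nf s').line_mem H)
  rw [← h] at h2
  refine ((Q.nf s).line_eq H (mem_leaf_trans h1 h2)).elim (fun h => h.2) fun h3 => ?_
  exact absurd ⟨h3.1.symm, by rw [← h, ← h3.2]⟩ (Q.nf s').ne

theorem κ_injective : Function.Injective κ := by
  intro x y hxy
  have hi : ∀ a b : ℝ, InjOn κ (Icc a b) := fun a b =>
    Q.κ_cont.continuousOn.injOn_Icc_of_locally fun t _ =>
      ⟨Ico (t - 1 / 2) (t - 1 / 2 + 1), Ico_mem_nhds (by linarith) (by linarith),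
        fun s hs s' hs' h => (coe_injOn_Ico _ hs' hs (Q.κ_inj_mod H (by rw [h]))).symm⟩
  exact hi (min x y) (max x y) ⟨min_le_left _ _, le_max_left _ _⟩ ⟨min_le_right _ _, le_max_right _ _⟩ hxy

/-- `κ` is injective modulo one, hence monotone and `ε ≠ 0`. If `|ε|` exceeded one, `κ` would take a
value congruent to `κ 0` strictly inside the period. -/
theorem ε_cases : (ε = 1 ∧ StrictMono κ) ∨ (ε = -1 ∧ StrictAnti κ) := by
  have h1 := Q.κ_add 0
  rw [zero_add] at h1
  have key : ∀ a : ℤ, (κ 0 + a ∈ uIcc (κ 0) (κ 1)) → a = 0 ∨ a = ε := fun a ha => by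
    obtain ⟨s, hs, hsa⟩ := intermediate_value_uIcc (Q.κ_cont.continuousOn (s := uIcc 0 1)) ha
    have h2 := Q.κ_inj_mod H (s := s) (s' := 0) (by rw [hsa, coe_add_int])
    rw [uIcc_of_le zero_le_one] at hs
    rcases hs.2.eq_or_lt with rfl | h
    · right
      have : (ε : ℝ) = a := by linarith
      exact_mod_cast this.symm
    · left
      have h3 := coe_injOn_Ico 0 ⟨le_rfl, by norm_num⟩ ⟨hs.1, by linarith⟩ h2
      rw [← h3] at hsa
      have : (a : ℝ) = 0 := by linarith
      exact_mod_cast this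
  rcases Q.κ_cont.strictMono_of_inj (Q.κ_injective H) with h | h
  · refine Or.inl ⟨?_, h⟩
    have h2 := h zero_lt_one
    have h3 : 0 < ε := by
      have : (0 : ℝ) < ε := by linarith
      exact_mod_cast this
    have h4 : (1 : ℝ) ≤ ε := by exact_mod_cast h3
    have := key 1 (by rw [uIcc_of_le h2.le]; push_cast; exact ⟨by linarith, by linarith⟩)
    omega
  · refine Or.inr ⟨?_, h⟩
    have h2 := h zero_lt_one
    have h3 : ε < 0 := by
      have : (ε : ℝ) < 0 := by linarith
      exact_mod_cast this
    have h4 : (ε : ℝ) ≤ -1 := by exact_mod_cast (show ε ≤ -1 by omega)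
    have := key (-1) (by rw [uIcc_of_ge h2.le]; push_cast; exact ⟨by linarith, by linarith⟩)
    omega

theorem locally_injective (z : ℝ × ℝ) : ∃ O ∈ 𝓝 z, InjOn (fun z : ℝ × ℝ => Θ (z.2, z.1)) O := by
  have hcoe : Continuous (fun s : ℝ => (s : UnitAddCircle)) := AddCircle.continuous_mk' 1
  have hB : ∃ B ∈ 𝓝 z.2, ∀ s ∈ B, ∀ s' ∈ B, ¬ (e = e' ∧ (s' : UnitAddCircle) = κ s) := by
    by_cases hee : e = e'
    · have hne : (z.2 : UnitAddCircle) ≠ κ z.2 := fun h => (Q.nf z.2).ne ⟨hee.symm, h.symm⟩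
      obtain ⟨U, V, hU, hV, hzU, hzV, hUV⟩ := t2_separation hne
      refine ⟨_, inter_mem (hcoe.continuousAt (hU.mem_nhds hzU))
        ((hcoe.comp Q.κ_cont).continuousAt (hV.mem_nhds hzV)), fun s hs s' hs' h => ?_⟩
      refine disjoint_left.1 hUV hs'.1 ?_
      have : (κ s : UnitAddCircle) ∈ V := hs.2
      rwa [← h.2] at this
    · exact ⟨univ, univ_mem, fun s _ s' _ h => hee h.1⟩
  obtain ⟨B, hB, hB'⟩ := hB
  refine ⟨_, continuous_snd.continuousAt (x := z) (inter_mem hB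
    (Ico_mem_nhds (show z.2 - 1 / 2 < z.2 by linarith) (show z.2 < z.2 - 1 / 2 + 1 by linarith))),
    fun p hp q hq hpq => ?_⟩
  have hs := (Q.coe_eq_or H hpq).resolve_right (hB' _ hp.1 _ hq.1)
  exact Prod.ext (Q.eq_of_coe_eq hpq hs.symm) (coe_injOn_Ico _ hq.2 hp.2 hs).symm

/-- A side paired with itself is excluded in two ways. If `κ` increases, the locally injective map
`Θ` agrees with the collar at both ends, reversing depth at one end only, so its local degree would
change sign over a connected domain. If `κ` decreases, it has a fixed point, that is, a leaf with
both ends on the same collar line. -/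
theorem ne : e' ≠ e := by
  rintro rfl
  rcases Q.ε_cases H with ⟨-, hm⟩ | ⟨rfl, ha⟩
  · have hcoe : Continuous (fun s : ℝ => (s : UnitAddCircle)) := AddCircle.continuous_mk' 1
    set C : ℝ × ℝ → Torus := fun z => S e' ((z.2 : UnitAddCircle), z.1)
    have hCc : Continuous C :=
      (H.continuous e').comp ((hcoe.comp continuous_snd).prodMk continuous_fst)
    have hCi : ∀ z, ∃ O ∈ 𝓝 z, InjOn C O := fun z => ((H.collar e'.1).locFol e'.2 z).exists_injOn
    have hCc' : ∀ z, ∀ᶠ w in 𝓝 z, ContinuousAt C w := fun z => Eventually.of_forall fun w => hCc.continuousAt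
    set T : ℝ × ℝ → Torus := fun z => Θ (z.2, z.1)
    have hTc : Continuous T := Q.Θ_cont.comp continuous_swap
    have hTi := Q.locally_injective H
    obtain ⟨k, hk0, hk⟩ := Torus.exists_ori (hCc' (0, 0)) (hCi (0, 0))
    have hkz : ∀ z, Torus.Ori C z k := fun z => Torus.ori_of_isPreconnected isPreconnected_univ
      (fun z _ => hCc' z) (fun z _ => hCi z) (mem_univ _) (mem_univ _) hk
    have o1 : Torus.Ori T (-N - 1, 0) (k * (-1 * 1)) := by
      refine Torus.Ori.comp (χ := fun z => (-z.1, z.2)) (hkz _) (hCc' _) (hCi _) ?_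
        (Eventually.of_forall fun w => by fun_prop) (Or.inr rfl) (Or.inl rfl) univ_mem
        (fun p _ q _ => ⟨fun h => by push_cast; linarith, fun _ h => by push_cast; linarith⟩)
      filter_upwards [continuous_fst.continuousAt (Iio_mem_nhds
        (show ((-N - 1, 0) : ℝ × ℝ).1 < -N by simp))] with z hz
      exact (Q.nf z.2).neg z.1 (le_of_lt hz)
    have o2 : Torus.Ori T (N + 1, 0) (k * (1 * 1)) := by
      refine Torus.Ori.comp (χ := fun z => (z.1, κ z.2)) (hkz _) (hCc' _) (hCi _) ?_
        (Eventually.of_forall fun w => by have := Q.κ_cont; fun_prop) (Or.inl rfl) (Or.inl rfl) univ_mem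
        (fun p _ q _ => ⟨fun h => by have := hm h; push_cast; linarith, fun _ h => by push_cast; linarith⟩)
      filter_upwards [continuous_fst.continuousAt (Ioi_mem_nhds
        (show N < ((N + 1, 0) : ℝ × ℝ).1 by simp))] with z hz
      exact (Q.nf z.2).pos z.1 (le_of_lt hz)
    have o3 : Torus.Ori T (N + 1, 0) (k * (-1 * 1)) := Torus.ori_of_isPreconnected
      isPreconnected_univ (fun z _ => Eventually.of_forall fun w => hTc.continuousAt)
      (fun z _ => hTi z) (mem_univ _) (mem_univ _) o1
    have := o2.unique o3
    omega
  · obtain ⟨K, hK⟩ := exists_int_gt |κ 0|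
    have hK' := abs_lt.1 hK
    have hK0 : (0 : ℝ) ≤ K := (abs_nonneg _).trans hK.le
    have a := Q.κ_add_int 0 K
    have b := Q.κ_add_int 0 (-K)
    push_cast at a b
    rw [zero_add] at a b
    have hc : ContinuousOn (fun s => κ s - s) (Icc (-K : ℝ) K) :=
      (Q.κ_cont.sub continuous_id).continuousOn
    obtain ⟨s, -, hs⟩ := intermediate_value_Icc' (show (-K : ℝ) ≤ K by linarith) hc
      (show (0 : ℝ) ∈ Icc (κ K - K) (κ (-K) - -K) from ⟨by rw [a]; linarith [hK'.2],
        by rw [b]; linarith [hK'.1]⟩)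
    have hs' : κ s = s := by simp only at hs; linarith
    exact (Q.nf s).ne ⟨rfl, by rw [hs']⟩

theorem eq_of_eq {s s' t t' : ℝ} (h : Θ (s, t) = Θ (s', t')) :
    (s : UnitAddCircle) = s' ∧ t = t' := by
  have hs := ((Q.coe_eq_or H h).resolve_right fun h => Q.ne H h.1.symm).symm
  exact ⟨hs, Q.eq_of_coe_eq h hs⟩

end Pairing

end OneFoliation

/-! ### Standard foliated annuli. -/

namespace OneFoliation

/-- The shear that turns the spiraling leaves of an annulus into curves with limits. -/
noncomputable def shear (ε : ℤ) (t : ℝ) : ℝ := (1 + ε) / 2 * |t| - (1 - ε) / 2 * t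

theorem shear_of_nonpos (ε : ℤ) {t : ℝ} (ht : t ≤ 0) : shear ε t = -t := by
  rw [shear, abs_of_nonpos ht]; ring

theorem shear_of_nonneg (ε : ℤ) {t : ℝ} (ht : 0 ≤ t) : shear ε t = ε * t := by
  rw [shear, abs_of_nonneg ht]; ring

theorem continuous_shear (ε : ℤ) : Continuous (shear ε) := by unfold shear; fun_prop

variable {F : OneFoliation Torus} {n : ℕ} {γ : Fin n → C(UnitAddCircle, Torus)}
  {S : Fin n × Bool → UnitAddCircle × ℝ → Torus} {e e' : Fin n × Bool} {ε : ℤ} {κ : ℝ → ℝ}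
  {Θ : ℝ × ℝ → Torus} {N : ℝ}

/-- The deviation of `κ` from `u ↦ ε * u` is periodic, hence bounded, and is moved from the label to
the depth: the leaf `u` is advanced by `b u` near its final end. Modulo integers the final label is
then `ε • u + (t - d)`, which unwinds to a linear map on the limiting compact leaf. -/
theorem Pairing.exists_sheared (Q : Pairing F S e e' ε κ Θ N) (H : CollarSystem F γ S) :
    ∃ (A : UnitAddCircle × ℝ → Torus) (N : ℝ), Continuous A ∧ Function.Injective A ∧
      (∀ u, range (fun t => A (u, t)) = F.leaf (S e (u, 0))) ∧
      (∀ u, ∀ t ≤ -N, A (u, t) = S e (u, -t)) ∧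
      ∀ u, ∀ t ≥ N, ∃ d ≥ t, A (u, t) = S e' (ε • u + ((t - d : ℝ) : UnitAddCircle), d) := by
  have hκ := Q.κ_cont
  have hp : Function.Periodic (fun u => κ u - ε * u) 1 := fun u => by
    simp only [Q.κ_add]; ring
  obtain ⟨K, hK⟩ : ∃ K : ℤ, ∀ u, κ u - ε * u ≤ K := by
    obtain ⟨C, hC⟩ := isCompact_Icc.bddAbove_image (f := fun u => κ u - ε * u) (K := Icc 0 1)
      (by fun_prop)
    obtain ⟨K, hK⟩ := exists_int_gt C
    refine ⟨K, fun u => ?_⟩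
    have h1 := hp.sub_int_mul_eq ⌊u⌋ (x := u)
    rw [mul_one] at h1
    refine (h1 ▸ hC ⟨u - ⌊u⌋, ⟨Int.fract_nonneg u, (Int.fract_lt_one u).le⟩, rfl⟩ : _ ≤ C).trans hK.le
  -- The integer `K` makes the advance nonnegative, so that `m u` stays increasing, without changing
  -- labels in the circle.
  set b : ℝ → ℝ := fun u => K - (κ u - ε * u) with hb
  have hbp : ∀ u, b (u + 1) = b u := fun u => by simp only [hb]; rw [Q.κ_add]; ring
  have hb0 : ∀ u, 0 ≤ b u := fun u => sub_nonneg.2 (hK u)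
  set cl : ℝ → ℝ := fun t => max 0 (min 1 (t - N)) with hcl
  have hclm : Monotone cl := fun x y h => max_le_max le_rfl (min_le_min le_rfl (by linarith))
  have cl0 : ∀ t ≤ N, cl t = 0 := fun t ht => by
    simp only [hcl]; rw [min_eq_right (by linarith), max_eq_left (by linarith)]
  have cl1 : ∀ t ≥ N + 1, cl t = 1 := fun t ht => by
    simp only [hcl]; rw [min_eq_left (by linarith), max_eq_right (by norm_num)]
  set m : ℝ → ℝ → ℝ := fun u t => t + b u * cl t with hm
  have hmm : ∀ u, StrictMono (m u) := fun u x y h =>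
    add_lt_add_of_lt_of_le h (mul_le_mul_of_nonneg_left (hclm h.le) (hb0 u))
  have hmc : ∀ u, Continuous (m u) := fun u => by simp only [hm, hcl]; fun_prop
  have hms : ∀ u, Function.Surjective (m u) := fun u => by
    refine (hmc u).surjective ?_ ?_
    · refine (tendsto_atTop_add_const_right _ (b u) tendsto_id).congr'
        ((eventually_ge_atTop (N + 1)).mono fun t ht => ?_)
      simp only [hm, cl1 t ht, mul_one, id]
    · refine tendsto_id.congr' ((eventually_le_atBot N).mono fun t ht => ?_)
      simp only [hm, cl0 t ht, mul_zero, add_zero, id]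
  have hper : ∀ t, Function.Periodic (fun u => Θ (u, m u t)) 1 := fun t u => by
    simp only [hm, hbp, Q.Θ_add]
  let A : UnitAddCircle × ℝ → Torus := fun p => (hper p.2).lift p.1
  have hA : ∀ u t : ℝ, A ((u : UnitAddCircle), t) = Θ (u, m u t) := fun u t => rfl
  refine ⟨A, max (N + 1) (-N), ?_, ?_, ?_, ?_, ?_⟩
  · rw [isOpenQuotientMap_coe_prod.isQuotientMap.continuous_iff]
    show Continuous fun z : ℝ × ℝ => Θ (z.1, m z.1 z.2)
    refine Q.Θ_cont.comp (continuous_fst.prodMk ?_)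
    simp only [hm, hcl, hb]; fun_prop
  · intro p q hpq
    obtain ⟨⟨u, t⟩, rfl⟩ := isOpenQuotientMap_coe_prod.surjective p
    obtain ⟨⟨u', t'⟩, rfl⟩ := isOpenQuotientMap_coe_prod.surjective q
    obtain ⟨h1, h2⟩ := Q.eq_of_eq H hpq
    obtain ⟨k, rfl⟩ := exists_int_of_coe_eq h1
    have h3 : m (u' + k) t = m u' t := by
      simp only [hm]; rw [periodic_add_int hbp]
    rw [h3] at h2
    exact Prod.ext h1 ((hmm u').injective h2)
  · intro u
    obtain ⟨x, rfl⟩ := QuotientAddGroup.mk_surjective u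
    have := (hms x).range_comp (fun t => Θ (x, t))
    rw [(Q.nf x).range_eq] at this
    exact this
  · intro u t ht
    obtain ⟨x, rfl⟩ := QuotientAddGroup.mk_surjective u
    have h1 : t ≤ N := by linarith [le_max_right (N + 1) (-N)]
    have h2 : t ≤ -N := by linarith [le_max_left (N + 1) (-N)]
    show Θ (x, m x t) = _
    simp only [hm, cl0 t h1, mul_zero, add_zero]
    exact (Q.nf x).neg t h2
  · intro u t ht
    obtain ⟨x, rfl⟩ := QuotientAddGroup.mk_surjective u
    have h1 : N + 1 ≤ t := (le_max_left _ _).trans ht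
    refine ⟨t + b x, by linarith [hb0 x], ?_⟩
    show Θ (x, m x t) = _
    simp only [hm, cl1 t h1, mul_one]
    rw [show Θ (x, t + b x) = _ from (Q.nf x).pos _ (by linarith [hb0 x])]
    congr 2
    show _ = ε • (x : UnitAddCircle) + _
    rw [← AddCircle.coe_zsmul, ← AddCircle.coe_add, ← coe_add_int _ (-K)]
    congr 1
    simp only [hb, zsmul_eq_mul]; push_cast; ring

/-- The closed annulus swept by the leaves that leave the compact leaf `γ e.1` on the side `e`. -/
structure IsAnnulus (F : OneFoliation Torus) {n : ℕ} (γ : Fin n → C(UnitAddCircle, Torus))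
    (S : Fin n × Bool → UnitAddCircle × ℝ → Torus) (e e' : Fin n × Bool) (ε : ℤ)
    (P : UnitAddCircle × ℝ → Torus) : Prop where
  cont : ContinuousOn P (univ ×ˢ Icc (-(Real.pi / 2)) (Real.pi / 2))
  left : ∀ θ, P (θ, -(Real.pi / 2)) = γ e.1 θ
  right : ∀ θ, P (θ, Real.pi / 2) = γ e'.1 (ε • θ)
  inj : InjOn P (univ ×ˢ Ioo (-(Real.pi / 2)) (Real.pi / 2))
  leaf : ∀ v : UnitAddCircle, (fun ρ => P (v + (shear ε (Real.tan ρ) : UnitAddCircle), ρ)) ''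
    Ioo (-(Real.pi / 2)) (Real.pi / 2) = F.leaf (S e (v, 0))
  collar : ∃ N : ℝ, ∀ (v : UnitAddCircle), ∀ t ≤ -N,
    P (v + (shear ε t : UnitAddCircle), Real.arctan t) = S e (v, -t)

/-- The leaf parameter is compactified by `tan` and the labels are sheared against the spiralling.
For `t → -∞` the label is `θ - d` with `d = -t`; for `t → ∞` the final label is `ε • θ - d`. Both
are exactly the form in which `IsCollar.lim` gives limits on the compact leaves. -/
theorem Pairing.exists_annulus (Q : Pairing F S e e' ε κ Θ N) (H : CollarSystem F γ S) :
    ∃ P, IsAnnulus F γ S e e' ε P := by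
  obtain ⟨A, N, hAc, hAi, hAr, hAn, hAp⟩ := Q.exists_sheared H
  have hpi := Real.pi_pos
  let P : UnitAddCircle × ℝ → Torus := fun p => if p.2 ≤ -(Real.pi / 2) then γ e.1 p.1 else
    if Real.pi / 2 ≤ p.2 then γ e'.1 (ε • p.1) else
      A (p.1 - (shear ε (Real.tan p.2) : UnitAddCircle), Real.tan p.2)
  have hl : ∀ θ, P (θ, -(Real.pi / 2)) = γ e.1 θ := fun θ => if_pos le_rfl
  have hr : ∀ θ, P (θ, Real.pi / 2) = γ e'.1 (ε • θ) := fun θ => by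
    simp only [P]; rw [if_neg (by linarith), if_pos le_rfl]
  have hi : ∀ p : UnitAddCircle × ℝ, p.2 ∈ Ioo (-(Real.pi / 2)) (Real.pi / 2) →
      P p = A (p.1 - (shear ε (Real.tan p.2) : UnitAddCircle), Real.tan p.2) := fun p hp => by
    simp only [P]; rw [if_neg (not_le.2 hp.1), if_neg (not_le.2 hp.2)]
  have hcoe : Continuous (fun s : ℝ => (s : UnitAddCircle)) := AddCircle.continuous_mk' 1
  have hsm : Continuous fun θ : UnitAddCircle => ε • θ := continuous_zsmul ε
  set B₁ : Set (UnitAddCircle × ℝ) := univ ×ˢ {-(Real.pi / 2)}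
  set B₂ : Set (UnitAddCircle × ℝ) := univ ×ˢ Ioo (-(Real.pi / 2)) (Real.pi / 2) with hB₂
  set B₃ : Set (UnitAddCircle × ℝ) := univ ×ˢ {Real.pi / 2}
  have c1 : ∀ z, ContinuousWithinAt P B₁ z := fun z => by
    by_cases hz : z ∈ B₁
    · refine ContinuousWithinAt.congr (f := fun p : UnitAddCircle × ℝ => γ e.1 p.1)
        (by fun_prop) ?_ ?_
      · rintro ⟨θ, _⟩ ⟨-, rfl⟩; exact hl θ
      · obtain ⟨θ, _⟩ := z; obtain ⟨-, rfl⟩ := hz; exact hl θ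
    · exact continuousWithinAt_of_notMem_closure
        fun h => hz ((isClosed_univ.prod isClosed_singleton).closure_subset h)
  have c3 : ∀ z, ContinuousWithinAt P B₃ z := fun z => by
    by_cases hz : z ∈ B₃
    · refine ContinuousWithinAt.congr (f := fun p : UnitAddCircle × ℝ => γ e'.1 (ε • p.1))
        (by fun_prop) ?_ ?_
      · rintro ⟨θ, _⟩ ⟨-, rfl⟩; exact hr θ
      · obtain ⟨θ, _⟩ := z; obtain ⟨-, rfl⟩ := hz; exact hr θ
    · exact continuousWithinAt_of_notMem_closure
        fun h => hz ((isClosed_univ.prod isClosed_singleton).closure_subset h)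
  have hfst : ∀ z : UnitAddCircle × ℝ, Tendsto Prod.fst (𝓝[B₂] z) (𝓝 z.1) := fun z =>
    continuous_fst.continuousAt.tendsto.mono_left nhdsWithin_le_nhds
  have hsnd : ∀ z : UnitAddCircle × ℝ, Tendsto Prod.snd (𝓝[B₂] z)
      (𝓝[Ioo (-(Real.pi / 2)) (Real.pi / 2)] z.2) := fun z =>
    tendsto_nhdsWithin_iff.2 ⟨continuous_snd.continuousAt.tendsto.mono_left nhdsWithin_le_nhds,
      eventually_mem_nhdsWithin.mono fun w hw => hw.2⟩
  have c2 : ∀ z : UnitAddCircle × ℝ, z.2 ∈ Icc (-(Real.pi / 2)) (Real.pi / 2) →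
      ContinuousWithinAt P B₂ z := by
    rintro ⟨θ, ρ⟩ hz
    rcases hz.1.eq_or_lt with h | h
    · obtain rfl : -(Real.pi / 2) = ρ := h
      have htan : Tendsto (fun p : UnitAddCircle × ℝ => Real.tan p.2) (𝓝[B₂] (θ, -(Real.pi / 2))) atBot :=
        Real.tendsto_tan_neg_pi_div_two.comp ((hsnd _).mono_right
          (nhdsWithin_mono _ Ioo_subset_Ioi_self))
      rw [ContinuousWithinAt, hl]
      refine (((H.collar e.1).lim e.2 θ).comp ((hfst _).prodMk
        (tendsto_neg_atBot_atTop.comp htan))).congr' ?_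
      filter_upwards [eventually_mem_nhdsWithin, htan.eventually_le_atBot (min (-N) 0)] with w hw ht
      rw [hi w hw.2, hAn _ _ (ht.trans (min_le_left _ _)),
        shear_of_nonpos ε (ht.trans (min_le_right _ _))]
      rfl
    rcases hz.2.eq_or_lt with h' | h'
    · obtain rfl : ρ = Real.pi / 2 := h'
      have htan : Tendsto (fun p : UnitAddCircle × ℝ => Real.tan p.2) (𝓝[B₂] (θ, Real.pi / 2)) atTop :=
        Real.tendsto_tan_pi_div_two.comp ((hsnd _).mono_right
          (nhdsWithin_mono _ Ioo_subset_Iio_self))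
      choose! d hd hAd using hAp
      have hdt : Tendsto (fun p : UnitAddCircle × ℝ =>
          d (p.1 - (shear ε (Real.tan p.2) : UnitAddCircle)) (Real.tan p.2))
          (𝓝[B₂] (θ, Real.pi / 2)) atTop :=
        tendsto_atTop_mono' _ ((htan.eventually_ge_atTop N).mono fun w hw => hd _ _ hw) htan
      have hεθ : Tendsto (fun p : UnitAddCircle × ℝ => ε • p.1) (𝓝[B₂] (θ, Real.pi / 2)) (𝓝 (ε • θ)) :=
        hsm.continuousAt.tendsto.comp (hfst (θ, Real.pi / 2))
      rw [ContinuousWithinAt, hr]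
      refine (((H.collar e'.1).lim e'.2 (ε • θ)).comp (hεθ.prodMk hdt)).congr' ?_
      filter_upwards [eventually_mem_nhdsWithin, htan.eventually_ge_atTop (max N 0)] with w hw ht
      rw [hi w hw.2, hAd _ _ ((le_max_left _ _).trans ht)]
      show S e' _ = S e' _
      congr 2
      show ε • w.1 - ((d (w.1 - (shear ε (Real.tan w.2) : UnitAddCircle)) (Real.tan w.2) : ℝ) :
        UnitAddCircle) = _
      generalize d (w.1 - (shear ε (Real.tan w.2) : UnitAddCircle)) (Real.tan w.2) = D
      rw [shear_of_nonneg ε ((le_max_right _ _).trans ht), AddCircle.coe_sub, zsmul_sub,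
        ← AddCircle.coe_zsmul]
      -- The shear at the right end is by `ε * t`, and `ε` squared being one makes it cancel the
      -- advance `t` of the final label.
      have hεε : (ε : ℝ) * ε = 1 := by
        rcases Q.ε_cases H with ⟨rfl, -⟩ | ⟨rfl, -⟩ <;> norm_num
      have : ε • ((ε : ℝ) * Real.tan w.2) = Real.tan w.2 := by
        rw [zsmul_eq_mul, ← mul_assoc, hεε, one_mul]
      rw [this]
      abel
    · have hρ : ρ ∈ Ioo (-(Real.pi / 2)) (Real.pi / 2) := ⟨h, h'⟩
      have htan : ContinuousWithinAt (fun p : UnitAddCircle × ℝ => Real.tan p.2) B₂ (θ, ρ) :=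
        ((Real.continuousOn_tan_Ioo ρ hρ).tendsto.comp (hsnd (θ, ρ)))
      refine ContinuousWithinAt.congr (f := fun p : UnitAddCircle × ℝ =>
        A (p.1 - (shear ε (Real.tan p.2) : UnitAddCircle), Real.tan p.2)) ?_
        (fun p hp => hi p hp.2) (hi _ hρ)
      refine hAc.continuousAt.comp_continuousWithinAt (ContinuousWithinAt.prodMk
        (continuousWithinAt_fst.sub ?_) htan)
      exact (hcoe.comp (continuous_shear ε)).continuousAt.comp_continuousWithinAt htan
  refine ⟨P, fun z hz => (((c1 z).union (c2 z hz.2)).union (c3 z)).mono fun w hw => ?_, hl, hr, ?_, ?_, N,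
    fun v t ht => ?_⟩
  · rcases hw.2.1.eq_or_lt with h | h
    · exact Or.inl (Or.inl ⟨trivial, h.symm⟩)
    rcases hw.2.2.eq_or_lt with h' | h'
    · exact Or.inr ⟨trivial, h'⟩
    · exact Or.inl (Or.inr ⟨trivial, h, h'⟩)
  · intro p hp q hq hpq
    rw [hi p hp.2, hi q hq.2] at hpq
    obtain ⟨h1, h2⟩ := Prod.ext_iff.1 (hAi hpq)
    simp only at h1 h2
    have h3 := Real.injOn_tan hp.2 hq.2 h2
    rw [h2] at h1
    exact Prod.ext (sub_left_injective h1) h3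
  · intro v
    rw [← hAr v]
    ext y
    constructor
    · rintro ⟨ρ, hρ, rfl⟩
      refine ⟨Real.tan ρ, ?_⟩
      simp only
      rw [hi _ hρ, add_sub_cancel_right]
    · rintro ⟨t, rfl⟩
      refine ⟨Real.arctan t, Real.arctan_mem_Ioo t, ?_⟩
      simp only
      rw [hi _ (Real.arctan_mem_Ioo t), add_sub_cancel_right, Real.tan_arctan]
  · rw [hi _ (Real.arctan_mem_Ioo t), Real.tan_arctan, add_sub_cancel_right, hAn v t ht]

end OneFoliation

/-! ### The components of the complement of the compact leaves. -/

namespace OneFoliation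

variable {F : OneFoliation Torus} {n : ℕ} {γ : Fin n → C(UnitAddCircle, Torus)}
  {S : Fin n × Bool → UnitAddCircle × ℝ → Torus}

/-- The union of the leaves through the side `e` of a compact leaf. -/
def sideRegion (F : OneFoliation Torus) {n : ℕ} (S : Fin n × Bool → UnitAddCircle × ℝ → Torus)
    (e : Fin n × Bool) : Set Torus := ⋃ v : UnitAddCircle, F.leaf (S e (v, 0))

/-- The sides of the compact leaves are paired by the non-compact leaves, and each pair bounds an
annulus. -/
structure SidePairing (F : OneFoliation Torus) {n : ℕ} (γ : Fin n → C(UnitAddCircle, Torus))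
    (S : Fin n × Bool → UnitAddCircle × ℝ → Torus) (π : Fin n × Bool → Fin n × Bool)
    (ε : Fin n × Bool → ℤ) (P : Fin n × Bool → UnitAddCircle × ℝ → Torus) : Prop where
  annulus : ∀ e, IsAnnulus F γ S e (π e) (ε e) (P e)
  ne : ∀ e, π e ≠ e
  invol : ∀ e, π (π e) = e
  sign : ∀ e, ε e = 1 ∨ ε e = -1
  disj : ∀ {e e' p}, p ∈ sideRegion F S e → p ∈ sideRegion F S e' → e' = e ∨ e' = π e
  region : ∀ e, sideRegion F S (π e) = sideRegion F S e

/-- The regions of two sides meet only if some leaf has its ends on both, that is, if the sides are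
equal or paired. Each region lies in that of its partner, which makes the pairing an involution. -/
theorem CollarSystem.exists_sidePairing (H : CollarSystem F γ S) (hF : F.IsMS) :
    ∃ π ε P, SidePairing F γ S π ε P := by
  choose π ε κ Θ N Q using H.exists_pairing hF
  choose P hP using fun e => (Q e).exists_annulus H
  have hdisj : ∀ {e e' p}, p ∈ sideRegion F S e → p ∈ sideRegion F S e' → e' = e ∨ e' = π e := by
    intro e e' p h h'
    obtain ⟨v, hv⟩ := mem_iUnion.1 h
    obtain ⟨v', hv'⟩ := mem_iUnion.1 h'
    obtain ⟨x, rfl⟩ := QuotientAddGroup.mk_surjective v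
    exact (((Q e).nf x).line_eq H (mem_leaf_trans hv (mem_leaf_symm hv'))).imp And.left And.left
  have hsub : ∀ e, sideRegion F S e ⊆ sideRegion F S (π e) := fun e p hp => by
    obtain ⟨v, hv⟩ := mem_iUnion.1 hp
    obtain ⟨x, rfl⟩ := QuotientAddGroup.mk_surjective v
    exact mem_iUnion.2 ⟨_, mem_leaf_trans (mem_leaf_symm (((Q e).nf x).line_mem H)) hv⟩
  have hinv : ∀ e, π (π e) = e := fun e => by
    have h0 : S e (0, 0) ∈ sideRegion F S e := mem_iUnion.2 ⟨0, mem_leaf_self F _⟩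
    exact ((hdisj (hsub e h0) h0).resolve_left fun h => (Q e).ne H h.symm).symm
  refine ⟨π, ε, P, hP, fun e => (Q e).ne H, hinv, fun e => ((Q e).ε_cases H).imp And.left And.left,
    hdisj, fun e => Subset.antisymm ?_ (hsub e)⟩
  have := hsub (π e)
  rwa [hinv] at this

theorem IsAnnulus.image_interior {e e' : Fin n × Bool} {ε : ℤ} {P : UnitAddCircle × ℝ → Torus}
    (h : IsAnnulus F γ S e e' ε P) :
    P '' (univ ×ˢ Ioo (-(Real.pi / 2)) (Real.pi / 2)) = sideRegion F S e := by
  ext p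
  constructor
  · rintro ⟨⟨θ, ρ⟩, ⟨-, hρ⟩, rfl⟩
    refine mem_iUnion.2 ⟨θ - (shear ε (Real.tan ρ) : UnitAddCircle), ?_⟩
    rw [← h.leaf]
    exact ⟨ρ, hρ, by simp only [sub_add_cancel]⟩
  · intro hp
    obtain ⟨v, hv⟩ := mem_iUnion.1 hp
    rw [← h.leaf] at hv
    obtain ⟨ρ, hρ, rfl⟩ := hv
    exact ⟨_, ⟨trivial, hρ⟩, rfl⟩

theorem IsAnnulus.image_closed {e e' : Fin n × Bool} {ε : ℤ} {P : UnitAddCircle × ℝ → Torus}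
    (h : IsAnnulus F γ S e e' ε P) (hε : ε = 1 ∨ ε = -1) :
    P '' (univ ×ˢ Icc (-(Real.pi / 2)) (Real.pi / 2)) =
      sideRegion F S e ∪ (range (γ e.1) ∪ range (γ e'.1)) := by
  have hpi := Real.pi_pos
  rw [← h.image_interior]
  ext p
  constructor
  · rintro ⟨⟨θ, ρ⟩, ⟨-, hρ⟩, rfl⟩
    rcases hρ.1.eq_or_lt with h1 | h1
    · obtain rfl : -(Real.pi / 2) = ρ := h1
      exact Or.inr (Or.inl ⟨θ, (h.left θ).symm⟩)
    rcases hρ.2.eq_or_lt with h2 | h2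
    · obtain rfl : ρ = Real.pi / 2 := h2
      exact Or.inr (Or.inr ⟨_, (h.right θ).symm⟩)
    · exact Or.inl ⟨_, ⟨trivial, h1, h2⟩, rfl⟩
  · rintro (⟨z, hz, rfl⟩ | ⟨θ, rfl⟩ | ⟨θ, rfl⟩)
    · exact ⟨z, ⟨trivial, Ioo_subset_Icc_self hz.2⟩, rfl⟩
    · exact ⟨(θ, _), ⟨trivial, ⟨le_rfl, by linarith⟩⟩, h.left θ⟩
    · refine ⟨(ε • θ, Real.pi / 2), ⟨trivial, ⟨by linarith, le_rfl⟩⟩, ?_⟩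
      rw [h.right]
      congr 1
      rcases hε with rfl | rfl <;> simp

theorem IsAnnulus.isCompact {e e' : Fin n × Bool} {ε : ℤ} {P : UnitAddCircle × ℝ → Torus}
    (h : IsAnnulus F γ S e e' ε P) :
    IsCompact (P '' (univ ×ˢ Icc (-(Real.pi / 2)) (Real.pi / 2))) :=
  (isCompact_univ.prod isCompact_Icc).image_of_continuousOn h.cont

theorem CollarSystem.disjoint_range (H : CollarSystem F γ S) {e : Fin n × Bool} {p : Torus}
    (hp : p ∈ sideRegion F S e) (i : Fin n) : p ∉ range (γ i) := by
  rintro ⟨θ, rfl⟩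
  obtain ⟨v, hv⟩ := mem_iUnion.1 hp
  refine H.not_isCompact_leaf e (v, 0) ?_
  rw [← leaf_eq_of_mem hv, ← H.range_eq_leaf]
  exact ((H.compactLeaf _).2 ⟨i, rfl⟩).2

theorem CollarSystem.mem_or (H : CollarSystem F γ S) (hF : F.IsMS) (p : Torus) :
    (∃ i, p ∈ range (γ i)) ∨ ∃ e, p ∈ sideRegion F S e := by
  by_cases hc : IsCompact (F.leaf p)
  · obtain ⟨i, hi⟩ := (H.compactLeaf _).1 ⟨⟨p, rfl⟩, hc⟩
    exact Or.inl ⟨i, hi ▸ mem_leaf_self F p⟩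
  · obtain ⟨c, h1, h2, h3, ⟨K, hK, hlim⟩, -⟩ := hF.asymptotic _ ⟨p, rfl⟩ hc
    obtain ⟨e, u, hu, -⟩ := H.exists_line h1 h2 h3 hc hK hlim
    exact Or.inr ⟨e, mem_iUnion.2 ⟨u, mem_leaf_symm hu⟩⟩

theorem range_eq_of_inter [NeZero n] (h : F.IsGeometricalEnumeration γ) {i j : Fin n} {p : Torus}
    (hi : p ∈ range (γ i)) (hj : p ∈ range (γ j)) : i = j := by
  refine h.distinct ?_
  obtain ⟨q, hq⟩ := (h.isCompactLeaf i).1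
  obtain ⟨q', hq'⟩ := (h.isCompactLeaf j).1
  simp only
  rw [hq, hq', ← leaf_eq_of_mem (show p ∈ F.leaf q from hq ▸ hi),
    ← leaf_eq_of_mem (show p ∈ F.leaf q' from hq' ▸ hj)]

section

variable {π : Fin n × Bool → Fin n × Bool} {ε : Fin n × Bool → ℤ}
  {P : Fin n × Bool → UnitAddCircle × ℝ → Torus}

/-- The complement is a finite union of compact sets: the compact leaves and the closed annuli of
the other sides. -/
theorem SidePairing.isOpen_sideRegion (R : SidePairing F γ S π ε P) (H : CollarSystem F γ S)
    (hF : F.IsMS) (e : Fin n × Bool) : IsOpen (sideRegion F S e) := by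
  have hcl : IsClosed ((⋃ i, range (γ i)) ∪ ⋃ e' : {e' // e' ≠ e ∧ e' ≠ π e},
      P e' '' (univ ×ˢ Icc (-(Real.pi / 2)) (Real.pi / 2))) :=
    (isClosed_iUnion_of_finite fun i => (isCompact_range (γ i).continuous).isClosed).union
      (isClosed_iUnion_of_finite fun e' => (R.annulus e').isCompact.isClosed)
  have : sideRegion F S e = ((⋃ i, range (γ i)) ∪ ⋃ e' : {e' // e' ≠ e ∧ e' ≠ π e},
      P e' '' (univ ×ˢ Icc (-(Real.pi / 2)) (Real.pi / 2)))ᶜ := by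
    ext p
    constructor
    · rintro hp (h | h)
      · obtain ⟨i, hi⟩ := mem_iUnion.1 h
        exact H.disjoint_range hp i hi
      · obtain ⟨⟨e', h1, h2⟩, he'⟩ := mem_iUnion.1 h
        rw [(R.annulus e').image_closed (R.sign e')] at he'
        rcases he' with he' | he' | he'
        · exact (R.disj hp he').elim h1 h2
        · exact H.disjoint_range hp _ he'
        · exact H.disjoint_range hp _ he'
    · intro hp
      rcases H.mem_or hF p with ⟨i, hi⟩ | ⟨e', he'⟩
      · exact absurd (Or.inl (mem_iUnion.2 ⟨i, hi⟩)) hp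
      · by_cases h1 : e' = e
        · rwa [h1] at he'
        by_cases h2 : e' = π e
        · rwa [h2, R.region] at he'
        · refine absurd (Or.inr (mem_iUnion.2 ⟨⟨e', h1, h2⟩, ?_⟩)) hp
          rw [(R.annulus e').image_closed (R.sign e')]
          exact Or.inl he'
  rw [this]
  exact hcl.isOpen_compl

theorem SidePairing.isPreconnected_sideRegion (R : SidePairing F γ S π ε P) (e : Fin n × Bool) :
    IsPreconnected (sideRegion F S e) := by
  rw [← (R.annulus e).image_interior]
  exact (isPreconnected_univ.prod isPreconnected_Ioo).image _
    ((R.annulus e).cont.mono (prod_mono subset_rfl Ioo_subset_Icc_self))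

/-- The side regions are open and connected, two of them are equal or disjoint, and together they
fill the complement. -/
theorem SidePairing.connectedComponentIn_eq (R : SidePairing F γ S π ε P) (H : CollarSystem F γ S)
    (hF : F.IsMS) {e : Fin n × Bool} {p : Torus} (hp : p ∈ sideRegion F S e) :
    connectedComponentIn (⋃ k, range (γ k))ᶜ p = sideRegion F S e := by
  have hsub : sideRegion F S e ⊆ (⋃ k, range (γ k))ᶜ := fun q hq h => by
    obtain ⟨i, hi⟩ := mem_iUnion.1 h
    exact H.disjoint_range hq i hi
  refine Subset.antisymm ?_
    ((R.isPreconnected_sideRegion e).subset_connectedComponentIn hp hsub)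
  set V : Set Torus := ⋃ e' : {e' // e' ≠ e ∧ e' ≠ π e}, sideRegion F S e'
  have hV : IsOpen V := isOpen_iUnion fun e' => R.isOpen_sideRegion H hF e'
  refine isPreconnected_connectedComponentIn.subset_left_of_subset_union
    (R.isOpen_sideRegion H hF e) hV ?_ ?_ ⟨p, mem_connectedComponentIn (hsub hp), hp⟩
  · rw [disjoint_left]
    intro q hq hqV
    obtain ⟨⟨e', h1, h2⟩, he'⟩ := mem_iUnion.1 hqV
    exact (R.disj hq he').elim h1 h2
  · intro q hq
    have hq' := connectedComponentIn_subset _ _ hq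
    obtain ⟨e', he'⟩ := (H.mem_or hF q).resolve_left fun ⟨i, hi⟩ => hq' (mem_iUnion.2 ⟨i, hi⟩)
    by_cases h1 : e' = e
    · left; rwa [h1] at he'
    by_cases h2 : e' = π e
    · left; rwa [h2, R.region] at he'
    · exact Or.inr (mem_iUnion.2 ⟨⟨e', h1, h2⟩, he'⟩)

theorem SidePairing.frontier_eq (R : SidePairing F γ S π ε P) (H : CollarSystem F γ S)
    (hF : F.IsMS) (e : Fin n × Bool) :
    frontier (sideRegion F S e) = range (γ e.1) ∪ range (γ (π e).1) := by
  have hpi := Real.pi_pos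
  have hcl : closure (sideRegion F S e) =
      sideRegion F S e ∪ (range (γ e.1) ∪ range (γ (π e).1)) := by
    rw [← (R.annulus e).image_closed (R.sign e)]
    refine Subset.antisymm (closure_minimal ?_ (R.annulus e).isCompact.isClosed) ?_
    · rw [← (R.annulus e).image_interior]
      exact image_mono (prod_mono subset_rfl Ioo_subset_Icc_self)
    · have hc : closure ((univ : Set UnitAddCircle) ×ˢ Ioo (-(Real.pi / 2)) (Real.pi / 2)) =
          univ ×ˢ Icc (-(Real.pi / 2)) (Real.pi / 2) := by
        rw [closure_prod_eq, closure_univ, closure_Ioo (by linarith)]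
      rw [← hc, ← (R.annulus e).image_interior]
      exact ContinuousOn.image_closure (by rw [hc]; exact (R.annulus e).cont)
  rw [(R.isOpen_sideRegion H hF e).frontier_eq, hcl, union_sdiff_left]
  refine sdiff_eq_left.2 (disjoint_left.2 ?_)
  rintro p (hp | hp) hp'
  · exact H.disjoint_range hp' _ hp
  · exact H.disjoint_range hp' _ hp

theorem SidePairing.index_eq [NeZero n] (R : SidePairing F γ S π ε P) (H : CollarSystem F γ S)
    (hF : F.IsMS) (hγ : F.IsGeometricalEnumeration γ) {e : Fin n × Bool} {i j : Fin n}
    (h : frontier (sideRegion F S e) = range (γ i) ∪ range (γ j)) :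
    ({e.1, (π e).1} : Set (Fin n)) = {i, j} := by
  rw [R.frontier_eq H hF] at h
  have key : ∀ {a b c d : Fin n}, range (γ a) ∪ range (γ b) = range (γ c) ∪ range (γ d) →
      ({a, b} : Set (Fin n)) ⊆ {c, d} := by
    intro a b c d h x hx
    have h1 : γ x 0 ∈ range (γ c) ∪ range (γ d) := by
      rw [← h]
      rcases hx with rfl | rfl
      · exact Or.inl (mem_range_self _)
      · exact Or.inr (mem_range_self _)
    exact h1.imp (fun h => range_eq_of_inter hγ (mem_range_self _) h)
      (fun h => range_eq_of_inter hγ (mem_range_self _) h)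
  exact Subset.antisymm (key h) (key h.symm)

theorem SidePairing.exists_side [NeZero n] (R : SidePairing F γ S π ε P) (H : CollarSystem F γ S)
    (hF : F.IsMS) (hγ : F.IsGeometricalEnumeration γ) (i : Fin n) :
    ∃ e : Fin n × Bool, e.1 = i ∧ (π e).1 = i + 1 := by
  obtain ⟨A, ⟨x, hx, rfl⟩, hfr, -⟩ := hγ.bounds i
  obtain ⟨e, he⟩ := (H.mem_or hF x).resolve_left fun ⟨i, hi⟩ => hx (mem_iUnion.2 ⟨i, hi⟩)
  rw [R.connectedComponentIn_eq H hF he] at hfr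
  have h := R.index_eq H hF hγ hfr
  have h1 : i ∈ ({e.1, (π e).1} : Set (Fin n)) := h ▸ Or.inl rfl
  have h2 : i + 1 ∈ ({e.1, (π e).1} : Set (Fin n)) := h ▸ Or.inr rfl
  have h3 : e.1 ∈ ({i, i + 1} : Set (Fin n)) := h ▸ Or.inl rfl
  have h4 : (π e).1 ∈ ({i, i + 1} : Set (Fin n)) := h ▸ Or.inr rfl
  simp only [mem_insert_iff, mem_singleton_iff] at h1 h2 h3 h4
  by_cases h5 : e.1 = i
  · exact ⟨e, h5, by grind⟩
  · exact ⟨π e, by grind, by rw [R.invol]; grind⟩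

/-- The component on the right of `γ 0` may touch `γ 0` from both sides, as when `n = 1`, so the
correct side is found by proximity: arbitrarily deep points of its half collar must accumulate at `g
0` within the right-hand region. -/
theorem SidePairing.exists_right_side [NeZero n] (R : SidePairing F γ S π ε P)
    (H : CollarSystem F γ S) (hF : F.IsMS) (hγ : F.IsGeometricalEnumeration γ) :
    ∃ e : Fin n × Bool, e.1 = 0 ∧ (π e).1 = 0 + 1 ∧ ∃ g, Torus.IsLift (γ 0) g ∧
      ∀ D : ℝ, ∃ᶠ p in 𝓝 (g 0), p ∈ Torus.rightOf g ∧ ∃ u d, D < d ∧ S e (u, d) = Torus.proj p := by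
  obtain ⟨A, ⟨x, hx, rfl⟩, hfr, hright⟩ := hγ.bounds 0
  obtain ⟨e, he⟩ := (H.mem_or hF x).resolve_left fun ⟨i, hi⟩ => hx (mem_iUnion.2 ⟨i, hi⟩)
  obtain ⟨g, hg, hgr⟩ := hright rfl
  rw [R.connectedComponentIn_eq H hF he] at hfr hgr
  have hproj : Continuous Torus.proj :=
    ((AddCircle.continuous_mk' 1).comp continuous_fst).prodMk
      ((AddCircle.continuous_mk' 1).comp continuous_snd)
  have hfreq := mem_closure_iff_frequently.1 (hgr (mem_range_self 0))
  obtain ⟨b, hb⟩ : ∃ b, ∀ D : ℝ, ∃ᶠ p in 𝓝 (g 0), p ∈ Torus.proj ⁻¹' sideRegion F S e ∩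
      Torus.rightOf g ∧ ∃ u d, D < d ∧ S (0, b) (u, d) = Torus.proj p := by
    -- If each half collar failed beyond some depth, the points of the component near `g 0` on the
    -- right would have nowhere to be, since the deep parts of both half collars and the leaf fill a
    -- neighbourhood.
    by_contra! hcon
    obtain ⟨D₁, h₁⟩ := hcon true
    obtain ⟨D₂, h₂⟩ := hcon false
    have hnear := (H.collar 0).nhds (max D₁ D₂) ((0 : ℝ) : UnitAddCircle)
    rw [← hg.2] at hnear
    obtain ⟨p, hp, h1, h2, h3⟩ := (hfreq.and_eventually (h₁.and
      (h₂.and (hproj.continuousAt.eventually hnear)))).exists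
    obtain ⟨b, u, d, hd, hud⟩ := h3.resolve_left (H.disjoint_range hp.1 0)
    cases b
    · exact h2 hp u d ((le_max_right _ _).trans_lt hd) hud
    · exact h1 hp u d ((le_max_left _ _).trans_lt hd) hud
  obtain ⟨p, ⟨hpA, -⟩, u, d, -, hud⟩ := (hb 0).exists
  have hpS : Torus.proj p ∈ sideRegion F S (0, b) :=
    mem_iUnion.2 ⟨u, hud ▸ H.line_mem_leaf (0, b) u 0 d⟩
  have hreg : sideRegion F S (0, b) = sideRegion F S e := by
    rcases R.disj hpA hpS with h | h
    · rw [h]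
    · rw [h, R.region]
  rw [← hreg] at hfr
  have h := R.index_eq H hF hγ hfr
  have h2 : (0 + 1 : Fin n) ∈ ({0, (π (0, b)).1} : Set (Fin n)) := h ▸ Or.inr rfl
  have h4 : (π (0, b)).1 ∈ ({0, 0 + 1} : Set (Fin n)) := h ▸ Or.inr rfl
  simp only [mem_insert_iff, mem_singleton_iff] at h2 h4
  exact ⟨(0, b), rfl, by grind, g, hg, fun D => (hb D).mono fun p hp => ⟨hp.1.2, hp.2⟩⟩

end

/-! ### Cyclic order of the annuli. -/

/-- Going round the torus: the sides are ordered so that each annulus ends where the next one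
starts. -/
theorem exists_cyclic_sides {n : ℕ} [NeZero n] {π : Fin n × Bool → Fin n × Bool}
    (hne : ∀ e, π e ≠ e) (hinv : ∀ e, π (π e) = e)
    (hex : ∀ i : Fin n, ∃ e : Fin n × Bool, e.1 = i ∧ (π e).1 = i + 1) {e₀ : Fin n × Bool}
    (h0 : e₀.1 = 0) (h1 : (π e₀).1 = 0 + 1) :
    ∃ E : Fin n → Fin n × Bool, E 0 = e₀ ∧ (∀ i, (E i).1 = i) ∧
      ∀ i, π (E i) = (i + 1, !(E (i + 1)).2) := by
  have hbool : ∀ {e e' : Fin n × Bool}, e.1 = e'.1 → e ≠ e' → e = (e'.1, !e'.2) := by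
    rintro ⟨a, b⟩ ⟨c, d⟩ h hne
    simp only at h
    subst h
    cases b <;> cases d <;> simp_all
  -- For `n ≥ 3` the indices `i` and `i + 2` differ, so consecutive annuli arrive at and leave `γ (i
  -- + 1)` on different sides. For `n = 1` and `n = 2` the bounding leaves do not determine the
  -- annulus, and the sides are chosen from the pairing itself.
  by_cases h3 : 3 ≤ n
  · choose E hE1 hE2 using hex
    classical
    set E' : Fin n → Fin n × Bool := fun i => if i = 0 then e₀ else E i with hE'
    have a1 : ∀ i, (E' i).1 = i := fun i => by
      by_cases h : i = 0
      · simp only [hE', h, if_true, h0]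
      · simp only [hE', h, if_false, hE1]
    have a2 : ∀ i, (π (E' i)).1 = i + 1 := fun i => by
      by_cases h : i = 0
      · simp only [hE', h, if_true, h1]
      · simp only [hE', h, if_false, hE2]
    refine ⟨E', if_pos rfl, a1, fun i => ?_⟩
    have := hbool (e := π (E' i)) (e' := E' (i + 1)) ((a2 i).trans (a1 _).symm) fun h => by
      have h4 := a2 (i + 1)
      rw [← h, hinv, a1] at h4
      have h5 : (1 + 1 : Fin n) = 0 := by
        have : i + (1 + 1) = i + 0 := by rw [← add_assoc, ← h4, add_zero]
        exact add_left_cancel this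
      have h6 := congrArg Fin.val h5
      obtain ⟨k, rfl⟩ : ∃ k, n = k + 3 := ⟨n - 3, by omega⟩
      simp [Fin.val_add, Nat.mod_eq_of_lt] at h6
    rw [this, a1]
  · obtain ⟨a, b⟩ := e₀
    simp only at h0
    subst h0
    have hn0 := NeZero.pos n
    obtain rfl | rfl : n = 1 ∨ n = 2 := by omega
    · refine ⟨fun _ => (0, b), rfl, fun i => Subsingleton.elim _ _, fun i => ?_⟩
      have := hbool (e := π (0, b)) (e' := (0, b)) (Subsingleton.elim _ _) (hne _)
      rw [this]
      exact Prod.ext (Subsingleton.elim _ _) rfl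
    · have e1 : π (0, b) = (1, (π (0, b)).2) := Prod.ext h1 rfl
      set b' := (π (0, b)).2
      -- Two of the four sides are already paired with each other, so a fixed-point-free involution
      -- pairs the other two.
      have e2 : π (1, !b') = (0, !b) := by
        have f1 := hne (1, !b')
        have f2 : π (1, !b') ≠ (1, b') := fun h => by
          have := congrArg π h
          rw [hinv, ← e1, hinv] at this
          simp at this
        have f3 : π (1, !b') ≠ (0, b) := fun h => by
          have := congrArg π h
          rw [hinv, e1] at this
          simp at this
        generalize π (1, !b') = e at f1 f2 f3
        obtain ⟨c, d⟩ := e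
        fin_cases c <;> cases d <;> cases b <;> cases b' <;> simp_all
      refine ⟨![(0, b), (1, !b')], rfl, fun i => ?_, fun i => ?_⟩
      · fin_cases i <;> rfl
      · fin_cases i
        · simp [e1]
        · simp [e2]

/-- The torus as a cyclic union of `n` closed annuli foliated in the standard way. -/
structure Strips (F : OneFoliation Torus) {n : ℕ} [NeZero n] (γ : Fin n → C(UnitAddCircle, Torus))
    (ε : Fin n → ℤ) (P : Fin n → UnitAddCircle × ℝ → Torus) : Prop where
  sign : ∀ i, ε i = 1 ∨ ε i = -1
  cont : ∀ i, ContinuousOn (P i) (univ ×ˢ Icc (-(Real.pi / 2)) (Real.pi / 2))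
  left : ∀ i θ, P i (θ, -(Real.pi / 2)) = γ i θ
  right : ∀ i θ, P i (θ, Real.pi / 2) = γ (i + 1) (ε i • θ)
  inj : ∀ {i j z w}, z ∈ univ ×ˢ Ioo (-(Real.pi / 2)) (Real.pi / 2) →
    w ∈ univ ×ˢ Ioo (-(Real.pi / 2)) (Real.pi / 2) → P i z = P j w → i = j ∧ z = w
  notMem : ∀ {i z}, z ∈ univ ×ˢ Ioo (-(Real.pi / 2)) (Real.pi / 2) → ∀ j, P i z ∉ range (γ j)
  γ_inj : ∀ {i j θ θ'}, γ i θ = γ j θ' → i = j ∧ θ = θ'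
  cover : ∀ p, ∃ i, ∃ z ∈ univ ×ˢ Icc (-(Real.pi / 2)) (Real.pi / 2), P i z = p
  leaf : ∀ i (v : UnitAddCircle), ∀ ρ ∈ Ioo (-(Real.pi / 2)) (Real.pi / 2),
    F.leaf (P i (v + (shear (ε i) (Real.tan ρ) : UnitAddCircle), ρ)) =
      (fun ρ => P i (v + (shear (ε i) (Real.tan ρ) : UnitAddCircle), ρ)) ''
        Ioo (-(Real.pi / 2)) (Real.pi / 2)
  leaf_γ : ∀ i θ, F.leaf (γ i θ) = range (γ i)
  rightSide : ∃ g, Torus.IsLift (γ 0) g ∧ ∀ η > 0, ∃ᶠ p in 𝓝 (g 0), p ∈ Torus.rightOf g ∧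
    ∃ θ, ∃ ρ ∈ Ioo (-(Real.pi / 2)) (-(Real.pi / 2) + η), P 0 (θ, ρ) = Torus.proj p

theorem IsGeometricalEnumeration.exists_strips [NeZero n] (hγ : F.IsGeometricalEnumeration γ)
    (hF : F.IsMS) : ∃ ε P, Strips F γ ε P := by
  obtain ⟨S, H⟩ := hγ.exists_collarSystem
  obtain ⟨π, ε, P, R⟩ := H.exists_sidePairing hF
  obtain ⟨e₀, h0, h1, hright⟩ := R.exists_right_side H hF hγ
  obtain ⟨E, hE0, hE1, hE2⟩ := exists_cyclic_sides R.ne R.invol (R.exists_side H hF hγ) h0 h1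
  have himg : ∀ i, P (E i) '' (univ ×ˢ Ioo (-(Real.pi / 2)) (Real.pi / 2)) = sideRegion F S (E i) :=
    fun i => (R.annulus (E i)).image_interior
  -- The two sides of a compact leaf are the start of its own annulus and the end of the preceding
  -- one, so no region is missed.
  have hall : ∀ e, ∃ i, sideRegion F S e = sideRegion F S (E i) := by
    rintro ⟨j, b⟩
    obtain ⟨i, rfl⟩ : ∃ i : Fin n, i + 1 = j := ⟨j - 1, sub_add_cancel j 1⟩
    by_cases hb : b = (E (i + 1)).2
    · exact ⟨i + 1, by rw [show (i + 1, b) = E (i + 1) from Prod.ext (hE1 _).symm hb]⟩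
    · refine ⟨i, ?_⟩
      rw [← R.region (E i), hE2]
      congr 2
      cases b <;> cases h : (E (i + 1)).2 <;> simp_all
  refine ⟨fun i => ε (E i), fun i => P (E i), fun i => R.sign _, fun i => (R.annulus _).cont,
    fun i θ => by rw [(R.annulus _).left, hE1], fun i θ => by rw [(R.annulus _).right, hE2], ?_, ?_,
    ?_, ?_, ?_, ?_, ?_⟩
  · intro i j z w hz hw hzw
    have m1 : P (E i) z ∈ sideRegion F S (E i) := himg i ▸ mem_image_of_mem _ hz
    have m2 : P (E i) z ∈ sideRegion F S (E j) := hzw ▸ himg j ▸ mem_image_of_mem _ hw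
    have hij : i = j := by
      rcases R.disj m1 m2 with h | h
      · rw [← hE1 i, ← h, hE1]
      · rw [hE2] at h
        have h2 := congrArg Prod.fst h
        simp only [hE1] at h2
        subst h2
        have h3 := congrArg Prod.snd h
        simp at h3
    subst hij
    exact ⟨rfl, (R.annulus _).inj hz hw hzw⟩
  · intro i z hz j
    exact H.disjoint_range (himg i ▸ mem_image_of_mem _ hz) j
  · intro i j θ θ' h
    have hij := range_eq_of_inter hγ (mem_range_self θ) ⟨θ', h.symm⟩
    subst hij
    exact ⟨rfl, (hγ.contracting i).1 h⟩
  · intro p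
    rcases H.mem_or hF p with ⟨i, hi⟩ | ⟨e, he⟩
    · refine ⟨i, ?_⟩
      have : p ∈ P (E i) '' (univ ×ˢ Icc (-(Real.pi / 2)) (Real.pi / 2)) := by
        rw [(R.annulus _).image_closed (R.sign _), hE1]
        exact Or.inr (Or.inl hi)
      exact this
    · obtain ⟨i, hi⟩ := hall e
      refine ⟨i, ?_⟩
      have : p ∈ P (E i) '' (univ ×ˢ Icc (-(Real.pi / 2)) (Real.pi / 2)) := by
        rw [(R.annulus _).image_closed (R.sign _), ← hi]
        exact Or.inl he
      exact this
  · intro i v ρ hρ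
    have h1 := (R.annulus (E i)).leaf v
    rw [h1]
    refine leaf_eq_of_mem ?_
    rw [← h1]
    exact mem_image_of_mem _ hρ
  · exact fun i θ => (H.range_eq_leaf i θ).symm
  · obtain ⟨g, hg, hfreq⟩ := hright
    refine ⟨g, hg, fun η hη => ?_⟩
    obtain ⟨N, hN⟩ := (R.annulus e₀).collar
    have hat : ∀ᶠ t in atBot, Real.arctan t < -(Real.pi / 2) + η :=
      (tendsto_nhds_of_tendsto_nhdsWithin Real.tendsto_arctan_atBot).eventually_lt_const (by linarith)
    obtain ⟨t₀, ht₀⟩ := eventually_atBot.1 hat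
    refine (hfreq (max N (-t₀))).mono ?_
    rintro p ⟨hp, u, d, hd, hud⟩
    have h1 := (le_max_left _ _).trans_lt hd
    have h2 := (le_max_right _ _).trans_lt hd
    refine ⟨hp, u + (shear (ε e₀) (-d) : UnitAddCircle), Real.arctan (-d),
      ⟨Real.neg_pi_div_two_lt_arctan _, ht₀ _ (by linarith)⟩, ?_⟩
    rw [hE0, hN u (-d) (by linarith), neg_neg, hud]

end OneFoliation

/-! ### Lifts to the plane and homotopy classes. -/

namespace Torus

theorem continuous_proj : Continuous proj :=
  ((AddCircle.continuous_mk' 1).comp continuous_fst).prodMk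
    ((AddCircle.continuous_mk' 1).comp continuous_snd)

/-- A lattice vector, as a vector of the plane. -/
def ofInt (m : ℤ × ℤ) : ℝ × ℝ := ((m.1 : ℝ), (m.2 : ℝ))

theorem proj_add_ofInt (p : ℝ × ℝ) (m : ℤ × ℤ) : proj (p + ofInt m) = proj p :=
  Prod.ext (coe_add_int _ _) (coe_add_int _ _)

theorem exists_of_proj_eq {p q : ℝ × ℝ} (h : proj p = proj q) : ∃ m, q = p + ofInt m := by
  obtain ⟨k, hk⟩ := exists_int_of_coe_eq (Prod.ext_iff.1 h.symm).1
  obtain ⟨l, hl⟩ := exists_int_of_coe_eq (Prod.ext_iff.1 h.symm).2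
  exact ⟨(k, l), Prod.ext hk hl⟩

theorem ofInt_injective : Function.Injective ofInt := fun m m' h => by
  have := Prod.ext_iff.1 h
  simp only [ofInt, Int.cast_inj] at this
  exact Prod.ext this.1 this.2

theorem eq_add_of_proj_eq {X : Type*} [TopologicalSpace X] [PreconnectedSpace X]
    {H H' : X → ℝ × ℝ} (hH : Continuous H) (hH' : Continuous H')
    (h : ∀ x, proj (H x) = proj (H' x)) : ∃ m, ∀ x, H' x = H x + ofInt m := by
  rcases isEmpty_or_nonempty X with hX | ⟨⟨x₀⟩⟩
  · exact ⟨0, fun x => (hX.false x).elim⟩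
  obtain ⟨m, hm⟩ := exists_of_proj_eq (h x₀)
  choose M hM using fun x => exists_of_proj_eq (h x)
  refine ⟨m, fun x => ?_⟩
  have key : ∀ x, H' x - H x = ofInt (M x) := fun x => by rw [hM x]; abel
  have hc : Continuous fun x => H' x - H x := hH'.sub hH
  have h1 := eq_of_continuous_of_int (g := fun x => (H' x - H x).1) (by fun_prop)
    (fun x => ⟨(M x).1, by rw [key]; rfl⟩) x x₀
  have h2 := eq_of_continuous_of_int (g := fun x => (H' x - H x).2) (by fun_prop)
    (fun x => ⟨(M x).2, by rw [key]; rfl⟩) x x₀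
  have h3 : H' x - H x = H' x₀ - H x₀ := Prod.ext h1 h2
  rw [hm, add_sub_cancel_left] at h3
  rw [← h3]; abel

theorem exists_lift {X : Type*} [TopologicalSpace X] [SimplyConnectedSpace X]
    [LocallyPathConnectedSpace X] {f : X → Torus} (hf : Continuous f) {x₀ : X} {e₀ : ℝ × ℝ}
    (he : proj e₀ = f x₀) :
    ∃ H : X → ℝ × ℝ, Continuous H ∧ (∀ x, proj (H x) = f x) ∧ H x₀ = e₀ := by
  obtain ⟨H₁, ⟨h₁, h₁'⟩, -⟩ :=
    (AddCircle.isCoveringMap_coe (1 : ℝ)).existsUnique_continuousMap_lifts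
      ⟨fun x => (f x).1, continuous_fst.comp hf⟩ x₀ e₀.1 (Prod.ext_iff.1 he).1
  obtain ⟨H₂, ⟨h₂, h₂'⟩, -⟩ :=
    (AddCircle.isCoveringMap_coe (1 : ℝ)).existsUnique_continuousMap_lifts
      ⟨fun x => (f x).2, continuous_snd.comp hf⟩ x₀ e₀.2 (Prod.ext_iff.1 he).2
  exact ⟨fun x => (H₁ x, H₂ x), H₁.continuous.prodMk H₂.continuous,
    fun x => Prod.ext (congrFun h₁' x) (congrFun h₂' x), Prod.ext h₁ h₂⟩

variable {γ γ' : C(UnitAddCircle, Torus)} {g g' : ℝ → ℝ × ℝ}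

theorem IsLift.exists_eq_add (h : IsLift γ g) (h' : IsLift γ g') : ∃ m, ∀ t, g' t = g t + ofInt m :=
  eq_add_of_proj_eq h.1 h'.1 fun t => (h.2 t).trans (h'.2 t).symm

theorem IsLift.exists_period (h : IsLift γ g) :
    ∃ m, g 1 - g 0 = ofInt m ∧ ∀ t, g (t + 1) = g t + ofInt m := by
  obtain ⟨m, hm⟩ := eq_add_of_proj_eq h.1 (h.1.comp (continuous_add_const 1)) fun t => by
    have := h.2 (t + 1)
    have h1 := coe_add_int t 1
    push_cast at h1
    rw [h1] at this
    rw [h.2 t, ← this]; rfl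
  refine ⟨m, ?_, hm⟩
  have := hm 0
  simp only [Function.comp, zero_add] at this
  rw [this]; abel

theorem IsLift.add_one (h : IsLift γ g) (t : ℝ) : g (t + 1) = g t + (g 1 - g 0) := by
  obtain ⟨m, h1, h2⟩ := h.exists_period
  rw [h1, h2]

theorem IsLift.add_int (h : IsLift γ g) (t : ℝ) (k : ℤ) : g (t + k) = g t + k • (g 1 - g 0) := by
  have h1 : ∀ t : ℝ, ∀ k : ℕ, g (t + k) = g t + k • (g 1 - g 0) := fun t k => by
    induction k with
    | zero => simp
    | succ k ih =>
      rw [Nat.cast_add_one, ← add_assoc, h.add_one, ih, succ_nsmul, add_assoc]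
  obtain ⟨k, rfl | rfl⟩ := k.eq_nat_or_neg
  · simpa using h1 t k
  · have := h1 (t + (-(k : ℤ) : ℤ)) k
    push_cast at this ⊢
    rw [neg_add_cancel_right] at this
    rw [this]
    simp

/-- The class of the closed curve `γ` in the fundamental group of the torus is `v`. -/
def HasClass (γ : C(UnitAddCircle, Torus)) (v : ℝ × ℝ) : Prop :=
  ∃ g, IsLift γ g ∧ g 1 - g 0 = v

theorem IsLift.hasClass (h : IsLift γ g) : HasClass γ (g 1 - g 0) := ⟨g, h, rfl⟩

theorem HasClass.eq {v w : ℝ × ℝ} (h : HasClass γ v) (h' : HasClass γ w) : v = w := by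
  obtain ⟨g, hg, rfl⟩ := h
  obtain ⟨g', hg', rfl⟩ := h'
  obtain ⟨m, hm⟩ := hg.exists_eq_add hg'
  rw [hm, hm]; abel

/-- In a lift of the homotopy the end-to-start displacement of each curve is a lattice vector
depending continuously on the curve, hence constant. -/
theorem HasClass.of_homotopic {v : ℝ × ℝ} (h : HasClass γ v) (hγ : γ.Homotopic γ') :
    HasClass γ' v := by
  obtain ⟨g, hg, rfl⟩ := h
  obtain ⟨K⟩ := hγ
  obtain ⟨H, h1, h2, -⟩ := exists_lift
    (f := fun z : ℝ × ℝ => K (projIcc 0 1 zero_le_one z.1, (z.2 : UnitAddCircle)))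
    (x₀ := (0, 0)) (e₀ := g 0) (by have := AddCircle.continuous_mk' (1 : ℝ); fun_prop)
    (by rw [hg.2]; simp)
  have hL : ∀ s : ℝ, IsLift ⟨fun θ => K (projIcc 0 1 zero_le_one s, θ), by fun_prop⟩
      fun t => H (s, t) := fun s => ⟨by fun_prop, fun t => h2 (s, t)⟩
  choose m hm using fun s => (hL s).exists_period
  obtain ⟨k, hk⟩ := eq_add_of_proj_eq (H := fun s => H (s, 0)) (H' := fun s => H (s, 1))
    (by fun_prop) (by fun_prop) fun s => by
      have := (hm s).1
      rw [sub_eq_iff_eq_add'] at this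
      simp only [this, proj_add_ofInt]
  have e0 : IsLift γ fun t => H (0, t) := ⟨by fun_prop, fun t => by rw [h2]; simp⟩
  have e1 : IsLift γ' fun t => H (1, t) := ⟨by fun_prop, fun t => by rw [h2]; simp⟩
  rw [hg.hasClass.eq e0.hasClass]
  refine ⟨_, e1, ?_⟩
  simp only [hk]; abel

/-- The rotation by the sign `ε` of the parameter of a closed curve. -/
def signMap (ε : ℤ) : C(UnitAddCircle, UnitAddCircle) := ⟨fun θ => ε • θ, continuous_zsmul ε⟩

theorem HasClass.comp_signMap {v : ℝ × ℝ} {ε : ℤ} (h : HasClass γ v) :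
    HasClass (γ.comp (signMap ε)) (ε • v) := by
  obtain ⟨g, hg, rfl⟩ := h
  refine ⟨fun t => g (ε * t), ⟨hg.1.comp (by fun_prop), fun t => ?_⟩, ?_⟩
  · rw [hg.2]
    rw [← zsmul_eq_mul]
    rfl
  · have := hg.add_int 0 ε
    simp only [zero_add] at this
    simp [this]

end Torus

/-! ### The signs and the combinatorial type determine each other. -/

namespace OneFoliation

variable {F G : OneFoliation Torus} {n : ℕ} [NeZero n] {γ γ' : Fin n → C(UnitAddCircle, Torus)}
  {ε ε' : Fin n → ℤ} {P P' : Fin n → UnitAddCircle × ℝ → Torus}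

namespace Strips

open scoped Fin.NatCast

/-- The annulus `P i` is the homotopy. -/
theorem homotopic (S : Strips F γ ε P) (i : Fin n) :
    (γ i).Homotopic ((γ (i + 1)).comp (Torus.signMap (ε i))) := by
  have hpi := Real.pi_pos
  refine ⟨⟨⟨fun z : unitInterval × UnitAddCircle => P i (z.2, -(Real.pi / 2) + z.1 * Real.pi), ?_⟩,
    fun θ => ?_, fun θ => ?_⟩⟩
  · refine (S.cont i).comp_continuous (by fun_prop) fun z => ⟨trivial, ?_, ?_⟩
    · nlinarith [z.1.2.1]
    · nlinarith [z.1.2.2]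
  · simp [S.left]
  · simp only [Icc.coe_one]
    rw [show -(Real.pi / 2) + 1 * Real.pi = Real.pi / 2 by ring, S.right]
    rfl

theorem homotopic_prod (S : Strips F γ ε P) (k : ℕ) :
    (γ 0).Homotopic ((γ (k : Fin n)).comp
      (Torus.signMap (∏ j ∈ Finset.range k, ε (j : Fin n)))) := by
  induction k with
  | zero =>
    have : (γ ((0 : ℕ) : Fin n)).comp (Torus.signMap 1) = γ 0 := by
      ext θ : 1
      simp [Torus.signMap]
    rw [Finset.range_zero, Finset.prod_empty, this]
  | succ k ih =>
    refine ih.trans ?_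
    have h := (S.homotopic (k : Fin n)).comp
      (.refl (Torus.signMap (∏ j ∈ Finset.range k, ε (j : Fin n))))
    convert h using 1
    ext θ : 1
    simp [Torus.signMap, Finset.prod_range_succ, mul_comm, mul_smul]

theorem prod_sign (S : Strips F γ ε P) (k : ℕ) :
    ∏ j ∈ Finset.range k, ε (j : Fin n) = 1 ∨ ∏ j ∈ Finset.range k, ε (j : Fin n) = -1 := by
  induction k with
  | zero => simp
  | succ k ih =>
    rw [Finset.prod_range_succ]
    rcases ih with h | h <;> rcases S.sign k with h' | h' <;> simp [h, h']

/-- If the product were `-1` and the curves were homotopic, the class of `γ 0` would equal its own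
negative and vanish. -/
theorem homotopic_iff (S : Strips F γ ε P) (k : ℕ) :
    (γ (k : Fin n)).Homotopic (γ 0) ↔ ∏ j ∈ Finset.range k, ε (j : Fin n) = 1 := by
  have h := S.homotopic_prod k
  constructor
  · intro hk
    refine (S.prod_sign k).resolve_right fun h1 => ?_
    obtain ⟨g, hg, hright⟩ := S.rightSide
    obtain ⟨p, ⟨q, -, hq⟩, -⟩ := (hright 1 one_pos).exists
    rw [h1] at h
    have c1 := hg.hasClass.of_homotopic h
    have c2 := (hg.hasClass.of_homotopic hk.symm).comp_signMap (ε := -1)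
    have := c1.eq c2
    rw [neg_one_smul, eq_neg_iff_add_eq_zero, ← two_smul ℝ, smul_eq_zero] at this
    -- The class is nonzero because the right-hand region is nonempty and is defined by a strict
    -- inequality for the cross product with the class.
    have h0 := hq 0
    rw [this.resolve_left two_ne_zero] at h0
    simp [Torus.cross] at h0
  · intro h1
    rw [h1] at h
    have : (γ (k : Fin n)).comp (Torus.signMap 1) = γ k := by
      ext θ : 1
      simp [Torus.signMap]
    rw [this] at h
    exact h.symm

/-- The homotopies fix all partial products of the signs, and a sign is the quotient of two
consecutive ones. The last sign uses the full product of length `n`, where the index wraps round to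
`0`. -/
theorem sign_eq (S : Strips F γ ε P) (S' : Strips G γ' ε' P')
    (h : ∀ i, (γ i).Homotopic (γ 0) ↔ (γ' i).Homotopic (γ' 0)) : ε = ε' := by
  have hp : ∀ k, ∏ j ∈ Finset.range k, ε (j : Fin n) = ∏ j ∈ Finset.range k, ε' (j : Fin n) := by
    intro k
    have h1 := h (k : Fin n)
    rw [S.homotopic_iff, S'.homotopic_iff] at h1
    rcases S.prod_sign k with h2 | h2 <;> rcases S'.prod_sign k with h3 | h3 <;>
      rw [h2, h3] at h1 ⊢ <;> norm_num at h1
  funext i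
  have h1 := hp i
  have h2 := hp (i + 1)
  rw [Finset.prod_range_succ, Finset.prod_range_succ, h1] at h2
  simp only [Fin.cast_val_eq_self] at h2
  refine mul_left_cancel₀ (fun h0 => ?_) h2
  rcases S'.prod_sign i with h3 | h3 <;> omega

end Strips

end OneFoliation

/-! ### The two sides of the lift of a closed curve. -/

theorem lt_of_forall_ne {f : ℝ → ℝ} (hf : Continuous f) {c : ℝ} (h : ∀ t, f t ≠ c) {a : ℝ}
    (ha : f a < c) (b : ℝ) : f b < c := by
  by_contra! hb
  obtain ⟨t, ht⟩ := mem_range_of_exists_le_of_exists_ge hf ⟨a, ha.le⟩ ⟨b, hb⟩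
  exact h t ht

theorem gt_of_forall_ne {f : ℝ → ℝ} (hf : Continuous f) {c : ℝ} (h : ∀ t, f t ≠ c) {a : ℝ}
    (ha : c < f a) (b : ℝ) : c < f b := by
  by_contra! hb
  obtain ⟨t, ht⟩ := mem_range_of_exists_le_of_exists_ge hf ⟨b, hb⟩ ⟨a, ha.le⟩
  exact h t ht

/-- A map from the rectangle to the plane that sends the four sides to the four half-planes, in
cyclic order, has a zero. -/
theorem exists_zero_of_sides {E : ℝ × ℝ → ℂ} (hE : Continuous E) {a b c d : ℝ}
    (h1 : ∀ t, 0 < (E (a, t)).im) (h2 : ∀ t, (E (b, t)).im < 0) (h3 : ∀ s, 0 < (E (s, c)).re)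
    (h4 : ∀ s, (E (s, d)).re < 0) : ∃ z, E z = 0 := by
  by_contra! h0
  obtain ⟨L, hL, hexp⟩ := exists_continuous_log hE h0
  have him : ∀ z, (E z).im = Real.exp (L z).re * Real.sin (L z).im := fun z => by
    rw [← hexp, Complex.exp_im]
  have hre : ∀ z, (E z).re = Real.exp (L z).re * Real.cos (L z).im := fun z => by
    rw [← hexp, Complex.exp_re]
  -- `f` is a continuous argument of `E`, normalized at one corner. Following it along the sides in
  -- the two ways round to the opposite corner `(b, d)` gives a value above `π / 2` and a negative
  -- value.
  obtain ⟨f, hf, hsin, hcos, hac⟩ : ∃ f : ℝ × ℝ → ℝ, Continuous f ∧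
      (∀ z, (E z).im = Real.exp (L z).re * Real.sin (f z)) ∧
      (∀ z, (E z).re = Real.exp (L z).re * Real.cos (f z)) ∧ f (a, c) ∈ Ico 0 (0 + 2 * Real.pi) := by
    refine ⟨fun z => (L z).im - toIcoDiv Real.two_pi_pos 0 (L (a, c)).im • (2 * Real.pi), by fun_prop,
      fun z => ?_, fun z => ?_, sub_toIcoDiv_zsmul_mem_Ico _ _ _⟩
    · rw [him, zsmul_eq_mul, Real.sin_sub_int_mul_two_pi]
    · rw [hre, zsmul_eq_mul, Real.cos_sub_int_mul_two_pi]
  have hpi := Real.pi_pos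
  have hneg : ∀ {x y : ℝ}, Real.exp x * y < 0 → y < 0 := fun {x y} h => by
    by_contra! h'
    exact (mul_nonneg (Real.exp_pos x).le h').not_gt h
  simp only [hsin, hcos, mul_pos_iff_of_pos_left (Real.exp_pos _)] at h1 h2 h3 h4
  replace h2 := fun t => hneg (h2 t)
  replace h4 := fun s => hneg (h4 s)
  have n1 : f (a, c) < Real.pi / 2 := by
    by_contra! h
    rcases le_or_gt (f (a, c)) (Real.pi + Real.pi / 2) with h' | h'
    · exact (Real.cos_nonpos_of_pi_div_two_le_of_le h (by linarith)).not_gt (h3 a)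
    · have := Real.sin_nonpos_of_nonpos_of_neg_pi_le (x := f (a, c) - 2 * Real.pi)
        (by linarith [hac.2]) (by linarith)
      rw [Real.sin_sub_two_pi] at this
      exact this.not_gt (h1 c)
  have n2 : 0 < f (a, c) := hac.1.lt_of_ne fun h => by simpa [← h] using h1 c
  have m1 : f (a, d) < Real.pi := lt_of_forall_ne (f := fun t => f (a, t)) (by fun_prop)
    (fun t h => by simpa [h] using h1 t) (by linarith : f (a, c) < _) d
  have m2 : 0 < f (a, d) := gt_of_forall_ne (f := fun t => f (a, t)) (by fun_prop)
    (fun t h => by simpa [h] using h1 t) n2 d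
  have m3 : Real.pi / 2 < f (a, d) := by
    by_contra! h
    exact (Real.cos_nonneg_of_neg_pi_div_two_le_of_le (by linarith) h).not_gt (h4 a)
  have l1 : f (b, c) < Real.pi / 2 := lt_of_forall_ne (f := fun s => f (s, c)) (by fun_prop)
    (fun s h => by simpa [h] using h3 s) n1 b
  have l2 : f (b, c) < 0 := by
    by_contra! h
    exact (Real.sin_nonneg_of_nonneg_of_le_pi h (by linarith)).not_gt (h2 c)
  have l3 : Real.pi / 2 < f (b, d) := gt_of_forall_ne (f := fun s => f (s, d)) (by fun_prop)
    (fun s h => by simpa [h] using h4 s) m3 b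
  have l4 : f (b, d) < 0 := lt_of_forall_ne (f := fun t => f (b, t)) (by fun_prop)
    (fun t h => by simpa [h] using h2 t) l2 d
  linarith

namespace Torus

variable {γ : C(UnitAddCircle, Torus)} {g : ℝ → ℝ × ℝ}

/-- The region on the left (`s = 1`) or on the right (`s = -1`) of the lift of a closed curve. -/
def sideOf (s : ℝ) (g : ℝ → ℝ × ℝ) : Set (ℝ × ℝ) :=
  {p | ∃ q, JoinedIn (range g)ᶜ p q ∧ ∀ t, 0 < s * cross (g 1 - g 0) (q - g t)}

theorem rightOf_eq (g : ℝ → ℝ × ℝ) : rightOf g = sideOf (-1) g := by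
  simp [rightOf, sideOf]

/-- A path from the left half-plane to the right one must cross the curve. For `e s - g t`, the
component across the period `v` changes sign between the ends of the path, and the component along
`v` changes sign when `t` runs over many periods, so `exists_zero_of_sides` produces an
intersection. -/
theorem IsLift.disjoint_sideOf (h : IsLift γ g) {p : ℝ × ℝ} (hp : p ∈ rightOf g)
    (hp' : p ∈ sideOf 1 g) : False := by
  obtain ⟨q, hq, hq'⟩ := hp
  obtain ⟨r, hr, hr'⟩ := hp'
  obtain ⟨c, hc⟩ := hr.symm.trans hq
  set v := g 1 - g 0 with hv
  have hgk : ∀ k : ℤ, g k = g 0 + (k : ℝ) • v := fun k => by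
    simpa [Int.cast_smul_eq_zsmul] using h.add_int 0 k
  have hv0 : 0 < v.1 * v.1 + v.2 * v.2 := by
    by_contra! h0
    have h1 : v.1 = 0 := by nlinarith [mul_self_nonneg v.1, mul_self_nonneg v.2]
    have h2 : v.2 = 0 := by nlinarith [mul_self_nonneg v.1, mul_self_nonneg v.2]
    simpa [cross, h1, h2] using hq' 0
  let e : ℝ → ℝ × ℝ := fun s => c (projIcc 0 1 zero_le_one s)
  have he : Continuous e := c.continuous.comp continuous_projIcc
  obtain ⟨N, hN⟩ : ∃ N : ℕ, ∀ s, |v.1 * (e s - g 0).1 + v.2 * (e s - g 0).2| <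
      N * (v.1 * v.1 + v.2 * v.2) := by
    obtain ⟨C, hC⟩ := isCompact_univ.exists_bound_of_continuousOn
      (f := fun s : unitInterval => v.1 * (c s - g 0).1 + v.2 * (c s - g 0).2) (by fun_prop)
    obtain ⟨N, hN⟩ := exists_nat_gt (C / (v.1 * v.1 + v.2 * v.2))
    exact ⟨N, fun s => (hC _ trivial).trans_lt ((div_lt_iff₀ hv0).1 hN)⟩
  have hg := h.1
  obtain ⟨⟨s, t⟩, hz⟩ := exists_zero_of_sides
    (E := fun z => ⟨v.1 * (e z.1 - g z.2).1 + v.2 * (e z.1 - g z.2).2, cross v (e z.1 - g z.2)⟩)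
    (a := 0) (b := 1) (c := ((-N : ℤ) : ℝ)) (d := ((N : ℤ) : ℝ)) (by
      refine Complex.equivRealProdCLM.symm.continuous.comp (f := fun z : ℝ × ℝ =>
        (v.1 * (e z.1 - g z.2).1 + v.2 * (e z.1 - g z.2).2, cross v (e z.1 - g z.2))) ?_
      simp only [cross]
      fun_prop)
    (fun t => by simpa [e] using hr' t) (fun t => by simpa [e] using hq' t)
    (fun s => by
      have := neg_lt_of_abs_lt (hN s)
      simp only [hgk, Prod.fst_sub, Prod.snd_sub, Prod.fst_add, Prod.snd_add, Prod.smul_fst,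
        Prod.smul_snd, smul_eq_mul] at this ⊢
      push_cast
      linarith)
    (fun s => by
      have := lt_of_abs_lt (hN s)
      simp only [hgk, Prod.fst_sub, Prod.snd_sub, Prod.fst_add, Prod.snd_add, Prod.smul_fst,
        Prod.smul_snd, smul_eq_mul] at this ⊢
      push_cast
      linarith)
  simp only [Complex.ext_iff, Complex.zero_re, Complex.zero_im, cross] at hz
  have h1 : (e s - g t).1 = 0 := by
    refine (mul_eq_zero.1 (?_ : (v.1 * v.1 + v.2 * v.2) * _ = 0)).resolve_left hv0.ne'
    linear_combination v.1 * hz.1 - v.2 * hz.2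
  have h2 : (e s - g t).2 = 0 := by
    refine (mul_eq_zero.1 (?_ : (v.1 * v.1 + v.2 * v.2) * _ = 0)).resolve_left hv0.ne'
    linear_combination v.2 * hz.1 + v.1 * hz.2
  exact hc (projIcc 0 1 zero_le_one s) ⟨t, (sub_eq_zero.1 (Prod.ext h1 h2 : e s - g t = 0)).symm⟩

/-- The linear map with columns `a` and `b`. -/
def linComb (a b p : ℝ × ℝ) : ℝ × ℝ := p.1 • a + p.2 • b

theorem cross_linComb (a b p q : ℝ × ℝ) :
    cross (linComb a b p) (linComb a b q) = cross a b * cross p q := by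
  simp [cross, linComb]; ring

/-- Far from the curve only the linear part of `H` matters. The point `q` is pushed further to the
right by a large lattice vector perpendicular to the period; its image moves by the linear image of
that vector, which lies right or left of the new period according to the sign of the determinant. -/
theorem IsLift.map_mem_sideOf (h : IsLift γ g) {H : ℝ × ℝ → ℝ × ℝ} (hH : Continuous H)
    (hinj : Function.Injective H) {a b : ℝ × ℝ} (hab : cross a b ≠ 0)
    (hlin : ∀ p m, H (p + ofInt m) = H p + linComb a b (ofInt m)) {p : ℝ × ℝ}
    (hp : p ∈ rightOf g) : H p ∈ sideOf (-cross a b) (H ∘ g) := by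
  obtain ⟨q, hq, hq'⟩ := hp
  obtain ⟨m, hm, hgm⟩ := h.exists_period
  rw [hm] at hq'
  have hg := h.1
  have hv0 : (0 : ℝ) < m.1 * m.1 + m.2 * m.2 := by
    by_contra! h0
    have h1 : (m.1 : ℝ) = 0 := by
      nlinarith [mul_self_nonneg (m.1 : ℝ), mul_self_nonneg (m.2 : ℝ)]
    have h2 : (m.2 : ℝ) = 0 := by
      nlinarith [mul_self_nonneg (m.1 : ℝ), mul_self_nonneg (m.2 : ℝ)]
    simpa [cross, ofInt, h1, h2] using hq' 0
  have hcls : H (g 1) - H (g 0) = linComb a b (ofInt m) := by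
    rw [sub_eq_iff_eq_add'.1 hm, hlin]; abel
  have hper : Function.Periodic
      (fun t => cross (linComb a b (ofInt m)) (H q - H (g t))) 1 := fun t => by
    simp only [hgm, hlin]
    simp only [cross, Prod.fst_sub, Prod.snd_sub, Prod.fst_add, Prod.snd_add]
    ring
  obtain ⟨C, hC⟩ := (hper.isBounded_of_continuous one_ne_zero
    (by simp only [cross]; fun_prop)).exists_norm_le
  have hC' : ∀ t, |cross (linComb a b (ofInt m)) (H q - H (g t))| ≤ C := fun t => hC _ ⟨t, rfl⟩
  -- `C` bounds the periodic offset of `H q` from the image curve; `k` makes the linear displacement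
  -- larger than this.
  obtain ⟨k, hk⟩ := exists_nat_gt (C / (|cross a b| * (m.1 * m.1 + m.2 * m.2)))
  have hab' := abs_pos.2 hab
  rw [div_lt_iff₀ (by positivity)] at hk
  have hseg : JoinedIn (range g)ᶜ q (q + ofInt (k * m.2, -(k * m.1))) := by
    refine JoinedIn.of_segment_subset fun x hx => ?_
    rintro ⟨t, rfl⟩
    rw [segment_eq_image'] at hx
    obtain ⟨θ, ⟨hθ, -⟩, hθ'⟩ := hx
    have h1 := hq' t
    rw [← hθ'] at h1
    simp only [cross, ofInt, Prod.fst_sub, Prod.snd_sub, Prod.fst_add, Prod.snd_add, Prod.smul_fst,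
      Prod.smul_snd, smul_eq_mul] at h1
    push_cast at h1
    have : 0 ≤ θ * k * (m.1 * m.1 + m.2 * m.2) := by positivity
    linarith
  refine ⟨H (q + ofInt (k * m.2, -(k * m.1))), ?_, fun t => ?_⟩
  · obtain ⟨c, hc⟩ := hq.trans hseg
    exact ⟨c.map hH, fun s ⟨t, ht⟩ => hc s ⟨t, hinj ht⟩⟩
  · simp only [Function.comp, hcls, hlin]
    have h1 := hC' t
    have h2 := cross_linComb a b (ofInt m) (ofInt (k * m.2, -(k * m.1)))
    have h3 : cross (ofInt m) (ofInt (k * m.2, -(k * m.1))) = - (k * (m.1 * m.1 + m.2 * m.2)) := by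
      simp [cross, ofInt]; ring
    have h4 : cross (linComb a b (ofInt m))
        (H q + linComb a b (ofInt (k * m.2, -(k * m.1))) - H (g t)) =
        cross (linComb a b (ofInt m)) (H q - H (g t)) -
          cross a b * (k * (m.1 * m.1 + m.2 * m.2)) := by
      rw [h3] at h2
      generalize linComb a b (ofInt (k * m.2, -(k * m.1))) = w at h2 ⊢
      simp only [cross, Prod.fst_sub, Prod.snd_sub, Prod.fst_add, Prod.snd_add] at h2 ⊢
      linear_combination h2
    rw [h4]
    generalize cross (linComb a b (ofInt m)) (H q - H (g t)) = y at *
    have h5 : |cross a b * y| < |cross a b| * (|cross a b| * (k * (m.1 * m.1 + m.2 * m.2))) := by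
      rw [abs_mul]
      refine mul_lt_mul_of_pos_left (h1.trans_lt (hk.trans_eq (by ring))) hab'
    rw [← mul_assoc, abs_mul_abs_self] at h5
    have := lt_of_abs_lt h5
    linarith

theorem IsLift.map_mem_rightOf (h : IsLift γ g) {H : ℝ × ℝ → ℝ × ℝ} (hH : Continuous H)
    (hinj : Function.Injective H) {a b : ℝ × ℝ} (hab : cross a b = 1)
    (hlin : ∀ p m, H (p + ofInt m) = H p + linComb a b (ofInt m)) {p : ℝ × ℝ}
    (hp : p ∈ rightOf g) : H p ∈ rightOf (H ∘ g) := by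
  have := h.map_mem_sideOf hH hinj (by rw [hab]; exact one_ne_zero) hlin hp
  rwa [hab, ← rightOf_eq] at this

end Torus

namespace OneFoliation

variable {F G : OneFoliation Torus} {n : ℕ} [NeZero n] {γ γ' : Fin n → C(UnitAddCircle, Torus)}
  {ε ε' : Fin n → ℤ} {P P' : Fin n → UnitAddCircle × ℝ → Torus}

/-- The retraction of the line onto the interval `[-π/2, π/2]`. -/
noncomputable def clamp (ρ : ℝ) : ℝ := max (-(Real.pi / 2)) (min ρ (Real.pi / 2))

theorem continuous_clamp : Continuous clamp := by unfold clamp; fun_prop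

theorem clamp_mem (ρ : ℝ) : clamp ρ ∈ Icc (-(Real.pi / 2)) (Real.pi / 2) :=
  ⟨le_max_left _ _, max_le (by linarith [Real.pi_pos]) (min_le_right _ _)⟩

theorem clamp_of_mem {ρ : ℝ} (h : ρ ∈ Icc (-(Real.pi / 2)) (Real.pi / 2)) : clamp ρ = ρ := by
  rw [clamp, min_eq_left h.2, max_eq_right h.1]

/-- One point of the lifted open annulus lies on the right of `g` by the choice of the enumeration.
Every other one is joined to it inside the lifted annulus, which avoids `g` because the open annulus
avoids `γ 0`. -/
theorem Strips.exists_right_lift (S : Strips F γ ε P) :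
    ∃ (Q : ℝ × ℝ → ℝ × ℝ) (g : ℝ → ℝ × ℝ), Torus.IsLift (γ 0) g ∧ Continuous Q ∧
      (∀ x ρ, Torus.proj (Q (x, ρ)) = P 0 (x, clamp ρ)) ∧ (∀ x, Q (x, -(Real.pi / 2)) = g x) ∧
      ∀ x, ∀ ρ ∈ Ioo (-(Real.pi / 2)) (Real.pi / 2), Q (x, ρ) ∈ Torus.rightOf g := by
  obtain ⟨g, hg, hright⟩ := S.rightSide
  have hpi := Real.pi_pos
  have hc0 : clamp (-(Real.pi / 2)) = -(Real.pi / 2) := clamp_of_mem ⟨le_rfl, by linarith⟩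
  have hPc : Continuous fun z : ℝ × ℝ => P 0 ((z.1 : UnitAddCircle), clamp z.2) :=
    (S.cont 0).comp_continuous (((AddCircle.continuous_mk' 1).comp continuous_fst).prodMk
      (continuous_clamp.comp continuous_snd)) fun z => ⟨trivial, clamp_mem _⟩
  obtain ⟨Q, hQ, hQP, hQ0⟩ := Torus.exists_lift hPc (x₀ := (0, -(Real.pi / 2))) (e₀ := g 0)
    (by rw [hg.2, hc0, S.left])
  have hQg : ∀ x, Q (x, -(Real.pi / 2)) = g x := by
    obtain ⟨m, hm⟩ := Torus.eq_add_of_proj_eq (H := g) (H' := fun x => Q (x, -(Real.pi / 2))) hg.1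
      (by fun_prop) fun x => by rw [hg.2, hQP, hc0, S.left]
    have h0 := hm 0
    rw [hQ0, left_eq_add] at h0
    intro x
    rw [hm, h0, add_zero]
  refine ⟨Q, g, hg, hQ, fun x ρ => hQP (x, ρ), hQg, ?_⟩
  obtain ⟨x₀, ρ₀, hρ₀, hx₀⟩ : ∃ x₀, ∃ ρ₀ ∈ Ioo (-(Real.pi / 2)) (Real.pi / 2),
      Q (x₀, ρ₀) ∈ Torus.rightOf g := by
    have hgc := hg.1
    -- A point near `g 0` projecting into the annulus near its left boundary must lie on this lift
    -- and not on a translate of it. Over labels near `0` a nonzero lattice vector would be too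
    -- long; over the other labels the projections differ because `γ 0` is injective. Compactness in
    -- the label makes this uniform.
    have hev := isCompact_Icc.eventually_forall_of_forall_eventually
      (x₀ := (-(Real.pi / 2), g 0)) (K := Icc (-(1 / 2) : ℝ) (1 / 2))
      (P := fun y x => Torus.proj y.2 = Torus.proj (Q (x, y.1)) → y.2 = Q (x, y.1)) (by
        intro x hx
        by_cases h0 : x = 0
        · subst h0
          have hd : ∀ᶠ z : (ℝ × ℝ × ℝ) × ℝ in 𝓝 ((-(Real.pi / 2), g 0), 0),
              dist z.1.2 (Q (z.2, z.1.1)) < 1 := by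
            refine Continuous.tendsto' (by fun_prop) _ 0 ?_ |>.eventually (gt_mem_nhds one_pos)
            simp [hQ0]
          filter_upwards [hd] with z hz hzp
          obtain ⟨m, hm⟩ := Torus.exists_of_proj_eq hzp.symm
          have : m = 0 := by
            rw [hm, dist_self_add_left, Prod.norm_def, max_lt_iff] at hz
            simp only [Torus.ofInt, Real.norm_eq_abs] at hz
            exact Prod.ext (Int.abs_lt_one_iff.1 (by exact_mod_cast hz.1))
              (Int.abs_lt_one_iff.1 (by exact_mod_cast hz.2))
          rw [hm, this]
          simp [Torus.ofInt]
        · have hd : ∀ᶠ z : (ℝ × ℝ × ℝ) × ℝ in 𝓝 ((-(Real.pi / 2), g 0), x),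
              Torus.proj z.1.2 ≠ Torus.proj (Q (z.2, z.1.1)) := by
            have hp := Torus.continuous_proj
            refine (isOpen_ne_fun (by fun_prop) (by fun_prop)).mem_nhds fun h => h0 ?_
            simp only [hQg, hg.2] at h
            obtain ⟨k, hk⟩ := exists_int_of_coe_eq (S.γ_inj h).2.symm
            rw [zero_add] at hk
            rw [hk] at hx ⊢
            have : |(k : ℝ)| < 1 := abs_lt.2 ⟨by linarith [hx.1], by linarith [hx.2]⟩
            have hk0 : k = 0 := Int.abs_lt_one_iff.1 (by exact_mod_cast this)
            rw [hk0, Int.cast_zero]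
          filter_upwards [hd] with z hz hzp using absurd hzp hz)
    rw [nhds_prod_eq, eventually_prod_iff] at hev
    obtain ⟨A, hA, B, hB, hAB⟩ := hev
    obtain ⟨η, hη, hηA⟩ := Metric.eventually_nhds_iff.1 hA
    obtain ⟨p, ⟨hp, θ, ρ, hρ, hθ⟩, hpB⟩ := ((hright (min η Real.pi) (lt_min hη hpi)).and_eventually hB).exists
    have hρ' : ρ ∈ Ioo (-(Real.pi / 2)) (Real.pi / 2) :=
      ⟨hρ.1, by linarith [hρ.2, min_le_right η Real.pi]⟩
    obtain ⟨x, hx, rfl⟩ := (AddCircle.coe_image_Icc_eq (1 : ℝ) (-(1 / 2))).ge (mem_univ θ)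
    have := hAB (x := ρ) (hηA (by
      rw [Real.dist_eq, abs_lt]
      constructor <;> linarith [hρ.1, hρ.2, min_le_left η Real.pi])) hpB x
      ⟨hx.1, hx.2.trans_eq (by norm_num)⟩ (by
        rw [hQP, clamp_of_mem (Ioo_subset_Icc_self hρ'), hθ])
    exact ⟨x, ρ, hρ', this ▸ hp⟩
  intro x ρ hρ
  obtain ⟨q, hq, hq'⟩ := hx₀
  refine ⟨q, JoinedIn.trans ?_ hq, hq'⟩
  have hj : JoinedIn ((univ : Set ℝ) ×ˢ Ioo (-(Real.pi / 2)) (Real.pi / 2)) (x, ρ) (x₀, ρ₀) :=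
    JoinedIn.of_segment_subset ((convex_univ.prod (convex_Ioo _ _)).segment_subset ⟨trivial, hρ⟩
      ⟨trivial, hρ₀⟩)
  obtain ⟨c, hc⟩ := hj
  refine ⟨c.map hQ, fun s ⟨t, ht⟩ => ?_⟩
  refine S.notMem (i := 0) (z := (((c s).1 : UnitAddCircle), (c s).2)) ⟨trivial, (hc s).2⟩ 0
    ⟨(t : UnitAddCircle), ?_⟩
  have h1 := hQP (c s)
  rw [clamp_of_mem (Ioo_subset_Icc_self (hc s).2)] at h1
  rw [← hg.2, ht, ← h1]; rfl

end OneFoliation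

/-! ### Construction of the equivalence. -/

theorem exists_homeomorph_of_eq_iff {X Y Z : Type*} [TopologicalSpace X] [TopologicalSpace Y]
    [TopologicalSpace Z] [CompactSpace X] [T2Space Y] [T2Space Z] {q : X → Y} {q' : X → Z}
    (hq : Continuous q) (hq' : Continuous q') (hs : Function.Surjective q)
    (hs' : Function.Surjective q') (h : ∀ z w, q z = q w ↔ q' z = q' w) :
    ∃ f : Y ≃ₜ Z, ∀ x, f (q x) = q' x := by
  have h1 : ∀ x, q' (Function.surjInv hs (q x)) = q' x := fun x =>
    (h _ _).1 (Function.surjInv_eq hs _)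
  have h2 : ∀ x, q (Function.surjInv hs' (q' x)) = q x := fun x =>
    (h _ _).2 (Function.surjInv_eq hs' _)
  refine ⟨⟨⟨fun y => q' (Function.surjInv hs y), fun z => q (Function.surjInv hs' z), ?_, ?_⟩,
    ?_, ?_⟩, h1⟩
  · intro y
    obtain ⟨x, rfl⟩ := hs y
    simp only [h1, h2]
  · intro z
    obtain ⟨x, rfl⟩ := hs' z
    simp only [h1, h2]
  · exact (hq.isClosedMap.isQuotientMap hq hs).continuous_iff.2 (hq'.congr fun x => (h1 x).symm)
  · exact (hq'.isClosedMap.isQuotientMap hq' hs').continuous_iff.2 (hq.congr fun x => (h2 x).symm)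

namespace Torus

theorem ofInt_add (m m' : ℤ × ℤ) : ofInt (m + m') = ofInt m + ofInt m' := by
  simp [ofInt]

theorem exists_linear_of_lift {f : Torus → Torus} {H : ℝ × ℝ → ℝ × ℝ} (hH : Continuous H)
    (hf : ∀ p, proj (H p) = f (proj p)) :
    (∃ m, H (1, 0) - H (0, 0) = ofInt m) ∧ (∃ m, H (0, 1) - H (0, 0) = ofInt m) ∧
      ∀ p m, H (p + ofInt m) =
        H p + linComb (H (1, 0) - H (0, 0)) (H (0, 1) - H (0, 0)) (ofInt m) := by
  choose M hM using fun m => eq_add_of_proj_eq hH (hH.comp (continuous_add_const (ofInt m)))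
    fun p => by rw [hf, Function.comp, hf, proj_add_ofInt]
  have hadd : ∀ m m', M (m + m') = M m + M m' := fun m m' => by
    have h1 := hM (m + m') 0
    have h2 := hM m' (0 + ofInt m)
    have h3 := hM m 0
    simp only [Function.comp] at h1 h2 h3
    rw [ofInt_add, ← add_assoc, h2, h3, add_assoc, ← ofInt_add] at h1
    rw [ofInt_injective (add_left_cancel h1).symm, add_comm]
  have h10 : H (1, 0) - H (0, 0) = ofInt (M (1, 0)) := by
    have := hM (1, 0) (0, 0)
    simp only [Function.comp, ofInt, Prod.mk_add_mk, zero_add, Int.cast_one, Int.cast_zero] at this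
    rw [this, add_sub_cancel_left]; rfl
  have h01 : H (0, 1) - H (0, 0) = ofInt (M (0, 1)) := by
    have := hM (0, 1) (0, 0)
    simp only [Function.comp, ofInt, Prod.mk_add_mk, zero_add, Int.cast_one, Int.cast_zero] at this
    rw [this, add_sub_cancel_left]; rfl
  refine ⟨⟨_, h10⟩, ⟨_, h01⟩, fun p m => ?_⟩
  rw [h10, h01]
  refine (hM m p).trans (congrArg _ ?_)
  let φ : ℤ × ℤ →+ ℤ × ℤ := AddMonoidHom.mk' M hadd
  have : m = m.1 • ((1, 0) : ℤ × ℤ) + m.2 • ((0, 1) : ℤ × ℤ) := by ext <;> simp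
  have h2 : M m = m.1 • M (1, 0) + m.2 • M (0, 1) := by
    change φ m = _
    conv_lhs => rw [this]
    rw [map_add, map_zsmul, map_zsmul]
    rfl
  rw [h2]
  simp [ofInt, linComb]

/-- A suitably normalized lift of the inverse homeomorphism is a left inverse of `H`. The linear
parts are then integer matrices with product the identity, so their determinants are units. -/
theorem lift_homeomorph {f : Torus ≃ₜ Torus} {H : ℝ × ℝ → ℝ × ℝ} (hH : Continuous H)
    (hf : ∀ p, proj (H p) = f (proj p)) :
    Function.Injective H ∧ (cross (H (1, 0) - H (0, 0)) (H (0, 1) - H (0, 0)) = 1 ∨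
      cross (H (1, 0) - H (0, 0)) (H (0, 1) - H (0, 0)) = -1) := by
  obtain ⟨K, hK, hKf, hK0⟩ := exists_lift (f := fun p => f.symm (proj p)) (x₀ := H 0) (e₀ := 0)
    (f.symm.continuous.comp continuous_proj) (by rw [hf, f.symm_apply_apply])
  have hKH : ∀ p, K (H p) = p := by
    obtain ⟨m, hm⟩ := eq_add_of_proj_eq (H := id) (H' := K ∘ H) continuous_id (hK.comp hH) fun p => by
      rw [Function.comp, hKf, hf, f.symm_apply_apply]; rfl
    have h0 := hm 0
    simp only [Function.comp, hK0, id, zero_add] at h0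
    intro p
    have := hm p
    rwa [← h0, add_zero] at this
  refine ⟨Function.LeftInverse.injective hKH, ?_⟩
  obtain ⟨⟨a, ha⟩, ⟨b, hb⟩, hlin⟩ := exists_linear_of_lift hH hf
  obtain ⟨⟨c, hc⟩, ⟨d, hd⟩, hlin'⟩ := exists_linear_of_lift hK hKf
  rw [ha, hb] at hlin ⊢
  rw [hc, hd] at hlin'
  have ha' : linComb (ofInt a) (ofInt b) (ofInt (1, 0)) = ofInt a := by simp [linComb, ofInt]
  have hb' : linComb (ofInt a) (ofInt b) (ofInt (0, 1)) = ofInt b := by simp [linComb, ofInt]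
  have h1 : linComb (ofInt c) (ofInt d) (ofInt a) = ofInt (1, 0) := by
    have := hKH (0 + ofInt (1, 0))
    rwa [hlin, ha', hlin', hKH, add_right_inj] at this
  have h2 : linComb (ofInt c) (ofInt d) (ofInt b) = ofInt (0, 1) := by
    have := hKH (0 + ofInt (0, 1))
    rwa [hlin, hb', hlin', hKH, add_right_inj] at this
  have h3 := cross_linComb (ofInt c) (ofInt d) (ofInt a) (ofInt b)
  rw [h1, h2] at h3
  simp only [cross, ofInt] at h3 ⊢
  norm_num at h3
  have h4 : (c.1 * d.2 - c.2 * d.1) * (a.1 * b.2 - a.2 * b.1) = 1 := by exact_mod_cast h3.symm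
  rcases Int.isUnit_iff.1 (IsUnit.of_mul_eq_one_right _ h4) with h | h
  · left; exact_mod_cast h
  · right; exact_mod_cast h

end Torus

namespace OneFoliation

variable {F G : OneFoliation Torus} {n : ℕ} [NeZero n] {γ γ' : Fin n → C(UnitAddCircle, Torus)}
  {ε ε' : Fin n → ℤ} {P P' : Fin n → UnitAddCircle × ℝ → Torus}

namespace Strips

theorem mem_Ioo_or (S : Strips F γ ε P) (S' : Strips G γ' ε P') (i : Fin n)
    {z : UnitAddCircle × ℝ} (hz : z ∈ univ ×ˢ Icc (-(Real.pi / 2)) (Real.pi / 2)) :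
    z ∈ univ ×ˢ Ioo (-(Real.pi / 2)) (Real.pi / 2) ∨
      ∃ k φ, P i z = γ k φ ∧ P' i z = γ' k φ := by
  obtain ⟨θ, ρ⟩ := z
  rcases eq_endpoints_or_mem_Ioo_of_mem_Icc hz.2 with h | h | h
  · simp only at h
    subst h
    exact .inr ⟨i, θ, S.left _ _, S'.left _ _⟩
  · simp only at h
    subst h
    exact .inr ⟨i + 1, _, S.right _ _, S'.right _ _⟩
  · exact .inl ⟨trivial, h⟩

/-- The closed annuli are identified only along their boundaries, by a rule in which nothing but the
indices and `ε` occurs; hence both foliations make the same identifications. -/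
theorem eq_of_eq (S : Strips F γ ε P) (S' : Strips G γ' ε P') {i j : Fin n}
    {z w : UnitAddCircle × ℝ} (hz : z ∈ univ ×ˢ Icc (-(Real.pi / 2)) (Real.pi / 2))
    (hw : w ∈ univ ×ˢ Icc (-(Real.pi / 2)) (Real.pi / 2)) (h : P i z = P j w) :
    P' i z = P' j w := by
  rcases S.mem_Ioo_or S' i hz with h1 | ⟨k, φ, h1, h1'⟩ <;>
    rcases S.mem_Ioo_or S' j hw with h2 | ⟨l, ψ, h2, h2'⟩
  · obtain ⟨rfl, rfl⟩ := S.inj h1 h2 h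
    rfl
  · exact absurd ⟨ψ, (h.trans h2).symm⟩ (S.notMem h1 l)
  · exact absurd ⟨φ, h1.symm.trans h⟩ (S.notMem h2 k)
  · obtain ⟨rfl, rfl⟩ := S.γ_inj (h1.symm.trans (h.trans h2))
    rw [h1', h2']

theorem exists_homeomorph (S : Strips F γ ε P) (S' : Strips G γ' ε P') :
    ∃ f : Torus ≃ₜ Torus, ∀ i, ∀ z ∈ univ ×ˢ Icc (-(Real.pi / 2)) (Real.pi / 2),
      f (P i z) = P' i z := by
  have key : ∀ {F : OneFoliation Torus} {γ : Fin n → C(UnitAddCircle, Torus)}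
      {P : Fin n → UnitAddCircle × ℝ → Torus}, Strips F γ ε P →
      Continuous (fun x : Fin n × UnitAddCircle × Icc (-(Real.pi / 2)) (Real.pi / 2) =>
        P x.1 (x.2.1, x.2.2)) ∧
      Function.Surjective (fun x : Fin n × UnitAddCircle × Icc (-(Real.pi / 2)) (Real.pi / 2) =>
        P x.1 (x.2.1, x.2.2)) := fun S => by
    refine ⟨continuous_prod_of_discrete_left.2 fun i => (S.cont i).comp_continuous (by fun_prop)
      fun x => ⟨trivial, x.2.2⟩, fun p => ?_⟩
    obtain ⟨i, z, hz, rfl⟩ := S.cover p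
    exact ⟨(i, z.1, ⟨z.2, hz.2⟩), rfl⟩
  obtain ⟨f, hf⟩ := exists_homeomorph_of_eq_iff (key S).1 (key S').1 (key S).2 (key S').2
    fun x y => ⟨S.eq_of_eq S' ⟨trivial, x.2.2.2⟩ ⟨trivial, y.2.2.2⟩,
      S'.eq_of_eq S ⟨trivial, x.2.2.2⟩ ⟨trivial, y.2.2.2⟩⟩
  exact ⟨f, fun i z hz => hf (i, z.1, ⟨z.2, hz.2⟩)⟩

/-- The homeomorphism matches leaves because both foliations have the same leaves in annulus
coordinates. It carries the lift of the first annulus of `F` to that of `G`, and both lie on the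
right of their boundary curves; with determinant `-1` the image would lie on the left as well. -/
theorem topologicallyEquivalent (S : Strips F γ ε P) (S' : Strips G γ' ε P') :
    F.TopologicallyEquivalent G := by
  obtain ⟨f, hf⟩ := S.exists_homeomorph S'
  have hpi := Real.pi_pos
  refine ⟨f, ?_, fun p => ?_⟩
  · obtain ⟨Q, g, hg, hQ, hQP, hQg, hQr⟩ := S.exists_right_lift
    obtain ⟨Q', g', hg', hQ', hQP', hQg', hQr'⟩ := S'.exists_right_lift
    have hproj : ∀ x ρ, f (Torus.proj (Q (x, ρ))) = Torus.proj (Q' (x, ρ)) := fun x ρ => by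
      rw [hQP, hQP', hf _ _ ⟨trivial, clamp_mem _⟩]
    obtain ⟨H, hH, hHf, hH0⟩ := Torus.exists_lift (f := fun p => f (Torus.proj p))
      (f.continuous.comp Torus.continuous_proj) (hproj 0 0).symm
    have hHQ : ∀ z, H (Q z) = Q' z := by
      obtain ⟨m, hm⟩ := Torus.eq_add_of_proj_eq (hH.comp hQ) hQ' fun z => by
        rw [Function.comp, hHf, hproj]
      have h0 := hm (0, 0)
      simp only [Function.comp, hH0, left_eq_add] at h0
      intro z
      rw [hm, h0, add_zero]; rfl
    have hHg : H ∘ g = g' := funext fun x => by rw [Function.comp, ← hQg, hHQ, hQg']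
    obtain ⟨hinj, hdet⟩ := Torus.lift_homeomorph hH hHf
    refine ⟨H, hH, hHf, hdet.resolve_right fun h => ?_⟩
    have h0 : (0 : ℝ) ∈ Ioo (-(Real.pi / 2)) (Real.pi / 2) := ⟨by linarith, by linarith⟩
    have := hg.map_mem_sideOf hH hinj (by rw [h]; norm_num)
      (Torus.exists_linear_of_lift hH hHf).2.2 (hQr 0 0 h0)
    rw [h, neg_neg, hHg, hHQ] at this
    exact hg'.disjoint_sideOf (hQr' 0 0 h0) this
  · obtain ⟨i, z, hz, rfl⟩ := S.cover p
    rw [hf i z hz]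
    rcases S.mem_Ioo_or S' i hz with h | ⟨k, φ, h, h'⟩
    · obtain ⟨v, hv⟩ : ∃ v : UnitAddCircle, z.1 = v + (shear (ε i) (Real.tan z.2) : UnitAddCircle) :=
        ⟨_, (sub_add_cancel _ _).symm⟩
      have hz' : z = (v + (shear (ε i) (Real.tan z.2) : UnitAddCircle), z.2) := by rw [← hv]
      rw [hz', S.leaf i v _ h.2, S'.leaf i v _ h.2, image_image]
      exact image_congr fun ρ hρ => hf i _ ⟨trivial, Ioo_subset_Icc_self hρ⟩
    · rw [h, h', S.leaf_γ, S'.leaf_γ, ← range_comp]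
      congr 1
      funext θ
      have := hf k (θ, -(Real.pi / 2)) ⟨trivial, le_rfl, by linarith⟩
      rwa [S.left, S'.left] at this

end Strips

end OneFoliation

/-! ### Invariance under topological equivalence. -/

namespace OneFoliation

section transfer

variable {F G : OneFoliation Torus} {f : Torus ≃ₜ Torus} (hf : ∀ p, f '' F.leaf p = G.leaf (f p))
include hf

theorem mem_leaf_map {p q : Torus} (h : q ∈ F.leaf p) : f q ∈ G.leaf (f p) :=
  hf p ▸ mem_image_of_mem f h

theorem mem_leaf_of_map {p q : Torus} (h : f q ∈ G.leaf (f p)) : q ∈ F.leaf p := by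
  rw [← hf] at h
  exact f.injective.mem_set_image.1 h

/-- `f` respects leaves, and plaques only locally: a short plaque segment of `ψ`, pulled back, is a
connected piece of a leaf inside one chart of `F`, hence lies in one plaque there. Thus equal
heights in `ψ` imply equal heights in `φ`. -/
theorem IsTransverseArc.exists_map {ε : ℝ} {τ : ℝ → Torus} (h : F.IsTransverseArc ε τ)
    (hε : 0 < ε) : ∃ ε' > 0, ε' ≤ ε ∧ G.IsTransverseArc ε' (f ∘ τ) := by
  obtain ⟨hτ, φ, hφ, hmaps, hinj⟩ := h
  obtain ⟨ψ, hψ, h0⟩ := G.cover (f (τ 0))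
  have h0' : (0 : ℝ) ∈ Ioo (-ε) ε := ⟨by linarith, hε⟩
  have hτ0 : ContinuousAt τ 0 := hτ.continuousAt (Ioo_mem_nhds h0'.1 h0'.2)
  have hE : Continuous fun z => f.symm (ψ.symm z) :=
    f.symm.continuous.comp (continuous_chart_symm hψ)
  have hU : {z | f.symm (ψ.symm z) ∈ φ.source} ∈ 𝓝 (ψ (f (τ 0))) := by
    refine hE.continuousAt.preimage_mem_nhds (φ.open_source.mem_nhds ?_)
    rw [ψ.left_inv h0, f.symm_apply_apply]
    exact hmaps h0'
  obtain ⟨r, hr, hball⟩ := Metric.mem_nhds_iff.1 hU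
  have hev : ∀ᶠ s in 𝓝 (0 : ℝ), f (τ s) ∈ ψ.source ∧ ψ (f (τ s)) ∈ Metric.ball (ψ (f (τ 0))) r := by
    have hc : ContinuousAt (fun s => f (τ s)) 0 := f.continuous.continuousAt.comp hτ0
    refine (hc.eventually (ψ.open_source.mem_nhds h0)).and
      (ContinuousAt.comp (g := ψ) (f := fun s => f (τ s)) (ψ.continuousAt h0) hc |>.eventually
        (Metric.ball_mem_nhds _ hr))
  obtain ⟨δ, hδ, hδ'⟩ := Metric.eventually_nhds_iff.1 hev
  have hsub : ∀ s ∈ Ioo (-(min ε δ)) (min ε δ), s ∈ Ioo (-ε) ε ∧ dist s 0 < δ := fun s hs => by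
    rw [Real.dist_eq, sub_zero, abs_lt]
    exact ⟨⟨by linarith [hs.1, min_le_left ε δ], by linarith [hs.2, min_le_left ε δ]⟩,
      by linarith [hs.1, min_le_right ε δ], by linarith [hs.2, min_le_right ε δ]⟩
  refine ⟨min ε δ, lt_min hε hδ, min_le_left _ _,
    f.continuous.comp_continuousOn (hτ.mono fun s hs => (hsub s hs).1), ψ, hψ,
    fun s hs => (hδ' (hsub s hs).2).1, fun s hs s' hs' hss => ?_⟩
  obtain ⟨e1, e2⟩ := hsub s hs
  obtain ⟨e1', e2'⟩ := hsub s' hs'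
  obtain ⟨m, b⟩ := hδ' e2
  obtain ⟨m', b'⟩ := hδ' e2'
  simp only [Function.comp] at hss
  have hback : ∀ s, f (τ s) ∈ ψ.source → f.symm (ψ.symm ((ψ (f (τ s))).1, (ψ (f (τ s))).2)) = τ s :=
    fun s hs => by rw [Prod.mk.eta, ψ.left_inv hs, f.symm_apply_apply]
  -- The two image points have the same height and lie in a ball for the maximum norm, so the
  -- horizontal segment between them stays in the ball, where the pulled-back chart is defined.
  have key := chart_snd_eq_of_isPreconnected hφ
    (A := uIcc (ψ (f (τ s))).1 (ψ (f (τ s'))).1) isPreconnected_uIcc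
    (c := fun x => f.symm (ψ.symm (x, (ψ (f (τ s))).2))) (p := τ s)
    (hE.comp (by fun_prop : Continuous fun x : ℝ => (x, (ψ (f (τ s))).2))).continuousOn
    (fun x _ => mem_leaf_of_map hf (by
      rw [f.apply_symm_apply]
      have := chart_symm_mem_leaf hψ (ψ (f (τ s))).1 x (ψ (f (τ s))).2
      rwa [Prod.mk.eta, ψ.left_inv m] at this))
    (fun x hx => hball (by
      rw [Metric.mem_ball, Prod.dist_eq, max_lt_iff] at b b' ⊢
      exact ⟨(convex_ball _ r).ordConnected.uIcc_subset (Metric.mem_ball.2 b.1)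
        (Metric.mem_ball.2 b'.1) hx, b.2⟩))
    left_mem_uIcc right_mem_uIcc
  simp only [hback s m] at key
  rw [hss, hback s' m'] at key
  exact hinj e1 e1' key

/-- The transverse arc may have to be shortened, and the holonomy still maps the shorter interval
into itself because it contracts. -/
theorem HolonomyContracts.map {γ : C(UnitAddCircle, Torus)} (h : F.HolonomyContracts γ) :
    G.HolonomyContracts ((f : C(Torus, Torus)).comp γ) := by
  obtain ⟨ε, hε, τ, h, hτ, hτ0, ⟨K, hK, hKγ, hKh⟩, hcon⟩ := h
  obtain ⟨ε', hε', hle, hτ'⟩ := hτ.exists_map hf hε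
  have hsub : Ioo (-ε') ε' ⊆ Ioo (-ε) ε := Ioo_subset_Ioo (neg_le_neg hle) hle
  have h0 : h 0 = 0 := by
    obtain ⟨-, φ, -, -, hinj⟩ := hτ
    obtain ⟨-, -, h1, h2⟩ := hKh 0 ⟨by linarith, hε⟩
    refine hinj h1 ⟨by linarith, hε⟩ ?_
    have h3 := hKγ 1 (by simp)
    rw [h2, AddCircle.coe_period, ← hτ0] at h3
    simp only [h3]
  refine ⟨ε', hε', f ∘ τ, h, hτ', congrArg f hτ0, ⟨fun z => f (K z),
    f.continuous.comp_continuousOn (hK.mono (prod_mono subset_rfl hsub)),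
    fun t ht => congrArg f (hKγ t ht), fun s hs => ?_⟩, fun s hs => hcon s (hsub hs)⟩
  obtain ⟨h1, h2, -, h4⟩ := hKh s (hsub hs)
  refine ⟨fun t ht => mem_leaf_map hf (h1 t ht), congrArg f h2, ?_, congrArg f h4⟩
  by_cases hs0 : s = 0
  · rw [hs0, h0]
    exact ⟨by linarith, hε'⟩
  · exact abs_lt.1 ((hcon s (hsub hs) hs0).trans (abs_lt.2 hs))

theorem IsCompactLeaf.map {L : Set Torus} (h : F.IsCompactLeaf L) : G.IsCompactLeaf (f '' L) := by
  obtain ⟨⟨p, rfl⟩, hc⟩ := h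
  exact ⟨⟨f p, hf p⟩, hc.image f.continuous⟩

theorem IsCompactLeaf.of_map {L : Set Torus} (h : G.IsCompactLeaf L) :
    ∃ L', F.IsCompactLeaf L' ∧ f '' L' = L := by
  obtain ⟨⟨p, rfl⟩, hc⟩ := h
  have : f '' F.leaf (f.symm p) = G.leaf p := by rw [hf, f.apply_symm_apply]
  refine ⟨F.leaf (f.symm p), ⟨⟨_, rfl⟩, f.isCompact_image.1 (this ▸ hc)⟩, this⟩

/-- Orientation matters for the right-hand side of `γ 0` only; there the lift with determinant `1`
sends right-hand regions to right-hand regions. -/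
theorem IsGeometricalEnumeration.map (hor : Torus.OrientationPreserving f) {n : ℕ} [NeZero n]
    {γ : Fin n → C(UnitAddCircle, Torus)} (h : F.IsGeometricalEnumeration γ) :
    G.IsGeometricalEnumeration fun i => (f : C(Torus, Torus)).comp (γ i) := by
  have hrange : ∀ i, range ((f : C(Torus, Torus)).comp (γ i)) = f '' range (γ i) := fun i =>
    range_comp f (γ i)
  refine ⟨fun i => ?_, fun i => ?_, fun i j hij => ?_, fun L hL => ?_, fun i => ?_⟩
  · rw [hrange]
    exact (h.isCompactLeaf i).map hf
  · exact ⟨f.injective.comp (h.contracting i).1, rfl, (h.contracting i).2.2.map hf⟩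
  · simp only [hrange] at hij
    exact h.distinct (f.injective.image_injective hij)
  · obtain ⟨L', hL', rfl⟩ := hL.of_map hf
    obtain ⟨i, rfl⟩ := h.exhaustive L' hL'
    exact ⟨i, hrange i⟩
  · obtain ⟨A, ⟨x, hx, hA⟩, hfr, hright⟩ := h.bounds i
    have hU : f '' (⋃ k, range (γ k))ᶜ = (⋃ k, range ((f : C(Torus, Torus)).comp (γ k)))ᶜ := by
      rw [image_compl_eq f.bijective, image_iUnion]
      simp only [hrange]
    refine ⟨f '' A, ⟨f x, hU ▸ mem_image_of_mem f hx, ?_⟩, ?_, fun hi => ?_⟩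
    · rw [hA, f.image_connectedComponentIn hx, hU]
    · rw [← f.image_frontier, hfr, image_union, hrange, hrange]
    · obtain ⟨g, hg, hgA⟩ := hright hi
      obtain ⟨H, hH, hHf, hdet⟩ := hor
      refine ⟨H ∘ g, ⟨hH.comp hg.1, fun t => by rw [Function.comp, hHf, hg.2]; rfl⟩, ?_⟩
      rw [range_comp]
      refine (image_mono hgA).trans ((image_closure_subset_closure_image hH).trans
        (closure_mono ?_))
      rintro _ ⟨p, ⟨hp, hp'⟩, rfl⟩
      refine ⟨?_, hg.map_mem_rightOf hH (Torus.lift_homeomorph hH hHf).1 hdet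
        (Torus.exists_linear_of_lift hH hHf).2.2 hp'⟩
      rw [mem_preimage, hHf]
      exact mem_image_of_mem f hp

end transfer

theorem IsCombinatorialType.map {F G : OneFoliation Torus} (h : F.TopologicallyEquivalent G)
    {n : ℕ} [NeZero n] {σ : Fin n → ℤˣ} (hσ : F.IsCombinatorialType σ) :
    G.IsCombinatorialType σ := by
  obtain ⟨f, hor, hf⟩ := h
  obtain ⟨γ, hγ, hσγ⟩ := hσ
  refine ⟨_, hγ.map hf hor, fun i => (hσγ i).trans ⟨fun h => .comp (.refl _) h, fun h => ?_⟩⟩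
  have h1 := ContinuousMap.Homotopic.comp (.refl (f.symm : C(Torus, Torus))) h
  have h2 : ∀ i, (f.symm : C(Torus, Torus)).comp ((f : C(Torus, Torus)).comp (γ i)) = γ i :=
    fun i => by ext θ : 1; simp
  rwa [h2, h2] at h1

end OneFoliation

/-- An MS-foliation `F` on the torus is characterized, up to topological equivalence, by any of its
combinatorial types `σ`. -/
theorem proposition5p1 (F : OneFoliation Torus) (hF : F.IsMS) (n : ℕ) [NeZero n]
    (σ : Fin n → ℤˣ) (hσ : F.IsCombinatorialType σ) (G : OneFoliation Torus) (hG : G.IsMS) :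
    G.IsCombinatorialType σ ↔ F.TopologicallyEquivalent G := by
  refine ⟨fun hσ' => ?_, fun h => hσ.map h⟩
  obtain ⟨γ, hγ, hσγ⟩ := hσ
  obtain ⟨γ', hγ', hσγ'⟩ := hσ'
  obtain ⟨ε, P, S⟩ := hγ.exists_strips hF
  obtain ⟨ε', P', S'⟩ := hγ'.exists_strips hG
  obtain rfl := S.sign_eq S' fun i => (hσγ i).symm.trans (hσγ' i)
  exact S.topologicallyEquivalent S'
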